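/- **Conventions.** An orbifold of dimension $d$ is a Hausdorff paracompact space $M$ with an atlas of compatible charts modelled on $U/G$, where $U\subset\mathbb R^d$ is open and $G$ is a finite group of linear automorphisms preserving $U$ whose nontrivial elements fix only the origin (and $0\in U$ if $G\neq 1$). The singular set $\Delta$ consists of the points which are the image of the origin in a chart with $G\ne 1$. $\Omega_{orb}(M)$ is the algebra of orbifold differential forms (compatible families of $G$-invariant smooth forms in the charts), with wedge product, differential $d$ and cohomology $H(M)=\ker d/\operatorname{im} d$; for a smooth manifold this is the de Rham complex. A symplectic orbifold $(M,\omega)$ is a $2n$-dimensional orbifold with $\omega\in\Omega^2_{orb}(M)$, $d\omega=0$ and $\omega^n\ne 0$ at every point. A symplectic resolution of $(M,\omega)$ is a (Hausdorff, paracompact) smooth symplectic manifold $(\tilde M,\tilde\omega)$ with a proper continuous map $\pi:\tilde M\to M$ such that, with $E=\pi^{-1}(\Delta)$: (a) $\pi$ restricts to a diffeomorphism $\tilde M\setminus E\to M\setminus\Delta$; (b) $E$ is a locally finite union of (possibly intersecting) embedded symplectic submanifolds of $\tilde M$ of codimension at least $2$; (c) $\tilde\omega=\pi^*\omega$ outside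 $\pi^{-1}(\bigcup_{p\in\Delta}V_p)$, for some pairwise disjoint open neighbourhoods $V_p$ of the points $p\in\Delta$, each with compact closure contained in an orbifold chart around $p$. Let $a$ be a closed form of even degree and $b_1,\dots,b_m$ closed forms (all homogeneous) such that every $a\wedge b_i$ is exact. The $m$-th order $a$-Massey product ($a$-product) is $$\langle a;b_1,\dots,b_m\rangle=\Big\{\Big[\sum_i\overline{\xi_1}\wedge\dots\wedge\overline{\xi_{i-1}}\wedge b_i\wedge\xi_{i+1}\wedge\dots\wedge\xi_m\Big]\;:\;d\xi_i=a\wedge b_i,\ |\xi_i|=|a|+|b_i|-1\Big\},$$ where $\overline\xi=(-1)^{|\xi|}\xi$. It is trivial if it contains $0$. Finally, $\pi^*:H(M)\to H(\tilde M)$ is the map which sends the class of a closed form $\alpha$ that is, around each point of $\Delta$, constant in its degree-$0$ part and zero in positive degrees (every class has such a representative) to the class of the smooth form on $\tilde M$ that equals $\pi^*\alpha$ on $\tilde M\setminus E$. **Theorem.** Let $\pi:(\tilde M,\tilde\omega)\to(M,\omega)$ be a symplectic resolution of a symplectic orbifold $(M,\omega)$. 1. For every $m$, if $M$ has a nontrivial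 $a$-product of order $m$, then so does $\tilde M$. In particular, if $M$ has a nontrivial $a$-product, then so does $\tilde M$. 2. Let $\langle a;b_1,\dots,b_m\rangle$ be a (defined) $a$-product of orbifold forms on $M$ with all $|b_i|>0$, and let $\tilde a,\tilde b_1,\dots,\tilde b_m$ be closed forms on $\tilde M$ of the same degrees with $[\tilde a]=\pi^*[a]$ and $[\tilde b_i]=\pi^*[b_i]$. Then $\langle\tilde a;\tilde b_1,\dots,\tilde b_m\rangle$ is defined and $$\langle\tilde a;\tilde b_1,\dots,\tilde b_m\rangle=\pi^*\langle a;b_1,\dots,b_m\rangle .$$ -/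

import Mathlib

open Set Topology
open scoped Manifold ContDiff DirectSum

noncomputable section

/-! ### Wedge product of alternating forms -/

/-- The wedge product of real alternating forms, in the determinant normalization
`(α ∧ β)(v₁, …, v_{k+l}) = ∑ sign σ • α(v_{σ 1}, …, v_{σ k}) * β(v_{σ (k+1)}, …, v_{σ (k+l)})`,
where `σ` runs over the `(k, l)`-shuffles. -/
def wedgeAlg {V : Type*} [AddCommGroup V] [Module ℝ V] {k l : ℕ}
    (α : V [⋀^Fin k]→ₗ[ℝ] ℝ) (β : V [⋀^Fin l]→ₗ[ℝ] ℝ) : V [⋀^Fin (k + l)]→ₗ[ℝ] ℝ :=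
  ((LinearMap.mul' ℝ ℝ).compAlternatingMap (α.domCoprod β)).domDomCongr finSumFinEquiv

theorem wedgeAlg_apply {V : Type*} [AddCommGroup V] [Module ℝ V] {k l : ℕ}
    (α : V [⋀^Fin k]→ₗ[ℝ] ℝ) (β : V [⋀^Fin l]→ₗ[ℝ] ℝ) (v : Fin (k + l) → V) :
    wedgeAlg α β v = ∑ σ : Equiv.Perm.ModSumCongr (Fin k) (Fin l),
      LinearMap.mul' ℝ ℝ (AlternatingMap.domCoprod.summand α β σ (v ∘ finSumFinEquiv)) := by
  simp [wedgeAlg, AlternatingMap.domCoprod_apply, Function.comp_def]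

theorem wedgeAlg_summand {V : Type*} [AddCommGroup V] [Module ℝ V] {k l : ℕ}
    (α : V [⋀^Fin k]→ₗ[ℝ] ℝ) (β : V [⋀^Fin l]→ₗ[ℝ] ℝ) (v : Fin k ⊕ Fin l → V)
    (σ : Equiv.Perm (Fin k ⊕ Fin l)) :
    LinearMap.mul' ℝ ℝ (AlternatingMap.domCoprod.summand α β (Quotient.mk'' σ) v) =
      ((Equiv.Perm.sign σ : ℤ) : ℝ) *
        (α (fun i => v (σ (Sum.inl i))) * β (fun i => v (σ (Sum.inr i)))) := by
  rw [AlternatingMap.domCoprod.summand_mk'', Units.smul_def, smul_apply, map_zsmul,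
    zsmul_eq_mul]
  rfl

theorem wedgeAlg_bound {V : Type*} [NormedAddCommGroup V] [NormedSpace ℝ V] {k l : ℕ}
    (α : V [⋀^Fin k]→L[ℝ] ℝ) (β : V [⋀^Fin l]→L[ℝ] ℝ) (v : Fin (k + l) → V) :
    ‖wedgeAlg α.toAlternatingMap β.toAlternatingMap v‖ ≤
      (Fintype.card (Equiv.Perm.ModSumCongr (Fin k) (Fin l)) * (‖α‖ * ‖β‖)) * ∏ i, ‖v i‖ := by
  rw [wedgeAlg_apply]
  refine (norm_sum_le _ _).trans ?_
  rw [mul_assoc, ← nsmul_eq_mul, ← Finset.card_univ]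
  refine Finset.sum_le_card_nsmul _ _ _ fun σ _ => ?_
  induction σ using Quotient.inductionOn' with | _ σ
  rw [wedgeAlg_summand, norm_mul, norm_mul]
  have h1 : ‖((Equiv.Perm.sign σ : ℤ) : ℝ)‖ = 1 := by
    rcases Int.units_eq_one_or (Equiv.Perm.sign σ) with h | h <;> simp [h]
  rw [h1, one_mul]
  have h2 : ∏ i, ‖v i‖ = (∏ i : Fin k, ‖v (finSumFinEquiv (σ (Sum.inl i)))‖) *
      ∏ i : Fin l, ‖v (finSumFinEquiv (σ (Sum.inr i)))‖ := by
    rw [← Fintype.prod_sum_type fun s => ‖v (finSumFinEquiv (σ s))‖]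
    exact (Equiv.prod_comp (σ.trans finSumFinEquiv) fun i => ‖v i‖).symm
  rw [h2, mul_mul_mul_comm]
  gcongr
  · exact α.le_opNorm _
  · exact β.le_opNorm _

/-- The wedge product of continuous alternating forms. -/
def wedge {V : Type*} [NormedAddCommGroup V] [NormedSpace ℝ V] {k l : ℕ}
    (α : V [⋀^Fin k]→L[ℝ] ℝ) (β : V [⋀^Fin l]→L[ℝ] ℝ) : V [⋀^Fin (k + l)]→L[ℝ] ℝ :=
  (wedgeAlg α.toAlternatingMap β.toAlternatingMap).mkContinuous _ (wedgeAlg_bound α β)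

theorem wedge_apply {V : Type*} [NormedAddCommGroup V] [NormedSpace ℝ V] {k l : ℕ}
    (α : V [⋀^Fin k]→L[ℝ] ℝ) (β : V [⋀^Fin l]→L[ℝ] ℝ) (v : Fin (k + l) → V) :
    wedge α β v = ∑ σ : Equiv.Perm.ModSumCongr (Fin k) (Fin l),
      LinearMap.mul' ℝ ℝ (AlternatingMap.domCoprod.summand α.toAlternatingMap β.toAlternatingMap σ
        (v ∘ finSumFinEquiv)) :=
  wedgeAlg_apply _ _ v

theorem wedge_compContinuousLinearMap {V W : Type*} [NormedAddCommGroup V] [NormedSpace ℝ V]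
    [NormedAddCommGroup W] [NormedSpace ℝ W] {k l : ℕ}
    (α : V [⋀^Fin k]→L[ℝ] ℝ) (β : V [⋀^Fin l]→L[ℝ] ℝ) (f : W →L[ℝ] V) :
    wedge (α.compContinuousLinearMap f) (β.compContinuousLinearMap f) =
      (wedge α β).compContinuousLinearMap f := by
  ext v
  rw [ContinuousAlternatingMap.compContinuousLinearMap_apply, wedge_apply, wedge_apply]
  refine Finset.sum_congr rfl fun σ _ => ?_
  induction σ using Quotient.inductionOn' with | _ σ
  rw [wedgeAlg_summand, wedgeAlg_summand]
  rfl

theorem wedge_add_left {V : Type*} [NormedAddCommGroup V] [NormedSpace ℝ V] {k l : ℕ}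
    (α α' : V [⋀^Fin k]→L[ℝ] ℝ) (β : V [⋀^Fin l]→L[ℝ] ℝ) :
    wedge (α + α') β = wedge α β + wedge α' β := by
  ext v
  rw [ContinuousAlternatingMap.add_apply, wedge_apply, wedge_apply, wedge_apply,
    ← Finset.sum_add_distrib]
  refine Finset.sum_congr rfl fun σ _ => ?_
  induction σ using Quotient.inductionOn' with | _ σ
  rw [wedgeAlg_summand, wedgeAlg_summand, wedgeAlg_summand, ← mul_add, ← add_mul]
  rfl

theorem wedge_add_right {V : Type*} [NormedAddCommGroup V] [NormedSpace ℝ V] {k l : ℕ}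
    (α : V [⋀^Fin k]→L[ℝ] ℝ) (β β' : V [⋀^Fin l]→L[ℝ] ℝ) :
    wedge α (β + β') = wedge α β + wedge α β' := by
  ext v
  rw [ContinuousAlternatingMap.add_apply, wedge_apply, wedge_apply, wedge_apply,
    ← Finset.sum_add_distrib]
  refine Finset.sum_congr rfl fun σ _ => ?_
  induction σ using Quotient.inductionOn' with | _ σ
  rw [wedgeAlg_summand, wedgeAlg_summand, wedgeAlg_summand, ← mul_add, ← mul_add]
  rfl

theorem wedge_smul_left {V : Type*} [NormedAddCommGroup V] [NormedSpace ℝ V] {k l : ℕ}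
    (r : ℝ) (α : V [⋀^Fin k]→L[ℝ] ℝ) (β : V [⋀^Fin l]→L[ℝ] ℝ) :
    wedge (r • α) β = r • wedge α β := by
  ext v
  rw [ContinuousAlternatingMap.smul_apply, wedge_apply, wedge_apply, Finset.smul_sum]
  refine Finset.sum_congr rfl fun σ _ => ?_
  induction σ using Quotient.inductionOn' with | _ σ
  rw [wedgeAlg_summand, wedgeAlg_summand, smul_eq_mul, mul_left_comm r, ← mul_assoc r]
  rfl

theorem wedge_smul_right {V : Type*} [NormedAddCommGroup V] [NormedSpace ℝ V] {k l : ℕ}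
    (r : ℝ) (α : V [⋀^Fin k]→L[ℝ] ℝ) (β : V [⋀^Fin l]→L[ℝ] ℝ) :
    wedge α (r • β) = r • wedge α β := by
  ext v
  rw [ContinuousAlternatingMap.smul_apply, wedge_apply, wedge_apply, Finset.smul_sum]
  refine Finset.sum_congr rfl fun σ _ => ?_
  induction σ using Quotient.inductionOn' with | _ σ
  rw [wedgeAlg_summand, wedgeAlg_summand, smul_eq_mul, mul_left_comm r, mul_left_comm r]
  rfl

theorem wedge_zero_left {V : Type*} [NormedAddCommGroup V] [NormedSpace ℝ V] {k l : ℕ}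
    (β : V [⋀^Fin l]→L[ℝ] ℝ) : wedge (0 : V [⋀^Fin k]→L[ℝ] ℝ) β = 0 := by
  simpa using wedge_smul_left 0 (0 : V [⋀^Fin k]→L[ℝ] ℝ) β

theorem wedge_zero_right {V : Type*} [NormedAddCommGroup V] [NormedSpace ℝ V] {k l : ℕ}
    (α : V [⋀^Fin k]→L[ℝ] ℝ) : wedge α (0 : V [⋀^Fin l]→L[ℝ] ℝ) = 0 := by
  simpa using wedge_smul_right 0 α (0 : V [⋀^Fin l]→L[ℝ] ℝ)

theorem wedge_norm_le {V : Type*} [NormedAddCommGroup V] [NormedSpace ℝ V] {k l : ℕ}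
    (α : V [⋀^Fin k]→L[ℝ] ℝ) (β : V [⋀^Fin l]→L[ℝ] ℝ) :
    ‖wedge α β‖ ≤ Fintype.card (Equiv.Perm.ModSumCongr (Fin k) (Fin l)) * ‖α‖ * ‖β‖ := by
  rw [mul_assoc]
  exact ContinuousAlternatingMap.opNorm_le_bound _ (by positivity) (wedgeAlg_bound α β)

/-- The wedge product as a continuous bilinear map. -/
def wedgeCLM (V : Type*) [NormedAddCommGroup V] [NormedSpace ℝ V] (k l : ℕ) :
    (V [⋀^Fin k]→L[ℝ] ℝ) →L[ℝ] (V [⋀^Fin l]→L[ℝ] ℝ) →L[ℝ] (V [⋀^Fin (k + l)]→L[ℝ] ℝ) :=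
  LinearMap.mkContinuous₂
    (LinearMap.mk₂ ℝ wedge wedge_add_left wedge_smul_left wedge_add_right
      (fun r α β => wedge_smul_right r α β))
    (Fintype.card (Equiv.Perm.ModSumCongr (Fin k) (Fin l))) wedge_norm_le

/-! ### Orbifolds with isolated singularities -/

/-- An orbifold chart of dimension `d` on `X`: an open set `dom ⊆ ℝᵈ`, a finite group of linear
automorphisms preserving `dom`, whose nontrivial elements fix only the origin (which lies in `dom`
if the group is nontrivial), and a map inducing a homeomorphism from the quotient of `dom` by the
group onto an open subset of `X`. -/
structure OrbifoldChart (d : ℕ) (X : Type*) [TopologicalSpace X] where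
  dom : Set (EuclideanSpace ℝ (Fin d))
  isOpen_dom : IsOpen dom
  group : Subgroup (EuclideanSpace ℝ (Fin d) ≃L[ℝ] EuclideanSpace ℝ (Fin d))
  finite_group : Finite group
  mapsTo : ∀ g ∈ group, MapsTo g dom dom
  eq_zero_of_fixed : ∀ g ∈ group, g ≠ 1 → ∀ x ∈ dom, g x = x → x = 0
  zero_mem : group ≠ ⊥ → 0 ∈ dom
  toFun : EuclideanSpace ℝ (Fin d) → X
  continuousOn_toFun : ContinuousOn toFun dom
  isOpen_image : ∀ s ⊆ dom, IsOpen s → IsOpen (toFun '' s)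
  toFun_eq_iff : ∀ x ∈ dom, ∀ y ∈ dom, (toFun x = toFun y ↔ ∃ g ∈ group, g x = y)

/-- `h` is a diffeomorphism between open subsets of the domains of the orbifold charts `c`, `c'`
which lifts the map `f`. -/
structure IsLocalLift {d : ℕ} {X Y : Type*} [TopologicalSpace X] [TopologicalSpace Y] (f : X → Y)
    (c : OrbifoldChart d X) (c' : OrbifoldChart d Y)
    (h : OpenPartialHomeomorph (EuclideanSpace ℝ (Fin d)) (EuclideanSpace ℝ (Fin d))) : Prop where
  source_subset : h.source ⊆ c.dom
  target_subset : h.target ⊆ c'.dom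
  contDiffOn : ContDiffOn ℝ ∞ h h.source
  contDiffOn_symm : ContDiffOn ℝ ∞ h.symm h.target
  map_eq : ∀ x ∈ h.source, f (c.toFun x) = c'.toFun (h x)

/-- An orbifold structure of dimension `d` (with isolated singularities) on `X`. -/
structure Orbifold (d : ℕ) (X : Type*) [TopologicalSpace X] where
  atlas : Set (OrbifoldChart d X)
  cover : ∀ p : X, ∃ c ∈ atlas, ∃ x ∈ c.dom, c.toFun x = p
  compatible : ∀ c ∈ atlas, ∀ c' ∈ atlas, ∀ x ∈ c.dom, ∀ y ∈ c'.dom, c.toFun x = c'.toFun y →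
    ∃ h, IsLocalLift id c c' h ∧ x ∈ h.source ∧ h x = y

namespace Orbifold

variable {d : ℕ} {X Y : Type*} [TopologicalSpace X] [TopologicalSpace Y]

/-- The set of singular points. -/
def singularSet (O : Orbifold d X) : Set X :=
  {p | ∃ c ∈ O.atlas, c.group ≠ ⊥ ∧ c.toFun 0 = p}

/-! ### Orbifold differential forms -/

theorem two_le_infty : (2 : ℕ∞ω) ≤ ∞ := by
  exact WithTop.coe_le_coe.2 (le_top : (2 : ℕ∞) ≤ ⊤)

/-- Orbifold differential forms of degree `k`: families of smooth forms on the chart domains which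
are compatible with all lifts of the identity between charts; in particular each of them is
invariant under the group of the chart. (Outside the domain the form is `0` by convention.) -/
def formSubmodule (O : Orbifold d X) (k : ℕ) :
    Submodule ℝ (O.atlas → EuclideanSpace ℝ (Fin d) →
      EuclideanSpace ℝ (Fin d) [⋀^Fin k]→L[ℝ] ℝ) where
  carrier := {Ω | (∀ c, ContDiffOn ℝ ∞ (Ω c) c.1.dom) ∧ (∀ c, ∀ x ∉ c.1.dom, Ω c x = 0) ∧
    ∀ c c' h, IsLocalLift id c.1 c'.1 h → ∀ x ∈ h.source,
      Ω c x = (Ω c' (h x)).compContinuousLinearMap (fderiv ℝ h x)}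
  add_mem' := by
    rintro α β ⟨h1, h2, h3⟩ ⟨h1', h2', h3'⟩
    refine ⟨fun c => (h1 c).add (h1' c), fun c x hx => ?_, fun c c' h hh x hx => ?_⟩
    · simp [h2 c x hx, h2' c x hx]
    · simp only [Pi.add_apply]
      rw [h3 c c' h hh x hx, h3' c c' h hh x hx]
      rfl
  zero_mem' := ⟨fun _ => contDiffOn_const, fun _ _ _ => rfl, fun _ _ _ _ _ _ => rfl⟩
  smul_mem' := by
    rintro r α ⟨h1, h2, h3⟩
    refine ⟨fun c => (h1 c).const_smul r, fun c x hx => ?_, fun c c' h hh x hx => ?_⟩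
    · simp [h2 c x hx]
    · simp only [Pi.smul_apply]
      rw [h3 c c' h hh x hx]
      rfl

/-- The real vector space of orbifold differential forms of degree `k`. -/
def Form (O : Orbifold d X) (k : ℕ) : Type _ := O.formSubmodule k

instance (O : Orbifold d X) (k : ℕ) : AddCommGroup (O.Form k) :=
  inferInstanceAs (AddCommGroup (O.formSubmodule k))

instance (O : Orbifold d X) (k : ℕ) : Module ℝ (O.Form k) :=
  inferInstanceAs (Module ℝ (O.formSubmodule k))

theorem Form.ext {O : Orbifold d X} {k : ℕ} {α β : O.Form k} (h : ∀ c x, α.1 c x = β.1 c x) :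
    α = β :=
  Subtype.ext (funext fun c => funext fun x => h c x)

variable (O : Orbifold d X)

theorem differentiableAt_of_mem {k : ℕ} (Ω : O.Form k) (c : O.atlas)
    {x : EuclideanSpace ℝ (Fin d)} (hx : x ∈ c.1.dom) : DifferentiableAt ℝ (Ω.1 c) x :=
  ((Ω.2.1 c).contDiffAt (c.1.isOpen_dom.mem_nhds hx)).differentiableAt (by simp)

open Classical in
/-- The exterior derivative of orbifold forms, computed in each chart. -/
def extD (k : ℕ) : O.Form k →ₗ[ℝ] O.Form (k + 1) where
  toFun Ω := ⟨fun c x => if x ∈ c.1.dom then extDeriv (Ω.1 c) x else 0, by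
    refine ⟨fun c => ?_, fun c x hx => if_neg hx, fun c c' h hh x hx => ?_⟩
    · have h1 : ContDiffOn ℝ ∞ (fun x => extDeriv (Ω.1 c) x) c.1.dom := by
        have h2 : ContDiffOn ℝ ∞ (fderiv ℝ (Ω.1 c)) c.1.dom :=
          (Ω.2.1 c).fderiv_of_isOpen c.1.isOpen_dom (by simp)
        exact (ContinuousAlternatingMap.alternatizeUncurryFinCLM ℝ
          (EuclideanSpace ℝ (Fin d)) ℝ).contDiff.comp_contDiffOn h2
      exact h1.congr fun x hx => if_pos hx
    · have hx1 := hh.source_subset hx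
      have hx2 := hh.target_subset (h.map_source hx)
      beta_reduce
      rw [if_pos hx1, if_pos hx2]
      have hev : Ω.1 c =ᶠ[𝓝 x]
          fun y => (Ω.1 c' (h y)).compContinuousLinearMap (fderiv ℝ h y) :=
        Filter.eventually_of_mem (h.open_source.mem_nhds hx) fun y hy => Ω.2.2.2 c c' h hh y hy
      rw [hev.extDeriv_eq]
      exact extDeriv_pullback (O.differentiableAt_of_mem Ω c' hx2)
        (hh.contDiffOn.contDiffAt (h.open_source.mem_nhds hx)) (by simpa using two_le_infty)⟩
  map_add' α β := by
    refine Form.ext fun c x => ?_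
    change (if x ∈ c.1.dom then extDeriv (α.1 c + β.1 c) x else 0) =
      (if x ∈ c.1.dom then extDeriv (α.1 c) x else 0) +
        (if x ∈ c.1.dom then extDeriv (β.1 c) x else 0)
    split_ifs with hx
    · exact extDeriv_add (O.differentiableAt_of_mem α c hx) (O.differentiableAt_of_mem β c hx)
    · simp
  map_smul' r α := by
    refine Form.ext fun c x => ?_
    change (if x ∈ c.1.dom then extDeriv (r • α.1 c) x else 0) =
      r • (if x ∈ c.1.dom then extDeriv (α.1 c) x else 0)
    split_ifs with hx
    · exact extDeriv_smul r _
    · simp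

/-- The wedge product of orbifold forms, computed in each chart. -/
def wedgeForm {k l : ℕ} (α : O.Form k) (β : O.Form l) : O.Form (k + l) :=
  ⟨fun c x => wedge (α.1 c x) (β.1 c x), by
    refine ⟨fun c => ?_, fun c x hx => ?_, fun c c' h hh x hx => ?_⟩
    · exact ((wedgeCLM (EuclideanSpace ℝ (Fin d)) k l).contDiff.comp_contDiffOn
        (α.2.1 c)).clm_apply (β.2.1 c)
    · beta_reduce
      rw [α.2.2.1 c x hx, wedge_zero_left]
    · beta_reduce
      rw [α.2.2.2 c c' h hh x hx, β.2.2.2 c c' h hh x hx, wedge_compContinuousLinearMap]⟩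

open Classical in
/-- The constant function `1`, as a form of degree `0`. -/
def oneForm : O.Form 0 :=
  ⟨fun c x => if x ∈ c.1.dom then
      ContinuousAlternatingMap.constOfIsEmpty ℝ (EuclideanSpace ℝ (Fin d)) (Fin 0) 1 else 0, by
    refine ⟨fun c => ?_, fun c x hx => if_neg hx, fun c c' h hh x hx => ?_⟩
    · exact contDiffOn_const.congr fun x hx => if_pos hx
    · beta_reduce
      rw [if_pos (hh.source_subset hx), if_pos (hh.target_subset (h.map_source hx))]
      rfl⟩

instance : DirectSum.GNonUnitalNonAssocSemiring (fun k : ℕ => O.Form k) where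
  mul α β := O.wedgeForm α β
  mul_zero α := by refine Form.ext fun c x => ?_; exact wedge_zero_right _
  zero_mul β := by refine Form.ext fun c x => ?_; exact wedge_zero_left _
  mul_add α β γ := by refine Form.ext fun c x => ?_; exact wedge_add_right _ _ _
  add_mul α β γ := by refine Form.ext fun c x => ?_; exact wedge_add_left _ _ _

instance : GradedMonoid.GOne (fun k : ℕ => O.Form k) where
  one := O.oneForm

/-- The algebra of orbifold differential forms, with the wedge product as multiplication. -/
abbrev Forms : Type _ := ⨁ k : ℕ, O.Form k

/-- A form of degree `k` as an element of the algebra of all forms. -/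
abbrev of {k : ℕ} (α : O.Form k) : O.Forms := DirectSum.lof ℝ ℕ (fun k => O.Form k) k α

/-- The differential on the algebra of forms. -/
def D : O.Forms →ₗ[ℝ] O.Forms :=
  DirectSum.toModule ℝ ℕ _ fun k => DirectSum.lof ℝ ℕ (fun k => O.Form k) (k + 1) ∘ₗ O.extD k

theorem D_of {k : ℕ} (α : O.Form k) : O.D (O.of α) = O.of (O.extD k α) := by
  simp [D, of]

theorem extD_extD {k : ℕ} (α : O.Form k) : O.extD (k + 1) (O.extD k α) = 0 := by
  classical
  refine Form.ext fun c x => ?_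
  change (if x ∈ c.1.dom then extDeriv (fun y => if y ∈ c.1.dom then _ else _) x else 0) = 0
  split_ifs with hx
  · have hev : (fun y => if y ∈ c.1.dom then extDeriv (α.1 c) y else 0) =ᶠ[𝓝 x]
        extDeriv (α.1 c) :=
      Filter.eventually_of_mem (c.1.isOpen_dom.mem_nhds hx) fun y hy => if_pos hy
    rw [hev.extDeriv_eq]
    exact extDeriv_extDeriv_apply ((α.2.1 c).contDiffAt (c.1.isOpen_dom.mem_nhds hx))
      (by simpa using two_le_infty)
  · rfl

theorem D_comp_D : O.D ∘ₗ O.D = 0 := by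
  refine DirectSum.linearMap_ext ℝ fun k => ?_
  ext1 α
  change O.D (O.D (O.of α)) = 0
  rw [D_of, D_of, extD_extD]
  exact map_zero _

/-- The involution `α ↦ (-1)^|α| α`. -/
def bar : O.Forms →ₗ[ℝ] O.Forms :=
  DirectSum.toModule ℝ ℕ _ fun k => (-1 : ℝ) ^ k • DirectSum.lof ℝ ℕ (fun k => O.Form k) k

/-- The product of a list of forms, in the order of the list. -/
def listProd (L : List O.Forms) : O.Forms := L.foldr (fun α β => α * β) 1

/-- The (total) orbifold de Rham cohomology, the quotient of closed by exact forms. -/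
abbrev Cohomology : Type _ :=
  LinearMap.ker O.D ⧸ (LinearMap.range O.D).comap (LinearMap.ker O.D).subtype

/-- The class of a closed form. -/
def cls (z : LinearMap.ker O.D) : O.Cohomology := Submodule.Quotient.mk z

/-! ### `a`-Massey products -/

/-- The data `dξᵢ = a ∧ bᵢ`, for all `i`, with `a` and `bᵢ` of degrees `p` and `q i` and
`ξᵢ` homogeneous of degree `p + q i - 1` (hence `ξᵢ = 0` if `p + q i = 0`). -/
def IsPrimitiveSystem {m p : ℕ} {q : Fin m → ℕ} (a : O.Form p) (b : ∀ i, O.Form (q i))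
    (ξ : Fin m → O.Forms) : Prop :=
  ∀ i, (∀ j : ℕ, j + 1 ≠ p + q i → ξ i j = 0) ∧ O.D (ξ i) = O.of a * O.of (b i)

/-- The form `∑ᵢ ξ̄₁ ∧ … ∧ ξ̄ᵢ₋₁ ∧ bᵢ ∧ ξᵢ₊₁ ∧ … ∧ ξₘ`. -/
def masseyForm {m : ℕ} {q : Fin m → ℕ} (b : ∀ i, O.Form (q i)) (ξ : Fin m → O.Forms) : O.Forms :=
  ∑ i : Fin m, O.listProd (List.ofFn fun j : Fin m =>
    if j < i then O.bar (ξ j) else if j = i then O.of (b i) else ξ j)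

/-- The `a`-Massey product `⟨a; b₁, …, bₘ⟩` is defined: `a` is closed of even degree, the `bᵢ` are
closed and all `a ∧ bᵢ` are exact. -/
def MasseyDefined {m p : ℕ} {q : Fin m → ℕ} (a : O.Form p) (b : ∀ i, O.Form (q i)) : Prop :=
  Even p ∧ O.extD p a = 0 ∧ (∀ i, O.extD (q i) (b i) = 0) ∧ ∃ ξ, O.IsPrimitiveSystem a b ξ

/-- The `a`-Massey product `⟨a; b₁, …, bₘ⟩`, a set of cohomology classes. -/
def masseyProduct {m p : ℕ} {q : Fin m → ℕ} (a : O.Form p) (b : ∀ i, O.Form (q i)) :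
    Set O.Cohomology :=
  {x | ∃ ξ, O.IsPrimitiveSystem a b ξ ∧
    ∃ z : LinearMap.ker O.D, (z : O.Forms) = O.masseyForm b ξ ∧ O.cls z = x}

/-- There is a nontrivial `a`-Massey product of order `m`. -/
def HasNontrivialMasseyProduct (m : ℕ) : Prop :=
  ∃ (p : ℕ) (q : Fin m → ℕ) (a : O.Form p) (b : ∀ i, O.Form (q i)),
    O.MasseyDefined a b ∧ 0 ∉ O.masseyProduct a b

end Orbifold

/-! ### Symplectic orbifolds -/

/-- `Ω` is a symplectic form on the `2n`-dimensional orbifold: it is closed and `Ωⁿ ≠ 0` at every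
point. -/
def Orbifold.IsSymplectic {n : ℕ} {X : Type*} [TopologicalSpace X] (O : Orbifold (2 * n) X)
    (Ω : O.Form 2) : Prop :=
  O.extD 2 Ω = 0 ∧ ∀ (c : O.atlas), ∀ x ∈ c.1.dom,
    (O.listProd (List.replicate n (O.of Ω)) (2 * n)).1 c x ≠ 0

/-! ### Manifolds as orbifolds -/

section Manifold

variable {d : ℕ} {N : Type*} [TopologicalSpace N]

/-- A chart of a manifold, as an orbifold chart with trivial group. -/
def OrbifoldChart.ofChart (e : OpenPartialHomeomorph N (EuclideanSpace ℝ (Fin d))) :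
    OrbifoldChart d N where
  dom := e.target
  isOpen_dom := e.open_target
  group := ⊥
  finite_group := inferInstance
  mapsTo := by
    rintro g hg x hx
    rw [Subgroup.mem_bot.1 hg]
    exact hx
  eq_zero_of_fixed g hg hg' := absurd (Subgroup.mem_bot.1 hg) hg'
  zero_mem h := absurd rfl h
  toFun := e.symm
  continuousOn_toFun := e.continuousOn_symm
  isOpen_image s hs hs' := e.isOpen_image_symm_of_subset_target hs' hs
  toFun_eq_iff x hx y hy := by
    constructor
    · intro h
      exact ⟨1, Subgroup.mem_bot.2 rfl, e.symm.injOn hx hy h⟩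
    · rintro ⟨g, hg, h⟩
      rw [Subgroup.mem_bot.1 hg] at h
      exact congrArg e.symm h

/-- A smooth manifold, as an orbifold: its charts are all charts of the maximal smooth atlas, with
trivial groups. -/
def Orbifold.ofManifold (d : ℕ) (N : Type*) [TopologicalSpace N]
    [ChartedSpace (EuclideanSpace ℝ (Fin d)) N] [IsManifold (𝓡 d) ∞ N] : Orbifold d N where
  atlas := OrbifoldChart.ofChart '' IsManifold.maximalAtlas (𝓡 d) ∞ N
  cover p := ⟨_, ⟨_, IsManifold.chart_mem_maximalAtlas p, rfl⟩,
    chartAt (EuclideanSpace ℝ (Fin d)) p p, mem_chart_target _ p,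
    (chartAt (EuclideanSpace ℝ (Fin d)) p).left_inv (mem_chart_source _ p)⟩
  compatible := by
    rintro _ ⟨e, he, rfl⟩ _ ⟨e', he', rfl⟩ x hx y hy hxy
    have hx : x ∈ e.target := hx
    have hy : y ∈ e'.target := hy
    have hxy : e.symm x = e'.symm y := hxy
    have hc : e.symm ≫ₕ e' ∈ contDiffGroupoid ∞ (𝓡 d) :=
      StructureGroupoid.compatible_of_mem_maximalAtlas he he'
    rw [contDiffGroupoid, mem_groupoid_of_pregroupoid] at hc
    have hsrc : (e.symm ≫ₕ e').source ⊆ e.target := by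
      rw [OpenPartialHomeomorph.trans_source]
      exact inter_subset_left
    refine ⟨e.symm ≫ₕ e', ⟨hsrc, ?_, ?_, ?_, ?_⟩, ?_, ?_⟩
    · rw [OpenPartialHomeomorph.trans_target]
      exact inter_subset_left
    · simpa [contDiffPregroupoid] using hc.1
    · simpa [contDiffPregroupoid] using hc.2
    · intro z hz
      rw [OpenPartialHomeomorph.trans_source] at hz
      exact (e'.left_inv hz.2).symm
    · rw [OpenPartialHomeomorph.trans_source]
      refine ⟨hx, ?_⟩
      change e.symm x ∈ e'.source
      rw [hxy]
      exact e'.map_target hy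
    · change e' (e.symm x) = y
      rw [hxy]
      exact e'.right_inv hy

variable [ChartedSpace (EuclideanSpace ℝ (Fin d)) N] [IsManifold (𝓡 d) ∞ N]

/-- The expression of a form on a manifold in a smooth chart. -/
def Orbifold.chartForm {k : ℕ} (Ω : (Orbifold.ofManifold d N).Form k)
    (e : OpenPartialHomeomorph N (EuclideanSpace ℝ (Fin d)))
    (he : e ∈ IsManifold.maximalAtlas (𝓡 d) ∞ N) :
    EuclideanSpace ℝ (Fin d) → EuclideanSpace ℝ (Fin d) [⋀^Fin k]→L[ℝ] ℝ :=
  Ω.1 ⟨OrbifoldChart.ofChart e, e, he, rfl⟩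

/-- `S` is an embedded `k`-dimensional submanifold on which `Ω` is nondegenerate: around every
point of `S` there is a smooth chart in which `S` is given by the vanishing of the coordinates
`xᵢ`, `i ≥ k`, and in which `Ω` is nondegenerate on the tangent spaces of `S`. -/
def IsSymplecticSubmanifold (Ω : (Orbifold.ofManifold d N).Form 2) (k : ℕ) (S : Set N) : Prop :=
  k ≤ d ∧ ∀ p ∈ S, ∃ (e : OpenPartialHomeomorph N (EuclideanSpace ℝ (Fin d)))
    (he : e ∈ IsManifold.maximalAtlas (𝓡 d) ∞ N), p ∈ e.source ∧
      (∀ y ∈ e.source, y ∈ S ↔ ∀ i : Fin d, k ≤ i → e y i = 0) ∧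
      ∀ y ∈ e.source ∩ S, ∀ v : EuclideanSpace ℝ (Fin d), (∀ i : Fin d, k ≤ i → v i = 0) →
        v ≠ 0 → ∃ w : EuclideanSpace ℝ (Fin d), (∀ i : Fin d, k ≤ i → w i = 0) ∧
          Orbifold.chartForm Ω e he (e y) ![v, w] ≠ 0

end Manifold

/-! ### Symplectic resolutions -/

section Resolution

variable {d : ℕ} {X Y : Type*} [TopologicalSpace X] [TopologicalSpace Y]

/-- At the points of `S`, the form `β` is the pullback of `α` along `π` (where `π` is a local
diffeomorphism). -/
def AgreesWithPullback (P : Orbifold d Y) (O : Orbifold d X) (π : Y → X) {k : ℕ} (S : Set Y)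
    (α : O.Form k) (β : P.Form k) : Prop :=
  ∀ (c : P.atlas) (c' : O.atlas) (h), IsLocalLift π c.1 c'.1 h → ∀ x ∈ h.source, c.1.toFun x ∈ S →
    β.1 c x = (α.1 c' (h x)).compContinuousLinearMap (fderiv ℝ h x)

/-- `π` restricts to a diffeomorphism from `S` onto `T`. -/
def IsDiffeoOn (P : Orbifold d Y) (O : Orbifold d X) (π : Y → X) (S : Set Y) (T : Set X) : Prop :=
  BijOn π S T ∧ ∀ y ∈ S, ∃ c ∈ P.atlas, ∃ c' ∈ O.atlas, ∃ h, IsLocalLift π c c' h ∧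
    ∃ x ∈ h.source, c.toFun x = y

/-- A choice of small pairwise disjoint neighbourhoods of the singular points: each is relatively
compact in the image of an orbifold chart around the singular point. -/
def IsSmallNeighbourhoodSystem (O : Orbifold d X) (V : X → Set X) : Prop :=
  (∀ p ∈ O.singularSet, IsOpen (V p) ∧ p ∈ V p ∧ IsCompact (closure (V p)) ∧
    ∃ c ∈ O.atlas, 0 ∈ c.dom ∧ c.toFun 0 = p ∧ closure (V p) ⊆ c.toFun '' c.dom) ∧
  O.singularSet.PairwiseDisjoint V

/-- A symplectic resolution `π : (N, Ω') → (X, Ω)` of a symplectic orbifold, where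
`E = π⁻¹(Δ)` is the preimage of the singular set. -/
structure IsSymplecticResolution {n : ℕ} {N : Type*} [TopologicalSpace N]
    [ChartedSpace (EuclideanSpace ℝ (Fin (2 * n))) N] [IsManifold (𝓡 (2 * n)) ∞ N]
    (O : Orbifold (2 * n) X) (Ω : O.Form 2) (Ω' : (Orbifold.ofManifold (2 * n) N).Form 2)
    (π : N → X) : Prop where
  isProperMap : IsProperMap π
  isDiffeoOn : IsDiffeoOn (Orbifold.ofManifold (2 * n) N) O π (π ⁻¹' O.singularSet)ᶜ
    (O.singularSet)ᶜ
  /-- `E` is a locally finite union of symplectic submanifolds of codimension at least `2`. -/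
  exceptional : ∃ 𝒮 : Set (Set N), ⋃₀ 𝒮 = π ⁻¹' O.singularSet ∧
    LocallyFinite (fun S : 𝒮 => (S : Set N)) ∧
    ∀ S ∈ 𝒮, ∃ k, k + 2 ≤ 2 * n ∧ IsSymplecticSubmanifold Ω' k S
  /-- `Ω'` agrees with `π^* Ω` outside a small neighbourhood of `E`. -/
  agrees : ∃ V, IsSmallNeighbourhoodSystem O V ∧
    AgreesWithPullback (Orbifold.ofManifold (2 * n) N) O π (π ⁻¹' ⋃ p ∈ O.singularSet, V p)ᶜ Ω Ω'

/-- The form is constant (in degree `0`) or zero (in positive degree) on a neighbourhood of every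
singular point. -/
def Orbifold.IsFlat (O : Orbifold d X) {k : ℕ} (α : O.Form k) : Prop :=
  ∀ p ∈ O.singularSet, ∃ V : Set X, IsOpen V ∧ p ∈ V ∧ ∃ r : ℝ,
    ∀ (c : O.atlas), ∀ x ∈ c.1.dom, c.1.toFun x ∈ V → ∀ v, α.1 c x v = if k = 0 then r else 0

/-- The (graph of the) map `π^*` induced on cohomology by a map which is a diffeomorphism outside
the preimage `E` of the singular set: a class is represented by a closed form which is flat around
the singular points, and is sent to the class of the form on `Y` which is the pullback off `E`. -/
def CohomologyPullback (P : Orbifold d Y) (O : Orbifold d X) (π : Y → X) (x : O.Cohomology)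
    (y : P.Cohomology) : Prop :=
  ∃ (α : LinearMap.ker O.D) (β : LinearMap.ker P.D), O.cls α = x ∧ P.cls β = y ∧
    ∀ k : ℕ, O.IsFlat (α.1 k) ∧
      AgreesWithPullback P O π (π ⁻¹' O.singularSet)ᶜ (α.1 k) (β.1 k)

/-- The class of a closed homogeneous form. -/
def Orbifold.homCls (O : Orbifold d X) {k : ℕ} (α : O.Form k) (hα : O.extD k α = 0) :
    O.Cohomology :=
  O.cls ⟨O.of α, by rw [LinearMap.mem_ker, O.D_of, hα]; exact map_zero _⟩

end Resolution

end

/-!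
The theorem compares the `a`-Massey products of a symplectic orbifold `M`, with isolated
singularities, and of a symplectic resolution `π : N → M` of it, with exceptional set
`E = π⁻¹(Δ)`. Every class on `M` has a *flat* representative, constant or zero near `Δ`
(`Orbifold.exists_isFlat_sub_extD`: the Poincaré lemma on a ball in a chart, averaging over the
finite group, and a cutoff), and the pullback of a flat form extends over `E`. So the proof is about
flat forms `a`, `b₁, …, bₘ` and their pullbacks `a'`, `b'₁, …, b'ₘ`
(`IsSymplecticResolution.masseyProduct_eq_of_isFlatPullback`).

*From `M` to `N`.* Primitives `ξᵢ` of `a ∧ bᵢ` can be made flat without changing the class of the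
Massey form, and then they pull back.

*From `N` to `M`.* Let `bᵢ` vanish on a neighbourhood `𝒱` of `Δ`. A primitive `ξ'` of `a' ∧ b'ᵢ` is
closed over `𝒱`. The main geometric fact is `IsResolutionMap.exists_splitting`: such a form
is `π^*α + μ + dτ`, with `α` flat and `μ` closed and supported over `𝒱`. Where the forms `μ` do not
vanish, all `b'ᵢ` do, and every term of the Massey form has a factor `b'ᵢ`; so the Massey form of
`b'` with respect to the primitives `π^*αᵢ + μᵢ` is the pullback of the one of `b` with respect to
`αᵢ`. The same splitting shows that `π^*` is injective in cohomology.

*The splitting.* Over a punctured conical neighbourhood of a singular point, `π` is a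
diffeomorphism, so `ξ'` gives a closed form on a punctured ball in `ℝᵈ`, `d = 2n`. By Mayer–Vietoris
(`isExactOn_diff_coordSubspace`), closed forms there are exact or constant, except in degree `d - 1`,
where the angular form `Q⁻ⁿ ι_x vol`, for an invariant quadratic form `Q`, spans the cohomology. No
closed form on the resolution near `E` restricts to a form cohomologous to a nonzero multiple of the
angular form (`IsResolutionMap.not_agreesInChart_angular`): cut off by a decreasing function of `Q`,
it would give a compactly supported form on `N` whose differential is everywhere a nonnegative
multiple of the volume form, and not zero, against Stokes' theorem (`extD_eq_zero_of_nonneg`). This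
is where the symplectic form of `N`, as an orientation, is used. Once `ξ'` is `dν` on the shell,
subtracting the differential of the pullback of a cut-off of `ν` separates the parts outside and
inside.

*Forms `bᵢ` of degree zero.* They matter for the first claim only. If `m ≥ 2` and some `bᵢ` is
locally constant, then `0 ∈ ⟨a; b₁, …, bₘ⟩`
(`Orbifold.zero_mem_masseyProduct_of_degree_eq_zero`): where `bᵢ ≠ 0`, the form `a` is exact and can
be replaced by `0`, and where `bᵢ = 0`, one can take `ξᵢ = 0`. For `m = 1`, the product
`⟨0; 1⟩ = {[1]}` on `N` is nontrivial.

The algebra consists of an associative graded-commutative product on `Orbifold.Forms`, which makes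
the space of forms a ring, and of identities for the pair of `∏ ξᵢ` and the Massey form, where
`d ∏ ξᵢ` is `a` times the Massey form: they show how the Massey form changes with `a`, `bᵢ`, `ξᵢ`.
-/

noncomputable section

/-! ### The ring of orbifold differential forms -/

section
variable {V : Type*} [AddCommGroup V] [Module ℝ V]

/-- The product `v ↦ x(v₁, …, v_k) * y(v_{k+1}, …, v_{k+l})` of two multilinear forms. -/
def mulForm {k l : ℕ} (x : MultilinearMap ℝ (fun _ : Fin k => V) ℝ)
    (y : MultilinearMap ℝ (fun _ : Fin l => V) ℝ) : MultilinearMap ℝ (fun _ : Fin (k + l) => V) ℝ :=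
  ((LinearMap.mul' ℝ ℝ).compMultilinearMap (x.domCoprod y)).domDomCongr finSumFinEquiv

theorem mulForm_apply {k l : ℕ} (x : MultilinearMap ℝ (fun _ : Fin k => V) ℝ)
    (y : MultilinearMap ℝ (fun _ : Fin l => V) ℝ) (v : Fin (k + l) → V) :
    mulForm x y v = x (fun i => v (Fin.castAdd l i)) * y (fun i => v (Fin.natAdd k i)) := by
  simp [mulForm, MultilinearMap.domCoprod_apply]

theorem alternatization_domDomCongr {ι ι' : Type*} [Fintype ι] [Fintype ι'] [DecidableEq ι]
    [DecidableEq ι'] (e : ι ≃ ι') (x : MultilinearMap ℝ (fun _ : ι => V) ℝ) :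
    (MultilinearMap.alternatization (x.domDomCongr e)) =
      (MultilinearMap.alternatization x).domDomCongr e := by
  ext v
  rw [MultilinearMap.alternatization_apply, AlternatingMap.domDomCongr_apply,
    MultilinearMap.alternatization_apply]
  refine (Equiv.sum_comp e.permCongr _).symm.trans ?_
  refine Finset.sum_congr rfl fun σ _ => ?_
  simp [MultilinearMap.domDomCongr_apply, Equiv.permCongr_apply]

theorem wedgeAlg_alternatization {k l : ℕ} (x : MultilinearMap ℝ (fun _ : Fin k => V) ℝ)
    (y : MultilinearMap ℝ (fun _ : Fin l => V) ℝ) :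
    wedgeAlg (MultilinearMap.alternatization x) (MultilinearMap.alternatization y) =
      MultilinearMap.alternatization (mulForm x y) := by
  rw [mulForm, alternatization_domDomCongr, LinearMap.compMultilinearMap_alternatization,
    MultilinearMap.domCoprod_alternization]
  rfl

theorem exists_alternatization_eq {k : ℕ} (α : V [⋀^Fin k]→ₗ[ℝ] ℝ) :
    ∃ x : MultilinearMap ℝ (fun _ : Fin k => V) ℝ, MultilinearMap.alternatization x = α := by
  refine ⟨((k.factorial : ℝ)⁻¹ • α : V [⋀^Fin k]→ₗ[ℝ] ℝ), ?_⟩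
  rw [AlternatingMap.coe_alternatization, Fintype.card_fin, ← Nat.cast_smul_eq_nsmul ℝ, smul_smul,
    mul_inv_cancel₀ (by positivity), one_smul]

theorem wedgeAlg_assoc {k l m : ℕ} (α : V [⋀^Fin k]→ₗ[ℝ] ℝ) (β : V [⋀^Fin l]→ₗ[ℝ] ℝ)
    (γ : V [⋀^Fin m]→ₗ[ℝ] ℝ) :
    wedgeAlg α (wedgeAlg β γ) =
      (wedgeAlg (wedgeAlg α β) γ).domDomCongr (finCongr (Nat.add_assoc k l m)) := by
  obtain ⟨x, rfl⟩ := exists_alternatization_eq α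
  obtain ⟨y, rfl⟩ := exists_alternatization_eq β
  obtain ⟨z, rfl⟩ := exists_alternatization_eq γ
  simp only [wedgeAlg_alternatization]
  rw [← alternatization_domDomCongr]
  congr 1
  ext v
  simp only [mulForm_apply, MultilinearMap.domDomCongr_apply, mul_assoc]
  congr 1
  congr 1
  congr 1
  ext i
  congr 1
  ext
  simp [Nat.add_assoc]

theorem finRotate_pow_val {n : ℕ} (l : ℕ) (i : Fin (n + 1)) :
    (((finRotate (n + 1)) ^ l) i : ℕ) = (i + l) % (n + 1) := by
  induction l with
  | zero => simp [Nat.mod_eq_of_lt i.2]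
  | succ l ih =>
    rw [pow_succ', Equiv.Perm.mul_apply, finRotate_apply, Fin.val_add, ih]
    simp [Nat.add_mod, ← Nat.add_assoc]

/-- The wedge product is graded-commutative. Both products are alternatizations of the products of
the same multilinear forms, up to the rotation of the arguments which moves one block past the
other; it is the `l`-th power of a cycle of length `k + l`, of sign `(-1) ^ (k * l)`. -/
theorem wedgeAlg_comm {k l : ℕ} (α : V [⋀^Fin k]→ₗ[ℝ] ℝ) (β : V [⋀^Fin l]→ₗ[ℝ] ℝ) :
    wedgeAlg β α = (-1 : ℝ) ^ (k * l) •
      (wedgeAlg α β).domDomCongr (finCongr (Nat.add_comm k l)) := by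
  by_cases h0 : k + l = 0
  · obtain ⟨rfl, rfl⟩ : k = 0 ∧ l = 0 := by omega
    ext v
    rw [wedgeAlg_apply]
    simp only [mul_zero, pow_zero, one_smul, AlternatingMap.domDomCongr_apply]
    rw [wedgeAlg_apply]
    refine Finset.sum_congr rfl fun σ _ => ?_
    induction σ using Quotient.inductionOn' with | _ σ
    rw [wedgeAlg_summand, wedgeAlg_summand, mul_comm (β _)]
    congr 2
    · congr 1; ext i; exact i.elim0
    · congr 1; ext i; exact i.elim0
  obtain ⟨n, hkl⟩ := Nat.exists_eq_succ_of_ne_zero h0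
  rw [Nat.succ_eq_add_one] at hkl
  obtain ⟨x, rfl⟩ := exists_alternatization_eq α
  obtain ⟨y, rfl⟩ := exists_alternatization_eq β
  simp only [wedgeAlg_alternatization]
  have h1 : mulForm y x = (mulForm x y).domDomCongr (finAddFlip : Fin (k + l) ≃ Fin (l + k)) := by
    ext v
    rw [MultilinearMap.domDomCongr_apply, mulForm_apply, mulForm_apply, mul_comm]
    congr 1
    · congr 1; ext i; rw [finAddFlip_apply_castAdd]
    · congr 1; ext i; rw [finAddFlip_apply_natAdd]
  rw [h1, alternatization_domDomCongr]
  ext v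
  simp only [AlternatingMap.domDomCongr_apply, AlternatingMap.smul_apply]
  set τ : Equiv.Perm (Fin (k + l)) := finAddFlip.trans (finCongr (Nat.add_comm l k)) with hτ
  have h2 : (fun i => v (finAddFlip i)) =
      (fun i => (fun j => v (finCongr (Nat.add_comm k l) j)) (τ i)) := by
    ext i
    simp [hτ]
  change MultilinearMap.alternatization (mulForm x y) (fun i => v (finAddFlip i)) = _
  rw [h2]
  have h3 := (MultilinearMap.alternatization (mulForm x y)).map_perm
    (fun j => v (finCongr (Nat.add_comm k l) j)) τ
  have h4 : Equiv.Perm.sign τ = (-1) ^ (k * l) := by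
    -- the block transposition is the rotation by `l`
    have h5 : (finCongr hkl).permCongr τ = (finRotate (n + 1)) ^ l := by
      ext i
      rw [finRotate_pow_val]
      obtain ⟨j, rfl⟩ := (finCongr hkl).surjective i
      simp only [Equiv.permCongr_apply, Equiv.symm_apply_apply, hτ]
      induction j using Fin.addCases with
      | left j =>
        simp
        rw [Nat.mod_eq_of_lt (by omega), Nat.add_comm]
      | right j =>
        simp
        rw [show k + j + l = j + (n + 1) by omega, Nat.add_mod_right, Nat.mod_eq_of_lt (by omega)]
    rw [← Equiv.Perm.sign_permCongr (finCongr hkl), h5, map_pow, sign_finRotate, ← pow_mul]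
    have h6 : n + 1 - 1 = k + l - 1 := by omega
    rw [h6]
    rcases l with _ | l
    · simp
    · have : (k + (l + 1) - 1) * (l + 1) = k * (l + 1) + l * (l + 1) := by
        rw [show k + (l + 1) - 1 = k + l by omega]; ring
      rw [this, pow_add, (Nat.even_mul_succ_self l).neg_one_pow, mul_one]
  rw [h4] at h3
  refine h3.trans ?_
  rw [Units.smul_def, zsmul_eq_mul]
  push_cast
  rfl
end

section
variable {V : Type*} [NormedAddCommGroup V] [NormedSpace ℝ V]

/-- A `k`-form regarded as a `k'`-form, for `k = k'`. -/
def castAlt {k k' : ℕ} (h : k = k') (α : V [⋀^Fin k]→L[ℝ] ℝ) : V [⋀^Fin k']→L[ℝ] ℝ :=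
  h ▸ α

theorem castAlt_apply {k k' : ℕ} (h : k = k') (α : V [⋀^Fin k]→L[ℝ] ℝ) (v : Fin k' → V) :
    castAlt h α v = α (fun i => v (Fin.cast h i)) := by
  subst h; rfl

@[simp] theorem castAlt_rfl {k : ℕ} (α : V [⋀^Fin k]→L[ℝ] ℝ) : castAlt rfl α = α := rfl

theorem castAlt_trans {k k' k'' : ℕ} (h : k = k') (h' : k' = k'') (α : V [⋀^Fin k]→L[ℝ] ℝ) :
    castAlt h' (castAlt h α) = castAlt (h.trans h') α := by
  subst h h'; rfl

theorem castAlt_smul {k k' : ℕ} (h : k = k') (r : ℝ) (α : V [⋀^Fin k]→L[ℝ] ℝ) :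
    castAlt h (r • α) = r • castAlt h α := by
  subst h; rfl

theorem castAlt_zero {k k' : ℕ} (h : k = k') :
    castAlt h (0 : V [⋀^Fin k]→L[ℝ] ℝ) = 0 := by
  subst h; rfl

theorem castAlt_sum {ι : Type*} (s : Finset ι) {k k' : ℕ} (h : k = k')
    (α : ι → V [⋀^Fin k]→L[ℝ] ℝ) :
    castAlt h (∑ i ∈ s, α i) = ∑ i ∈ s, castAlt h (α i) := by
  subst h; rfl

theorem wedge_castAlt_left {k k' l : ℕ} (h : k = k') (α : V [⋀^Fin k]→L[ℝ] ℝ)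
    (β : V [⋀^Fin l]→L[ℝ] ℝ) :
    wedge (castAlt h α) β = castAlt (by rw [h]) (wedge α β) := by
  subst h; rfl

theorem wedge_castAlt_right {k l l' : ℕ} (h : l = l') (α : V [⋀^Fin k]→L[ℝ] ℝ)
    (β : V [⋀^Fin l]→L[ℝ] ℝ) :
    wedge α (castAlt h β) = castAlt (by rw [h]) (wedge α β) := by
  subst h; rfl

theorem wedge_assoc {k l m : ℕ} (α : V [⋀^Fin k]→L[ℝ] ℝ) (β : V [⋀^Fin l]→L[ℝ] ℝ)
    (γ : V [⋀^Fin m]→L[ℝ] ℝ) :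
    wedge α (wedge β γ) = castAlt (Nat.add_assoc k l m) (wedge (wedge α β) γ) := by
  ext v
  rw [castAlt_apply]
  exact DFunLike.congr_fun (wedgeAlg_assoc α.toAlternatingMap β.toAlternatingMap
    γ.toAlternatingMap) v

theorem wedge_comm {k l : ℕ} (α : V [⋀^Fin k]→L[ℝ] ℝ) (β : V [⋀^Fin l]→L[ℝ] ℝ) :
    wedge β α = (-1 : ℝ) ^ (k * l) • castAlt (Nat.add_comm k l) (wedge α β) := by
  ext v
  rw [ContinuousAlternatingMap.smul_apply, castAlt_apply]
  exact DFunLike.congr_fun (wedgeAlg_comm α.toAlternatingMap β.toAlternatingMap) v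

theorem wedge_constOfIsEmpty_left {k : ℕ} (r : ℝ) (β : V [⋀^Fin k]→L[ℝ] ℝ) :
    wedge (ContinuousAlternatingMap.constOfIsEmpty ℝ V (Fin 0) r) β =
      r • castAlt (Nat.zero_add k).symm β := by
  ext v
  obtain ⟨y, hy⟩ := exists_alternatization_eq β.toAlternatingMap
  have h0 : MultilinearMap.alternatization
      (MultilinearMap.constOfIsEmpty ℝ (fun _ : Fin 0 => V) r) =
      (ContinuousAlternatingMap.constOfIsEmpty ℝ V (Fin 0) r).toAlternatingMap := by
    ext v
    simp [MultilinearMap.alternatization_apply]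
  rw [ContinuousAlternatingMap.smul_apply, castAlt_apply]
  change wedgeAlg _ _ v = r * β.toAlternatingMap _
  rw [← h0, ← hy, wedgeAlg_alternatization]
  have h1 : mulForm (MultilinearMap.constOfIsEmpty ℝ (fun _ : Fin 0 => V) r) y =
      r • y.domDomCongr (finCongr (Nat.zero_add k).symm) := by
    ext v
    simp only [mulForm_apply, smul_apply, MultilinearMap.domDomCongr_apply,
      smul_eq_mul]
    congr 2
    ext i; congr 1; ext; simp
  rw [h1, MultilinearMap.alternatization_apply]
  have h2 := DFunLike.congr_fun
    (alternatization_domDomCongr (finCongr (Nat.zero_add k).symm) y) v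
  rw [MultilinearMap.alternatization_apply, AlternatingMap.domDomCongr_apply] at h2
  change _ = r * MultilinearMap.alternatization y _
  refine Eq.trans ?_ (congrArg (r * ·) h2)
  rw [Finset.mul_sum]
  refine Finset.sum_congr rfl fun σ _ => ?_
  rw [mul_smul_comm]
  rfl

/-- A continuous linear form as an alternating `1`-form. -/
def oneAlt (ℓ : V →L[ℝ] ℝ) : V [⋀^Fin 1]→L[ℝ] ℝ :=
  ContinuousAlternatingMap.ofSubsingleton ℝ V ℝ (0 : Fin 1) ℓ

/-- The alternatization which defines the exterior derivative, of a tensor `ℓ ⊗ α`, is `ℓ ∧ α`. The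
identity is proved after alternatizing both sides, that is up to the factor `(k + 1)!`. -/
theorem alternatizeUncurryFin_smulRight {k : ℕ} (ℓ : V →L[ℝ] ℝ) (α : V [⋀^Fin k]→L[ℝ] ℝ) :
    ContinuousAlternatingMap.alternatizeUncurryFin (ℓ.smulRight α) =
      castAlt (Nat.add_comm 1 k) (wedge (oneAlt ℓ) α) := by
  set A := ContinuousAlternatingMap.alternatizeUncurryFin (ℓ.smulRight α) with hA
  set m : MultilinearMap ℝ (fun _ : Fin (k + 1) => V) ℝ :=
    (mulForm (oneAlt ℓ).toAlternatingMap.toMultilinearMap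
      α.toAlternatingMap.toMultilinearMap).domDomCongr (finCongr (Nat.add_comm 1 k)) with hm
  have hm_apply (v : Fin (k + 1) → V) : m v = ℓ (v 0) * α (fun i => v i.succ) := by
    rw [hm, MultilinearMap.domDomCongr_apply, mulForm_apply]
    congr 1
    change α _ = α _
    congr 1
    ext i; congr 1; ext; simp
  have h1 : (A.toAlternatingMap : MultilinearMap ℝ (fun _ : Fin (k + 1) => V) ℝ) =
      ∑ i : Fin (k + 1), Equiv.Perm.sign i.cycleRange.symm • m.domDomCongr i.cycleRange.symm := by
    ext v
    change A v = _
    rw [hA, ContinuousAlternatingMap.alternatizeUncurryFin_apply, sum_apply]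
    refine Finset.sum_congr rfl fun i _ => ?_
    have h0 : m (fun j => v (i.cycleRange.symm j)) = ℓ (v i) * α (i.removeNth v) := by
      rw [hm_apply, Fin.cycleRange_symm_zero]
      congr 2
      ext j
      rw [Fin.cycleRange_symm_succ]
      rfl
    rw [smul_apply, MultilinearMap.domDomCongr_apply, h0, Equiv.Perm.sign_symm,
      Fin.sign_cycleRange, Units.smul_def]
    push_cast
    rfl
  have h2 (σ : Equiv.Perm (Fin (k + 1))) :
      MultilinearMap.alternatization (Equiv.Perm.sign σ • m.domDomCongr σ) =
        MultilinearMap.alternatization m := by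
    rw [Units.smul_def, map_zsmul, alternatization_domDomCongr, AlternatingMap.domDomCongr_perm,
      Units.smul_def, smul_smul, ← Units.val_mul, Int.units_mul_self, Units.val_one, one_smul]
  have h3 := congrArg MultilinearMap.alternatization h1
  rw [AlternatingMap.coe_alternatization, map_sum, Finset.sum_congr rfl fun i _ => h2 _,
    Finset.sum_const, Finset.card_univ, Fintype.card_fin, hm, alternatization_domDomCongr,
    ← wedgeAlg_alternatization, AlternatingMap.coe_alternatization,
    AlternatingMap.coe_alternatization] at h3
  ext v
  have h4 := DFunLike.congr_fun h3 v
  have hw : wedgeAlg ((Fintype.card (Fin 1)).factorial • (oneAlt ℓ).toAlternatingMap)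
      ((Fintype.card (Fin k)).factorial • α.toAlternatingMap) =
      ((wedge (oneAlt ℓ) ((k.factorial : ℝ) • α)).toAlternatingMap) := by
    ext w
    simp only [Fintype.card_fin, Nat.factorial_one, one_smul]
    rw [← Nat.cast_smul_eq_nsmul ℝ]
    rfl
  rw [hw, wedge_smul_right, Nat.factorial_succ] at h4
  have h5 : ((k + 1 : ℕ) : ℝ) * (k.factorial : ℝ) * A v = ((k + 1 : ℕ) : ℝ) *
      ((k.factorial : ℝ) * (castAlt (Nat.add_comm 1 k) (wedge (oneAlt ℓ) α)) v) := by
    rw [castAlt_apply, ← Nat.cast_mul]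
    simpa [← Nat.cast_smul_eq_nsmul ℝ, Function.comp_def] using h4
  rw [mul_assoc] at h5
  exact mul_left_cancel₀ (by positivity) (mul_left_cancel₀ (by positivity) h5)

end

section
variable {d : ℕ}

local notation "E" d => EuclideanSpace ℝ (Fin d)

theorem sum_smulRight_single {F : Type*} [NormedAddCommGroup F] [NormedSpace ℝ F]
    (f : (E d) →L[ℝ] F) :
    f = ∑ i : Fin d, (EuclideanSpace.proj i : (E d) →L[ℝ] ℝ).smulRight
      (f (EuclideanSpace.single i 1)) := by
  ext x
  have h : x = ∑ i, x i • EuclideanSpace.single i (1 : ℝ) := by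
    ext j
    simp [Finset.sum_apply, Pi.single_apply]
  conv_lhs => rw [h]
  simp only [map_sum, map_smul, sum_apply, ContinuousLinearMap.smulRight_apply]
  rfl

theorem alternatizeUncurryFin_wedge_left {k l : ℕ} (f : (E d) →L[ℝ] (E d) [⋀^Fin k]→L[ℝ] ℝ)
    (β : (E d) [⋀^Fin l]→L[ℝ] ℝ) :
    ContinuousAlternatingMap.alternatizeUncurryFin
      (((wedgeCLM (E d) k l).flip β).comp f) =
      castAlt (by omega) (wedge (ContinuousAlternatingMap.alternatizeUncurryFin f) β) := by
  have hc (φ : (E d) →L[ℝ] ℝ) (α : (E d) [⋀^Fin k]→L[ℝ] ℝ) :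
      ((wedgeCLM (E d) k l).flip β).comp (φ.smulRight α) = φ.smulRight (wedge α β) := by
    ext x : 1
    exact wedge_smul_left _ _ _
  have hw (α : (E d) [⋀^Fin (k + 1)]→L[ℝ] ℝ) :
      wedge α β = (wedgeCLM (E d) (k + 1) l).flip β α := rfl
  rw [sum_smulRight_single f]
  simp only [← ContinuousAlternatingMap.alternatizeUncurryFinCLM_apply, map_sum,
    ContinuousLinearMap.comp_finsetSum]
  rw [hw, map_sum, castAlt_sum]
  refine Finset.sum_congr rfl fun i _ => ?_
  rw [hc, ContinuousAlternatingMap.alternatizeUncurryFinCLM_apply,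
    ContinuousAlternatingMap.alternatizeUncurryFinCLM_apply, alternatizeUncurryFin_smulRight,
    ← hw, alternatizeUncurryFin_smulRight, wedge_castAlt_left, wedge_assoc, castAlt_trans,
    castAlt_trans]

theorem alternatizeUncurryFin_wedge_right {k l : ℕ} (α : (E d) [⋀^Fin k]→L[ℝ] ℝ)
    (f : (E d) →L[ℝ] (E d) [⋀^Fin l]→L[ℝ] ℝ) :
    ContinuousAlternatingMap.alternatizeUncurryFin ((wedgeCLM (E d) k l α).comp f) =
      (-1 : ℝ) ^ k • wedge α (ContinuousAlternatingMap.alternatizeUncurryFin f) := by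
  have hc (φ : (E d) →L[ℝ] ℝ) (β : (E d) [⋀^Fin l]→L[ℝ] ℝ) :
      (wedgeCLM (E d) k l α).comp (φ.smulRight β) = φ.smulRight (wedge α β) := by
    ext x : 1
    exact wedge_smul_right _ _ _
  have hw (β : (E d) [⋀^Fin (l + 1)]→L[ℝ] ℝ) :
      wedge α β = wedgeCLM (E d) k (l + 1) α β := rfl
  rw [sum_smulRight_single f]
  simp only [← ContinuousAlternatingMap.alternatizeUncurryFinCLM_apply, map_sum,
    ContinuousLinearMap.comp_finsetSum]
  rw [hw, map_sum, Finset.smul_sum]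
  refine Finset.sum_congr rfl fun i _ => ?_
  rw [hc, ContinuousAlternatingMap.alternatizeUncurryFinCLM_apply,
    ContinuousAlternatingMap.alternatizeUncurryFinCLM_apply, alternatizeUncurryFin_smulRight,
    ← hw, alternatizeUncurryFin_smulRight, wedge_castAlt_right, wedge_assoc, wedge_assoc,
    wedge_comm (oneAlt _) α, wedge_smul_left, wedge_castAlt_left, castAlt_smul, castAlt_smul,
    smul_smul]
  simp only [castAlt_trans, one_mul]
  rw [← pow_add, Even.neg_one_pow ⟨k, rfl⟩, one_smul]

theorem extDeriv_wedge {k l : ℕ} {α : (E d) → (E d) [⋀^Fin k]→L[ℝ] ℝ}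
    {β : (E d) → (E d) [⋀^Fin l]→L[ℝ] ℝ} {x : E d} (hα : DifferentiableAt ℝ α x)
    (hβ : DifferentiableAt ℝ β x) :
    extDeriv (fun y => wedge (α y) (β y)) x =
      castAlt (by omega) (wedge (extDeriv α x) (β x)) +
        (-1 : ℝ) ^ k • wedge (α x) (extDeriv β x) := by
  have h1 := ((wedgeCLM (E d) k l).hasFDerivAt_of_bilinear hα.hasFDerivAt hβ.hasFDerivAt).fderiv
  have h2 : fderiv ℝ (fun y => wedge (α y) (β y)) x =
      (wedgeCLM (E d) k l (α x)).comp (fderiv ℝ β x) +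
        ((wedgeCLM (E d) k l).flip (β x)).comp (fderiv ℝ α x) := by
    refine h1.trans ?_
    ext v : 1
    rfl
  rw [extDeriv, h2, ContinuousAlternatingMap.alternatizeUncurryFin_add,
    alternatizeUncurryFin_wedge_left, alternatizeUncurryFin_wedge_right]
  exact add_comm _ _

end

namespace Orbifold

variable {d : ℕ} {X : Type*} [TopologicalSpace X] (O : Orbifold d X)

theorem of_eq_of {k k' : ℕ} (h : k = k') {α : O.Form k} {β : O.Form k'}
    (hαβ : ∀ c x, β.1 c x = castAlt h (α.1 c x)) : O.of α = O.of β := by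
  subst h
  rw [show α = β from Form.ext fun c x => (hαβ c x).symm]

theorem exists_castForm {k k' : ℕ} (h : k = k') (α : O.Form k) :
    ∃ β : O.Form k', ∀ c x, β.1 c x = castAlt h (α.1 c x) := by
  subst h
  exact ⟨α, fun _ _ => rfl⟩

theorem of_mul_of {k l : ℕ} (α : O.Form k) (β : O.Form l) :
    O.of α * O.of β = O.of (O.wedgeForm α β) :=
  DirectSum.of_mul_of (A := fun k => O.Form k) α β

/-- Forms are determined by a property on homogeneous forms which is additive. -/
theorem forms_induction {p : O.Forms → Prop} (h0 : p 0) (hof : ∀ (k : ℕ) (α : O.Form k), p (O.of α))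
    (hadd : ∀ x y, p x → p y → p (x + y)) (x : O.Forms) : p x :=
  DirectSum.induction_on x h0 hof hadd

theorem forms_mul_assoc (x y z : O.Forms) : x * y * z = x * (y * z) := by
  induction x using O.forms_induction with
  | h0 => simp only [zero_mul]
  | hadd x x' h h' => simp only [add_mul, h, h']
  | hof k α =>
  induction y using O.forms_induction with
  | h0 => simp only [zero_mul, mul_zero]
  | hadd x x' h h' => simp only [add_mul, mul_add, h, h']
  | hof l β =>
  induction z using O.forms_induction with
  | h0 => simp only [mul_zero]
  | hadd x x' h h' => simp only [mul_add, h, h']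
  | hof m γ =>
  simp only [of_mul_of]
  exact O.of_eq_of (Nat.add_assoc k l m) fun c x =>
    wedge_assoc (α.1 c x) (β.1 c x) (γ.1 c x)

theorem of_mul_comm {k l : ℕ} (α : O.Form k) (β : O.Form l) :
    O.of β * O.of α = (-1 : ℝ) ^ (k * l) • (O.of α * O.of β) := by
  rw [of_mul_of, of_mul_of, ← map_smul]
  refine (O.of_eq_of (Nat.add_comm k l) fun c x => ?_).symm
  exact (wedge_comm (α.1 c x) (β.1 c x)).trans (castAlt_smul _ _ _).symm

theorem bar_of {k : ℕ} (α : O.Form k) : O.bar (O.of α) = (-1 : ℝ) ^ k • O.of α := by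
  simp [bar, of]

theorem one_eq_of : (1 : O.Forms) = O.of O.oneForm := rfl

theorem forms_one_mul (x : O.Forms) : 1 * x = x := by
  induction x using O.forms_induction with
  | h0 => simp only [mul_zero]
  | hadd x x' h h' => simp only [mul_add, h, h']
  | hof k α =>
  rw [one_eq_of, of_mul_of]
  refine (O.of_eq_of (Nat.zero_add k).symm fun c x => ?_).symm
  change wedge (O.oneForm.1 c x) (α.1 c x) = _
  by_cases hx : x ∈ c.1.dom
  · have : O.oneForm.1 c x = ContinuousAlternatingMap.constOfIsEmpty ℝ _ (Fin 0) 1 := if_pos hx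
    rw [this, wedge_constOfIsEmpty_left, one_smul]
  · rw [α.2.2.1 c x hx, wedge_zero_right]
    exact (castAlt_zero _).symm

theorem forms_mul_one (x : O.Forms) : x * 1 = x := by
  refine Eq.trans ?_ (O.forms_one_mul x)
  induction x using O.forms_induction with
  | h0 => simp only [mul_zero, zero_mul]
  | hadd x x' h h' => simp only [mul_add, add_mul, h, h']
  | hof k α => rw [one_eq_of, of_mul_comm, Nat.zero_mul, pow_zero, one_smul]

/-- The associative ring structure on the algebra of forms; its operations are the ones of
`Orbifold.Forms`. -/
instance instRingForms : Ring O.Forms :=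
  { (inferInstance : AddCommGroup O.Forms),
    (inferInstance : NonUnitalNonAssocSemiring O.Forms) with
    one := 1
    mul_assoc := O.forms_mul_assoc
    one_mul := O.forms_one_mul
    mul_one := O.forms_mul_one }

theorem smul_mul_forms (r : ℝ) (x y : O.Forms) : (r • x) * y = r • (x * y) := by
  induction x using O.forms_induction with
  | h0 => simp
  | hadd x x' h h' => simp only [smul_add, add_mul, h, h']
  | hof k α =>
  induction y using O.forms_induction with
  | h0 => simp
  | hadd x x' h h' => simp only [smul_add, mul_add, h, h']
  | hof l β =>
  rw [← map_smul, of_mul_of, of_mul_of, ← map_smul]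
  congr 1
  exact Form.ext fun c x => wedge_smul_left _ _ _

theorem mul_smul_forms (r : ℝ) (x y : O.Forms) : x * (r • y) = r • (x * y) := by
  induction x using O.forms_induction with
  | h0 => simp
  | hadd x x' h h' => simp only [smul_add, add_mul, h, h']
  | hof k α =>
  induction y using O.forms_induction with
  | h0 => simp
  | hadd x x' h h' => simp only [smul_add, mul_add, h, h']
  | hof l β =>
  rw [← map_smul, of_mul_of, of_mul_of, ← map_smul]
  congr 1
  exact Form.ext fun c x => wedge_smul_right _ _ _

theorem bar_mul (x y : O.Forms) : O.bar (x * y) = O.bar x * O.bar y := by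
  induction x using O.forms_induction with
  | h0 => simp
  | hadd x x' h h' => simp only [map_add, add_mul, h, h']
  | hof k α =>
  induction y using O.forms_induction with
  | h0 => simp
  | hadd x x' h h' => simp only [map_add, mul_add, h, h']
  | hof l β =>
  rw [of_mul_of, bar_of, bar_of, bar_of, smul_mul_forms, mul_smul_forms, of_mul_of, smul_smul,
    pow_add]

theorem bar_bar (x : O.Forms) : O.bar (O.bar x) = x := by
  induction x using O.forms_induction with
  | h0 => simp
  | hadd x x' h h' => simp only [map_add, h, h']
  | hof k α =>
  rw [bar_of, map_smul, bar_of, smul_smul, ← pow_add, Even.neg_one_pow ⟨k, rfl⟩, one_smul]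

theorem D_bar (x : O.Forms) : O.D (O.bar x) = -O.bar (O.D x) := by
  induction x using O.forms_induction with
  | h0 => simp
  | hadd x x' h h' => simp only [map_add, h, h', neg_add]
  | hof k α =>
  rw [bar_of, map_smul, D_of, bar_of, pow_succ, mul_neg_one, neg_smul, neg_neg]

theorem extD_apply {k : ℕ} (α : O.Form k) (c : O.atlas) {x : EuclideanSpace ℝ (Fin d)}
    (hx : x ∈ c.1.dom) : (O.extD k α).1 c x = extDeriv (α.1 c) x :=
  if_pos hx

theorem D_mul (x y : O.Forms) : O.D (x * y) = O.D x * y + O.bar x * O.D y := by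
  induction x using O.forms_induction with
  | h0 => simp
  | hadd x x' h h' => simp only [map_add, add_mul, h, h']; abel
  | hof k α =>
  induction y using O.forms_induction with
  | h0 => simp
  | hadd x x' h h' => simp only [map_add, mul_add, h, h']; abel
  | hof l β =>
  rw [of_mul_of, D_of, D_of, D_of, bar_of, smul_mul_forms, of_mul_of, of_mul_of, ← map_smul]
  have h : k + 1 + l = k + l + 1 := by omega
  obtain ⟨γ, hγ⟩ : ∃ γ : O.Form (k + l + 1),
      ∀ c x, γ.1 c x = castAlt h ((O.wedgeForm (O.extD k α) β).1 c x) :=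
    O.exists_castForm h _
  rw [O.of_eq_of h hγ]
  refine Eq.trans (congrArg O.of ?_) (map_add (DirectSum.lof ℝ ℕ (fun k => O.Form k) (k + l + 1))
    γ ((-1 : ℝ) ^ k • O.wedgeForm α (O.extD l β)))
  refine Form.ext fun c x => ?_
  change _ = γ.1 c x + (-1 : ℝ) ^ k • wedge (α.1 c x) ((O.extD l β).1 c x)
  rw [hγ]
  change _ = castAlt h (wedge ((O.extD k α).1 c x) (β.1 c x)) + _
  by_cases hx : x ∈ c.1.dom
  · rw [extD_apply _ _ _ hx, extD_apply _ _ _ hx, extD_apply _ _ _ hx]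
    exact extDeriv_wedge (O.differentiableAt_of_mem α c hx) (O.differentiableAt_of_mem β c hx)
  · rw [(O.extD _ _).2.2.1 c x hx, (O.extD _ _).2.2.1 c x hx, (O.extD _ _).2.2.1 c x hx,
      wedge_zero_left, wedge_zero_right, smul_zero, add_zero, castAlt_zero]

theorem even_central {p : ℕ} (hp : Even p) (a : O.Form p) (x : O.Forms) :
    x * O.of a = O.of a * x := by
  induction x using O.forms_induction with
  | h0 => simp
  | hadd x x' h h' => simp only [mul_add, add_mul, h, h']
  | hof k α => rw [of_mul_comm, (hp.mul_right k).neg_one_pow, one_smul]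

theorem odd_mul_bar {p : ℕ} (hp : Odd p) (a : O.Form p) (x : O.Forms) :
    x * O.of a = O.of a * O.bar x := by
  induction x using O.forms_induction with
  | h0 => simp
  | hadd x x' h h' => simp only [mul_add, map_add, add_mul, h, h']
  | hof k α => rw [of_mul_comm, bar_of, mul_smul_forms, pow_mul, hp.neg_one_pow]

end Orbifold

/-! ### The algebra of `a`-Massey products -/

namespace Orbifold

variable {d : ℕ} {X : Type*} [TopologicalSpace X] (O : Orbifold d X)

theorem listProd_cons (x : O.Forms) (L : List O.Forms) :
    O.listProd (x :: L) = x * O.listProd L := rfl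

/-- The form `∑ᵢ ξ̄₁ ∧ … ∧ ξ̄ᵢ₋₁ ∧ bᵢ ∧ ξᵢ₊₁ ∧ … ∧ ξₘ`, for possibly inhomogeneous `bᵢ`. -/
def masseySum {m : ℕ} (b ξ : Fin m → O.Forms) : O.Forms :=
  ∑ i : Fin m, O.listProd (List.ofFn fun j : Fin m =>
    if j < i then O.bar (ξ j) else if j = i then b i else ξ j)

theorem masseyForm_eq {m : ℕ} {q : Fin m → ℕ} (b : ∀ i, O.Form (q i)) (ξ : Fin m → O.Forms) :
    O.masseyForm b ξ = O.masseySum (fun i => O.of (b i)) ξ := rfl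

/-- The product `ξ₁ ∧ … ∧ ξₘ`. -/
def prodForm {m : ℕ} (ξ : Fin m → O.Forms) : O.Forms := O.listProd (List.ofFn ξ)

theorem prodForm_zero (ξ : Fin 0 → O.Forms) : O.prodForm ξ = 1 := by
  simp [prodForm, listProd]

theorem prodForm_succ {m : ℕ} (ξ : Fin (m + 1) → O.Forms) :
    O.prodForm ξ = ξ 0 * O.prodForm fun i => ξ i.succ := by
  rw [prodForm, List.ofFn_succ, listProd_cons, prodForm]

theorem masseySum_zero (b ξ : Fin 0 → O.Forms) : O.masseySum b ξ = 0 := by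
  simp [masseySum]

/-- The recursion which governs all computations with Massey products. -/
theorem masseySum_succ {m : ℕ} (b ξ : Fin (m + 1) → O.Forms) :
    O.masseySum b ξ = b 0 * O.prodForm (fun i => ξ i.succ) +
      O.bar (ξ 0) * O.masseySum (fun i => b i.succ) fun i => ξ i.succ := by
  rw [masseySum, Fin.sum_univ_succ, masseySum, Finset.mul_sum]
  congr 1
  · rw [List.ofFn_succ, listProd_cons, prodForm]
    simp [Fin.succ_ne_zero]
  · refine Finset.sum_congr rfl fun i _ => ?_
    rw [List.ofFn_succ, listProd_cons]
    simp [Fin.succ_pos]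

theorem D_D (x : O.Forms) : O.D (O.D x) = 0 := DFunLike.congr_fun O.D_comp_D x

theorem D_one : O.D 1 = 0 := by
  have h := O.D_mul 1 1
  have h1 : O.bar 1 = 1 := by rw [one_eq_of, bar_of, pow_zero, one_smul]
  rw [mul_one, h1, one_mul, mul_one] at h
  simpa using h

theorem D_prodForm_masseySum {m : ℕ} {a : O.Forms} {b ξ : Fin m → O.Forms}
    (ha : ∀ x, x * a = a * x) (hbar : O.bar a = a) (hb : ∀ i, O.D (b i) = 0)
    (hξ : ∀ i, O.D (ξ i) = a * b i) :
    O.D (O.prodForm ξ) = a * O.masseySum b ξ ∧ O.D (O.masseySum b ξ) = 0 := by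
  induction m with
  | zero => simp [prodForm_zero, masseySum_zero, D_one]
  | succ m ih =>
    obtain ⟨h1, h2⟩ := ih (fun i => hb i.succ) fun i => hξ i.succ
    rw [prodForm_succ, masseySum_succ, D_mul, hξ, h1, map_add, D_mul, D_mul, hb, h1, h2, D_bar, hξ,
      bar_mul, hbar, bar_bar]
    constructor
    · rw [← mul_assoc (O.bar _), ha]; noncomm_ring
    · rw [← mul_assoc (O.bar _), ha]; noncomm_ring

/-- Changing the primitives `ξᵢ` by exact forms changes the Massey form by an exact form. -/
theorem masseySum_add_D {m : ℕ} {a : O.Forms} {b ξ : Fin m → O.Forms}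
    (ha : ∀ x, x * a = a * x) (hbar : O.bar a = a) (hb : ∀ i, O.D (b i) = 0)
    (hξ : ∀ i, O.D (ξ i) = a * b i) (τ : Fin m → O.Forms) :
    ∃ Q S, O.prodForm (fun i => ξ i + O.D (τ i)) = O.prodForm ξ + O.D Q + a * S ∧
      O.masseySum b (fun i => ξ i + O.D (τ i)) = O.masseySum b ξ + O.D S := by
  induction m with
  | zero => exact ⟨0, 0, by simp [prodForm_zero, masseySum_zero]⟩
  | succ m ih =>
    obtain ⟨Q, S, hP, hF⟩ := ih (fun i => hb i.succ) (fun i => hξ i.succ) fun i => τ i.succ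
    have hP' : O.D (O.prodForm fun i : Fin m => ξ i.succ + O.D (τ i.succ)) =
        a * O.masseySum (fun i => b i.succ) fun i => ξ i.succ + O.D (τ i.succ) :=
      (O.D_prodForm_masseySum ha hbar (fun i => hb i.succ) fun i => by
        rw [map_add, hξ, D_D, add_zero]).1
    have hF' : O.D (O.masseySum (fun i => b i.succ) fun i : Fin m => ξ i.succ + O.D (τ i.succ)) =
        0 :=
      (O.D_prodForm_masseySum ha hbar (fun i => hb i.succ) fun i => by
        rw [map_add, hξ, D_D, add_zero]).2
    rw [prodForm_succ, prodForm_succ, masseySum_succ, masseySum_succ]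
    set P := O.prodForm fun i => ξ i.succ
    set F := O.masseySum (fun i => b i.succ) fun i => ξ i.succ
    set P' := O.prodForm fun i : Fin m => ξ i.succ + O.D (τ i.succ)
    set F' := O.masseySum (fun i => b i.succ) fun i : Fin m => ξ i.succ + O.D (τ i.succ)
    refine ⟨τ 0 * P' + O.bar (ξ 0) * Q, ξ 0 * S - O.bar (τ 0) * F' + O.bar (b 0) * Q, ?_, ?_⟩
    · simp only [map_add, D_mul, D_bar, hξ, bar_mul, hbar, bar_bar, hP']
      rw [add_mul, hP, ← mul_assoc (O.bar (τ 0)), ha]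
      have h1 : ξ 0 * (P + O.D Q + a * S) = ξ 0 * P + ξ 0 * O.D Q + a * ξ 0 * S := by
        rw [← ha (ξ 0)]; noncomm_ring
      rw [h1]
      noncomm_ring
    · simp only [map_add, map_sub, D_mul, D_bar, hξ, bar_bar, hF', hb, map_zero]
      rw [add_mul, hP, hF]
      have h1 : b 0 * (P + O.D Q + a * S) = b 0 * P + b 0 * O.D Q + a * b 0 * S := by
        rw [← ha (b 0)]; noncomm_ring
      rw [h1]
      noncomm_ring

/-- Changing the forms `bᵢ` by exact forms (and the primitives accordingly) changes the Massey form
by an exact form. -/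
theorem masseySum_add_D_right {m : ℕ} {a : O.Forms} {b ξ : Fin m → O.Forms}
    (ha : ∀ x, x * a = a * x) (hbar : O.bar a = a) (hda : O.D a = 0) (hb : ∀ i, O.D (b i) = 0)
    (hξ : ∀ i, O.D (ξ i) = a * b i) (β : Fin m → O.Forms) :
    ∃ T, O.prodForm (fun i => ξ i + a * β i) = O.prodForm ξ + a * T ∧
      O.masseySum (fun i => b i + O.D (β i)) (fun i => ξ i + a * β i) =
        O.masseySum b ξ + O.D T := by
  induction m with
  | zero => exact ⟨0, by simp [prodForm_zero, masseySum_zero]⟩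
  | succ m ih =>
    obtain ⟨T, hP, hF⟩ := ih (fun i => hb i.succ) (fun i => hξ i.succ) fun i => β i.succ
    have hP' : O.D (O.prodForm fun i : Fin m => ξ i.succ + a * β i.succ) =
        a * O.masseySum (fun i => b i.succ + O.D (β i.succ)) fun i => ξ i.succ + a * β i.succ :=
      (O.D_prodForm_masseySum ha hbar (fun i => by rw [map_add, hb, D_D, add_zero]) fun i => by
        rw [map_add, hξ, D_mul, hda, hbar]; noncomm_ring).1
    rw [prodForm_succ, prodForm_succ, masseySum_succ, masseySum_succ]
    set P := O.prodForm fun i => ξ i.succ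
    set F := O.masseySum (fun i => b i.succ) fun i => ξ i.succ
    set P' := O.prodForm fun i : Fin m => ξ i.succ + a * β i.succ
    set F' := O.masseySum (fun i => b i.succ + O.D (β i.succ))
      fun i : Fin m => ξ i.succ + a * β i.succ
    refine ⟨ξ 0 * T + β 0 * P', ?_, ?_⟩
    · rw [add_mul, hP]
      have h1 : ξ 0 * (P + a * T) = ξ 0 * P + a * ξ 0 * T := by
        rw [← ha (ξ 0)]; noncomm_ring
      rw [h1]
      noncomm_ring
    · simp only [map_add, D_mul, hξ, bar_mul, hbar, hP']
      rw [add_mul, add_mul (O.bar _), hP, hF]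
      have h1 : b 0 * (P + a * T) = b 0 * P + a * b 0 * T := by
        rw [← ha (b 0)]; noncomm_ring
      have h2 : O.bar (β 0) * (a * (F + O.D T)) = a * O.bar (β 0) * (F + O.D T) := by
        rw [← mul_assoc, ha]
      rw [h1, h2]
      noncomm_ring

/-- Changing `a` by the exact form `dα`, and the primitives `ξᵢ` by `α ∧ bᵢ`, does not change the
Massey form. -/
theorem masseySum_add_mul {m : ℕ} {α : O.Forms} {b : Fin m → O.Forms}
    (hα : ∀ x, x * α = α * O.bar x) (hbar : O.bar α = -α) (hαα : α * α = 0)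
    (ξ : Fin m → O.Forms) :
    O.prodForm (fun i => ξ i + α * b i) = O.prodForm ξ + α * O.masseySum b ξ ∧
      O.masseySum b (fun i => ξ i + α * b i) = O.masseySum b ξ := by
  induction m with
  | zero => simp [prodForm_zero, masseySum_zero]
  | succ m ih =>
    obtain ⟨hP, hF⟩ := ih (b := fun i => b i.succ) fun i => ξ i.succ
    rw [prodForm_succ, prodForm_succ, masseySum_succ, masseySum_succ, hP, hF]
    set P := O.prodForm fun i => ξ i.succ
    set F := O.masseySum (fun i => b i.succ) fun i => ξ i.succ
    constructor
    · have h1 : ξ 0 * (α * F) = α * (O.bar (ξ 0) * F) := by rw [← mul_assoc, hα, mul_assoc]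
      have h2 : α * b 0 * (α * F) = 0 := by
        rw [mul_assoc, ← mul_assoc (b 0), hα, mul_assoc α, ← mul_assoc α, hαα, zero_mul]
      rw [add_mul, mul_add, mul_add, h1, h2]
      noncomm_ring
    · have h1 : b 0 * (α * F) = α * O.bar (b 0) * F := by rw [← mul_assoc, hα]
      rw [mul_add, h1, map_add, bar_mul, hbar]
      noncomm_ring

/-! ### Homogeneous primitives -/

theorem of_apply_self {k : ℕ} (α : O.Form k) : (O.of α) k = α :=
  DirectSum.of_eq_same (β := fun k => O.Form k) k α

theorem of_apply_ne {k j : ℕ} (α : O.Form k) (h : j ≠ k) : (O.of α) j = 0 :=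
  DirectSum.of_eq_of_ne (β := fun k => O.Form k) k j α h

theorem D_apply_succ (x : O.Forms) (k : ℕ) : O.D x (k + 1) = O.extD k (x k) := by
  induction x using O.forms_induction with
  | h0 => simp
  | hadd x y hx hy => rw [map_add, DirectSum.add_apply, hx, hy, DirectSum.add_apply, map_add]
  | hof l α =>
    rw [D_of]
    by_cases h : k = l
    · subst h; rw [of_apply_self, of_apply_self]
    · rw [of_apply_ne _ _ h, of_apply_ne _ _ (by omega), map_zero]

theorem D_apply_zero (x : O.Forms) : O.D x 0 = 0 := by
  induction x using O.forms_induction with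
  | h0 => simp
  | hadd x y hx hy => rw [map_add, DirectSum.add_apply, hx, hy, add_zero]
  | hof l α => rw [D_of, of_apply_ne _ _ (by omega)]

/-- The forms which are homogeneous of degree `k - 1` (so they vanish if `k = 0`). -/
def IsHomPred (k : ℕ) (x : O.Forms) : Prop := ∀ j : ℕ, j + 1 ≠ k → x j = 0

variable {O}

theorem IsHomPred.eq_zero {x : O.Forms} (h : O.IsHomPred 0 x) : x = 0 :=
  DFinsupp.ext fun j => h j (by omega)

theorem IsHomPred.eq_of {k : ℕ} {x : O.Forms} (h : O.IsHomPred (k + 1) x) : x = O.of (x k) := by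
  refine DFinsupp.ext fun j => ?_
  by_cases hj : j = k
  · subst hj; exact (O.of_apply_self _).symm
  · exact (h j (by omega)).trans (O.of_apply_ne _ hj).symm

theorem isHomPred_of {k : ℕ} (α : O.Form k) : O.IsHomPred (k + 1) (O.of α) :=
  fun _ hj => O.of_apply_ne α (by omega)

theorem isHomPred_zero (k : ℕ) : O.IsHomPred k 0 := fun _ _ => rfl

theorem IsHomPred.add {k : ℕ} {x y : O.Forms} (hx : O.IsHomPred k x) (hy : O.IsHomPred k y) :
    O.IsHomPred k (x + y) := fun j hj => by
  rw [DirectSum.add_apply, hx j hj, hy j hj, add_zero]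

theorem IsHomPred.neg {k : ℕ} {x : O.Forms} (hx : O.IsHomPred k x) :
    O.IsHomPred k (-x) := fun j hj => by
  have : (-x) j = -(x j) := rfl
  rw [this, hx j hj, neg_zero]

theorem IsHomPred.sub {k : ℕ} {x y : O.Forms} (hx : O.IsHomPred k x) (hy : O.IsHomPred k y) :
    O.IsHomPred k (x - y) := sub_eq_add_neg x y ▸ hx.add hy.neg

theorem IsHomPred.mul_of {k l : ℕ} {x : O.Forms} (hx : O.IsHomPred k x) (β : O.Form l) :
    O.IsHomPred (k + l) (x * O.of β) := by
  cases k with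
  | zero => rw [hx.eq_zero, zero_mul]; exact isHomPred_zero _
  | succ k =>
    rw [hx.eq_of, of_mul_of]
    have := isHomPred_of (O.wedgeForm (x k) β)
    rwa [show k + 1 + l = k + l + 1 by omega]

theorem IsHomPred.of_mul {k l : ℕ} {x : O.Forms} (hx : O.IsHomPred k x) (β : O.Form l) :
    O.IsHomPred (l + k) (O.of β * x) := by
  cases k with
  | zero => rw [hx.eq_zero, mul_zero]; exact isHomPred_zero _
  | succ k =>
    rw [hx.eq_of, of_mul_of]
    exact isHomPred_of (O.wedgeForm β (x k))

theorem IsHomPred.D {k : ℕ} {x : O.Forms} (hx : O.IsHomPred k x) :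
    O.IsHomPred (k + 1) (O.D x) := by
  cases k with
  | zero => rw [hx.eq_zero, map_zero]; exact isHomPred_zero _
  | succ k => rw [hx.eq_of, D_of]; exact isHomPred_of _

theorem exists_isHomPred_D_eq {k : ℕ} {x : O.Forms} {α : O.Form k} (h : O.D x = O.of α) :
    ∃ y, O.IsHomPred k y ∧ O.D y = O.of α := by
  cases k with
  | zero =>
    refine ⟨0, isHomPred_zero _, ?_⟩
    have h0 := O.D_apply_zero x
    rw [h, of_apply_self] at h0
    rw [h0, map_zero]
    exact (map_zero (DirectSum.lof ℝ ℕ (fun k => O.Form k) 0)).symm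
  | succ k =>
    refine ⟨O.of (x k), isHomPred_of _, ?_⟩
    have h0 := O.D_apply_succ x k
    rw [h, of_apply_self] at h0
    rw [D_of, h0]

/-! ### Dependence of Massey products on the representatives -/

theorem isPrimitiveSystem_iff {m p : ℕ} {q : Fin m → ℕ} {a : O.Form p} {b : ∀ i, O.Form (q i)}
    {ξ : Fin m → O.Forms} : O.IsPrimitiveSystem a b ξ ↔
      ∀ i, O.IsHomPred (p + q i) (ξ i) ∧ O.D (ξ i) = O.of a * O.of (b i) := Iff.rfl

theorem D_of_eq_zero {k : ℕ} {α : O.Form k} (h : O.extD k α = 0) : O.D (O.of α) = 0 := by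
  rw [D_of, h]; exact map_zero _

theorem bar_of_even {k : ℕ} (hk : Even k) (α : O.Form k) : O.bar (O.of α) = O.of α := by
  rw [bar_of, hk.neg_one_pow, one_smul]

theorem cls_eq_of_eq_add_D {z w : LinearMap.ker O.D} {x : O.Forms}
    (h : (w : O.Forms) = z + O.D x) : O.cls w = O.cls z := by
  refine (Submodule.Quotient.eq _).2 ?_
  refine ⟨x, ?_⟩
  change O.D x = (w : O.Forms) - z
  rw [h]; abel

theorem exists_of_cls_eq {z w : LinearMap.ker O.D} (h : O.cls w = O.cls z) :
    ∃ x, (w : O.Forms) = z + O.D x := by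
  obtain ⟨x, hx⟩ := (Submodule.Quotient.eq _).1 h
  refine ⟨x, ?_⟩
  have hx' : O.D x = (w : O.Forms) - z := hx
  rw [hx']; abel

theorem cls_mem_masseyProduct_of_eq_add_D {m p : ℕ} {q : Fin m → ℕ} {a : O.Form p}
    {b : ∀ i, O.Form (q i)} {ξ : Fin m → O.Forms} (hξ : O.IsPrimitiveSystem a b ξ)
    {z : LinearMap.ker O.D} {S : O.Forms} (h : O.masseyForm b ξ = z + O.D S) :
    O.cls z ∈ O.masseyProduct a b := by
  refine ⟨ξ, hξ, z + ⟨O.D S, O.D_D S⟩, h.symm, ?_⟩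
  exact cls_eq_of_eq_add_D rfl

theorem IsPrimitiveSystem.congr_left {m p : ℕ} {q : Fin m → ℕ} {a a' : O.Form p}
    {b : ∀ i, O.Form (q i)} {ξ : Fin m → O.Forms} (hξ : O.IsPrimitiveSystem a b ξ) (hp : Even p)
    (hb : ∀ i, O.extD (q i) (b i) = 0) {x : O.Forms} (hx : O.of a' = O.of a + O.D x) :
    ∃ ξ', O.IsPrimitiveSystem a' b ξ' ∧ O.masseyForm b ξ' = O.masseyForm b ξ := by
  have hx' : O.D x = O.of (a' - a) := by
    rw [eq_sub_of_add_eq' hx.symm]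
    exact (map_sub (DirectSum.lof ℝ ℕ (fun k => O.Form k) p) a' a).symm
  obtain ⟨α, hα, hDα⟩ := exists_isHomPred_D_eq hx'
  rw [← hx'] at hDα
  refine ⟨fun i => ξ i + α * O.of (b i), fun i => ⟨?_, ?_⟩, ?_⟩
  · exact IsHomPred.add (hξ i).1 (hα.mul_of (b i))
  · rw [map_add, (hξ i).2, D_mul, D_of_eq_zero (hb i), hDα, hx]
    noncomm_ring
  · have key : (∀ x, x * α = α * O.bar x) ∧ O.bar α = -α := by
      cases p with
      | zero => rw [hα.eq_zero]; simp
      | succ p =>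
        have hodd : Odd p := by
          by_contra h
          exact Nat.not_even_iff_odd.2 (Nat.not_odd_iff_even.1 h).add_one hp
        rw [hα.eq_of]
        exact ⟨O.odd_mul_bar hodd _, by rw [bar_of, hodd.neg_one_pow, neg_one_smul]⟩
    refine (O.masseySum_add_mul key.1 key.2 ?_ ξ).2
    have h := key.1 α
    rw [key.2, mul_neg] at h
    have h2 : (2 : ℝ) • (α * α) = 0 := by rw [two_smul]; nth_rw 1 [h]; simp
    simpa using h2

theorem MasseyDefined.congr_left {m p : ℕ} {q : Fin m → ℕ} {a a' : O.Form p}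
    {b : ∀ i, O.Form (q i)} (h : O.MasseyDefined a b) (ha' : O.extD p a' = 0) {x : O.Forms}
    (hx : O.of a' = O.of a + O.D x) : O.MasseyDefined a' b := by
  obtain ⟨hp, -, hb, ξ, hξ⟩ := h
  obtain ⟨ξ', hξ', -⟩ := hξ.congr_left hp hb hx
  exact ⟨hp, ha', hb, ξ', hξ'⟩

theorem masseyProduct_subset_left {m p : ℕ} {q : Fin m → ℕ} {a a' : O.Form p}
    {b : ∀ i, O.Form (q i)} (h : O.MasseyDefined a b) {x : O.Forms}
    (hx : O.of a' = O.of a + O.D x) : O.masseyProduct a b ⊆ O.masseyProduct a' b := by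
  rintro _ ⟨ξ, hξ, z, hz, rfl⟩
  obtain ⟨ξ', hξ', h'⟩ := hξ.congr_left h.1 h.2.2.1 hx
  exact ⟨ξ', hξ', z, hz.trans h'.symm, rfl⟩

theorem IsPrimitiveSystem.congr_right {m p : ℕ} {q : Fin m → ℕ} {a : O.Form p}
    {b b' : ∀ i, O.Form (q i)} {ξ : Fin m → O.Forms} (hξ : O.IsPrimitiveSystem a b ξ)
    (hp : Even p) (ha : O.extD p a = 0)
    (hb : ∀ i, O.extD (q i) (b i) = 0) {x : Fin m → O.Forms}
    (hx : ∀ i, O.of (b' i) = O.of (b i) + O.D (x i)) :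
    ∃ ξ' T, O.IsPrimitiveSystem a b' ξ' ∧ O.masseyForm b' ξ' = O.masseyForm b ξ + O.D T := by
  have hx' (i : Fin m) : O.D (x i) = O.of (b' i - b i) := by
    rw [eq_sub_of_add_eq' (hx i).symm]
    exact (map_sub (DirectSum.lof ℝ ℕ (fun k => O.Form k) (q i)) (b' i) (b i)).symm
  choose β hβ hDβ using fun i => exists_isHomPred_D_eq (hx' i)
  simp only [← hx'] at hDβ
  obtain ⟨T, -, hT⟩ := O.masseySum_add_D_right (O.even_central hp a) (bar_of_even hp a)
    (D_of_eq_zero ha) (fun i => D_of_eq_zero (hb i)) (fun i => (hξ i).2) β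
  refine ⟨fun i => ξ i + O.of a * β i, T, fun i => ⟨?_, ?_⟩, ?_⟩
  · exact IsHomPred.add (hξ i).1 ((hβ i).of_mul a)
  · rw [map_add, (hξ i).2, D_mul, D_of_eq_zero ha, hDβ, hx, bar_of_even hp]
    noncomm_ring
  · rw [masseyForm_eq, masseyForm_eq, ← hT]
    congr 1
    ext1 i
    rw [hx, hDβ]

theorem MasseyDefined.congr_right {m p : ℕ} {q : Fin m → ℕ} {a : O.Form p}
    {b b' : ∀ i, O.Form (q i)} (h : O.MasseyDefined a b) (hb' : ∀ i, O.extD (q i) (b' i) = 0)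
    {x : Fin m → O.Forms} (hx : ∀ i, O.of (b' i) = O.of (b i) + O.D (x i)) :
    O.MasseyDefined a b' := by
  obtain ⟨hp, ha, hb, ξ, hξ⟩ := h
  obtain ⟨ξ', T, hξ', -⟩ := hξ.congr_right hp ha hb hx
  exact ⟨hp, ha, hb', ξ', hξ'⟩

theorem masseyProduct_subset_right {m p : ℕ} {q : Fin m → ℕ} {a : O.Form p}
    {b b' : ∀ i, O.Form (q i)} (h : O.MasseyDefined a b)
    {x : Fin m → O.Forms} (hx : ∀ i, O.of (b' i) = O.of (b i) + O.D (x i)) :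
    O.masseyProduct a b ⊆ O.masseyProduct a b' := by
  rintro _ ⟨ξ, hξ, z, hz, rfl⟩
  obtain ⟨ξ', T, hξ', h'⟩ := hξ.congr_right h.1 h.2.1 h.2.2.1 hx
  rw [← hz] at h'
  exact cls_mem_masseyProduct_of_eq_add_D hξ' h'

/-- The Massey product only depends on the cohomology classes of `a` and of the `bᵢ`. -/
theorem masseyProduct_congr {m p : ℕ} {q : Fin m → ℕ} {a a' : O.Form p}
    {b b' : ∀ i, O.Form (q i)} (h : O.MasseyDefined a b) (ha' : O.extD p a' = 0)
    (hb' : ∀ i, O.extD (q i) (b' i) = 0) {x : O.Forms} {y : Fin m → O.Forms}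
    (hx : O.of a' = O.of a + O.D x) (hy : ∀ i, O.of (b' i) = O.of (b i) + O.D (y i)) :
    O.MasseyDefined a' b' ∧ O.masseyProduct a' b' = O.masseyProduct a b := by
  have h1 := h.congr_left ha' hx
  have h2 := h1.congr_right hb' hy
  refine ⟨h2, Set.Subset.antisymm ?_ ?_⟩
  · refine (masseyProduct_subset_right h2 (b' := b) (x := fun i => -y i) fun i => ?_).trans
      (masseyProduct_subset_left h1 (x := -x) ?_)
    · rw [hy, map_neg]; abel
    · rw [hx, map_neg]; abel
  · exact (masseyProduct_subset_left h hx).trans (masseyProduct_subset_right h1 hy)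

/-- Changing the primitives by exact forms does not change the class. -/
theorem exists_masseyForm_add_D {m p : ℕ} {q : Fin m → ℕ} {a : O.Form p}
    {b : ∀ i, O.Form (q i)} {ξ : Fin m → O.Forms} (hp : Even p)
    (hb : ∀ i, O.extD (q i) (b i) = 0) (hξ : O.IsPrimitiveSystem a b ξ) (τ : Fin m → O.Forms) :
    ∃ S, O.masseyForm b (fun i => ξ i + O.D (τ i)) = O.masseyForm b ξ + O.D S := by
  obtain ⟨Q, S, -, h⟩ := O.masseySum_add_D (O.even_central hp a) (bar_of_even hp a)
    (fun i => D_of_eq_zero (hb i)) (fun i => (hξ i).2) τ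
  exact ⟨S, h⟩

theorem D_masseyForm {m p : ℕ} {q : Fin m → ℕ} {a : O.Form p}
    {b : ∀ i, O.Form (q i)} {ξ : Fin m → O.Forms} (hp : Even p)
    (hb : ∀ i, O.extD (q i) (b i) = 0) (hξ : O.IsPrimitiveSystem a b ξ) :
    O.D (O.masseyForm b ξ) = 0 :=
  (O.D_prodForm_masseySum (O.even_central hp a) (bar_of_even hp a)
    (fun i => D_of_eq_zero (hb i)) (fun i => (hξ i).2)).2

end Orbifold

/-! ### Closed forms of degree zero -/

theorem eq_constOfIsEmpty {V : Type*} [NormedAddCommGroup V] [NormedSpace ℝ V]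
    (α : V [⋀^Fin 0]→L[ℝ] ℝ) :
    α = ContinuousAlternatingMap.constOfIsEmpty ℝ V (Fin 0) (α ![]) := by
  ext v
  rw [Subsingleton.elim v ![]]
  rfl

theorem fderiv_eq_zero_of_extDeriv_eq_zero {V : Type*} [NormedAddCommGroup V] [NormedSpace ℝ V]
    {α : V → V [⋀^Fin 0]→L[ℝ] ℝ} {x : V} (h : extDeriv α x = 0) : fderiv ℝ α x = 0 := by
  ext v w
  have h1 := DFunLike.congr_fun h (fun _ => v)
  rw [extDeriv, ContinuousAlternatingMap.alternatizeUncurryFin_apply, Fin.sum_univ_one] at h1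
  simpa [Subsingleton.elim w (Fin.removeNth (0 : Fin 1) fun _ => v)] using h1

theorem IsOpen.eqOn_of_extDeriv_eq_zero {V : Type*} [NormedAddCommGroup V] [NormedSpace ℝ V]
    {α : V → V [⋀^Fin 0]→L[ℝ] ℝ} {s : Set V} (hs : IsOpen s) (hs' : IsPreconnected s)
    (hα : DifferentiableOn ℝ α s) (h : ∀ x ∈ s, extDeriv α x = 0) {x y : V} (hx : x ∈ s)
    (hy : y ∈ s) : α x = α y :=
  hs.is_const_of_fderiv_eq_zero hs' hα (fun _ hz => fderiv_eq_zero_of_extDeriv_eq_zero (h _ hz))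
    hx hy

namespace Orbifold

variable {d : ℕ} {X : Type*} [TopologicalSpace X] {O : Orbifold d X}

theorem eventually_eq_of_extD_eq_zero {f : O.Form 0} {c : O.atlas}
    {x : EuclideanSpace ℝ (Fin d)} (hx : x ∈ c.1.dom)
    (hf : ∀ᶠ y in 𝓝 x, (O.extD 0 f).1 c y = 0) : ∀ᶠ y in 𝓝 x, f.1 c y = f.1 c x := by
  obtain ⟨r, hr, hsub⟩ := Metric.eventually_nhds_iff_ball.1
    (hf.and (c.1.isOpen_dom.mem_nhds hx))
  filter_upwards [Metric.ball_mem_nhds x hr] with y hy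
  refine Metric.isOpen_ball.eqOn_of_extDeriv_eq_zero (convex_ball x r).isPreconnected
    (fun z hz => (O.differentiableAt_of_mem f c (hsub z hz).2).differentiableWithinAt)
    (fun z hz => ?_) hy (Metric.mem_ball_self hr)
  rw [← O.extD_apply f c (hsub z hz).2]
  exact (hsub z hz).1

/-- A closed function has a closed pointwise (generalized) inverse. -/
theorem exists_inverse_of_closed (f : O.Form 0) (hf : O.extD 0 f = 0) :
    ∃ e : O.Form 0, O.extD 0 e = 0 ∧ O.of e * O.of f * O.of f = O.of f := by
  have hloc (c : O.atlas) (x : EuclideanSpace ℝ (Fin d)) (hx : x ∈ c.1.dom) :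
      ∀ᶠ y in 𝓝 x, f.1 c y = f.1 c x :=
    eventually_eq_of_extD_eq_zero hx (by rw [hf]; exact Filter.Eventually.of_forall fun _ => rfl)
  let g : O.atlas → EuclideanSpace ℝ (Fin d) → EuclideanSpace ℝ (Fin d) [⋀^Fin 0]→L[ℝ] ℝ :=
    fun c x => ContinuousAlternatingMap.constOfIsEmpty ℝ _ (Fin 0) (f.1 c x ![])⁻¹
  have hg (c : O.atlas) (x : EuclideanSpace ℝ (Fin d)) (hx : x ∈ c.1.dom) :
      g c =ᶠ[𝓝 x] fun _ => g c x := by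
    filter_upwards [hloc c x hx] with y hy
    simp only [g, hy]
  obtain ⟨e, he⟩ : ∃ e : O.Form 0, e.1 = g := by
    refine ⟨⟨g, fun c x hx => ?_, fun c x hx => ?_, fun c c' h hh x hx => ?_⟩, rfl⟩
    · exact ((contDiffAt_const (c := g c x)).congr_of_eventuallyEq (hg c x hx)).contDiffWithinAt
    · ext v
      simp [g, f.2.2.1 c x hx]
    · ext v
      simp only [g]
      rw [f.2.2.2 c c' h hh x hx]
      simp only [ContinuousAlternatingMap.compContinuousLinearMap_apply,
        ContinuousAlternatingMap.constOfIsEmpty_apply]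
      rw [Subsingleton.elim (_ ∘ _) ![]]
  refine ⟨e, Form.ext fun c x => ?_, ?_⟩
  · by_cases hx : x ∈ c.1.dom
    · rw [extD_apply _ _ _ hx, he, (hg c x hx).extDeriv_eq, extDeriv, fderiv_fun_const]
      exact map_zero (ContinuousAlternatingMap.alternatizeUncurryFinCLM ℝ _ ℝ)
    · exact (O.extD 0 _).2.2.1 c x hx
  · rw [of_mul_of, of_mul_of]
    congr 1
    refine Form.ext fun c x => ?_
    change wedge (wedge (e.1 c x) (f.1 c x)) (f.1 c x) = f.1 c x
    simp only [he, g]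
    rw [wedge_constOfIsEmpty_left, wedge_smul_left]
    simp only [Nat.add_zero, castAlt_rfl]
    conv_lhs => rw [eq_constOfIsEmpty (f.1 c x)]
    rw [wedge_constOfIsEmpty_left]
    conv_rhs => rw [eq_constOfIsEmpty (f.1 c x)]
    ext v
    simp only [Nat.add_zero, castAlt_rfl, ContinuousAlternatingMap.smul_apply,
      ContinuousAlternatingMap.constOfIsEmpty_apply, smul_eq_mul]
    by_cases h0 : f.1 c x ![] = 0
    · simp [h0]
    · field_simp

theorem mul_listProd_of_mem {χ : O.Forms} (hχ : ∀ x, x * χ = χ * x) {L : List O.Forms}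
    {x : O.Forms} (hx : x ∈ L) (hrx : χ * x = x) : χ * O.listProd L = O.listProd L := by
  induction L with
  | nil => cases hx
  | cons y L ih =>
    rw [listProd_cons]
    rcases List.mem_cons.1 hx with rfl | h
    · rw [← mul_assoc, hrx]
    · rw [← mul_assoc, ← hχ, mul_assoc, ih h]

theorem mul_listProd_eq_zero {χ : O.Forms} (hχ : ∀ x, x * χ = χ * x) {L : List O.Forms}
    {x : O.Forms} (hx : x ∈ L) (hrx : χ * x = 0) : χ * O.listProd L = 0 := by
  induction L with
  | nil => cases hx
  | cons y L ih =>
    rw [listProd_cons]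
    rcases List.mem_cons.1 hx with rfl | h
    · rw [← mul_assoc, hrx, zero_mul]
    · rw [← mul_assoc, ← hχ, mul_assoc, ih h, mul_zero]

theorem listProd_eq_zero {L : List O.Forms} (h : (0 : O.Forms) ∈ L) : O.listProd L = 0 := by
  have := mul_listProd_eq_zero (O := O) (χ := 1) (fun x => by rw [mul_one, one_mul]) h
    (by rw [mul_zero])
  rwa [one_mul] at this

/-- If `χ ∧ bᵢ = bᵢ` for a central `χ` which annihilates the other primitives, and `ξᵢ = 0`, then
the Massey form vanishes. -/
theorem masseySum_eq_zero {m : ℕ} (hm : 2 ≤ m) {b ξ : Fin m → O.Forms} (i : Fin m)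
    {χ : O.Forms} (hχ : ∀ x, x * χ = χ * x) (hb : χ * b i = b i) (hi : ξ i = 0)
    (hξ : ∀ j, j ≠ i → χ * ξ j = 0 ∧ χ * O.bar (ξ j) = 0) : O.masseySum b ξ = 0 := by
  refine Finset.sum_eq_zero fun k _ => ?_
  by_cases hk : k = i
  · subst hk
    obtain ⟨j, hj⟩ : ∃ j, j ≠ k := by
      have : Nontrivial (Fin m) := Fin.nontrivial_iff_two_le.2 hm
      exact exists_ne k
    rw [← mul_listProd_of_mem hχ (x := b k) ((List.mem_ofFn' _ _).2 ⟨k, by simp⟩) hb]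
    by_cases hjk : j < k
    · exact mul_listProd_eq_zero hχ ((List.mem_ofFn' _ _).2 ⟨j, rfl⟩) (by simp [hjk, (hξ j hj).2])
    · exact mul_listProd_eq_zero hχ ((List.mem_ofFn' _ _).2 ⟨j, rfl⟩)
        (by simp [hjk, hj, (hξ j hj).1])
  · refine listProd_eq_zero ((List.mem_ofFn' _ _).2 ⟨i, ?_⟩)
    by_cases hik : i < k
    · simp [hik, hi]
    · simp [hik, Ne.symm hk, hi]

/-- Massey products of order at least two are trivial if one of the `bᵢ` is a function. -/
theorem zero_mem_masseyProduct_of_degree_eq_zero {m p : ℕ} {q : Fin m → ℕ} {a : O.Form p}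
    {b : ∀ i, O.Form (q i)} (h : O.MasseyDefined a b) (hm : 2 ≤ m) (i : Fin m) (hi : q i = 0) :
    0 ∈ O.masseyProduct a b := by
  obtain ⟨f, hf⟩ := O.exists_castForm hi (b i)
  have hfb : O.of f = O.of (b i) := (O.of_eq_of hi hf).symm
  have hf0 : O.D (O.of f) = 0 := hfb ▸ D_of_eq_zero (h.2.2.1 i)
  have hf0' : O.extD 0 f = 0 := by
    rw [← O.of_apply_self (O.extD 0 f), ← D_of, hf0]; rfl
  obtain ⟨e, he, hef⟩ := exists_inverse_of_closed f hf0'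
  obtain ⟨hp, ha, hb, ξ, hξ⟩ := id h
  have hce := O.even_central (Even.zero) e
  have hcf := O.even_central (Even.zero) f
  set χ := O.of e * O.of f with hχdef
  have hχ (x : O.Forms) : x * χ = χ * x := by
    rw [hχdef, ← mul_assoc, hce, mul_assoc, hcf, mul_assoc]
  have hDχ : O.D χ = 0 := by
    rw [hχdef, D_mul, D_of_eq_zero he, hf0, zero_mul, mul_zero, add_zero]
  have hbχ : O.bar χ = χ := by
    rw [hχdef, bar_mul, bar_of_even Even.zero, bar_of_even Even.zero]
  have hχb : χ * O.of (b i) = O.of (b i) := by rw [← hfb, hef]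
  -- `χ ∧ a` is exact, so that `a` may be replaced by `(1 - χ) ∧ a`
  have hη : O.D (O.of e * ξ i) = χ * O.of a := by
    rw [D_mul, D_of_eq_zero he, bar_of_even Even.zero, (hξ i).2, zero_mul, zero_add, hχdef,
      ← O.even_central hp a, ← hfb, mul_assoc]
  obtain ⟨a', ha'⟩ : ∃ a' : O.Form p, O.of a' = O.of a + O.D (-(O.of e * ξ i)) := by
    rw [map_neg, hη, hχdef, of_mul_of, of_mul_of]
    obtain ⟨g, hg⟩ := O.exists_castForm (show 0 + 0 + p = p by omega)
      (O.wedgeForm (O.wedgeForm e f) a)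
    rw [O.of_eq_of _ hg, ← sub_eq_add_neg]
    exact ⟨a - g, map_sub (DirectSum.lof ℝ ℕ (fun k => O.Form k) p) a g⟩
  have ha'' : O.of a' = (1 - χ) * O.of a := by
    rw [ha', map_neg, hη]; noncomm_ring
  have hda' : O.extD p a' = 0 := by
    have : O.D (O.of a') = 0 := by
      rw [ha', map_add, map_neg, map_neg, D_D, D_of_eq_zero ha, neg_zero, add_zero]
    rw [← O.of_apply_self (O.extD p a'), ← D_of, this]; rfl
  obtain ⟨-, heq⟩ := masseyProduct_congr h hda' hb ha' (y := fun _ => 0) fun i => by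
    rw [map_zero, add_zero]
  rw [← heq]
  have hχξ (x : O.Forms) : χ * ((1 - χ) * x) = 0 := by
    have : χ * χ = χ := calc
      χ * χ = O.of e * (O.of f * χ) := by rw [hχdef, mul_assoc]
      _ = χ := by rw [hχ, hef]
    rw [← mul_assoc, mul_sub, mul_one, this, sub_self, zero_mul]
  have hbar1 : O.bar (1 - χ) = 1 - χ := by
    rw [map_sub, hbχ, one_eq_of, bar_of_even Even.zero]
  refine ⟨fun j => if j = i then 0 else (1 - χ) * ξ j, fun j => ⟨?_, ?_⟩, 0, ?_, ?_⟩
  · beta_reduce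
    split_ifs with hj
    · exact fun _ _ => rfl
    · rw [sub_mul, one_mul]
      refine IsHomPred.sub (hξ j).1 ?_
      have h0 : O.IsHomPred (p + q j) (ξ j) := (hξ j).1
      have := (h0.of_mul f).of_mul e
      rw [hχdef, mul_assoc]
      rwa [show 0 + (0 + (p + q j)) = p + q j by omega] at this
  · rw [ha'']
    beta_reduce
    split_ifs with hj
    · subst hj
      rw [map_zero, sub_mul, sub_mul, one_mul, mul_assoc, ← O.even_central hp a, ← mul_assoc χ,
        hχb, sub_self]
    · rw [D_mul, map_sub, D_one, hDχ, hbar1, (hξ j).2]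
      noncomm_ring
  · symm
    refine masseySum_eq_zero hm i hχ hχb (if_pos rfl) fun j hj => ?_
    rw [if_neg hj, bar_mul, hbar1, hχξ, hχξ]
    exact ⟨rfl, rfl⟩
  · exact map_zero (Submodule.mkQ _)

end Orbifold

/-! ### The Poincaré lemma -/

section Parametric

variable {V H : Type} [NormedAddCommGroup V] [NormedSpace ℝ V] [NormedAddCommGroup H]
  [NormedSpace ℝ H]

/-- Differentiation under the integral sign. By the tube lemma, one bound on the partial derivative
holds for all parameters near `x`. -/
theorem hasFDerivAt_intervalIntegral_of_contDiffOn {F : V → ℝ → H} {W : Set (V × ℝ)}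
    (hW : IsOpen W) (hF : ContDiffOn ℝ 1 (fun z : V × ℝ => F z.1 z.2) W) {x : V}
    (hx : ∀ t ∈ Icc (0 : ℝ) 1, (x, t) ∈ W) :
    HasFDerivAt (fun y => ∫ t in (0 : ℝ)..1, F y t)
      (∫ t in (0 : ℝ)..1, fderiv ℝ (fun y => F y t) x) x := by
  have hdiff {y : V} {t : ℝ} (h : (y, t) ∈ W) :
      HasFDerivAt (fun y => F y t) ((fderiv ℝ (fun z : V × ℝ => F z.1 z.2) (y, t)).comp
        (ContinuousLinearMap.inl ℝ V ℝ)) y := by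
    have h1 := ((hF.differentiableOn one_ne_zero).differentiableAt (hW.mem_nhds h)).hasFDerivAt
    exact HasFDerivAt.comp (g := fun z : V × ℝ => F z.1 z.2) (f := fun e => (e, t)) y h1
      (hasFDerivAt_prodMk_left y t)
  have hcont : ContinuousOn (fun z : V × ℝ => (fderiv ℝ (fun z : V × ℝ => F z.1 z.2) z).comp
      (ContinuousLinearMap.inl ℝ V ℝ)) W :=
    (hF.continuousOn_fderiv_of_isOpen hW le_rfl).clm_comp continuousOn_const
  obtain ⟨C, hC⟩ : ∃ C : ℝ, ∀ t ∈ Icc (0 : ℝ) 1,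
      ‖(fderiv ℝ (fun z : V × ℝ => F z.1 z.2) (x, t)).comp (ContinuousLinearMap.inl ℝ V ℝ)‖ <
        C := by
    have h1 : ContinuousOn (fun t : ℝ => (fderiv ℝ (fun z : V × ℝ => F z.1 z.2) (x, t)).comp
        (ContinuousLinearMap.inl ℝ V ℝ)) (Icc 0 1) :=
      hcont.comp (by fun_prop) fun t ht => hx t ht
    obtain ⟨C, hC⟩ := isCompact_Icc.exists_bound_of_continuousOn h1
    exact ⟨C + 1, fun t ht => (hC t ht).trans_lt (lt_add_one C)⟩
  set W' : Set (V × ℝ) := W ∩ {z | ‖(fderiv ℝ (fun z : V × ℝ => F z.1 z.2) z).comp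
      (ContinuousLinearMap.inl ℝ V ℝ)‖ < C} with hW'
  have hW'o : IsOpen W' := hcont.norm.isOpen_inter_preimage hW isOpen_Iio
  obtain ⟨u, v, hu, -, hxu, htv, huv⟩ := generalized_tube_lemma (isCompact_singleton (x := x))
    (isCompact_Icc (a := (0 : ℝ)) (b := 1)) hW'o (by
      rintro ⟨y, t⟩ ⟨rfl, ht⟩
      exact ⟨hx t ht, hC t ht⟩)
  have hmem {y : V} (hy : y ∈ u) {t : ℝ} (ht : t ∈ Icc (0 : ℝ) 1) : (y, t) ∈ W' :=
    huv ⟨hy, htv ht⟩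
  have hunhds : u ∈ 𝓝 x := hu.mem_nhds (hxu rfl)
  have hsub : uIoc (0 : ℝ) 1 ⊆ Icc 0 1 := by
    rw [uIoc_of_le zero_le_one]; exact Ioc_subset_Icc_self
  have hFc {y : V} (hy : y ∈ u) : ContinuousOn (F y) (Icc 0 1) :=
    hF.continuousOn.comp (f := fun t : ℝ => (y, t)) (by fun_prop) fun t ht => (hmem hy ht).1
  have heq : ∀ t ∈ Icc (0 : ℝ) 1, fderiv ℝ (fun y => F y t) x =
      (fderiv ℝ (fun z : V × ℝ => F z.1 z.2) (x, t)).comp (ContinuousLinearMap.inl ℝ V ℝ) :=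
    fun t ht => (hdiff (hx t ht)).fderiv
  refine intervalIntegral.hasFDerivAt_integral_of_dominated_of_fderiv_le (bound := fun _ => C)
    (F' := fun y t => fderiv ℝ (fun y => F y t) y) hunhds ?_ ?_ ?_ ?_ ?_ ?_
  · filter_upwards [hunhds] with y hy
    exact ((hFc hy).mono hsub).aestronglyMeasurable measurableSet_uIoc
  · refine ContinuousOn.intervalIntegrable ?_
    rw [uIcc_of_le zero_le_one]
    exact hFc (hxu rfl)
  · refine ContinuousOn.aestronglyMeasurable ?_ measurableSet_uIoc
    refine ContinuousOn.congr ?_ fun t ht => heq t (hsub ht)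
    exact hcont.comp (by fun_prop) fun t ht => hx t (hsub ht)
  · refine Filter.Eventually.of_forall fun t ht y hy => ?_
    rw [(hdiff (hmem hy (hsub ht)).1).fderiv]
    exact (hmem hy (hsub ht)).2.le
  · exact intervalIntegrable_const
  · refine Filter.Eventually.of_forall fun t ht y hy => ?_
    have h := hdiff (hmem hy (hsub ht)).1
    rwa [← h.fderiv] at h

theorem contDiffOn_fderiv_left {F : V → ℝ → H} {W : Set (V × ℝ)} (hW : IsOpen W)
    (hF : ContDiffOn ℝ ∞ (fun z : V × ℝ => F z.1 z.2) W) :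
    ContDiffOn ℝ ∞ (fun z : V × ℝ => fderiv ℝ (fun y => F y z.2) z.1) W := by
  have h : ContDiffOn ℝ ∞ (fun z : V × ℝ => (fderiv ℝ (fun z : V × ℝ => F z.1 z.2) z).comp
      (ContinuousLinearMap.inl ℝ V ℝ)) W :=
    (hF.fderiv_of_isOpen hW (by simp)).clm_comp contDiffOn_const
  refine h.congr fun z hz => ?_
  have h1 := ((hF.differentiableOn (by simp)).differentiableAt (hW.mem_nhds hz)).hasFDerivAt
  exact (HasFDerivAt.comp (g := fun z : V × ℝ => F z.1 z.2) (f := fun e => (e, z.2)) z.1 h1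
    (hasFDerivAt_prodMk_left z.1 z.2)).fderiv

theorem apply_intervalIntegral_fderiv {G : Type} [NormedAddCommGroup G] [NormedSpace ℝ G]
    [CompleteSpace H] [CompleteSpace G]
    (A : (V →L[ℝ] H) →L[ℝ] G) {F : V → ℝ → H} {W : Set (V × ℝ)} (hW : IsOpen W)
    (hF : ContDiffOn ℝ ∞ (fun z : V × ℝ => F z.1 z.2) W) {x : V}
    (hx : ∀ t ∈ Icc (0 : ℝ) 1, (x, t) ∈ W) :
    A (∫ t in (0 : ℝ)..1, fderiv ℝ (fun y => F y t) x) =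
      ∫ t in (0 : ℝ)..1, A (fderiv ℝ (fun y => F y t) x) := by
  refine (A.intervalIntegral_comp_comm (ContinuousOn.intervalIntegrable ?_)).symm
  rw [uIcc_of_le zero_le_one]
  exact (contDiffOn_fderiv_left hW hF).continuousOn.comp (f := fun t : ℝ => (x, t))
    (by fun_prop) fun t ht => hx t ht

end Parametric

theorem contDiffOn_intervalIntegral_nat {V : Type} [NormedAddCommGroup V] [NormedSpace ℝ V]
    (n : ℕ) : ∀ {H : Type} [NormedAddCommGroup H] [NormedSpace ℝ H] {F : V → ℝ → H}
    {W : Set (V × ℝ)} {U : Set V}, IsOpen W → IsOpen U →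
    ContDiffOn ℝ ∞ (fun z : V × ℝ => F z.1 z.2) W → (∀ x ∈ U, ∀ t ∈ Icc (0 : ℝ) 1, (x, t) ∈ W) →
    ContDiffOn ℝ n (fun x => ∫ t in (0 : ℝ)..1, F x t) U := by
  induction n with
  | zero =>
    intro H _ _ F W U hW hU hF hx
    rw [Nat.cast_zero, contDiffOn_zero]
    exact fun x hxU => (hasFDerivAt_intervalIntegral_of_contDiffOn hW (hF.of_le (by simp))
      (hx x hxU)).continuousAt.continuousWithinAt
  | succ n ih =>
    intro H _ _ F W U hW hU hF hx
    have hd (x) (hxU : x ∈ U) := hasFDerivAt_intervalIntegral_of_contDiffOn hW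
      (hF.of_le (by simp)) (hx x hxU)
    rw [Nat.cast_succ, contDiffOn_succ_iff_fderiv_of_isOpen hU]
    refine ⟨fun x hxU => (hd x hxU).differentiableAt.differentiableWithinAt, by simp, ?_⟩
    exact (ih hW hU (contDiffOn_fderiv_left hW hF) hx).congr fun x hxU => (hd x hxU).fderiv

theorem contDiffOn_intervalIntegral {V : Type} [NormedAddCommGroup V] [NormedSpace ℝ V]
    {H : Type} [NormedAddCommGroup H] [NormedSpace ℝ H] {F : V → ℝ → H}
    {W : Set (V × ℝ)} {U : Set V} (hW : IsOpen W) (hU : IsOpen U)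
    (hF : ContDiffOn ℝ ∞ (fun z : V × ℝ => F z.1 z.2) W)
    (hx : ∀ x ∈ U, ∀ t ∈ Icc (0 : ℝ) 1, (x, t) ∈ W) :
    ContDiffOn ℝ ∞ (fun x => ∫ t in (0 : ℝ)..1, F x t) U :=
  contDiffOn_infty.2 fun n => contDiffOn_intervalIntegral_nat n hW hU hF hx

/-- The pointwise form of Cartan's formula used in the Poincaré lemma: `α` is the value at a point
of a closed form, `δ` is its derivative there, and `f` is the derivative of its contraction with the
radial field. -/
theorem alternatizeUncurryFin_eq_of_closed {V : Type*} [NormedAddCommGroup V] [NormedSpace ℝ V]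
    {k : ℕ} {f : V →L[ℝ] V [⋀^Fin k]→L[ℝ] ℝ} {α : V [⋀^Fin (k + 1)]→L[ℝ] ℝ}
    {δ : V →L[ℝ] V [⋀^Fin (k + 1)]→L[ℝ] ℝ} {y : V} {s t : ℝ}
    (hf : ∀ v, f v = s • (α.curryLeft v + t • (δ v).curryLeft y))
    (hδ : ContinuousAlternatingMap.alternatizeUncurryFin δ = 0) :
    ContinuousAlternatingMap.alternatizeUncurryFin f = ((k + 1 : ℕ) * s) • α + (s * t) • δ y := by
  ext v
  have h8 := DFunLike.congr_fun hδ (Matrix.vecCons y v)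
  rw [ContinuousAlternatingMap.alternatizeUncurryFin_apply, Fin.sum_univ_succ] at h8
  have h9 : ∑ i : Fin (k + 1), (-1) ^ (i : ℕ) • α (Matrix.vecCons (v i) (i.removeNth v)) =
      (k + 1) • α v := by
    have := DFunLike.congr_fun (ContinuousAlternatingMap.alternatizeUncurryFin_curryLeft α) v
    rw [ContinuousAlternatingMap.alternatizeUncurryFin_apply] at this
    exact this
  have h10 : ∑ i : Fin (k + 1), (-1) ^ (i : ℕ) • (δ (v i))
      (Matrix.vecCons y (i.removeNth v)) = (δ y) v := by
    have h11 (i : Fin (k + 1)) : Fin.removeNth i.succ (Matrix.vecCons y v) =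
        Matrix.vecCons y (i.removeNth v) := by
      ext1 j
      refine Fin.cases ?_ (fun j => ?_) j
      · simp [Fin.removeNth]
      · simp [Fin.removeNth, Fin.succ_succAbove_succ]
    have h12 : Fin.removeNth 0 (Matrix.vecCons y v) = v := by
      ext1 j; simp [Fin.removeNth]
    simp only [Fin.val_zero, pow_zero, one_smul, Matrix.cons_val_zero, h12, Fin.val_succ,
      Matrix.cons_val_succ, h11, pow_succ, mul_neg_one, neg_smul, Finset.sum_neg_distrib] at h8
    exact (add_neg_eq_zero.1 h8).symm
  rw [ContinuousAlternatingMap.alternatizeUncurryFin_apply, ContinuousAlternatingMap.add_apply,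
    ContinuousAlternatingMap.smul_apply, ContinuousAlternatingMap.smul_apply, ← h10]
  have h13 : (((k + 1 : ℕ) : ℝ) * s) • α v = s * ((k + 1) • α v) := by
    rw [nsmul_eq_mul, smul_eq_mul]; ring
  rw [h13, ← h9, smul_eq_mul, Finset.mul_sum, Finset.mul_sum, ← Finset.sum_add_distrib]
  refine Finset.sum_congr rfl fun i _ => ?_
  rw [hf]
  change (-1) ^ (i : ℕ) • (s * (α (Matrix.vecCons (v i) (i.removeNth v)) +
    t * δ (v i) (Matrix.vecCons y (i.removeNth v)))) = _
  simp only [zsmul_eq_mul]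
  ring

theorem fderiv_smul_clm_apply {V H H' : Type*} [NormedAddCommGroup V] [NormedSpace ℝ V]
    [NormedAddCommGroup H] [NormedSpace ℝ H] [NormedAddCommGroup H'] [NormedSpace ℝ H']
    (L : H →L[ℝ] V →L[ℝ] H') {β : V → H} {β' : V →L[ℝ] H} {x : V} (hβ : HasFDerivAt β β' x)
    (s : ℝ) (a v : V) :
    fderiv ℝ (fun y => s • L (β y) (y - a)) x v = s • (L (β x) v + L (β' v) (x - a)) := by
  have h1 : HasFDerivAt (fun y => L (β y)) (L.comp β') x := L.hasFDerivAt.comp x hβ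
  have h2 : HasFDerivAt (fun y => y - a) (ContinuousLinearMap.id ℝ V) x :=
    (hasFDerivAt_id (𝕜 := ℝ) x).sub_const a
  exact DFunLike.congr_fun ((h1.clm_apply h2).const_smul s).fderiv v

theorem fderiv_smul_curryLeft {V : Type*} [NormedAddCommGroup V] [NormedSpace ℝ V]
    {k : ℕ} {β : V → V [⋀^Fin (k + 1)]→L[ℝ] ℝ} {β' : V →L[ℝ] V [⋀^Fin (k + 1)]→L[ℝ] ℝ}
    {x : V} (hβ : HasFDerivAt β β' x) (s : ℝ) (a v : V) :
    fderiv ℝ (fun y => s • (β y).curryLeft (y - a)) x v =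
      s • ((β x).curryLeft v + (β' v).curryLeft (x - a)) := by
  exact fderiv_smul_clm_apply (ContinuousAlternatingMap.curryLeftLI (𝕜 := ℝ) (E := V) (F := ℝ)
    (n := k)).toContinuousLinearMap hβ s a v

/-- The Poincaré lemma on star-shaped open sets: the primitive is the integral of
`t ^ k • ι_{x - a} θ (a + t (x - a))` over `0 ≤ t ≤ 1`. -/
theorem StarConvex.exists_extDeriv_eq {V : Type} [NormedAddCommGroup V] [NormedSpace ℝ V] {k : ℕ}
    {U : Set V} {a : V} (hs : StarConvex ℝ a U) (hU : IsOpen U)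
    {θ : V → V [⋀^Fin (k + 1)]→L[ℝ] ℝ} (hθ : ContDiffOn ℝ ∞ θ U)
    (hd : ∀ x ∈ U, extDeriv θ x = 0) :
    ∃ ν : V → V [⋀^Fin k]→L[ℝ] ℝ, ContDiffOn ℝ ∞ ν U ∧ ∀ x ∈ U, extDeriv ν x = θ x := by
  let γ : V × ℝ → V := fun z => a + z.2 • (z.1 - a)
  have hγ : ContDiff ℝ ∞ γ := by fun_prop
  set W : Set (V × ℝ) := γ ⁻¹' U with hWdef
  have hW : IsOpen W := hU.preimage hγ.continuous
  have hmem (x) (hx : x ∈ U) (t : ℝ) (ht : t ∈ Icc (0 : ℝ) 1) : (x, t) ∈ W := by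
    have h := hs hx (sub_nonneg.2 ht.2) ht.1 (sub_add_cancel 1 t)
    change a + t • (x - a) ∈ U
    convert h using 1
    module
  let F : V → ℝ → V [⋀^Fin k]→L[ℝ] ℝ := fun x t => t ^ k • (θ (γ (x, t))).curryLeft (x - a)
  let cl : (V [⋀^Fin (k + 1)]→L[ℝ] ℝ) →L[ℝ] V →L[ℝ] V [⋀^Fin k]→L[ℝ] ℝ :=
    (ContinuousAlternatingMap.curryLeftLI (𝕜 := ℝ) (E := V) (F := ℝ)
      (n := k)).toContinuousLinearMap
  have hcl (α : V [⋀^Fin (k + 1)]→L[ℝ] ℝ) : cl α = α.curryLeft := rfl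
  have hθγ : ContDiffOn ℝ ∞ (fun z => θ (γ z)) W := hθ.comp hγ.contDiffOn fun z hz => hz
  have hF : ContDiffOn ℝ ∞ (fun z : V × ℝ => F z.1 z.2) W := by
    have h1 : ContDiffOn ℝ ∞ (fun z : V × ℝ => cl (θ (γ z)) (z.1 - a)) W :=
      (cl.contDiff.comp_contDiffOn hθγ).clm_apply (by fun_prop)
    exact ContDiffOn.smul (f := fun z : V × ℝ => z.2 ^ k) (by fun_prop) h1
  refine ⟨fun x => ∫ t in (0 : ℝ)..1, F x t, contDiffOn_intervalIntegral hW hU hF hmem,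
    fun x hx => ?_⟩
  have hder := hasFDerivAt_intervalIntegral_of_contDiffOn hW (hF.of_le (by simp)) (hmem x hx)
  let AU := ContinuousAlternatingMap.alternatizeUncurryFinCLM (n := k) ℝ V ℝ
  -- the derivative of `t ^ (k + 1) • θ (γ (x, t))`
  have hθd (t : ℝ) (ht : t ∈ Icc (0 : ℝ) 1) :
      HasFDerivAt θ (fderiv ℝ θ (γ (x, t))) (γ (x, t)) :=
    ((hθ.differentiableOn (by simp)).differentiableAt (hU.mem_nhds (hmem x hx t ht))).hasFDerivAt
  have hAU (t : ℝ) (ht : t ∈ Icc (0 : ℝ) 1) : HasDerivAt (fun s : ℝ => s ^ (k + 1) • θ (γ (x, s)))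
      (AU (fderiv ℝ (fun y => F y t) x)) t := by
    have h1 : HasDerivAt (fun s : ℝ => γ (x, s)) (x - a) t := by
      simpa [γ] using ((hasDerivAt_id t).smul_const (x - a)).const_add a
    have h2 : HasDerivAt (fun s : ℝ => θ (γ (x, s))) (fderiv ℝ θ (γ (x, t)) (x - a)) t :=
      (hθd t ht).comp_hasDerivAt t h1
    have h3 := (hasDerivAt_pow (k + 1) t).smul h2
    have h4 : HasFDerivAt (fun y => γ (y, t)) (t • ContinuousLinearMap.id ℝ V) x := by
      simpa [γ] using (((hasFDerivAt_id (𝕜 := ℝ) x).sub_const a).const_smul t).const_add a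
    have h5 : HasFDerivAt (fun y => θ (γ (y, t)))
        ((fderiv ℝ θ (γ (x, t))).comp (t • ContinuousLinearMap.id ℝ V)) x := (hθd t ht).comp x h4
    have h6 : AU (fderiv ℝ (fun y => F y t) x) =
        ((k + 1 : ℕ) * t ^ k) • θ (γ (x, t)) + (t ^ k * t) • fderiv ℝ θ (γ (x, t)) (x - a) := by
      refine alternatizeUncurryFin_eq_of_closed (fun v => ?_) (hd _ (hmem x hx t ht))
      rw [fderiv_smul_curryLeft h5]
      simp only [ContinuousLinearMap.comp_apply, smul_apply, ContinuousLinearMap.id_apply,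
        map_smul, ContinuousAlternatingMap.curryLeft_smul]
    rw [h6]
    refine HasDerivAt.congr_deriv h3 ?_
    rw [Nat.add_sub_cancel, ← pow_succ]
    exact add_comm _ _
  rw [extDeriv, hder.fderiv]
  change AU _ = _
  rw [apply_intervalIntegral_fderiv AU hW hF (hmem x hx),
    intervalIntegral.integral_eq_sub_of_hasDerivAt
    (f := fun s : ℝ => s ^ (k + 1) • θ (γ (x, s)))]
  · simp [γ]
  · rw [uIcc_of_le zero_le_one]; exact hAU
  · refine ContinuousOn.intervalIntegrable ?_
    rw [uIcc_of_le zero_le_one]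
    refine AU.continuous.comp_continuousOn ?_
    exact (contDiffOn_fderiv_left hW hF).continuousOn.comp (f := fun t : ℝ => (x, t))
      (by fun_prop) fun t ht => hmem x hx t ht

/-! ### Closed forms on the complement of a linear subspace in a ball -/

section MayerVietoris

variable {V : Type} [NormedAddCommGroup V] [NormedSpace ℝ V]

/-- The form `θ` of degree `k` is exact on `U`, where a form of degree `0` counts as exact if it is
constant: these are the forms which vanish in the reduced de Rham cohomology of `U`. -/
def IsExactOn (U : Set V) : (k : ℕ) → (V → V [⋀^Fin k]→L[ℝ] ℝ) → Prop
  | 0, θ => ∃ r, ∀ x ∈ U, θ x = r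
  | k + 1, θ => ∃ ν : V → V [⋀^Fin k]→L[ℝ] ℝ, ContDiffOn ℝ ∞ ν U ∧ ∀ x ∈ U, extDeriv ν x = θ x

theorem ContDiffOn.extDeriv {U : Set V} (hU : IsOpen U) {k : ℕ} {ν : V → V [⋀^Fin k]→L[ℝ] ℝ}
    (hν : ContDiffOn ℝ ∞ ν U) : ContDiffOn ℝ ∞ (extDeriv ν) U :=
  (ContinuousAlternatingMap.alternatizeUncurryFinCLM ℝ V ℝ).contDiff.comp_contDiffOn
    (hν.fderiv_of_isOpen hU (by simp))

theorem ContDiffOn.differentiableAt_of_isOpen {H : Type*} [NormedAddCommGroup H] [NormedSpace ℝ H]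
    {U : Set V} (hU : IsOpen U) {ν : V → H} (hν : ContDiffOn ℝ ∞ ν U) {x : V} (hx : x ∈ U) :
    DifferentiableAt ℝ ν x :=
  (hν.contDiffAt (hU.mem_nhds hx)).differentiableAt (by simp)

theorem ContDiffOn.extDeriv_extDeriv {U : Set V} (hU : IsOpen U) {k : ℕ}
    {ν : V → V [⋀^Fin k]→L[ℝ] ℝ} (hν : ContDiffOn ℝ ∞ ν U) {x : V} (hx : x ∈ U) :
    _root_.extDeriv (_root_.extDeriv ν) x = 0 :=
  extDeriv_extDeriv_apply (hν.contDiffAt (hU.mem_nhds hx))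
    (by simpa using Orbifold.two_le_infty)

theorem Set.EqOn.extDeriv_eq {U : Set V} (hU : IsOpen U) {k : ℕ} {ν ν' : V → V [⋀^Fin k]→L[ℝ] ℝ}
    (h : EqOn ν ν' U) {x : V} (hx : x ∈ U) : extDeriv ν x = extDeriv ν' x :=
  (h.eventuallyEq_of_mem (hU.mem_nhds hx)).extDeriv_eq

theorem extDeriv_sub_apply {k : ℕ} {ν ν' : V → V [⋀^Fin k]→L[ℝ] ℝ} {x : V}
    (h : DifferentiableAt ℝ ν x) (h' : DifferentiableAt ℝ ν' x) :
    extDeriv (fun y => ν y - ν' y) x = extDeriv ν x - extDeriv ν' x := by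
  have h1 : (fun y => ν y - ν' y) = ν + (-1 : ℝ) • ν' := by
    ext1 y
    exact (sub_eq_add_neg _ _).trans (congrArg (ν y + ·) (neg_one_smul ℝ (ν' y)).symm)
  rw [h1, extDeriv_add h (h'.const_smul _), extDeriv_smul, neg_one_smul, sub_eq_add_neg]

theorem extDeriv_add_apply {k : ℕ} {ν ν' : V → V [⋀^Fin k]→L[ℝ] ℝ} {x : V}
    (h : DifferentiableAt ℝ ν x) (h' : DifferentiableAt ℝ ν' x) :
    extDeriv (fun y => ν y + ν' y) x = extDeriv ν x + extDeriv ν' x :=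
  extDeriv_add h h'

open Classical in
/-- Multiplying by a function which vanishes near `A \ B` extends a smooth map from `A ∩ B`
to `A`. -/
theorem contDiffOn_ite_smul {H : Type*} [NormedAddCommGroup H] [NormedSpace ℝ H] {A B : Set V}
    (hA : IsOpen A) (hB : IsOpen B) {φ : V → ℝ} {γ : V → H} (hφ : ContDiffOn ℝ ∞ φ A)
    (hφ0 : ∀ x ∈ A \ B, ∀ᶠ y in 𝓝 x, φ y = 0) (hγ : ContDiffOn ℝ ∞ γ (A ∩ B)) :
    ContDiffOn ℝ ∞ (fun x => if x ∈ B then φ x • γ x else 0) A := by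
  intro x hx
  refine ContDiffAt.contDiffWithinAt ?_
  by_cases hxB : x ∈ B
  · have h1 : ContDiffAt ℝ ∞ (fun y => φ y • γ y) x :=
      (hφ.contDiffAt (hA.mem_nhds hx)).smul (hγ.contDiffAt ((hA.inter hB).mem_nhds ⟨hx, hxB⟩))
    refine h1.congr_of_eventuallyEq ?_
    filter_upwards [hB.mem_nhds hxB] with y hy
    simp [hy]
  · refine (contDiffAt_const (c := (0 : H))).congr_of_eventuallyEq ?_
    filter_upwards [hφ0 x ⟨hx, hxB⟩] with y hy
    simp [hy]

open Classical in
/-- The connecting step of the Mayer–Vietoris sequence: primitives on `A` and on `B` whose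
difference is exact on `A ∩ B` can be glued. -/
theorem exists_extDeriv_eq_of_isExactOn_inter {A B : Set V} (hA : IsOpen A) (hB : IsOpen B)
    {φ : V → ℝ} (hφ : ContDiffOn ℝ ∞ φ (A ∪ B)) (hφA : ∀ x ∈ A \ B, ∀ᶠ y in 𝓝 x, φ y = 0)
    (hφB : ∀ x ∈ B \ A, ∀ᶠ y in 𝓝 x, φ y = 1) {k : ℕ} {α β : V → V [⋀^Fin k]→L[ℝ] ℝ}
    (hα : ContDiffOn ℝ ∞ α A) (hβ : ContDiffOn ℝ ∞ β B)
    (h : IsExactOn (A ∩ B) k fun x => α x - β x) :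
    ∃ ν : V → V [⋀^Fin k]→L[ℝ] ℝ, ContDiffOn ℝ ∞ ν (A ∪ B) ∧
      (∀ x ∈ A, extDeriv ν x = extDeriv α x) ∧ ∀ x ∈ B, extDeriv ν x = extDeriv β x := by
  suffices h' : ∃ α' β' : V → V [⋀^Fin k]→L[ℝ] ℝ, ContDiffOn ℝ ∞ α' A ∧ ContDiffOn ℝ ∞ β' B ∧
      (∀ x ∈ A, extDeriv α' x = extDeriv α x) ∧ (∀ x ∈ B, extDeriv β' x = extDeriv β x) ∧
      ∀ x ∈ A ∩ B, α' x = β' x by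
    obtain ⟨α', β', h1, h2, h3, h4, h5⟩ := h'
    have e1 : EqOn (fun x => if x ∈ A then α' x else β' x) α' A := fun x hx => if_pos hx
    have e2 : EqOn (fun x => if x ∈ A then α' x else β' x) β' B := by
      intro x hx
      by_cases hxA : x ∈ A
      · simpa [hxA] using h5 x ⟨hxA, hx⟩
      · simp [hxA]
    refine ⟨fun x => if x ∈ A then α' x else β' x, (h1.congr e1).union_of_isOpen (h2.congr e2)
      hA hB,
      fun x hx => ?_, fun x hx => ?_⟩
    · rw [e1.extDeriv_eq hA hx, h3 x hx]
    · rw [e2.extDeriv_eq hB hx, h4 x hx]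
  cases k with
  | zero =>
    obtain ⟨r, hr⟩ := h
    refine ⟨α, fun x => β x + r, hα, hβ.add contDiffOn_const, fun x _ => rfl, fun x hx => ?_,
      fun x hx => ?_⟩
    · rw [extDeriv_add_apply (hβ.differentiableAt_of_isOpen hB hx) (differentiableAt_const r)]
      have : extDeriv (fun _ : V => r) x = 0 := by
        rw [extDeriv, fderiv_const_apply]
        exact map_zero (ContinuousAlternatingMap.alternatizeUncurryFinCLM ℝ V ℝ)
      rw [this, add_zero]
    · rw [← hr x hx]; exact (add_sub_cancel _ _).symm
  | succ k =>
    obtain ⟨γ, hγ, hγd⟩ := h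
    have g1 := contDiffOn_ite_smul hA hB (hφ.mono subset_union_left) hφA hγ
    have hφ' : ContDiffOn ℝ ∞ (fun x => 1 - φ x) B :=
      contDiffOn_const.sub (hφ.mono subset_union_right)
    have g2 := contDiffOn_ite_smul hB hA hφ'
      (fun x hx => (hφB x hx).mono fun y hy => by simp [hy]) (hγ.mono (inter_comm B A).subset)
    refine ⟨fun x => α x - extDeriv (fun x => if x ∈ B then φ x • γ x else 0) x,
      fun x => β x + extDeriv (fun x => if x ∈ A then (1 - φ x) • γ x else 0) x,
      hα.sub (g1.extDeriv hA), hβ.add (g2.extDeriv hB), fun x hx => ?_, fun x hx => ?_,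
      fun x hx => ?_⟩
    · rw [extDeriv_sub_apply (hα.differentiableAt_of_isOpen hA hx)
        ((g1.extDeriv hA).differentiableAt_of_isOpen hA hx), g1.extDeriv_extDeriv hA hx, sub_zero]
    · rw [extDeriv_add_apply (hβ.differentiableAt_of_isOpen hB hx)
        ((g2.extDeriv hB).differentiableAt_of_isOpen hB hx), g2.extDeriv_extDeriv hB hx, add_zero]
    · have h1 : extDeriv γ x = extDeriv (fun x => if x ∈ B then φ x • γ x else 0) x +
          extDeriv (fun x => if x ∈ A then (1 - φ x) • γ x else 0) x := by
        rw [← extDeriv_add_apply (g1.differentiableAt_of_isOpen hA hx.1)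
          (g2.differentiableAt_of_isOpen hB hx.2)]
        refine EqOn.extDeriv_eq (hA.inter hB) (fun y hy => ?_) hx
        simp only [hy.1, hy.2, if_true]
        rw [← add_smul]; simp
      have h2 := hγd x hx
      rw [h1] at h2
      beta_reduce
      have h3 : ∀ a b p q : V [⋀^Fin (k + 1)]→L[ℝ] ℝ, p + q = a - b → a - p = b + q := by
        intro a b p q h
        rw [sub_eq_iff_eq_add, add_assoc, add_comm q p, h, add_sub_cancel]
      exact h3 _ _ _ _ h2

end MayerVietoris

section Subspace

variable {d : ℕ}

local notation "𝔼" => EuclideanSpace ℝ (Fin d)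

/-- The linear subspace of `ℝᵈ` on which the first `j` coordinates vanish. -/
def coordSubspace (d j : ℕ) : Set (EuclideanSpace ℝ (Fin d)) := {x | ∀ i : Fin d, i.1 < j → x i = 0}

/-- The half of `coordSubspace d j` on which the coordinate of index `j`, multiplied by `s`, is
nonpositive. -/
def coordHalfSubspace (d j : ℕ) (s : ℝ) : Set (EuclideanSpace ℝ (Fin d)) :=
  {x | x ∈ coordSubspace d j ∧ ∀ i : Fin d, i.1 = j → s * x i ≤ 0}

theorem coordSubspace_self : coordSubspace d d = {0} := by
  ext x
  simp only [coordSubspace, mem_ofPred_eq, mem_singleton_iff]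
  exact ⟨fun h => by ext i; exact h i i.2, fun h i _ => by simp [h]⟩

theorem isClosed_coordSubspace (j : ℕ) : IsClosed (coordSubspace d j) := by
  simp only [coordSubspace, ofPred_forall]
  refine isClosed_iInter fun i => isClosed_iInter fun _ => isClosed_eq (by fun_prop) (by fun_prop)

theorem isClosed_coordHalfSubspace (j : ℕ) (s : ℝ) : IsClosed (coordHalfSubspace d j s) := by
  have : coordHalfSubspace d j s = coordSubspace d j ∩
      ⋂ i : Fin d, ⋂ _ : i.1 = j, {x : 𝔼 | s * x i ≤ 0} := by
    ext x; simp [coordHalfSubspace]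
  rw [this]
  refine (isClosed_coordSubspace j).inter ?_
  refine isClosed_iInter fun i => isClosed_iInter fun _ => isClosed_le (by fun_prop) (by fun_prop)

theorem coordHalfSubspace_union {j : ℕ} (hj : j < d) :
    coordHalfSubspace d j 1 ∪ coordHalfSubspace d j (-1) = coordSubspace d j := by
  ext x
  constructor
  · rintro (h | h) <;> exact h.1
  · intro h
    rcases le_total (x ⟨j, hj⟩) 0 with h' | h'
    · exact Or.inl ⟨h, fun i hi => by obtain rfl : i = ⟨j, hj⟩ := Fin.ext hi; simpa⟩
    · exact Or.inr ⟨h, fun i hi => by obtain rfl : i = ⟨j, hj⟩ := Fin.ext hi; simpa⟩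

theorem coordHalfSubspace_inter {j : ℕ} :
    coordHalfSubspace d j 1 ∩ coordHalfSubspace d j (-1) = coordSubspace d (j + 1) := by
  ext x
  constructor
  · rintro ⟨h, h'⟩ i hi
    rcases Nat.lt_succ_iff_lt_or_eq.1 hi with hi | hi
    · exact h.1 i hi
    · have := h.2 i hi
      have := h'.2 i hi
      linarith
  · intro h
    have h0 : x ∈ coordSubspace d j := fun i hi => h i (by omega)
    refine ⟨⟨h0, fun i hi => ?_⟩, h0, fun i hi => ?_⟩ <;> rw [h i (by omega)] <;> simp

/-- The complement of a half subspace in a convex neighbourhood of the origin is star-shaped. -/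
theorem exists_starConvex_diff_coordHalfSubspace {C : Set 𝔼} (hC : IsOpen C) (hc : Convex ℝ C)
    (h0 : 0 ∈ C) {j : ℕ} (hj : j < d) {s : ℝ} (hs : s ≠ 0) :
    ∃ a, a ∈ C \ coordHalfSubspace d j s ∧ StarConvex ℝ a (C \ coordHalfSubspace d j s) := by
  obtain ⟨ε, hε, hεC⟩ : ∃ ε : ℝ, 0 < ε ∧
      ε • (s • EuclideanSpace.single (⟨j, hj⟩ : Fin d) (1 : ℝ)) ∈ C := by
    have h1 : Filter.Tendsto (fun ε : ℝ =>
        ε • (s • EuclideanSpace.single (⟨j, hj⟩ : Fin d) (1 : ℝ)))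
        (𝓝 0) (𝓝 0) := by
      have : Continuous (fun ε : ℝ =>
          ε • (s • EuclideanSpace.single (⟨j, hj⟩ : Fin d) (1 : ℝ))) := by
        fun_prop
      simpa using this.tendsto 0
    have h2 := h1.eventually (hC.mem_nhds h0)
    obtain ⟨ε, h3, h4⟩ := ((h2.filter_mono nhdsWithin_le_nhds).and
      (self_mem_nhdsWithin (s := Ioi (0 : ℝ)))).exists
    exact ⟨ε, h4, h3⟩
  set a := ε • (s • EuclideanSpace.single (⟨j, hj⟩ : Fin d) (1 : ℝ)) with ha
  have haj : a ⟨j, hj⟩ = ε * s := by simp [ha]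
  have hai : ∀ i : Fin d, i.1 < j → a i = 0 := fun i hi => by
    have : i ≠ ⟨j, hj⟩ := fun h => by rw [h] at hi; exact lt_irrefl _ hi
    simp [ha, this]
  have hss : 0 < s * s := mul_self_pos.2 hs
  have haS : a ∉ coordHalfSubspace d j s := by
    intro h
    have := h.2 ⟨j, hj⟩ rfl
    rw [haj] at this
    nlinarith [mul_pos hε hss]
  refine ⟨a, ⟨hεC, haS⟩, ?_⟩
  intro x hx t u ht hu htu
  refine ⟨hc hεC hx.1 ht hu htu, fun h => ?_⟩
  have hj' := h.2 ⟨j, hj⟩ rfl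
  simp only [PiLp.add_apply, PiLp.smul_apply, smul_eq_mul, haj] at hj'
  rcases hu.eq_or_lt with rfl | hu
  · have : t = 1 := by linarith
    subst this
    nlinarith [mul_pos hε hss]
  · refine hx.2 ⟨fun i hi => ?_, fun i hi => ?_⟩
    · have := h.1 i hi
      simp only [PiLp.add_apply, PiLp.smul_apply, smul_eq_mul, hai i hi] at this
      have h3 : u * x i = 0 := by linarith
      exact (mul_eq_zero.1 h3).resolve_left hu.ne'
    · obtain rfl : i = ⟨j, hj⟩ := Fin.ext hi
      by_contra! hpos
      have h1 : 0 < u * (s * x ⟨j, hj⟩) := mul_pos hu hpos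
      have h2 : 0 ≤ t * (ε * (s * s)) := by positivity
      nlinarith

/-- The square of the distance to `coordSubspace d j`. -/
def coordSq (d j : ℕ) (x : EuclideanSpace ℝ (Fin d)) : ℝ :=
  ∑ i : Fin d, if i.1 < j then x i ^ 2 else 0

theorem coordSq_pos {j : ℕ} {x : 𝔼} (hx : x ∉ coordSubspace d j) : 0 < coordSq d j x := by
  simp only [coordSubspace, mem_ofPred_eq, not_forall] at hx
  obtain ⟨i, hi, hxi⟩ := hx
  refine Finset.sum_pos' (fun i _ => by split_ifs <;> positivity) ⟨i, Finset.mem_univ _, ?_⟩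
  rw [if_pos hi]
  positivity

theorem coordSq_succ_of_mem {j : ℕ} (hj : j < d) {x : 𝔼} (hx : x ∈ coordSubspace d j) :
    coordSq d (j + 1) x = x ⟨j, hj⟩ ^ 2 := by
  rw [coordSq, Finset.sum_eq_single ⟨j, hj⟩]
  · simp
  · intro i _ hi
    split_ifs with h
    · have : i.1 ≠ j := fun h => hi (Fin.ext h)
      rw [hx i (by omega)]; simp
    · rfl
  · simp

theorem contDiff_coordSq (j : ℕ) : ContDiff ℝ ∞ (coordSq d j) := by
  refine ContDiff.sum fun i _ => ?_
  split_ifs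
  · fun_prop
  · exact contDiff_const

/-- The cosine of the angle with the coordinate axis of index `j`, as a smooth function on the
complement of `coordSubspace d (j + 1)`. -/
def coordCos (d : ℕ) {j : ℕ} (hj : j < d) (x : EuclideanSpace ℝ (Fin d)) : ℝ :=
  x ⟨j, hj⟩ / √(coordSq d (j + 1) x)

theorem contDiffOn_coordCos {j : ℕ} (hj : j < d) :
    ContDiffOn ℝ ∞ (coordCos d hj) (coordSubspace d (j + 1))ᶜ := by
  have h1 : ContDiff ℝ ∞ fun x : 𝔼 => x ⟨j, hj⟩ := by fun_prop
  exact h1.contDiffOn.div ((contDiff_coordSq (j + 1)).contDiffOn.sqrt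
    fun x hx => (coordSq_pos hx).ne')
    fun x hx => (Real.sqrt_pos.2 (coordSq_pos hx)).ne'

/-- A smooth function which is `0` near the part of `coordSubspace d j` where the coordinate of
index `j` is positive, and `1` near the part where it is negative. -/
def coordCutoff (d : ℕ) {j : ℕ} (hj : j < d) (x : EuclideanSpace ℝ (Fin d)) : ℝ :=
  Real.smoothTransition (1 / 2 - coordCos d hj x)

theorem contDiffOn_coordCutoff {j : ℕ} (hj : j < d) :
    ContDiffOn ℝ ∞ (coordCutoff d hj) (coordSubspace d (j + 1))ᶜ :=
  Real.smoothTransition.contDiff.comp_contDiffOn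
    (contDiffOn_const.sub (contDiffOn_coordCos hj))

theorem eventually_coordCutoff {j : ℕ} (hj : j < d) {x : 𝔼} (hx : x ∈ coordSubspace d j) :
    (0 < x ⟨j, hj⟩ → ∀ᶠ y in 𝓝 x, coordCutoff d hj y = 0) ∧
    (x ⟨j, hj⟩ < 0 → ∀ᶠ y in 𝓝 x, coordCutoff d hj y = 1) := by
  have hcont : ∀ (hne : x ⟨j, hj⟩ ≠ 0), ContinuousAt (coordCos d hj) x := fun hne =>
    ((contDiffOn_coordCos hj).contDiffAt ((isClosed_coordSubspace (j + 1)).isOpen_compl.mem_nhds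
      fun h => hne (h ⟨j, hj⟩ (Nat.lt_succ_self j)))).continuousAt
  have hval : coordCos d hj x = x ⟨j, hj⟩ / |x ⟨j, hj⟩| := by
    rw [coordCos, coordSq_succ_of_mem hj hx, Real.sqrt_sq_eq_abs]
  constructor <;> intro h
  · rw [abs_of_pos h, div_self h.ne'] at hval
    have : ∀ᶠ y in 𝓝 x, 1 / 2 < coordCos d hj y :=
      (hcont h.ne').eventually (lt_mem_nhds (by rw [hval]; norm_num))
    filter_upwards [this] with y hy
    exact Real.smoothTransition.zero_of_nonpos (by linarith)
  · rw [abs_of_neg h, div_neg, div_self h.ne] at hval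
    have : ∀ᶠ y in 𝓝 x, coordCos d hj y < -(1 / 2) :=
      (hcont h.ne).eventually (gt_mem_nhds (by rw [hval]; norm_num))
    filter_upwards [this] with y hy
    exact Real.smoothTransition.one_of_one_le (by linarith)

variable {C : Set (EuclideanSpace ℝ (Fin d))} (hC : IsOpen C) (hc : Convex ℝ C) (h0 : 0 ∈ C)
include hC hc h0

theorem exists_extDeriv_eq_diff_coordHalfSubspace {j : ℕ} (hj : j < d) {s : ℝ} (hs : s ≠ 0) {k : ℕ}
    {θ : 𝔼 → 𝔼 [⋀^Fin (k + 1)]→L[ℝ] ℝ} (hθ : ContDiffOn ℝ ∞ θ (C \ coordHalfSubspace d j s))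
    (hd : ∀ x ∈ C \ coordHalfSubspace d j s, extDeriv θ x = 0) :
    ∃ ν : 𝔼 → 𝔼 [⋀^Fin k]→L[ℝ] ℝ, ContDiffOn ℝ ∞ ν (C \ coordHalfSubspace d j s) ∧
      ∀ x ∈ C \ coordHalfSubspace d j s, extDeriv ν x = θ x := by
  obtain ⟨a, ha, hst⟩ := exists_starConvex_diff_coordHalfSubspace hC hc h0 hj hs
  exact hst.exists_extDeriv_eq (hC.sdiff (isClosed_coordHalfSubspace j s)) hθ hd

/-- Primitives of a closed form on the two halves of the complement of `coordSubspace d (j + 1)`. -/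
theorem exists_primitives_diff_coordHalfSubspace {j : ℕ} (hj : j < d) {k : ℕ}
    {θ : 𝔼 → 𝔼 [⋀^Fin (k + 1)]→L[ℝ] ℝ} (hθ : ContDiffOn ℝ ∞ θ (C \ coordSubspace d (j + 1)))
    (hd : ∀ x ∈ C \ coordSubspace d (j + 1), extDeriv θ x = 0) :
    ∃ α β : 𝔼 → 𝔼 [⋀^Fin k]→L[ℝ] ℝ,
      ContDiffOn ℝ ∞ α (C \ coordHalfSubspace d j 1) ∧
      ContDiffOn ℝ ∞ β (C \ coordHalfSubspace d j (-1)) ∧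
      (∀ x ∈ C \ coordHalfSubspace d j 1, extDeriv α x = θ x) ∧
      (∀ x ∈ C \ coordHalfSubspace d j (-1), extDeriv β x = θ x) := by
  have hU : C \ coordSubspace d (j + 1) =
      (C \ coordHalfSubspace d j 1) ∪ (C \ coordHalfSubspace d j (-1)) := by
    rw [← coordHalfSubspace_inter, sdiff_inter]
  rw [hU] at hθ hd
  obtain ⟨α, h1, h2⟩ := exists_extDeriv_eq_diff_coordHalfSubspace hC hc h0 hj one_ne_zero
    (hθ.mono subset_union_left) fun x hx => hd x (Or.inl hx)
  obtain ⟨β, h3, h4⟩ := exists_extDeriv_eq_diff_coordHalfSubspace hC hc h0 hj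
    (neg_ne_zero.2 one_ne_zero) (hθ.mono subset_union_right) fun x hx => hd x (Or.inr hx)
  exact ⟨α, β, h1, h3, h2, h4⟩

omit hc h0 in
/-- The Mayer–Vietoris step: a form with primitives on the two star-shaped sets is exact on their
union, if the difference of the primitives is exact on the intersection. -/
theorem isExactOn_diff_coordSubspace_succ {j : ℕ} (hj : j < d) {k : ℕ}
    {θ : 𝔼 → 𝔼 [⋀^Fin (k + 1)]→L[ℝ] ℝ} {α β : 𝔼 → 𝔼 [⋀^Fin k]→L[ℝ] ℝ}
    (hα : ContDiffOn ℝ ∞ α (C \ coordHalfSubspace d j 1))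
    (hβ : ContDiffOn ℝ ∞ β (C \ coordHalfSubspace d j (-1)))
    (hαd : ∀ x ∈ C \ coordHalfSubspace d j 1, extDeriv α x = θ x)
    (hβd : ∀ x ∈ C \ coordHalfSubspace d j (-1), extDeriv β x = θ x)
    (h : IsExactOn (C \ coordSubspace d j) k fun x => α x - β x) :
    IsExactOn (C \ coordSubspace d (j + 1)) (k + 1) θ := by
  have hU : C \ coordSubspace d (j + 1) =
      (C \ coordHalfSubspace d j 1) ∪ (C \ coordHalfSubspace d j (-1)) := by
    rw [← coordHalfSubspace_inter, sdiff_inter]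
  have hI : C \ coordSubspace d j =
      (C \ coordHalfSubspace d j 1) ∩ (C \ coordHalfSubspace d j (-1)) := by
    rw [← coordHalfSubspace_union hj, ← sdiff_inter_sdiff]
  have hAB : ∀ s t x, x ∈ (C \ coordHalfSubspace d j s) \ (C \ coordHalfSubspace d j t) →
      x ∈ coordSubspace d j ∧ 0 < s * x ⟨j, hj⟩ := by
    rintro s t x ⟨⟨hx, hx'⟩, hx2⟩
    have h1 : x ∈ coordHalfSubspace d j t := by
      by_contra h; exact hx2 ⟨hx, h⟩
    refine ⟨h1.1, ?_⟩
    by_contra! h2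
    exact hx' ⟨h1.1, fun i hi => by obtain rfl : i = ⟨j, hj⟩ := Fin.ext hi; exact h2⟩
  rw [hI] at h
  obtain ⟨ν, h1, h2, h3⟩ := exists_extDeriv_eq_of_isExactOn_inter
    (hC.sdiff (isClosed_coordHalfSubspace j 1)) (hC.sdiff (isClosed_coordHalfSubspace j (-1)))
    (φ := coordCutoff d hj)
    ((contDiffOn_coordCutoff hj).mono (by rw [← hU]; exact fun x hx => hx.2))
    (fun x hx => (eventually_coordCutoff hj (hAB _ _ x hx).1).1 (by simpa using (hAB _ _ x hx).2))
    (fun x hx => (eventually_coordCutoff hj (hAB _ _ x hx).1).2 (by simpa using (hAB _ _ x hx).2))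
    hα hβ h
  refine ⟨ν, hU ▸ h1, fun x hx => ?_⟩
  rw [hU] at hx
  rcases hx with hx | hx
  · rw [h2 x hx, hαd x hx]
  · rw [h3 x hx, hβd x hx]

omit hc h0 in
theorem isExactOn_coordHalfSubspace_zero {j : ℕ} {a : 𝔼} {s : ℝ}
    (ha : StarConvex ℝ a (C \ coordHalfSubspace d j s))
    {θ : 𝔼 → 𝔼 [⋀^Fin 0]→L[ℝ] ℝ} (hθ : ContDiffOn ℝ ∞ θ (C \ coordHalfSubspace d j s))
    (hd : ∀ x ∈ C \ coordHalfSubspace d j s, extDeriv θ x = 0) :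
    ∀ x ∈ C \ coordHalfSubspace d j s, θ x = θ a := by
  intro x hx
  refine IsOpen.eqOn_of_extDeriv_eq_zero (hC.sdiff (isClosed_coordHalfSubspace j s))
    ?_ (hθ.differentiableOn (by simp)) hd hx (ha.mem ⟨x, hx⟩)
  exact (ha.isPathConnected (ha.mem ⟨x, hx⟩)).isConnected.isPreconnected

/-- The reduced de Rham cohomology of the complement of a subspace of codimension `j` vanishes
outside degree `j - 1`, in which it is at most one-dimensional. -/
theorem isExactOn_diff_coordSubspace (j : ℕ) (hj : j ≤ d) (k : ℕ) :
    (k + 1 ≠ j → ∀ θ : 𝔼 → 𝔼 [⋀^Fin k]→L[ℝ] ℝ, ContDiffOn ℝ ∞ θ (C \ coordSubspace d j) →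
      (∀ x ∈ C \ coordSubspace d j, extDeriv θ x = 0) → IsExactOn (C \ coordSubspace d j) k θ) ∧
    (∀ θ θ' : 𝔼 → 𝔼 [⋀^Fin k]→L[ℝ] ℝ, ContDiffOn ℝ ∞ θ (C \ coordSubspace d j) →
      ContDiffOn ℝ ∞ θ' (C \ coordSubspace d j) →
      (∀ x ∈ C \ coordSubspace d j, extDeriv θ x = 0) →
      (∀ x ∈ C \ coordSubspace d j, extDeriv θ' x = 0) →
      ∃ r r' : ℝ, (r, r') ≠ 0 ∧
        IsExactOn (C \ coordSubspace d j) k fun x => r • θ x + r' • θ' x) := by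
  induction j generalizing k with
  | zero =>
    have hE : C \ coordSubspace d 0 = ∅ := by
      ext x; simp [coordSubspace]
    rw [hE]
    have : ∀ θ : 𝔼 → 𝔼 [⋀^Fin k]→L[ℝ] ℝ, IsExactOn ∅ k θ := fun θ => by
      cases k with
      | zero => exact ⟨0, by simp⟩
      | succ k => exact ⟨0, by simp⟩
    exact ⟨fun _ θ _ _ => this θ, fun θ θ' _ _ _ _ => ⟨1, 0, by simp, this _⟩⟩
  | succ j ih =>
    have hj' : j < d := hj
    have hU : C \ coordSubspace d (j + 1) =
        (C \ coordHalfSubspace d j 1) ∪ (C \ coordHalfSubspace d j (-1)) := by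
      rw [← coordHalfSubspace_inter, sdiff_inter]
    have hI : C \ coordSubspace d j =
        (C \ coordHalfSubspace d j 1) ∩ (C \ coordHalfSubspace d j (-1)) := by
      rw [← coordHalfSubspace_union hj', ← sdiff_inter_sdiff]
    cases k with
    | zero =>
      obtain ⟨a, ha, hsa⟩ := exists_starConvex_diff_coordHalfSubspace hC hc h0 hj' one_ne_zero
      obtain ⟨b, hb, hsb⟩ := exists_starConvex_diff_coordHalfSubspace hC hc h0 hj'
        (neg_ne_zero.2 (one_ne_zero (α := ℝ)))
      -- the complement is the union of two star-shaped sets, on each of which closed functions are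
      -- constant
      have key : ∀ θ : 𝔼 → 𝔼 [⋀^Fin 0]→L[ℝ] ℝ, ContDiffOn ℝ ∞ θ (C \ coordSubspace d (j + 1)) →
          (∀ x ∈ C \ coordSubspace d (j + 1), extDeriv θ x = 0) →
          (∀ x ∈ C \ coordHalfSubspace d j 1, θ x = θ a) ∧
          (∀ x ∈ C \ coordHalfSubspace d j (-1), θ x = θ b) := by
        intro θ hθ hd
        rw [hU] at hθ hd
        exact ⟨isExactOn_coordHalfSubspace_zero hC hsa (hθ.mono subset_union_left)
            fun x hx => hd x (Or.inl hx),
          isExactOn_coordHalfSubspace_zero hC hsb (hθ.mono subset_union_right)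
            fun x hx => hd x (Or.inr hx)⟩
      constructor
      · intro hk θ hθ hd
        obtain ⟨h1, h2⟩ := key θ hθ hd
        -- the two halves meet, since `j > 0`
        obtain ⟨c, hc1, hc2⟩ : ((C \ coordHalfSubspace d j 1) ∩
            (C \ coordHalfSubspace d j (-1))).Nonempty := by
          rw [← hI]
          obtain ⟨j, rfl⟩ : ∃ i, j = i + 1 := ⟨j - 1, by omega⟩
          obtain ⟨a', ha', -⟩ := exists_starConvex_diff_coordHalfSubspace hC hc h0
            (j := j) (by omega) (one_ne_zero (α := ℝ))
          refine ⟨a', ha'.1, fun h => ha'.2 ?_⟩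
          rw [← coordHalfSubspace_inter] at h
          exact h.1
        refine ⟨θ a, fun x hx => ?_⟩
        rw [hU] at hx
        rcases hx with hx | hx
        · exact h1 x hx
        · rw [h2 x hx, ← h2 c hc2, h1 c hc1]
      · intro θ θ' hθ hθ' hd hd'
        obtain ⟨h1, h2⟩ := key θ hθ hd
        obtain ⟨h1', h2'⟩ := key θ' hθ' hd'
        -- a form of degree zero is determined by its value on the empty family of vectors
        have hext : ∀ α β : 𝔼 [⋀^Fin 0]→L[ℝ] ℝ, α 0 = β 0 → α = β := fun α β h => by
          ext v; rw [Subsingleton.elim v 0, h]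
        obtain ⟨r, r', hr, hrr⟩ : ∃ r r' : ℝ, (r, r') ≠ 0 ∧
            r * (θ a 0 - θ b 0) + r' * (θ' a 0 - θ' b 0) = 0 := by
          by_cases h : θ a 0 - θ b 0 = 0
          · exact ⟨1, 0, by simp, by rw [h]; ring⟩
          · refine ⟨-(θ' a 0 - θ' b 0), θ a 0 - θ b 0, ?_, by ring⟩
            simp only [ne_eq, Prod.mk_eq_zero, not_and]
            exact fun _ => h
        refine ⟨r, r', hr, r • θ a + r' • θ' a, fun x hx => ?_⟩
        rw [hU] at hx
        beta_reduce
        rcases hx with hx | hx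
        · rw [h1 x hx, h1' x hx]
        · rw [h2 x hx, h2' x hx]
          refine hext _ _ ?_
          simp only [ContinuousAlternatingMap.add_apply, ContinuousAlternatingMap.smul_apply,
            smul_eq_mul]
          linarith
    | succ k =>
      have hoA := hC.sdiff (isClosed_coordHalfSubspace (d := d) j 1)
      have hoB := hC.sdiff (isClosed_coordHalfSubspace (d := d) j (-1))
      -- the connecting map sends `θ` to the difference of its primitives on the two sets
      have hclosed : ∀ {θ : 𝔼 → 𝔼 [⋀^Fin (k + 1)]→L[ℝ] ℝ} {α β : 𝔼 → 𝔼 [⋀^Fin k]→L[ℝ] ℝ}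
          (_ : ContDiffOn ℝ ∞ α (C \ coordHalfSubspace d j 1))
          (_ : ContDiffOn ℝ ∞ β (C \ coordHalfSubspace d j (-1)))
          (_ : ∀ x ∈ C \ coordHalfSubspace d j 1, extDeriv α x = θ x)
          (_ : ∀ x ∈ C \ coordHalfSubspace d j (-1), extDeriv β x = θ x),
          ContDiffOn ℝ ∞ (fun x => α x - β x) (C \ coordSubspace d j) ∧
          ∀ x ∈ C \ coordSubspace d j, extDeriv (fun x => α x - β x) x = 0 := by
        intro θ α β hα hβ hαd hβd
        rw [hI]
        refine ⟨(hα.mono inter_subset_left).sub (hβ.mono inter_subset_right), fun x hx => ?_⟩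
        rw [extDeriv_sub_apply (hα.differentiableAt_of_isOpen hoA hx.1)
          (hβ.differentiableAt_of_isOpen hoB hx.2), hαd x hx.1, hβd x hx.2, sub_self]
      constructor
      · intro hk θ hθ hd
        obtain ⟨α, β, hα, hβ, hαd, hβd⟩ :=
          exists_primitives_diff_coordHalfSubspace hC hc h0 hj' hθ hd
        refine isExactOn_diff_coordSubspace_succ hC hj' hα hβ hαd hβd ?_
        obtain ⟨h1, h2⟩ := hclosed hα hβ hαd hβd
        exact (ih hj'.le k).1 (by omega) _ h1 h2
      · intro θ θ' hθ hθ' hd hd'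
        obtain ⟨α, β, hα, hβ, hαd, hβd⟩ :=
          exists_primitives_diff_coordHalfSubspace hC hc h0 hj' hθ hd
        obtain ⟨α', β', hα', hβ', hαd', hβd'⟩ :=
          exists_primitives_diff_coordHalfSubspace hC hc h0 hj' hθ' hd'
        obtain ⟨h1, h2⟩ := hclosed hα hβ hαd hβd
        obtain ⟨h1', h2'⟩ := hclosed hα' hβ' hαd' hβd'
        obtain ⟨r, r', hr, hex⟩ := (ih hj'.le k).2 _ _ h1 h1' h2 h2'
        have hcomb : ∀ {U : Set 𝔼} (_ : IsOpen U) {ν ν' : 𝔼 → 𝔼 [⋀^Fin k]→L[ℝ] ℝ}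
            (_ : ContDiffOn ℝ ∞ ν U) (_ : ContDiffOn ℝ ∞ ν' U), ∀ x ∈ U,
            extDeriv (fun x => r • ν x + r' • ν' x) x = r • extDeriv ν x + r' • extDeriv ν' x := by
          intro U hU ν ν' hν hν' x hx
          refine (extDeriv_add_apply ((hν.differentiableAt_of_isOpen hU hx).const_smul r)
            ((hν'.differentiableAt_of_isOpen hU hx).const_smul r')).trans ?_
          exact congrArg₂ _ (extDeriv_smul r ν) (extDeriv_smul r' ν')
        refine ⟨r, r', hr, isExactOn_diff_coordSubspace_succ hC hj'
          (α := fun x => r • α x + r' • α' x) (β := fun x => r • β x + r' • β' x)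
          ((hα.const_smul r).add (hα'.const_smul r')) ((hβ.const_smul r).add (hβ'.const_smul r'))
          (fun x hx => ?_) (fun x hx => ?_) ?_⟩
        · rw [hcomb hoA hα hα' x hx, hαd x hx, hαd' x hx]
        · rw [hcomb hoB hβ hβ' x hx, hβd x hx, hβd' x hx]
        · convert hex using 2 with x
          simp only [smul_sub]
          abel

end Subspace

/-! ### Stokes' theorem -/

namespace Orbifold

variable {d : ℕ} {X : Type*} [TopologicalSpace X]

/-- A real function on an orbifold is smooth if it is smooth in all charts. -/
def IsSmooth (O : Orbifold d X) (f : X → ℝ) : Prop :=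
  ∀ c : O.atlas, ContDiffOn ℝ ∞ (fun x => f (c.1.toFun x)) c.1.dom

/-- The product of a smooth function and a form. -/
def smulForm (O : Orbifold d X) {f : X → ℝ} (hf : O.IsSmooth f) {k : ℕ} (θ : O.Form k) :
    O.Form k :=
  ⟨fun c x => f (c.1.toFun x) • θ.1 c x, by
    refine ⟨fun c => (hf c).smul (θ.2.1 c), fun c x hx => ?_, fun c c' h hh x hx => ?_⟩
    · beta_reduce
      rw [θ.2.2.1 c x hx, smul_zero]
    · beta_reduce
      rw [θ.2.2.2 c c' h hh x hx, ← hh.map_eq x hx]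
      rfl⟩

theorem form_sum_apply {O : Orbifold d X} {k : ℕ} {ι : Type*} (s : Finset ι) (θ : ι → O.Form k)
    (c : O.atlas) (x : EuclideanSpace ℝ (Fin d)) : (∑ i ∈ s, θ i).1 c x = ∑ i ∈ s, (θ i).1 c x := by
  classical
  induction s using Finset.induction_on with
  | empty => rfl
  | insert i s hi ih =>
    rw [Finset.sum_insert hi, Finset.sum_insert hi, ← ih]
    rfl

end Orbifold

section Euclidean

variable {k : ℕ}

local notation "𝔼" => EuclideanSpace ℝ (Fin (k + 1))

/-- The value of a top degree form on the standard basis. -/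
def topCoeff {k : ℕ} (θ : EuclideanSpace ℝ (Fin (k + 1)) [⋀^Fin (k + 1)]→L[ℝ] ℝ) : ℝ :=
  θ fun i => EuclideanSpace.single i 1

theorem topCoeff_compContinuousLinearMap (θ : 𝔼 [⋀^Fin (k + 1)]→L[ℝ] ℝ) (f : 𝔼 →L[ℝ] 𝔼) :
    topCoeff (θ.compContinuousLinearMap f) = f.det * topCoeff θ := by
  set b := (EuclideanSpace.basisFun (Fin (k + 1)) ℝ).toBasis with hb
  have hbi : (fun i => EuclideanSpace.single i (1 : ℝ)) = b := by ext1 i; simp [hb]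
  have h1 := θ.toAlternatingMap.eq_smul_basis_det b
  have h2 : ∀ v, θ v = θ b * b.det v := fun v => congrArg (fun g => g v) h1
  rw [topCoeff, topCoeff, hbi, ContinuousAlternatingMap.compContinuousLinearMap_apply, h2,
    ← ContinuousLinearMap.coe_coe, Module.Basis.det_comp, b.det_self, mul_one, mul_comm]

theorem topCoeff_smul (r : ℝ) (θ : 𝔼 [⋀^Fin (k + 1)]→L[ℝ] ℝ) :
    topCoeff (r • θ) = r * topCoeff θ := rfl

theorem topCoeff_injective {θ θ' : 𝔼 [⋀^Fin (k + 1)]→L[ℝ] ℝ} (h : topCoeff θ = topCoeff θ') :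
    θ = θ' := by
  set b := (EuclideanSpace.basisFun (Fin (k + 1)) ℝ).toBasis with hb
  have hbi : (fun i => EuclideanSpace.single i (1 : ℝ)) = b := by ext1 i; simp [hb]
  rw [topCoeff, topCoeff, hbi] at h
  refine ContinuousAlternatingMap.toAlternatingMap_injective ?_
  rw [θ.toAlternatingMap.eq_smul_basis_det b, θ'.toAlternatingMap.eq_smul_basis_det b]
  exact congrArg (· • b.det) h

theorem topCoeff_ne_zero {θ : 𝔼 [⋀^Fin (k + 1)]→L[ℝ] ℝ} (h : θ ≠ 0) : topCoeff θ ≠ 0 :=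
  fun h' => h (topCoeff_injective (h'.trans rfl))

theorem ContDiffOn.topCoeff {V : Type*} [NormedAddCommGroup V] [NormedSpace ℝ V]
    {θ : V → 𝔼 [⋀^Fin (k + 1)]→L[ℝ] ℝ} {U : Set V} (h : ContDiffOn ℝ ∞ θ U) :
    ContDiffOn ℝ ∞ (fun x => _root_.topCoeff (θ x)) U :=
  (ContinuousAlternatingMap.apply ℝ 𝔼 ℝ fun i => EuclideanSpace.single i (1 : ℝ)).contDiff.comp_contDiffOn
    h

open MeasureTheory

theorem integral_fderiv_apply_eq_zero {V : Type*} [NormedAddCommGroup V] [NormedSpace ℝ V]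
    [FiniteDimensional ℝ V] [MeasurableSpace V] [BorelSpace V] {μ : Measure V}
    [μ.IsAddHaarMeasure] {f : V → ℝ} (hf : ContDiff ℝ ∞ f) (hc : HasCompactSupport f) (v : V) :
    ∫ x, fderiv ℝ f x v ∂μ = 0 := by
  have h1 : Continuous fun x => fderiv ℝ f x v :=
    (hf.continuous_fderiv (by simp)).clm_apply continuous_const
  have h2 : HasCompactSupport fun x => fderiv ℝ f x v := hc.fderiv_apply (𝕜 := ℝ) v
  have h3 := integral_mul_fderiv_eq_neg_fderiv_mul_of_integrable (μ := μ) (𝕜 := ℝ)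
    (f := fun _ : V => (1 : ℝ)) (g := f) (v := v) (by simp)
    (by simpa using h1.integrable_of_hasCompactSupport h2)
    (by simpa using hf.continuous.integrable_of_hasCompactSupport hc)
    (fun x _ => differentiableAt_const _) (fun x _ => hf.differentiable (by simp) x)
  simpa using h3

/-- Stokes' theorem for compactly supported forms on Euclidean space. -/
theorem integral_topCoeff_extDeriv {θ : 𝔼 → 𝔼 [⋀^Fin k]→L[ℝ] ℝ} (hθ : ContDiff ℝ ∞ θ)
    (hc : HasCompactSupport θ) : ∫ x, topCoeff (extDeriv θ x) = 0 := by
  set b : Fin (k + 1) → 𝔼 := fun i => EuclideanSpace.single i (1 : ℝ)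
  have hsm : ∀ v : Fin k → 𝔼, ContDiff ℝ ∞ fun x => θ x v := fun v =>
    (ContinuousAlternatingMap.apply ℝ 𝔼 ℝ v).contDiff.comp hθ
  have hcs : ∀ v : Fin k → 𝔼, HasCompactSupport fun x => θ x v := fun v =>
    hc.comp_left (g := fun α : 𝔼 [⋀^Fin k]→L[ℝ] ℝ => α v) rfl
  have h1 : ∀ x, topCoeff (extDeriv θ x) =
      ∑ i : Fin (k + 1), (-1 : ℝ) ^ i.val * fderiv ℝ (fun y => θ y (i.removeNth b)) x (b i) :=
    fun x => (extDeriv_apply (hθ.differentiable (by simp) x) b).trans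
      (Finset.sum_congr rfl fun i _ => by rw [zsmul_eq_mul]; push_cast; rfl)
  simp_rw [h1]
  rw [integral_finsetSum]
  · refine Finset.sum_eq_zero fun i _ => ?_
    rw [integral_const_mul, integral_fderiv_apply_eq_zero (hsm _) (hcs _), mul_zero]
  · intro i _
    refine Integrable.const_mul ?_ _
    exact (((hsm _).continuous_fderiv (by simp)).clm_apply
      continuous_const).integrable_of_hasCompactSupport ((hcs _).fderiv_apply (𝕜 := ℝ) _)

end Euclidean

section Manifold

open MeasureTheory

variable {N : Type*} [TopologicalSpace N]

theorem isLocalLift_ofChart {d : ℕ} [ChartedSpace (EuclideanSpace ℝ (Fin d)) N]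
    [IsManifold (𝓡 d) ∞ N] {e e' : OpenPartialHomeomorph N (EuclideanSpace ℝ (Fin d))}
    (he : e ∈ IsManifold.maximalAtlas (𝓡 d) ∞ N) (he' : e' ∈ IsManifold.maximalAtlas (𝓡 d) ∞ N) :
    IsLocalLift id (OrbifoldChart.ofChart e) (OrbifoldChart.ofChart e') (e.symm ≫ₕ e') := by
  have hc : e.symm ≫ₕ e' ∈ contDiffGroupoid ∞ (𝓡 d) :=
    StructureGroupoid.compatible_of_mem_maximalAtlas he he'
  rw [contDiffGroupoid, mem_groupoid_of_pregroupoid] at hc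
  refine ⟨?_, ?_, ?_, ?_, ?_⟩
  · rw [OpenPartialHomeomorph.trans_source]
    exact inter_subset_left
  · rw [OpenPartialHomeomorph.trans_target]
    exact inter_subset_left
  · simpa [contDiffPregroupoid] using hc.1
  · simpa [contDiffPregroupoid] using hc.2
  · intro z hz
    rw [OpenPartialHomeomorph.trans_source] at hz
    exact (e'.left_inv hz.2).symm

theorem ContMDiff.isSmooth_ofManifold {d : ℕ} [ChartedSpace (EuclideanSpace ℝ (Fin d)) N]
    [IsManifold (𝓡 d) ∞ N] {f : N → ℝ} (hf : ContMDiff (𝓡 d) 𝓘(ℝ, ℝ) ∞ f) :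
    (Orbifold.ofManifold d N).IsSmooth f := by
  rintro ⟨_, e, he, rfl⟩
  rw [← contMDiffOn_iff_contDiffOn]
  exact hf.comp_contMDiffOn (contMDiffOn_symm_of_mem_maximalAtlas he)

variable {k : ℕ} [ChartedSpace (EuclideanSpace ℝ (Fin (k + 1))) N] [IsManifold (𝓡 (k + 1)) ∞ N]

local notation "𝔒" => Orbifold.ofManifold (k + 1) N

local notation "𝓜" => IsManifold.maximalAtlas (𝓡 (k + 1)) ∞ N

/-- The density, in the chart `e`, of a top degree form `θ`, relative to the orientation given by
the volume form `vol`. -/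
def chartDensity (vol θ : (Orbifold.ofManifold (k + 1) N).Form (k + 1))
    (e : OpenPartialHomeomorph N (EuclideanSpace ℝ (Fin (k + 1))))
    (he : e ∈ IsManifold.maximalAtlas (𝓡 (k + 1)) ∞ N) (x : EuclideanSpace ℝ (Fin (k + 1))) : ℝ :=
  SignType.sign (topCoeff (Orbifold.chartForm vol e he x)) *
    topCoeff (Orbifold.chartForm θ e he x)

theorem chartDensity_eq_zero (vol θ : (Orbifold.ofManifold (k + 1) N).Form (k + 1))
    {e : OpenPartialHomeomorph N (EuclideanSpace ℝ (Fin (k + 1)))} (he : e ∈ 𝓜)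
    {x : EuclideanSpace ℝ (Fin (k + 1))} (hx : x ∉ e.target) : chartDensity vol θ e he x = 0 := by
  have h : Orbifold.chartForm θ e he x = 0 := θ.2.2.1 ⟨OrbifoldChart.ofChart e, e, he, rfl⟩ x hx
  rw [chartDensity, h]
  exact mul_zero _

theorem chartDensity_trans (vol θ : (Orbifold.ofManifold (k + 1) N).Form (k + 1))
    {e e' : OpenPartialHomeomorph N (EuclideanSpace ℝ (Fin (k + 1)))} (he : e ∈ 𝓜) (he' : e' ∈ 𝓜)
    {x : EuclideanSpace ℝ (Fin (k + 1))} (hx : x ∈ (e.symm ≫ₕ e').source) :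
    chartDensity vol θ e he x =
      |(fderiv ℝ (e.symm ≫ₕ e') x).det| * chartDensity vol θ e' he' ((e.symm ≫ₕ e') x) := by
  have h : ∀ η : (Orbifold.ofManifold (k + 1) N).Form (k + 1),
      topCoeff (Orbifold.chartForm η e he x) = (fderiv ℝ (e.symm ≫ₕ e') x).det *
        topCoeff (Orbifold.chartForm η e' he' ((e.symm ≫ₕ e') x)) := fun η => by
    rw [← topCoeff_compContinuousLinearMap]
    exact congrArg topCoeff (η.2.2.2 ⟨OrbifoldChart.ofChart e, e, he, rfl⟩
      ⟨OrbifoldChart.ofChart e', e', he', rfl⟩ _ (isLocalLift_ofChart he he') x hx)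
  rw [chartDensity, chartDensity, h, h, sign_mul, SignType.coe_mul, ← sign_mul_self
    ((fderiv ℝ (e.symm ≫ₕ e') x).det)]
  ring

/-- The change of variables formula: the integral of a function times a density does not depend on
the chart, if the function vanishes outside both chart domains. -/
theorem integral_chartDensity_eq (vol θ : (Orbifold.ofManifold (k + 1) N).Form (k + 1))
    {e e' : OpenPartialHomeomorph N (EuclideanSpace ℝ (Fin (k + 1)))} (he : e ∈ 𝓜) (he' : e' ∈ 𝓜)
    {f : N → ℝ} (hf : ∀ y, y ∉ e.source ∩ e'.source → f y = 0) :
    ∫ x, f (e.symm x) * chartDensity vol θ e he x =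
      ∫ x, f (e'.symm x) * chartDensity vol θ e' he' x := by
  set T := e.symm ≫ₕ e' with hT
  have hl := isLocalLift_ofChart he he'
  have hs : T.source = e.target ∩ e.symm ⁻¹' e'.source := OpenPartialHomeomorph.trans_source _ _
  have ht : T.target = e'.target ∩ e'.symm ⁻¹' e.source := OpenPartialHomeomorph.trans_target _ _
  have key : ∫ x in T.target, f (e'.symm x) * chartDensity vol θ e' he' x =
      ∫ x in T.source, f (e.symm x) * chartDensity vol θ e he x := by
    rw [← T.image_source_eq_target,
      integral_image_eq_integral_abs_det_fderiv_smul volume T.open_source.measurableSet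
        (f' := fun x => fderiv ℝ T x) (fun x hx => ((hl.contDiffOn.contDiffAt
          (T.open_source.mem_nhds hx)).differentiableAt
            (by simp)).hasFDerivAt.hasFDerivWithinAt) T.injOn]
    refine setIntegral_congr_fun T.open_source.measurableSet fun x hx => ?_
    have h1 : e'.symm (T x) = e.symm x := (hl.map_eq x hx).symm
    rw [h1, chartDensity_trans vol θ he he' hx, smul_eq_mul]
    ring
  rw [← setIntegral_eq_integral_of_forall_compl_eq_zero (s := T.source),
    ← setIntegral_eq_integral_of_forall_compl_eq_zero (s := T.target)
      (f := fun x => f (e'.symm x) * chartDensity vol θ e' he' x), key]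
  · intro x hx
    by_cases hx' : x ∈ e'.target
    · rw [hf, zero_mul]
      rintro ⟨h, -⟩
      exact hx (ht ▸ ⟨hx', h⟩)
    · rw [chartDensity_eq_zero vol θ he' hx', mul_zero]
  · intro x hx
    by_cases hx' : x ∈ e.target
    · rw [hf, zero_mul]
      rintro ⟨-, h⟩
      exact hx (hs ▸ ⟨hx', h⟩)
    · rw [chartDensity_eq_zero vol θ he hx', mul_zero]

theorem contDiffOn_chartForm {d : ℕ} [ChartedSpace (EuclideanSpace ℝ (Fin d)) N]
    [IsManifold (𝓡 d) ∞ N] {l : ℕ} (θ : (Orbifold.ofManifold d N).Form l)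
    {e : OpenPartialHomeomorph N (EuclideanSpace ℝ (Fin d))}
    (he : e ∈ IsManifold.maximalAtlas (𝓡 d) ∞ N) :
    ContDiffOn ℝ ∞ (Orbifold.chartForm θ e he) e.target :=
  θ.2.1 ⟨OrbifoldChart.ofChart e, e, he, rfl⟩

/-- The orientation sign of a nowhere vanishing form is locally constant. -/
theorem eventually_sign_topCoeff_eq {vol : (Orbifold.ofManifold (k + 1) N).Form (k + 1)}
    (hvol : ∀ c, ∀ x ∈ c.1.dom, vol.1 c x ≠ 0)
    {e : OpenPartialHomeomorph N (EuclideanSpace ℝ (Fin (k + 1)))} (he : e ∈ 𝓜)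
    {x : EuclideanSpace ℝ (Fin (k + 1))} (hx : x ∈ e.target) :
    ∀ᶠ y in 𝓝 x, SignType.sign (topCoeff (Orbifold.chartForm vol e he y)) =
      SignType.sign (topCoeff (Orbifold.chartForm vol e he x)) := by
  have h1 : ContinuousAt (fun y => topCoeff (Orbifold.chartForm vol e he y)) x :=
    ((contDiffOn_chartForm vol he).topCoeff.continuousOn).continuousAt (e.open_target.mem_nhds hx)
  rcases lt_or_gt_of_ne (topCoeff_ne_zero
    (hvol ⟨OrbifoldChart.ofChart e, e, he, rfl⟩ x hx)) with h | h
  · filter_upwards [h1.eventually (gt_mem_nhds h)] with y hy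
    rw [sign_neg hy]
    exact (sign_neg h).symm
  · filter_upwards [h1.eventually (lt_mem_nhds h)] with y hy
    rw [sign_pos hy]
    exact (sign_pos h).symm

theorem continuousOn_chartDensity {vol : (Orbifold.ofManifold (k + 1) N).Form (k + 1)}
    (hvol : ∀ c, ∀ x ∈ c.1.dom, vol.1 c x ≠ 0)
    (θ : (Orbifold.ofManifold (k + 1) N).Form (k + 1))
    {e : OpenPartialHomeomorph N (EuclideanSpace ℝ (Fin (k + 1)))} (he : e ∈ 𝓜) :
    ContinuousOn (chartDensity vol θ e he) e.target := by
  intro x hx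
  refine ContinuousAt.continuousWithinAt ?_
  have h1 : ContinuousAt (fun y => topCoeff (Orbifold.chartForm θ e he y)) x :=
    ((contDiffOn_chartForm θ he).topCoeff.continuousOn).continuousAt (e.open_target.mem_nhds hx)
  refine (h1.const_mul
    (SignType.sign (topCoeff (Orbifold.chartForm vol e he x)) : ℝ)).congr_of_eventuallyEq ?_
  filter_upwards [eventually_sign_topCoeff_eq hvol he hx] with y hy
  rw [chartDensity, hy]

/-- A function which is continuous on the target of a chart and vanishes outside the image of a
compact subset of its source extends by zero. -/
theorem tsupport_subset_of_chart [T2Space N] {d : ℕ} {H : Type*} [Zero H]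
    {e : OpenPartialHomeomorph N (EuclideanSpace ℝ (Fin d))} {K : Set N} (hK : IsCompact K)
    (hKe : K ⊆ e.source) {F : EuclideanSpace ℝ (Fin d) → H}
    (hF : ∀ x, ¬ (x ∈ e.target ∧ e.symm x ∈ K) → F x = 0) :
    tsupport F ⊆ e.target ∧ HasCompactSupport F := by
  have h1 : IsCompact (e '' K) := hK.image_of_continuousOn (e.continuousOn.mono hKe)
  have h2 : Function.support F ⊆ e '' K := by
    intro x hx
    by_contra h
    refine hx (hF x fun hx' => h ⟨_, hx'.2, e.right_inv hx'.1⟩)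
  have h3 : tsupport F ⊆ e '' K := closure_minimal h2 h1.isClosed
  refine ⟨h3.trans ?_, h1.of_isClosed_subset (isClosed_tsupport F) h3⟩
  rintro _ ⟨y, hy, rfl⟩
  exact e.map_source (hKe hy)

/-- Stokes' theorem for a form with compact support in the domain of a chart. The orientation sign
is locally constant, so it can be taken inside the differential. -/
theorem integral_chartDensity_extD [T2Space N]
    {vol : (Orbifold.ofManifold (k + 1) N).Form (k + 1)}
    (hvol : ∀ c, ∀ x ∈ c.1.dom, vol.1 c x ≠ 0) (Φ : (Orbifold.ofManifold (k + 1) N).Form k)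
    {e : OpenPartialHomeomorph N (EuclideanSpace ℝ (Fin (k + 1)))} (he : e ∈ 𝓜) {K : Set N}
    (hK : IsCompact K) (hKe : K ⊆ e.source)
    (hΦ : ∀ c, ∀ x ∈ c.1.dom, c.1.toFun x ∉ K → Φ.1 c x = 0) :
    ∫ x, chartDensity vol ((Orbifold.ofManifold (k + 1) N).extD k Φ) e he x = 0 := by
  set c : (Orbifold.ofManifold (k + 1) N).atlas := ⟨OrbifoldChart.ofChart e, e, he, rfl⟩ with hc
  set F : EuclideanSpace ℝ (Fin (k + 1)) → _ := fun x =>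
    (SignType.sign (topCoeff (Orbifold.chartForm vol e he x)) : ℝ) • Φ.1 c x with hFdef
  have hF0 : ∀ x, ¬ (x ∈ e.target ∧ e.symm x ∈ K) → F x = 0 := by
    intro x hx
    have : Φ.1 c x = 0 := by
      by_cases hx' : x ∈ e.target
      · exact hΦ c x hx' fun h => hx ⟨hx', h⟩
      · exact Φ.2.2.1 c x hx'
    rw [hFdef]
    beta_reduce
    rw [this, smul_zero]
  have hev : ∀ x ∈ e.target, F =ᶠ[𝓝 x]
      (SignType.sign (topCoeff (Orbifold.chartForm vol e he x)) : ℝ) • Φ.1 c := by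
    intro x hx
    filter_upwards [eventually_sign_topCoeff_eq hvol he hx] with y hy
    rw [hFdef]
    beta_reduce
    rw [hy]
    rfl
  obtain ⟨h1, h2⟩ := tsupport_subset_of_chart hK hKe hF0
  have hsm : ContDiff ℝ ∞ F := by
    rw [contDiff_iff_contDiffAt]
    intro x
    by_cases hx : x ∈ tsupport F
    · exact ContDiffAt.congr_of_eventuallyEq
        (((Φ.2.1 c).contDiffAt (e.open_target.mem_nhds (h1 hx))).const_smul
          (SignType.sign (topCoeff (Orbifold.chartForm vol e he x)) : ℝ)) (hev x (h1 hx))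
    · exact (contDiffAt_const (c := 0)).congr_of_eventuallyEq
        (notMem_tsupport_iff_eventuallyEq.1 hx)
  rw [← integral_topCoeff_extDeriv hsm h2]
  refine integral_congr_ae (Filter.Eventually.of_forall fun x => ?_)
  beta_reduce
  by_cases hx : x ∈ e.target
  · rw [(hev x hx).extDeriv_eq, extDeriv_smul, topCoeff_smul, chartDensity]
    congr 2
    exact (Orbifold.ofManifold (k + 1) N).extD_apply Φ (c := c) hx
  · rw [chartDensity_eq_zero _ _ he hx]
    have h3 : F =ᶠ[𝓝 x] 0 := notMem_tsupport_iff_eventuallyEq.1 fun h => hx (h1 h)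
    rw [h3.extDeriv_eq]
    rw [show extDeriv (0 : EuclideanSpace ℝ (Fin (k + 1)) →
      EuclideanSpace ℝ (Fin (k + 1)) [⋀^Fin k]→L[ℝ] ℝ) x = 0 from by
        rw [extDeriv, fderiv_zero]
        exact map_zero (ContinuousAlternatingMap.alternatizeUncurryFinCLM ℝ
          (EuclideanSpace ℝ (Fin (k + 1))) ℝ)]
    rfl

/-- A finite smooth partition of unity on a compact set, subordinate to charts. It is built from
bump functions `fᵢ` which are `1` on a cover of the compact set, as `fᵢ * ∏_{j < i} (1 - fⱼ)`; the
manifold need not be paracompact. -/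
theorem exists_partition_of_isCompact [T2Space N] {K : Set N} (hK : IsCompact K) :
    ∃ (m : ℕ) (p : Fin m → N) (φ : Fin m → N → ℝ) (L : Fin m → Set N),
      (∀ i, (Orbifold.ofManifold (k + 1) N).IsSmooth (φ i)) ∧
      (∀ i, IsCompact (L i) ∧ L i ⊆ (chartAt (EuclideanSpace ℝ (Fin (k + 1))) (p i)).source ∧
        ∀ y ∉ L i, φ i y = 0) ∧
      (∀ i y, 0 ≤ φ i y) ∧ (∀ i, Continuous (φ i)) ∧ ∀ y ∈ K, ∑ i, φ i y = 1 := by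
  set f : ∀ p : N, SmoothBumpFunction (𝓡 (k + 1)) p := fun p => Classical.arbitrary _ with hf
  obtain ⟨t, -, ht⟩ := hK.elim_nhds_subcover (fun p => {y | f p y = 1})
    fun p _ => (f p).eventuallyEq_one
  set p : Fin t.card → N := fun i => (t.equivFin.symm i : N) with hp
  set φ : Fin t.card → N → ℝ := fun i y =>
    f (p i) y * ∏ j ∈ Finset.univ.filter (· < i), (1 - f (p j) y) with hφ
  have hsm : ∀ i, ContMDiff (𝓡 (k + 1)) 𝓘(ℝ, ℝ) ∞ (φ i) := fun i =>
    (f (p i)).contMDiff.mul (contMDiff_finsetProd fun j _ =>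
      contMDiff_const.sub (f (p j)).contMDiff)
  refine ⟨t.card, p, φ, fun i => tsupport (f (p i)), fun i => (hsm i).isSmooth_ofManifold,
    fun i => ⟨(f (p i)).hasCompactSupport, (f (p i)).tsupport_subset_chartAt_source,
      fun y hy => ?_⟩,
    fun i y => mul_nonneg (f (p i)).nonneg (Finset.prod_nonneg fun j _ =>
      sub_nonneg.2 (f (p j)).le_one), fun i => (hsm i).continuous, fun y hy => ?_⟩
  · change f (p i) y * _ = 0
    rw [image_eq_zero_of_notMem_tsupport hy, zero_mul]
  · have h1 := Finset.prod_one_sub_ordered Finset.univ fun i => f (p i) y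
    obtain ⟨q, hq, hqy⟩ := mem_iUnion₂.1 (ht hy)
    have h2 : ∏ i, (1 - f (p i) y) = 0 := by
      refine Finset.prod_eq_zero (Finset.mem_univ (t.equivFin ⟨q, hq⟩)) ?_
      have : p (t.equivFin ⟨q, hq⟩) = q := by simp [hp]
      rw [this, sub_eq_zero]
      exact hqy.symm
    rw [h2] at h1
    change ∑ i, f (p i) y * ∏ j ∈ Finset.univ.filter (· < i), (1 - f (p j) y) = 1
    linarith

/-- Stokes' theorem on a manifold, in the form of a maximum principle: the differential of a
compactly supported form of degree one less than the dimension cannot be nonnegative with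
respect to a volume form without vanishing. -/
theorem extD_eq_zero_of_nonneg_aux [T2Space N]
    {vol : (Orbifold.ofManifold (k + 1) N).Form (k + 1)}
    (hvol : ∀ c, ∀ x ∈ c.1.dom, vol.1 c x ≠ 0) (Φ : (Orbifold.ofManifold (k + 1) N).Form k)
    {K : Set N} (hK : IsCompact K) (hΦ : ∀ c, ∀ x ∈ c.1.dom, c.1.toFun x ∉ K → Φ.1 c x = 0)
    (hpos : ∀ c, ∀ x ∈ c.1.dom, ∃ r : ℝ, 0 ≤ r ∧
      ((Orbifold.ofManifold (k + 1) N).extD k Φ).1 c x = r • vol.1 c x) :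
    (Orbifold.ofManifold (k + 1) N).extD k Φ = 0 := by
  obtain ⟨m, p, φ, L, hsm, hL, hφ0, hφc, hφ1⟩ := exists_partition_of_isCompact (k := k) hK
  set e := fun i => chartAt (EuclideanSpace ℝ (Fin (k + 1))) (p i) with he'
  have he : ∀ i, e i ∈ 𝓜 := fun i => IsManifold.chart_mem_maximalAtlas (p i)
  set Ψ : Fin m → (𝔒).Form k := fun j => (𝔒).smulForm (hsm j) Φ with hΨ
  have hsum : Φ = ∑ j, Ψ j := by
    refine Orbifold.Form.ext fun c x => ?_
    rw [Orbifold.form_sum_apply]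
    change _ = ∑ j, φ j (c.1.toFun x) • Φ.1 c x
    by_cases hx : x ∈ c.1.dom ∧ c.1.toFun x ∈ K
    · rw [← Finset.sum_smul, hφ1 _ hx.2, one_smul]
    · have : Φ.1 c x = 0 := by
        by_cases hx' : x ∈ c.1.dom
        · exact hΦ c x hx' fun h => hx ⟨hx', h⟩
        · exact Φ.2.2.1 c x hx'
      simp [this]
  have hdsum : (𝔒).extD k Φ = ∑ j, (𝔒).extD k (Ψ j) :=
    (congrArg ((𝔒).extD k) hsum).trans (map_sum _ _ _)
  have hdens : ∀ i x, chartDensity vol ((𝔒).extD k Φ) (e i) (he i) x =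
      ∑ j, chartDensity vol ((𝔒).extD k (Ψ j)) (e i) (he i) x := by
    intro i x
    simp only [chartDensity, ← Finset.mul_sum]
    congr 1
    rw [hdsum]
    simp only [topCoeff, Orbifold.chartForm, Orbifold.form_sum_apply]
    exact ContinuousAlternatingMap.sum_apply _ _
  -- the differential of a form vanishing outside a closed set vanishes outside that set
  have hsupp : ∀ (Θ : (𝔒).Form k) (S : Set N), IsClosed S →
      (∀ c, ∀ x ∈ c.1.dom, c.1.toFun x ∉ S → Θ.1 c x = 0) →
      ∀ i x, (e i).symm x ∉ S → chartDensity vol ((𝔒).extD k Θ) (e i) (he i) x = 0 := by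
    intro Θ S hS hΘ i x hx
    by_cases hxe : x ∈ (e i).target
    · set c : (𝔒).atlas := ⟨OrbifoldChart.ofChart (e i), e i, he i, rfl⟩ with hc
      have h1 : Θ.1 c =ᶠ[𝓝 x] 0 := by
        have h2 : ContinuousAt (e i).symm x := (e i).continuousAt_symm hxe
        filter_upwards [h2.eventually (hS.isOpen_compl.mem_nhds hx),
          (e i).open_target.mem_nhds hxe] with y hy hy'
        exact hΘ c y hy' hy
      have h3 : Orbifold.chartForm ((𝔒).extD k Θ) (e i) (he i) x = 0 := by
        refine ((𝔒).extD_apply Θ (c := c) hxe).trans ?_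
        rw [h1.extDeriv_eq, extDeriv, fderiv_zero]
        exact map_zero (ContinuousAlternatingMap.alternatizeUncurryFinCLM ℝ
          (EuclideanSpace ℝ (Fin (k + 1))) ℝ)
      rw [chartDensity, h3]
      exact mul_zero _
    · exact chartDensity_eq_zero _ _ _ hxe
  have hΨK : ∀ j, ∀ c, ∀ x ∈ c.1.dom, c.1.toFun x ∉ K → (Ψ j).1 c x = 0 := fun j c x hx h => by
    change φ j _ • Φ.1 c x = 0
    rw [hΦ c x hx h, smul_zero]
  have hΨL : ∀ j, ∀ c, ∀ x ∈ c.1.dom, c.1.toFun x ∉ L j → (Ψ j).1 c x = 0 := fun j c x hx h => by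
    change φ j _ • Φ.1 c x = 0
    rw [(hL j).2.2 _ h, zero_smul]
  have hcont : ∀ i (θ : (𝔒).Form (k + 1)), Continuous (fun x =>
      φ i ((e i).symm x) * chartDensity vol θ (e i) (he i) x) ∧ HasCompactSupport (fun x =>
      φ i ((e i).symm x) * chartDensity vol θ (e i) (he i) x) := by
    intro i θ
    obtain ⟨h1, h2⟩ := tsupport_subset_of_chart (hL i).1 (hL i).2.1
      (F := fun x => φ i ((e i).symm x) * chartDensity vol θ (e i) (he i) x) fun x hx => by
        by_cases hx' : x ∈ (e i).target
        · rw [(hL i).2.2 _ fun h => hx ⟨hx', h⟩, zero_mul]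
        · rw [chartDensity_eq_zero _ _ _ hx', mul_zero]
    refine ⟨ContinuousOn.continuous_of_tsupport_subset ?_ (e i).open_target h1, h2⟩
    exact ((hφc i).comp_continuousOn (e i).continuousOn_symm).mul
      (continuousOn_chartDensity hvol θ (he i))
  -- the total integral of the differential vanishes
  have htotal : ∑ i, ∫ x, φ i ((e i).symm x) * chartDensity vol ((𝔒).extD k Φ) (e i)
        (he i) x = 0 := by
    -- the part `φ j • Φ` can be integrated in the chart `e j` instead of `e i`
    have h1 : ∀ i, ∫ x, φ i ((e i).symm x) * chartDensity vol ((𝔒).extD k Φ) (e i) (he i) x =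
        ∑ j, ∫ x, φ i ((e j).symm x) * chartDensity vol ((𝔒).extD k (Ψ j)) (e j) (he j) x := by
      intro i
      simp_rw [hdens, Finset.mul_sum]
      rw [integral_finsetSum _ fun j _ =>
        (hcont i ((𝔒).extD k (Ψ j))).1.integrable_of_hasCompactSupport (hcont i _).2]
      refine Finset.sum_congr rfl fun j _ => ?_
      have hz : ∀ l, (fun x => φ i ((e l).symm x) *
          chartDensity vol ((𝔒).extD k (Ψ j)) (e l) (he l) x) = fun x =>
          (L j).indicator (φ i) ((e l).symm x) *
          chartDensity vol ((𝔒).extD k (Ψ j)) (e l) (he l) x := by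
        intro l
        ext1 x
        by_cases hx : (e l).symm x ∈ L j
        · rw [indicator_of_mem hx]
        · rw [hsupp _ _ (hL j).1.isClosed (hΨL j) l x hx, mul_zero, mul_zero]
      rw [hz i, hz j]
      refine integral_chartDensity_eq vol _ (he i) (he j) fun y hy => ?_
      by_cases hyj : y ∈ L j
      · rw [indicator_of_mem hyj]
        exact (hL i).2.2 y fun h => hy ⟨(hL i).2.1 h, (hL j).2.1 hyj⟩
      · exact indicator_of_notMem hyj _
    simp_rw [h1]
    rw [Finset.sum_comm]
    refine Finset.sum_eq_zero fun j _ => ?_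
    rw [← integral_finsetSum]
    · rw [← integral_chartDensity_extD hvol (Ψ j) (he j) (hL j).1 (hL j).2.1 (hΨL j)]
      refine integral_congr_ae (Filter.Eventually.of_forall fun x => ?_)
      beta_reduce
      rw [← Finset.sum_mul]
      by_cases hx : (e j).symm x ∈ K
      · rw [hφ1 _ hx, one_mul]
      · rw [hsupp _ _ hK.isClosed (hΨK j) j x hx, mul_zero]
    · intro i _
      obtain ⟨h1, h2⟩ := tsupport_subset_of_chart (hL j).1 (hL j).2.1
        (F := fun x => φ i ((e j).symm x) * chartDensity vol ((𝔒).extD k (Ψ j)) (e j) (he j) x)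
        fun x hx => by
          by_cases hx' : x ∈ (e j).target
          · rw [hsupp _ _ (hL j).1.isClosed (hΨL j) j x fun h => hx ⟨hx', h⟩, mul_zero]
          · rw [chartDensity_eq_zero _ _ _ hx', mul_zero]
      refine (ContinuousOn.continuous_of_tsupport_subset ?_ (e j).open_target
        h1).integrable_of_hasCompactSupport h2
      exact ((hφc i).comp_continuousOn (e j).continuousOn_symm).mul
        (continuousOn_chartDensity hvol _ (he j))
  -- the integrands are nonnegative and continuous, so they vanish
  have hnn : ∀ i x, 0 ≤ chartDensity vol ((𝔒).extD k Φ) (e i) (he i) x := by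
    intro i x
    by_cases hx : x ∈ (e i).target
    · obtain ⟨r, hr, h⟩ := hpos ⟨OrbifoldChart.ofChart (e i), e i, he i, rfl⟩ x hx
      have h' : topCoeff (Orbifold.chartForm ((𝔒).extD k Φ) (e i) (he i) x) =
          r * topCoeff (Orbifold.chartForm vol (e i) (he i) x) := congrArg topCoeff h
      rw [chartDensity, h', mul_left_comm, sign_mul_self]
      positivity
    · rw [chartDensity_eq_zero _ _ _ hx]
  have hzero : ∀ i, ∀ x ∈ (e i).target, φ i ((e i).symm x) ≠ 0 →
      ((𝔒).extD k Φ).1 ⟨OrbifoldChart.ofChart (e i), e i, he i, rfl⟩ x = 0 := by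
    intro i x hx hne
    have h1 := (Finset.sum_eq_zero_iff_of_nonneg fun i _ => integral_nonneg fun x =>
      mul_nonneg (hφ0 i _) (hnn i x)).1 htotal i (Finset.mem_univ _)
    have h2 : φ i ((e i).symm x) * chartDensity vol ((𝔒).extD k Φ) (e i) (he i) x = 0 := by
      by_contra h
      exact ((hcont i _).1.integral_pos_of_hasCompactSupport_nonneg_nonzero (hcont i _).2
        (fun x => mul_nonneg (hφ0 i _) (hnn i x)) h).ne' h1
    have h3 := (mul_eq_zero.1 h2).resolve_left hne
    have h4 : (SignType.sign (topCoeff (Orbifold.chartForm vol (e i) (he i) x)) : ℝ) ≠ 0 := by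
      have := topCoeff_ne_zero (hvol ⟨OrbifoldChart.ofChart (e i), e i, he i, rfl⟩ x hx)
      intro h
      have h' := sign_mul_self (topCoeff (Orbifold.chartForm vol (e i) (he i) x))
      rw [h, zero_mul] at h'
      exact this (abs_eq_zero.1 h'.symm)
    exact topCoeff_injective (((mul_eq_zero.1 h3).resolve_left h4).trans rfl)
  refine Orbifold.Form.ext fun c x => ?_
  by_cases hx : x ∈ c.1.dom
  swap
  · exact ((𝔒).extD k Φ).2.2.1 c x hx
  by_cases hxK : c.1.toFun x ∈ K
  · obtain ⟨i, -, hi⟩ : ∃ i ∈ Finset.univ, φ i (c.1.toFun x) ≠ 0 := by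
      by_contra! h
      have := hφ1 _ hxK
      rw [Finset.sum_eq_zero h] at this
      exact zero_ne_one this
    have hsrc : c.1.toFun x ∈ (e i).source := (hL i).2.1 (by
      by_contra h
      exact hi ((hL i).2.2 _ h))
    set c' : (𝔒).atlas := ⟨OrbifoldChart.ofChart (e i), e i, he i, rfl⟩ with hc'
    obtain ⟨h, hh, hxh, hhx⟩ := (𝔒).compatible c.1 c.2 c'.1 c'.2 x hx (e i (c.1.toFun x))
      ((e i).map_source hsrc) ((e i).left_inv hsrc).symm
    rw [((𝔒).extD k Φ).2.2.2 c c' h hh x hxh, hhx, hzero i _ ((e i).map_source hsrc)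
      (by rwa [(e i).left_inv hsrc])]
    rfl
  · have h1 : Φ.1 c =ᶠ[𝓝 x] 0 := by
      have h2 : ContinuousAt c.1.toFun x :=
        c.1.continuousOn_toFun.continuousAt (c.1.isOpen_dom.mem_nhds hx)
      filter_upwards [h2.eventually (hK.isClosed.isOpen_compl.mem_nhds hxK),
        c.1.isOpen_dom.mem_nhds hx] with y hy hy'
      exact hΦ c y hy' hy
    rw [(𝔒).extD_apply Φ c hx, h1.extDeriv_eq, extDeriv, fderiv_zero]
    exact map_zero (ContinuousAlternatingMap.alternatizeUncurryFinCLM ℝ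
      (EuclideanSpace ℝ (Fin (k + 1))) ℝ)

end Manifold

theorem extD_eq_zero_of_nonneg {N : Type*} [TopologicalSpace N] [T2Space N] {d k : ℕ}
    (hd : d = k + 1) [ChartedSpace (EuclideanSpace ℝ (Fin d)) N] [IsManifold (𝓡 d) ∞ N]
    {vol : (Orbifold.ofManifold d N).Form (k + 1)}
    (hvol : ∀ c, ∀ x ∈ c.1.dom, vol.1 c x ≠ 0) (Φ : (Orbifold.ofManifold d N).Form k)
    {K : Set N} (hK : IsCompact K) (hΦ : ∀ c, ∀ x ∈ c.1.dom, c.1.toFun x ∉ K → Φ.1 c x = 0)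
    (hpos : ∀ c, ∀ x ∈ c.1.dom, ∃ r : ℝ, 0 ≤ r ∧
      ((Orbifold.ofManifold d N).extD k Φ).1 c x = r • vol.1 c x) :
    (Orbifold.ofManifold d N).extD k Φ = 0 := by
  subst hd
  exact extD_eq_zero_of_nonneg_aux hvol Φ hK hΦ hpos

/-! ### Local lifts -/

section SmoothPullback

variable {V W Z : Type*} [NormedAddCommGroup V] [NormedSpace ℝ V] [FiniteDimensional ℝ V]
  [NormedAddCommGroup W] [NormedSpace ℝ W] [NormedAddCommGroup Z] [NormedSpace ℝ Z]

/-- The alternating maps are a direct summand of the multilinear maps. -/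
theorem exists_leftInverse_toContinuousMultilinearMap (k : ℕ) :
    ∃ L : ContinuousMultilinearMap ℝ (fun _ : Fin k => V) ℝ →L[ℝ] V [⋀^Fin k]→L[ℝ] ℝ,
      ∀ α : V [⋀^Fin k]→L[ℝ] ℝ, L α.toContinuousMultilinearMap = α := by
  have h1 : FiniteDimensional ℝ (ContinuousMultilinearMap ℝ (fun _ : Fin k => V) ℝ) :=
    FiniteDimensional.of_injective (ContinuousMultilinearMap.toMultilinearMapLinear :
      ContinuousMultilinearMap ℝ (fun _ : Fin k => V) ℝ →ₗ[ℝ]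
        MultilinearMap ℝ (fun _ : Fin k => V) ℝ)
      ContinuousMultilinearMap.toMultilinearMap_injective
  let J : (V [⋀^Fin k]→L[ℝ] ℝ) →ₗ[ℝ] ContinuousMultilinearMap ℝ (fun _ : Fin k => V) ℝ :=
    { toFun := ContinuousAlternatingMap.toContinuousMultilinearMap
      map_add' := fun _ _ => rfl
      map_smul' := fun _ _ => rfl }
  obtain ⟨L, hL⟩ := LinearMap.exists_leftInverse_of_injective J
    (LinearMap.ker_eq_bot.2 ContinuousAlternatingMap.toContinuousMultilinearMap_injective)
  exact ⟨LinearMap.toContinuousLinearMap L, fun α => congrArg (fun g => g α) hL⟩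

theorem ContDiffAt.compContinuousLinearMap_alternating {k : ℕ} {α : Z → W [⋀^Fin k]→L[ℝ] ℝ}
    {f : Z → V →L[ℝ] W} {z : Z} (hα : ContDiffAt ℝ ∞ α z) (hf : ContDiffAt ℝ ∞ f z) :
    ContDiffAt ℝ ∞ (fun y => (α y).compContinuousLinearMap (f y)) z := by
  obtain ⟨L, hL⟩ := exists_leftInverse_toContinuousMultilinearMap (V := V) k
  have h1 : ContDiffAt ℝ ∞ (fun y =>
      ContinuousMultilinearMap.compContinuousLinearMapContinuousMultilinear ℝ
        (fun _ : Fin k => V) (fun _ => W) ℝ (fun _ => f y)) z :=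
    (ContinuousMultilinearMap.contDiff _).contDiffAt.comp z (contDiffAt_pi.2 fun _ => hf)
  have h2 : ContDiffAt ℝ ∞ (fun y => (α y).toContinuousMultilinearMap) z :=
    (ContinuousAlternatingMap.toContinuousMultilinearMapCLM ℝ :
      (W [⋀^Fin k]→L[ℝ] ℝ) →L[ℝ] _).contDiff.contDiffAt.comp z hα
  refine (L.contDiff.contDiffAt.comp z (h1.clm_apply h2)).congr_of_eventuallyEq
    (Filter.Eventually.of_forall fun y => ?_)
  exact (hL ((α y).compContinuousLinearMap (f y))).symm

end SmoothPullback

namespace IsLocalLift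

variable {d : ℕ} {X Y Z : Type*} [TopologicalSpace X] [TopologicalSpace Y] [TopologicalSpace Z]
  {f : X → Y} {g : Y → Z} {c : OrbifoldChart d X} {c' : OrbifoldChart d Y} {c'' : OrbifoldChart d Z}
  {h h' : OpenPartialHomeomorph (EuclideanSpace ℝ (Fin d)) (EuclideanSpace ℝ (Fin d))}
  {x : EuclideanSpace ℝ (Fin d)}

theorem contDiffAt (hh : IsLocalLift f c c' h) (hx : x ∈ h.source) : ContDiffAt ℝ ∞ h x :=
  hh.contDiffOn.contDiffAt (h.open_source.mem_nhds hx)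

theorem differentiableAt (hh : IsLocalLift f c c' h) (hx : x ∈ h.source) :
    DifferentiableAt ℝ h x :=
  (hh.contDiffAt hx).differentiableAt (by simp)

theorem symm' {f' : Y → X} (hh : IsLocalLift f c c' h)
    (hf : ∀ x ∈ h.source, f' (c'.toFun (h x)) = c.toFun x) : IsLocalLift f' c' c h.symm where
  source_subset := hh.target_subset
  target_subset := hh.source_subset
  contDiffOn := hh.contDiffOn_symm
  contDiffOn_symm := hh.contDiffOn
  map_eq y hy := by
    have h1 := hf _ (h.map_target hy)
    rw [h.right_inv hy] at h1
    exact h1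

theorem trans (hh : IsLocalLift f c c' h) (hh' : IsLocalLift g c' c'' h') :
    IsLocalLift (g ∘ f) c c'' (h.trans h') where
  source_subset x hx := by
    rw [OpenPartialHomeomorph.trans_source] at hx
    exact hh.source_subset hx.1
  target_subset x hx := by
    rw [OpenPartialHomeomorph.trans_target] at hx
    exact hh'.target_subset hx.1
  contDiffOn := by
    rw [OpenPartialHomeomorph.trans_source]
    exact hh'.contDiffOn.comp (hh.contDiffOn.mono inter_subset_left) fun x hx => hx.2
  contDiffOn_symm := by
    rw [OpenPartialHomeomorph.trans_target]
    exact hh.contDiffOn_symm.comp (hh'.contDiffOn_symm.mono inter_subset_left) fun x hx => hx.2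
  map_eq x hx := by
    rw [OpenPartialHomeomorph.trans_source] at hx
    change g (f (c.toFun x)) = c''.toFun (h' (h x))
    rw [hh.map_eq x hx.1, hh'.map_eq _ hx.2]

/-- Two local lifts of the same map from the same chart differ by a local lift of the identity. -/
theorem symm_trans {c₁ c₂ : OrbifoldChart d Y} (hh : IsLocalLift f c c₁ h)
    (hh' : IsLocalLift f c c₂ h') : IsLocalLift id c₁ c₂ (h.symm.trans h') where
  source_subset x hx := by
    rw [OpenPartialHomeomorph.trans_source] at hx
    exact hh.target_subset hx.1
  target_subset x hx := by
    rw [OpenPartialHomeomorph.trans_target] at hx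
    exact hh'.target_subset hx.1
  contDiffOn := by
    rw [OpenPartialHomeomorph.trans_source]
    exact hh'.contDiffOn.comp (hh.contDiffOn_symm.mono inter_subset_left) fun x hx => hx.2
  contDiffOn_symm := by
    rw [OpenPartialHomeomorph.trans_target]
    exact hh.contDiffOn.comp (hh'.contDiffOn_symm.mono inter_subset_left) fun x hx => hx.2
  map_eq x hx := by
    rw [OpenPartialHomeomorph.trans_source] at hx
    have h1 := hh.map_eq _ (h.map_target hx.1)
    rw [h.right_inv hx.1] at h1
    exact h1.symm.trans (hh'.map_eq _ hx.2)

theorem restr (hh : IsLocalLift f c c' h) {s : Set (EuclideanSpace ℝ (Fin d))} (hs : IsOpen s) :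
    IsLocalLift f c c' (h.restrOpen s hs) where
  source_subset _ hx := hh.source_subset hx.1
  target_subset _ hx := hh.target_subset hx.1
  contDiffOn := hh.contDiffOn.mono fun _ hx => hx.1
  contDiffOn_symm := hh.contDiffOn_symm.mono fun _ hx => hx.1
  map_eq x hx := hh.map_eq x hx.1

theorem fderiv_trans (hh : IsLocalLift f c c' h) (hh' : IsLocalLift g c' c'' h')
    (hx : x ∈ h.source) (hx' : h x ∈ h'.source) :
    fderiv ℝ (h.trans h') x = (fderiv ℝ h' (h x)).comp (fderiv ℝ h x) :=
  fderiv_comp x (hh'.differentiableAt hx') (hh.differentiableAt hx)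

theorem differentiableAt_symm (hh : IsLocalLift f c c' h) (hx : x ∈ h.source) :
    DifferentiableAt ℝ h.symm (h x) :=
  (hh.contDiffOn_symm.contDiffAt (h.open_target.mem_nhds (h.map_source hx))).differentiableAt
    (by simp)

theorem fderiv_symm_comp (hh : IsLocalLift f c c' h) (hx : x ∈ h.source) :
    (fderiv ℝ h.symm (h x)).comp (fderiv ℝ h x) = ContinuousLinearMap.id ℝ _ := by
  rw [← fderiv_comp x (hh.differentiableAt_symm hx) (hh.differentiableAt hx), ← fderiv_id]
  exact Filter.EventuallyEq.fderiv_eq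
    (Filter.eventually_of_mem (h.open_source.mem_nhds hx) fun y hy => h.left_inv hy)

theorem fderiv_comp_symm (hh : IsLocalLift f c c' h) (hx : x ∈ h.source) :
    (fderiv ℝ h x).comp (fderiv ℝ h.symm (h x)) = ContinuousLinearMap.id ℝ _ := by
  have h1 : fderiv ℝ (h ∘ h.symm) (h x) = ContinuousLinearMap.id ℝ _ := by
    rw [← fderiv_id]
    exact Filter.EventuallyEq.fderiv_eq (Filter.eventually_of_mem
      (h.open_target.mem_nhds (h.map_source hx)) fun y hy => h.right_inv hy)
  have h2 := fderiv_comp (h x) (g := h) (f := h.symm)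
    (by rw [h.left_inv hx]; exact hh.differentiableAt hx) (hh.differentiableAt_symm hx)
  rw [h1, h.left_inv hx] at h2
  exact h2.symm

theorem fderiv_symm_trans {c₁ c₂ : OrbifoldChart d Y} (hh : IsLocalLift f c c₁ h)
    (hh' : IsLocalLift f c c₂ h') (hx : x ∈ h.source) (hx' : x ∈ h'.source) :
    (fderiv ℝ (h.symm.trans h') (h x)).comp (fderiv ℝ h x) = fderiv ℝ h' x := by
  have h2 := fderiv_comp (h x) (g := h') (f := h.symm)
    (by rw [h.left_inv hx]; exact hh'.differentiableAt hx') (hh.differentiableAt_symm hx)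
  rw [h.left_inv hx] at h2
  change (fderiv ℝ (h' ∘ h.symm) (h x)).comp _ = _
  rw [h2, ContinuousLinearMap.comp_assoc, hh.fderiv_symm_comp hx, ContinuousLinearMap.comp_id]

/-- A chart group element, as a lift of the identity. -/
theorem exists_group (c : OrbifoldChart d X) {g} (hg : g ∈ c.group) :
    ∃ h, IsLocalLift id c c h ∧ h.source = c.dom ∧ ∀ x, h x = g x := by
  refine ⟨g.toHomeomorph.toOpenPartialHomeomorph.restrOpen c.dom c.isOpen_dom, ?_, ?_, ?_⟩
  · refine ⟨?_, ?_, ?_, ?_, ?_⟩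
    · exact fun x hx => hx.2
    · rintro x ⟨-, hx⟩
      have h1 : g (g.symm x) ∈ c.dom := c.mapsTo g hg hx
      rwa [g.apply_symm_apply] at h1
    · exact g.contDiff.contDiffOn
    · exact g.symm.contDiff.contDiffOn
    · intro x hx
      exact (c.toFun_eq_iff x hx.2 (g x) (c.mapsTo g hg hx.2)).2 ⟨g, hg, rfl⟩
  · exact univ_inter _
  · exact fun x => rfl

/-- Every local lift of the identity of a chart agrees to first order at each point with an element
of the group of the chart. -/
theorem exists_group_eq {c : OrbifoldChart d X} (hh : IsLocalLift id c c h) (hx : x ∈ h.source) :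
    ∃ g ∈ c.group, g x = h x ∧ fderiv ℝ h x = (g : _ →L[ℝ] _) := by
  have := c.finite_group
  have hfin : Finite {g : c.group // g.1 x = h x} := inferInstance
  -- each vector is mapped in the same way by the derivative and by some element of the group
  have key : ∀ v, ∃ g : {g : c.group // g.1 x = h x}, fderiv ℝ h x v = g.1.1 v := by
    intro v
    have hγ : Filter.Tendsto (fun t : ℝ => x + t • v) (𝓝[≠] 0) (𝓝 x) := by
      have : Continuous fun t : ℝ => x + t • v := by fun_prop
      simpa using (this.tendsto 0).mono_left nhdsWithin_le_nhds
    have h1 : ∀ᶠ t in 𝓝[≠] (0 : ℝ), ∃ g : c.group, g.1 (x + t • v) = h (x + t • v) := by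
      filter_upwards [hγ.eventually (h.open_source.mem_nhds hx)] with t ht
      obtain ⟨g, hg, h2⟩ := (c.toFun_eq_iff _ (hh.source_subset ht) _
        (hh.target_subset (h.map_source ht))).1 (hh.map_eq _ ht)
      exact ⟨⟨g, hg⟩, h2⟩
    obtain ⟨g, hg⟩ : ∃ g : c.group, ∃ᶠ t in 𝓝[≠] (0 : ℝ), g.1 (x + t • v) = h (x + t • v) := by
      by_contra! hcon
      obtain ⟨t, ⟨g, ht⟩, ht'⟩ := (h1.and (Filter.eventually_all.2 hcon)).exists
      exact ht' g ht
    have hcont : ContinuousAt h x := (hh.differentiableAt hx).continuousAt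
    have hgx : g.1 x = h x := by
      have h3 : Filter.Tendsto (fun t : ℝ => g.1 (x + t • v) - h (x + t • v)) (𝓝[≠] 0)
          (𝓝 (g.1 x - h x)) :=
        ((g.1.continuous.tendsto x).comp hγ).sub (hcont.tendsto.comp hγ)
      by_contra hne
      have h4 := h3.eventually (isOpen_ne.mem_nhds (sub_ne_zero.2 hne))
      obtain ⟨t, ht, ht'⟩ := (hg.and_eventually h4).exists
      exact ht' (sub_eq_zero.2 ht)
    refine ⟨⟨g, hgx⟩, ?_⟩
    have h5 : HasDerivAt (fun t : ℝ => h (x + t • v)) (fderiv ℝ h x v) 0 := by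
      have h6 : HasDerivAt (fun t : ℝ => x + t • v) v 0 := by
        simpa using ((hasDerivAt_id (0 : ℝ)).smul_const v).const_add x
      refine HasFDerivAt.comp_hasDerivAt (0 : ℝ) (f := fun t : ℝ => x + t • v) ?_ h6
      simpa using (hh.differentiableAt hx).hasFDerivAt
    have h7 := h5.tendsto_slope
    have h8 : ∃ᶠ t in 𝓝[≠] (0 : ℝ), slope (fun t : ℝ => h (x + t • v)) 0 t = g.1 v := by
      refine (hg.and_eventually self_mem_nhdsWithin).mono fun t ht => ?_
      rw [slope_def_module]
      have ht0 : t ≠ 0 := ht.2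
      beta_reduce
      rw [← ht.1, zero_smul, add_zero, ← hgx, map_add, map_smul, sub_zero, add_sub_cancel_left,
        smul_smul, inv_mul_cancel₀ ht0, one_smul]
    by_contra hne
    obtain ⟨t, ht, ht'⟩ := (h8.and_eventually (h7.eventually (isOpen_ne.mem_nhds hne))).exists
    exact ht' ht
  have hU : (⋃ g : {g : c.group // g.1 x = h x},
      ((LinearMap.ker ((fderiv ℝ h x - (g.1.1 : _ →L[ℝ] _) : EuclideanSpace ℝ (Fin d) →L[ℝ] _) :
        EuclideanSpace ℝ (Fin d) →ₗ[ℝ] EuclideanSpace ℝ (Fin d)) : Submodule ℝ _) :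
          Set (EuclideanSpace ℝ (Fin d)))) = univ := by
    refine eq_univ_of_forall fun v => ?_
    obtain ⟨g, hg⟩ := key v
    refine mem_iUnion.2 ⟨g, ?_⟩
    rw [SetLike.mem_coe, LinearMap.mem_ker]
    exact sub_eq_zero.2 hg
  obtain ⟨g, hg⟩ := Subspace.exists_eq_top_of_iUnion_eq_univ hU
  refine ⟨g.1.1, g.1.2, g.2, ?_⟩
  ext1 v
  have h9 : v ∈ (⊤ : Submodule ℝ (EuclideanSpace ℝ (Fin d))) := Submodule.mem_top
  rw [← hg, LinearMap.mem_ker] at h9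
  exact sub_eq_zero.1 h9

end IsLocalLift

/-! ### Forms on open subsets of an orbifold -/

section FormOn

variable {d : ℕ} {X Y : Type*} [TopologicalSpace X] [TopologicalSpace Y]

/-- The form of degree `k` which is the constant `r` in degree `0` and zero in positive degree. -/
def flatValue (V : Type*) [NormedAddCommGroup V] [NormedSpace ℝ V] (r : ℝ) :
    (k : ℕ) → V [⋀^Fin k]→L[ℝ] ℝ
  | 0 => ContinuousAlternatingMap.constOfIsEmpty ℝ V (Fin 0) r
  | _ + 1 => 0

theorem flatValue_apply {V : Type*} [NormedAddCommGroup V] [NormedSpace ℝ V] (r : ℝ) (k : ℕ)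
    (v : Fin k → V) : flatValue V r k v = if k = 0 then r else 0 := by
  cases k <;> rfl

theorem flatValue_zero {V : Type*} [NormedAddCommGroup V] [NormedSpace ℝ V] (k : ℕ) :
    flatValue V 0 k = 0 := by
  ext v
  rw [flatValue_apply, ite_self]
  rfl

theorem flatValue_compContinuousLinearMap {V W : Type*} [NormedAddCommGroup V] [NormedSpace ℝ V]
    [NormedAddCommGroup W] [NormedSpace ℝ W] (r : ℝ) (k : ℕ) (f : V →L[ℝ] W) :
    (flatValue W r k).compContinuousLinearMap f = flatValue V r k := by
  ext v
  rw [ContinuousAlternatingMap.compContinuousLinearMap_apply, flatValue_apply, flatValue_apply]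

/-- Families of forms `α c`, one for each orbifold chart `c`, which are smooth and compatible on the
part over the open set `S` of the charts in the collection `A`. The values elsewhere are
irrelevant. -/
structure IsFormOn (A : Set (OrbifoldChart d X)) (S : Set X) {k : ℕ}
    (α : OrbifoldChart d X → EuclideanSpace ℝ (Fin d) →
      EuclideanSpace ℝ (Fin d) [⋀^Fin k]→L[ℝ] ℝ) : Prop where
  contDiffAt : ∀ c ∈ A, ∀ x ∈ c.dom, c.toFun x ∈ S → ContDiffAt ℝ ∞ (α c) x
  compat : ∀ c ∈ A, ∀ c' ∈ A, ∀ h, IsLocalLift id c c' h → ∀ x ∈ h.source, c.toFun x ∈ S →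
    α c x = (α c' (h x)).compContinuousLinearMap (fderiv ℝ h x)

theorem OrbifoldChart.continuousAt_toFun (c : OrbifoldChart d X) {x : EuclideanSpace ℝ (Fin d)}
    (hx : x ∈ c.dom) : ContinuousAt c.toFun x :=
  c.continuousOn_toFun.continuousAt (c.isOpen_dom.mem_nhds hx)

/-- The pullback of forms along a map with local lifts. -/
theorem IsFormOn.exists_pullback {f : Y → X} {A : Set (OrbifoldChart d Y)}
    {B : Set (OrbifoldChart d X)} {S : Set Y} {T : Set X} (hS : IsOpen S) (hST : MapsTo f S T)
    (hf : ∀ c ∈ A, ∀ x ∈ c.dom, c.toFun x ∈ S →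
      ∃ c' ∈ B, ∃ h, IsLocalLift f c c' h ∧ x ∈ h.source)
    {k : ℕ} {α : OrbifoldChart d X → EuclideanSpace ℝ (Fin d) →
      EuclideanSpace ℝ (Fin d) [⋀^Fin k]→L[ℝ] ℝ} (hα : IsFormOn B T α) :
    ∃ β : OrbifoldChart d Y → EuclideanSpace ℝ (Fin d) →
      EuclideanSpace ℝ (Fin d) [⋀^Fin k]→L[ℝ] ℝ, IsFormOn A S β ∧
      ∀ c ∈ A, ∀ c' ∈ B, ∀ h, IsLocalLift f c c' h → ∀ x ∈ h.source, c.toFun x ∈ S →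
        β c x = (α c' (h x)).compContinuousLinearMap (fderiv ℝ h x) := by
  classical
  have hex : ∀ (c : OrbifoldChart d Y) (x : EuclideanSpace ℝ (Fin d)),
      ∃ β : EuclideanSpace ℝ (Fin d) [⋀^Fin k]→L[ℝ] ℝ,
      c ∈ A → c.toFun x ∈ S → ∀ c' ∈ B, ∀ h, IsLocalLift f c c' h → x ∈ h.source →
        β = (α c' (h x)).compContinuousLinearMap (fderiv ℝ h x) := by
    intro c x
    by_cases hx : c ∈ A ∧ c.toFun x ∈ S ∧ x ∈ c.dom
    · obtain ⟨hc, hxS, hx⟩ := hx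
      obtain ⟨c', hc', h, hh, hxh⟩ := hf c hc x hx hxS
      refine ⟨(α c' (h x)).compContinuousLinearMap (fderiv ℝ h x), ?_⟩
      intro _ _ c'' hc'' h' hh' hxh'
      -- the two lifts differ by a lift of the identity
      have h1 := hα.compat c' hc' c'' hc'' _ (hh.symm_trans hh') (h x)
        (by
          rw [OpenPartialHomeomorph.trans_source]
          exact ⟨h.map_source hxh, by rw [mem_preimage, h.left_inv hxh]; exact hxh'⟩)
        (by rw [← hh.map_eq x hxh]; exact hST hxS)
      have h2 : (h.symm.trans h') (h x) = h' x := congrArg h' (h.left_inv hxh)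
      rw [h1, h2, ← hh.fderiv_symm_trans hh' hxh hxh']
      rfl
    · refine ⟨0, fun hc hxS c' _ h hh hxh => absurd ⟨hc, hxS, hh.source_subset hxh⟩ hx⟩
  choose β hβ using hex
  refine ⟨β, ⟨fun c hc x hx hxS => ?_, fun c hc c' hc' h hh x hxh hxS => ?_⟩,
    fun c hc c' hc' h hh x hxh hxS => hβ c x hc hxS c' hc' h hh hxh⟩
  · obtain ⟨c', hc', h, hh, hxh⟩ := hf c hc x hx hxS
    have h1 : β c =ᶠ[𝓝 x] fun y => (α c' (h y)).compContinuousLinearMap (fderiv ℝ h y) := by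
      filter_upwards [h.open_source.mem_nhds hxh,
        (c.continuousAt_toFun hx).eventually (hS.mem_nhds hxS)] with y hy hyS
      exact hβ c y hc hyS c' hc' h hh hy
    refine ContDiffAt.congr_of_eventuallyEq ?_ h1
    have h2 : ContDiffAt ℝ ∞ (α c') (h x) :=
      hα.contDiffAt c' hc' _ (hh.target_subset (h.map_source hxh))
        (by rw [← hh.map_eq x hxh]; exact hST hxS)
    exact (h2.comp x (hh.contDiffAt hxh)).compContinuousLinearMap_alternating
      ((hh.contDiffAt hxh).fderiv_right (by simp))
  · have hxS' : c'.toFun (h x) ∈ S := by rw [← hh.map_eq x hxh]; exact hxS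
    obtain ⟨c'', hc'', h', hh', hxh'⟩ := hf c' hc' (h x) (hh.target_subset (h.map_source hxh)) hxS'
    rw [hβ c' (h x) hc' hxS' c'' hc'' h' hh' hxh',
      hβ c x hc hxS c'' hc'' _ (hh.trans hh') (by
        rw [OpenPartialHomeomorph.trans_source]; exact ⟨hxh, hxh'⟩),
      hh.fderiv_trans hh' hxh hxh']
    rfl

open Classical in
/-- A form, as a family indexed by all orbifold charts. -/
def Orbifold.Form.toFamily {O : Orbifold d X} {k : ℕ} (α : O.Form k) (c : OrbifoldChart d X) :
    EuclideanSpace ℝ (Fin d) → EuclideanSpace ℝ (Fin d) [⋀^Fin k]→L[ℝ] ℝ :=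
  if hc : c ∈ O.atlas then α.1 ⟨c, hc⟩ else 0

theorem Orbifold.Form.toFamily_eq {O : Orbifold d X} {k : ℕ} (α : O.Form k) (c : O.atlas) :
    α.toFamily c.1 = α.1 c :=
  dif_pos c.2

theorem Orbifold.Form.isFormOn {O : Orbifold d X} {k : ℕ} (α : O.Form k) (S : Set X) :
    IsFormOn O.atlas S α.toFamily where
  contDiffAt c hc x hx _ := by
    rw [α.toFamily_eq ⟨c, hc⟩]
    exact (α.2.1 _).contDiffAt (c.isOpen_dom.mem_nhds hx)
  compat c hc c' hc' h hh x hx _ := by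
    rw [α.toFamily_eq ⟨c, hc⟩, α.toFamily_eq ⟨c', hc'⟩]
    exact α.2.2.2 _ _ h hh x hx

/-- A form on an open subset which is flat near all other points extends to a global form. -/
theorem IsFormOn.exists_extension {O : Orbifold d X} {S : Set X} (hS : IsOpen S) {k : ℕ}
    {α : OrbifoldChart d X → EuclideanSpace ℝ (Fin d) →
      EuclideanSpace ℝ (Fin d) [⋀^Fin k]→L[ℝ] ℝ} (hα : IsFormOn O.atlas S α) (r : X → ℝ)
    (hr : ∀ p ∉ S, ∃ W, IsOpen W ∧ p ∈ W ∧ (∀ p' ∈ W \ S, r p' = r p) ∧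
      ∀ c ∈ O.atlas, ∀ x ∈ c.dom, c.toFun x ∈ W → c.toFun x ∈ S →
        α c x = flatValue _ (r p) k) :
    ∃ β : O.Form k, (∀ c : O.atlas, ∀ x ∈ c.1.dom, c.1.toFun x ∈ S → β.1 c x = α c.1 x) ∧
      ∀ c : O.atlas, ∀ x ∈ c.1.dom, c.1.toFun x ∉ S →
        β.1 c x = flatValue _ (r (c.1.toFun x)) k := by
  classical
  refine ⟨⟨fun c x => if x ∈ c.1.dom then
      if c.1.toFun x ∈ S then α c.1 x else flatValue _ (r (c.1.toFun x)) k else 0,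
      fun c => ?_, fun c x hx => if_neg hx, fun c c' h hh x hx => ?_⟩,
    fun c x hx hxS => (if_pos hx).trans (if_pos hxS),
    fun c x hx hxS => (if_pos hx).trans (if_neg hxS)⟩
  · intro x hx
    refine ContDiffAt.contDiffWithinAt ?_
    have hcont := c.1.continuousAt_toFun hx
    by_cases hxS : c.1.toFun x ∈ S
    · refine (hα.contDiffAt c.1 c.2 x hx hxS).congr_of_eventuallyEq ?_
      filter_upwards [c.1.isOpen_dom.mem_nhds hx, hcont.eventually (hS.mem_nhds hxS)] with y hy hyS
      exact (if_pos hy).trans (if_pos hyS)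
    · obtain ⟨W, hW, hpW, h1, h2⟩ := hr _ hxS
      refine (contDiffAt_const (c := flatValue _ (r (c.1.toFun x)) k)).congr_of_eventuallyEq ?_
      filter_upwards [c.1.isOpen_dom.mem_nhds hx, hcont.eventually (hW.mem_nhds hpW)] with y hy hyW
      rw [if_pos hy]
      split_ifs with hyS
      · exact h2 c.1 c.2 y hy hyW hyS
      · rw [h1 _ ⟨hyW, hyS⟩]
  · have h1 : c'.1.toFun (h x) = c.1.toFun x := (hh.map_eq x hx).symm
    beta_reduce
    rw [if_pos (hh.source_subset hx), if_pos (hh.target_subset (h.map_source hx)), h1]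
    split_ifs with hxS
    · exact hα.compat c.1 c.2 c'.1 c'.2 h hh x hx hxS
    · rw [flatValue_compContinuousLinearMap]

theorem Orbifold.isFlat_iff {O : Orbifold d X} {k : ℕ} (α : O.Form k) :
    O.IsFlat α ↔ ∀ p ∈ O.singularSet, ∃ V : Set X, IsOpen V ∧ p ∈ V ∧ ∃ r : ℝ,
      ∀ (c : O.atlas), ∀ x ∈ c.1.dom, c.1.toFun x ∈ V → α.1 c x = flatValue _ r k := by
  refine forall₂_congr fun p _ => exists_congr fun V => and_congr_right fun _ =>
    and_congr_right fun _ => exists_congr fun r => forall₂_congr fun c x =>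
      forall₂_congr fun _ _ => ?_
  constructor
  · intro h
    ext v
    rw [h v, flatValue_apply]
  · intro h v
    rw [h, flatValue_apply]

end FormOn

/-! ### The singular set -/

namespace Orbifold

variable {d : ℕ} {X Y : Type*} [TopologicalSpace X] [TopologicalSpace Y]

/-- In every chart, a singular point is the image of the origin. -/
theorem eq_zero_of_mem_singularSet (O : Orbifold d X) {c : OrbifoldChart d X} (hc : c ∈ O.atlas)
    {x : EuclideanSpace ℝ (Fin d)} (hx : x ∈ c.dom) (hp : c.toFun x ∈ O.singularSet) :
    x = 0 ∧ c.group ≠ ⊥ := by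
  obtain ⟨c₀, hc₀, hne, h0⟩ := hp
  obtain ⟨⟨g, hg⟩, hg1⟩ := c₀.group.ne_bot_iff_exists_ne_one.1 hne
  have hg1 : g ≠ 1 := fun h => hg1 (Subtype.ext h)
  obtain ⟨h, hh, h0s, h0x⟩ := O.compatible c₀ hc₀ c hc 0 (c₀.zero_mem hne) x hx h0
  obtain ⟨k, hk, hks, hkg⟩ := IsLocalLift.exists_group c₀ hg
  have hk0 : k 0 = 0 := by rw [hkg, map_zero]
  have h0k : (0 : EuclideanSpace ℝ (Fin d)) ∈ k.source := by rw [hks]; exact c₀.zero_mem hne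
  have h0kh : (0 : EuclideanSpace ℝ (Fin d)) ∈ (k.trans h).source := by
    rw [OpenPartialHomeomorph.trans_source]
    exact ⟨h0k, by rw [mem_preimage, hk0]; exact h0s⟩
  have hl : IsLocalLift id c c (h.symm.trans (k.trans h)) :=
    IsLocalLift.symm_trans (f := id) hh (hk.trans hh)
  have hxl : x ∈ (h.symm.trans (k.trans h)).source := by
    rw [OpenPartialHomeomorph.trans_source, ← h0x]
    exact ⟨h.map_source h0s, by rw [mem_preimage, h.left_inv h0s]; exact h0kh⟩
  obtain ⟨g', hg', hgx, hfd⟩ := hl.exists_group_eq hxl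
  have hlx : (h.symm.trans (k.trans h)) x = x := by
    change h (k (h.symm x)) = x
    rw [← h0x, h.left_inv h0s, hk0]
  have hne' : g' ≠ 1 := by
    intro h1
    apply hg1
    have h2 := IsLocalLift.fderiv_symm_trans (f := id) hh (hk.trans hh) h0s h0kh
    rw [h0x, hfd, h1, hk.fderiv_trans hh h0k (by rw [hk0]; exact h0s), hk0] at h2
    have h3 : fderiv ℝ k 0 = (g : EuclideanSpace ℝ (Fin d) →L[ℝ] EuclideanSpace ℝ (Fin d)) := by
      rw [show (k : EuclideanSpace ℝ (Fin d) → EuclideanSpace ℝ (Fin d)) = g from funext hkg]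
      exact g.fderiv
    rw [h3] at h2
    have h4 := congrArg (fun f => (fderiv ℝ h.symm (h 0)).comp f) h2
    beta_reduce at h4
    rw [← ContinuousLinearMap.comp_assoc, ← ContinuousLinearMap.comp_assoc,
      hh.fderiv_symm_comp h0s, ContinuousLinearMap.id_comp] at h4
    refine ContinuousLinearEquiv.ext (funext fun v => ?_)
    have h5 := congrArg (fun f => f v) h4
    have h6 := congrArg (fun f => f v) (hh.fderiv_symm_comp h0s)
    exact h5.symm.trans h6
  exact ⟨c.eq_zero_of_fixed g' hg' hne' x hx (hgx.trans hlx), fun hb => by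
    rw [hb] at hg'
    exact hne' (Subgroup.mem_bot.1 hg')⟩

theorem isClosed_of_subset_singularSet [T1Space X] (O : Orbifold d X) {S : Set X}
    (hS : S ⊆ O.singularSet) : IsClosed S := by
  rw [← isOpen_compl_iff, isOpen_iff_mem_nhds]
  intro p hp
  obtain ⟨c, hc, x, hx, rfl⟩ := O.cover p
  have h1 : c.toFun '' c.dom ∈ 𝓝 (c.toFun x) :=
    (c.isOpen_image _ subset_rfl c.isOpen_dom).mem_nhds ⟨x, hx, rfl⟩
  have h2 : (S ∩ {c.toFun 0})ᶜ ∈ 𝓝 (c.toFun x) :=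
    ((Set.finite_singleton _).subset inter_subset_right).isClosed.isOpen_compl.mem_nhds
      fun h => hp h.1
  filter_upwards [h1, h2]
  rintro _ ⟨y, hy, rfl⟩ hy' hyS
  refine hy' ⟨hyS, ?_⟩
  rw [(O.eq_zero_of_mem_singularSet hc hy (hS hyS)).1]
  rfl

theorem isClosed_singularSet [T1Space X] (O : Orbifold d X) : IsClosed O.singularSet :=
  O.isClosed_of_subset_singularSet subset_rfl

theorem dense_compl_singularSet (O : Orbifold d X) : Dense (O.singularSet)ᶜ := by
  rw [← interior_eq_empty_iff_dense_compl, Set.eq_empty_iff_forall_notMem]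
  intro p hp
  obtain ⟨c, hc, hne, hcp⟩ := interior_subset hp
  have h0 := c.zero_mem hne
  have : Nontrivial (EuclideanSpace ℝ (Fin d)) := by
    by_contra h
    rw [not_nontrivial_iff_subsingleton] at h
    obtain ⟨⟨g, hg⟩, hg1⟩ := c.group.ne_bot_iff_exists_ne_one.1 hne
    exact hg1 (Subtype.ext (ContinuousLinearEquiv.ext (funext fun v => Subsingleton.elim _ _)))
  have h1 : ∀ᶠ x in 𝓝[≠] (0 : EuclideanSpace ℝ (Fin d)), x ∈ c.dom ∧ c.toFun x ∈ O.singularSet := by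
    refine Filter.Eventually.filter_mono nhdsWithin_le_nhds ?_
    rw [← hcp] at hp
    filter_upwards [c.isOpen_dom.mem_nhds h0, (c.continuousAt_toFun h0).eventually
      (isOpen_interior.mem_nhds hp)] with x hx hx'
    exact ⟨hx, interior_subset hx'⟩
  obtain ⟨x, ⟨hx, hxs⟩, hx0⟩ := (h1.and self_mem_nhdsWithin).exists
  exact hx0 (O.eq_zero_of_mem_singularSet hc hx hxs).1

/-- Two forms which agree on a dense subset of an open set agree on the open set. -/
theorem form_eq_of_dense {O : Orbifold d X} {S W : Set X} (hS : Dense S) (hW : IsOpen W) {k : ℕ}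
    {α β : O.Form k}
    (h : ∀ c : O.atlas, ∀ x ∈ c.1.dom, c.1.toFun x ∈ S → c.1.toFun x ∈ W → α.1 c x = β.1 c x)
    (c : O.atlas) {x : EuclideanSpace ℝ (Fin d)} (hx : x ∈ c.1.dom) (hxW : c.1.toFun x ∈ W) :
    α.1 c x = β.1 c x := by
  by_contra hne
  have hα := ((α.2.1 c).continuousOn).continuousAt (c.1.isOpen_dom.mem_nhds hx)
  have hβ := ((β.2.1 c).continuousOn).continuousAt (c.1.isOpen_dom.mem_nhds hx)
  have h1 : ∀ᶠ y in 𝓝 x, y ∈ c.1.dom ∧ c.1.toFun y ∈ W ∧ α.1 c y ≠ β.1 c y := by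
    filter_upwards [c.1.isOpen_dom.mem_nhds hx, (c.1.continuousAt_toFun hx).eventually
      (hW.mem_nhds hxW), (hα.sub hβ).eventually_ne (sub_ne_zero.2 hne)] with y h1 h2 h3
    exact ⟨h1, h2, sub_ne_zero.1 h3⟩
  obtain ⟨U, hU, hUo, hxU⟩ := mem_nhds_iff.1 h1
  obtain ⟨_, ⟨y, hy, rfl⟩, hyS⟩ := hS.inter_open_nonempty _
    (c.1.isOpen_image U (fun y hy => (hU hy).1) hUo) ⟨_, x, hxU, rfl⟩
  exact (hU hy).2.2 (h c y (hU hy).1 hyS (hU hy).2.1)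

theorem form_ext_of_dense {O : Orbifold d X} {S : Set X} (hS : Dense S) {k : ℕ} {α β : O.Form k}
    (h : ∀ c : O.atlas, ∀ x ∈ c.1.dom, c.1.toFun x ∈ S → α.1 c x = β.1 c x) : α = β := by
  refine Form.ext fun c x => ?_
  by_cases hx : x ∈ c.1.dom
  · exact form_eq_of_dense hS isOpen_univ (fun c x hx hxS _ => h c x hx hxS) c hx (mem_univ _)
  · rw [α.2.2.1 c x hx, β.2.2.1 c x hx]

end Orbifold

/-! ### Pullback of forms -/

section Agrees

variable {d : ℕ} {X Y : Type*} [TopologicalSpace X] [TopologicalSpace Y] {P : Orbifold d Y}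
  {O : Orbifold d X} {π : Y → X} {S : Set Y} {k l : ℕ}

theorem AgreesWithPullback.add {α α' : O.Form k} {β β' : P.Form k}
    (h : AgreesWithPullback P O π S α β) (h' : AgreesWithPullback P O π S α' β') :
    AgreesWithPullback P O π S (α + α') (β + β') := fun c c' g hg x hx hxS =>
  (congrArg₂ (· + ·) (h c c' g hg x hx hxS) (h' c c' g hg x hx hxS)).trans rfl

theorem AgreesWithPullback.smul (r : ℝ) {α : O.Form k} {β : P.Form k}
    (h : AgreesWithPullback P O π S α β) :
    AgreesWithPullback P O π S (r • α) (r • β) := fun c c' g hg x hx hxS =>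
  (congrArg (r • ·) (h c c' g hg x hx hxS)).trans rfl

theorem agreesWithPullback_zero : AgreesWithPullback P O π S (0 : O.Form k) (0 : P.Form k) :=
  fun _ _ _ _ _ _ _ => rfl

theorem AgreesWithPullback.wedgeForm {α : O.Form k} {α' : O.Form l} {β : P.Form k} {β' : P.Form l}
    (h : AgreesWithPullback P O π S α β) (h' : AgreesWithPullback P O π S α' β') :
    AgreesWithPullback P O π S (O.wedgeForm α α') (P.wedgeForm β β') := fun c c' g hg x hx hxS =>
  (congrArg₂ wedge (h c c' g hg x hx hxS) (h' c c' g hg x hx hxS)).trans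
    (wedge_compContinuousLinearMap _ _ _)

theorem agreesWithPullback_oneForm : AgreesWithPullback P O π S O.oneForm P.oneForm := by
  intro c c' g hg x hx _
  have h1 : P.oneForm.1 c x = flatValue _ 1 0 := if_pos (hg.source_subset hx)
  have h2 : O.oneForm.1 c' (g x) = flatValue _ 1 0 :=
    if_pos (hg.target_subset (g.map_source hx))
  rw [h1, h2, flatValue_compContinuousLinearMap]

theorem AgreesWithPullback.extD (hS : IsOpen S) {α : O.Form k} {β : P.Form k}
    (h : AgreesWithPullback P O π S α β) :
    AgreesWithPullback P O π S (O.extD k α) (P.extD k β) := by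
  intro c c' g hg x hx hxS
  have hx1 := hg.source_subset hx
  have hx2 := hg.target_subset (g.map_source hx)
  rw [P.extD_apply β c hx1, O.extD_apply α c' hx2]
  have hev : β.1 c =ᶠ[𝓝 x] fun y => (α.1 c' (g y)).compContinuousLinearMap (fderiv ℝ g y) := by
    filter_upwards [g.open_source.mem_nhds hx,
      (c.1.continuousAt_toFun hx1).eventually (hS.mem_nhds hxS)] with y hy hyS
    exact h c c' g hg y hy hyS
  rw [hev.extDeriv_eq]
  exact extDeriv_pullback (O.differentiableAt_of_mem α c' hx2) (hg.contDiffAt hx)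
    (by simpa using Orbifold.two_le_infty)

namespace Orbifold

theorem isFlat_zero : O.IsFlat (0 : O.Form k) := fun _ _ =>
  ⟨univ, isOpen_univ, mem_univ _, 0, fun _ _ _ _ _ => (ite_self _).symm⟩

theorem IsFlat.add {α α' : O.Form k} (h : O.IsFlat α) (h' : O.IsFlat α') : O.IsFlat (α + α') := by
  intro p hp
  obtain ⟨V, hV, hpV, r, hr⟩ := h p hp
  obtain ⟨V', hV', hpV', r', hr'⟩ := h' p hp
  refine ⟨V ∩ V', hV.inter hV', ⟨hpV, hpV'⟩, r + r', fun c x hx hxV v => ?_⟩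
  refine (congrArg₂ (· + ·) (hr c x hx hxV.1 v) (hr' c x hx hxV.2 v)).trans ?_
  split_ifs <;> simp

theorem IsFlat.smul (s : ℝ) {α : O.Form k} (h : O.IsFlat α) : O.IsFlat (s • α) := by
  intro p hp
  obtain ⟨V, hV, hpV, r, hr⟩ := h p hp
  refine ⟨V, hV, hpV, s * r, fun c x hx hxV v => ?_⟩
  refine (congrArg (s * ·) (hr c x hx hxV v)).trans ?_
  split_ifs <;> simp

theorem wedge_flatValue {V : Type*} [NormedAddCommGroup V] [NormedSpace ℝ V] (r s : ℝ) (k l : ℕ) :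
    wedge (flatValue V r k) (flatValue V s l) = flatValue V (r * s) (k + l) := by
  cases k with
  | succ k =>
    refine (wedge_zero_left _).trans ?_
    ext v
    rw [flatValue_apply, if_neg (by omega)]
    rfl
  | zero =>
    cases l with
    | succ l => exact wedge_zero_right _
    | zero =>
      refine (wedge_constOfIsEmpty_left _ _).trans ?_
      ext v
      rfl

theorem IsFlat.wedgeForm {α : O.Form k} {α' : O.Form l} (h : O.IsFlat α) (h' : O.IsFlat α') :
    O.IsFlat (O.wedgeForm α α') := by
  rw [isFlat_iff] at h h' ⊢
  intro p hp
  obtain ⟨V, hV, hpV, r, hr⟩ := h p hp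
  obtain ⟨V', hV', hpV', r', hr'⟩ := h' p hp
  refine ⟨V ∩ V', hV.inter hV', ⟨hpV, hpV'⟩, r * r', fun c x hx hxV => ?_⟩
  rw [← wedge_flatValue, ← hr c x hx hxV.1, ← hr' c x hx hxV.2]
  rfl

theorem isFlat_oneForm : O.IsFlat O.oneForm := by
  rw [isFlat_iff]
  exact fun p _ => ⟨univ, isOpen_univ, mem_univ _, 1, fun c x hx _ => if_pos hx⟩

theorem extD_eq_zero_of_eq_flatValue {α : O.Form k} {V : Set X} (hV : IsOpen V) {r : ℝ}
    (h : ∀ (c : O.atlas), ∀ x ∈ c.1.dom, c.1.toFun x ∈ V → α.1 c x = flatValue _ r k)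
    {c : O.atlas} {x : EuclideanSpace ℝ (Fin d)} (hx : x ∈ c.1.dom) (hxV : c.1.toFun x ∈ V) :
    (O.extD k α).1 c x = 0 := by
  have hev : α.1 c =ᶠ[𝓝 x] fun _ => flatValue _ r k := by
    filter_upwards [c.1.isOpen_dom.mem_nhds hx,
      (c.1.continuousAt_toFun hx).eventually (hV.mem_nhds hxV)] with y hy hyV
    exact h c y hy hyV
  rw [O.extD_apply α c hx, hev.extDeriv_eq, extDeriv, fderiv_const_apply]
  exact map_zero (ContinuousAlternatingMap.alternatizeUncurryFinCLM ℝ (EuclideanSpace ℝ (Fin d)) ℝ)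

theorem IsFlat.extD {α : O.Form k} (h : O.IsFlat α) : O.IsFlat (O.extD k α) := by
  rw [isFlat_iff] at h ⊢
  intro p hp
  obtain ⟨V, hV, hpV, r, hr⟩ := h p hp
  exact ⟨V, hV, hpV, 0, fun c x hx hxV => by
    rw [flatValue_zero]; exact extD_eq_zero_of_eq_flatValue hV hr hx hxV⟩

end Orbifold

end Agrees

/-! ### Forms on the two sides of a resolution -/

section Resolution

variable {d : ℕ} {X Y : Type*} [TopologicalSpace X] [TopologicalSpace Y]

/-- The properties of a resolution which do not refer to symplectic forms: `π` is proper, and it is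
a diffeomorphism over the complement of the singular set, whose preimage is dense. -/
structure IsResolutionMap (P : Orbifold d Y) (O : Orbifold d X) (π : Y → X) : Prop where
  isProperMap : IsProperMap π
  isDiffeoOn : IsDiffeoOn P O π (π ⁻¹' O.singularSet)ᶜ (O.singularSet)ᶜ
  dense_compl : Dense (π ⁻¹' O.singularSet)ᶜ

/-- The form `β` is constant or zero near the fibres over the singular points. -/
def IsFlatOver (P : Orbifold d Y) (O : Orbifold d X) (π : Y → X) {k : ℕ} (β : P.Form k) : Prop :=
  ∀ p ∈ O.singularSet, ∃ V : Set X, IsOpen V ∧ p ∈ V ∧ ∃ r : ℝ,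
    ∀ (c : P.atlas), ∀ x ∈ c.1.dom, π (c.1.toFun x) ∈ V → β.1 c x = flatValue _ r k

namespace IsResolutionMap

variable {P : Orbifold d Y} {O : Orbifold d X} {π : Y → X} (hπ : IsResolutionMap P O π) {k : ℕ}
include hπ

theorem continuous : Continuous π := hπ.isProperMap.continuous

theorem isOpen_compl [T1Space X] : IsOpen (π ⁻¹' O.singularSet)ᶜ :=
  (O.isClosed_singularSet.preimage hπ.continuous).isOpen_compl

theorem exists_lift {c : OrbifoldChart d Y} (hc : c ∈ P.atlas) {x : EuclideanSpace ℝ (Fin d)}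
    (hx : x ∈ c.dom) (hxS : π (c.toFun x) ∉ O.singularSet) {c' : OrbifoldChart d X}
    (hc' : c' ∈ O.atlas) {x' : EuclideanSpace ℝ (Fin d)} (hx' : x' ∈ c'.dom)
    (hxx' : c'.toFun x' = π (c.toFun x)) :
    ∃ h, IsLocalLift π c c' h ∧ x ∈ h.source ∧ h x = x' := by
  obtain ⟨c₁, hc₁, c₂, hc₂, h, hh, y, hy, hyx⟩ := hπ.isDiffeoOn.2 (c.toFun x) hxS
  obtain ⟨t, ht, hxt, htx⟩ := P.compatible c hc c₁ hc₁ x hx y (hh.source_subset hy) hyx.symm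
  obtain ⟨s, hs, hys, hsx⟩ := O.compatible c₂ hc₂ c' hc' (h y)
    (hh.target_subset (h.map_source hy)) x' hx' (by rw [hxx', ← hyx, hh.map_eq y hy])
  have h1 : x ∈ (t.trans h).source := by
    rw [OpenPartialHomeomorph.trans_source]
    exact ⟨hxt, by rw [mem_preimage, htx]; exact hy⟩
  have h2 : (t.trans h) x = h y := congrArg h htx
  refine ⟨(t.trans h).trans s, (ht.trans hh).trans hs, ?_, ?_⟩
  · rw [OpenPartialHomeomorph.trans_source]
    exact ⟨h1, by rw [mem_preimage, h2]; exact hys⟩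
  · change s ((t.trans h) x) = x'
    rw [h2, hsx]

theorem exists_lift_to {c' : OrbifoldChart d X} (hc' : c' ∈ O.atlas)
    {x' : EuclideanSpace ℝ (Fin d)} (hx' : x' ∈ c'.dom) (hxS : c'.toFun x' ∉ O.singularSet) :
    ∃ c ∈ P.atlas, ∃ h, IsLocalLift π c c' h ∧ ∃ x ∈ h.source,
      π (c.toFun x) = c'.toFun x' ∧ h x = x' := by
  obtain ⟨y, hy, hyx⟩ := hπ.isDiffeoOn.1.surjOn hxS
  obtain ⟨c, hc, x, hx, rfl⟩ := P.cover y
  obtain ⟨h, hh, hxh, hhx⟩ := hπ.exists_lift hc hx hy hc' hx' hyx.symm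
  exact ⟨c, hc, h, hh, x, hxh, hyx, hhx⟩

theorem exists_inverse : ∃ σ : X → Y,
    (∀ p ∉ O.singularSet, π (σ p) = p) ∧ ∀ y, π y ∉ O.singularSet → σ (π y) = y := by
  classical
  rcases isEmpty_or_nonempty Y with hY | hY
  · have hX : IsEmpty X := by
      by_contra hX
      rw [not_isEmpty_iff] at hX
      obtain ⟨p, hp⟩ := O.dense_compl_singularSet.nonempty
      obtain ⟨y, -⟩ := hπ.isDiffeoOn.1.surjOn hp
      exact hY.false y
    exact ⟨hX.elim, fun p => hX.elim p, fun y => hY.elim y⟩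
  · have h1 := hπ.isDiffeoOn.1.invOn_invFunOn
    exact ⟨_, fun p hp => h1.2 hp, fun y hy => h1.1 hy⟩

theorem unique_right {α : O.Form k} {β β' : P.Form k}
    (h : AgreesWithPullback P O π (π ⁻¹' O.singularSet)ᶜ α β)
    (h' : AgreesWithPullback P O π (π ⁻¹' O.singularSet)ᶜ α β') : β = β' := by
  refine Orbifold.form_ext_of_dense hπ.dense_compl fun c x hx hxS => ?_
  obtain ⟨c', hc', x', hx', hxx'⟩ := O.cover (π (c.1.toFun x))
  obtain ⟨g, hg, hxg, -⟩ := hπ.exists_lift c.2 hx hxS hc' hx' hxx'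
  rw [h c ⟨c', hc'⟩ g hg x hxg hxS, h' c ⟨c', hc'⟩ g hg x hxg hxS]

theorem unique_left {α α' : O.Form k} {β : P.Form k}
    (h : AgreesWithPullback P O π (π ⁻¹' O.singularSet)ᶜ α β)
    (h' : AgreesWithPullback P O π (π ⁻¹' O.singularSet)ᶜ α' β) : α = α' := by
  refine Orbifold.form_ext_of_dense O.dense_compl_singularSet fun c' x' hx' hxS => ?_
  obtain ⟨c, hc, g, hg, x, hxg, hcx, rfl⟩ := hπ.exists_lift_to c'.2 hx' hxS
  have hxS' : c.toFun x ∈ (π ⁻¹' O.singularSet)ᶜ := by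
    rw [mem_compl_iff, mem_preimage, hcx]; exact hxS
  have h1 := (h ⟨c, hc⟩ c' g hg x hxg hxS').symm.trans (h' ⟨c, hc⟩ c' g hg x hxg hxS')
  have h2 := congrArg (fun β : EuclideanSpace ℝ (Fin d) [⋀^Fin k]→L[ℝ] ℝ =>
    β.compContinuousLinearMap (fderiv ℝ g.symm (g x))) h1
  have h3 : ∀ γ : EuclideanSpace ℝ (Fin d) [⋀^Fin k]→L[ℝ] ℝ,
      (γ.compContinuousLinearMap (fderiv ℝ g x)).compContinuousLinearMap
        (fderiv ℝ g.symm (g x)) = γ := by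
    intro γ
    change γ.compContinuousLinearMap ((fderiv ℝ g x).comp (fderiv ℝ g.symm (g x))) = γ
    rw [hg.fderiv_comp_symm hxg]
    rfl
  beta_reduce at h2
  rwa [h3, h3] at h2

/-- Flat forms on the orbifold pull back to forms on the resolution. -/
theorem exists_pullback [T1Space X] {α : O.Form k} (hα : O.IsFlat α) :
    ∃ β : P.Form k, IsFlatOver P O π β ∧
      AgreesWithPullback P O π (π ⁻¹' O.singularSet)ᶜ α β := by
  rw [Orbifold.isFlat_iff] at hα
  choose! V hV hpV r hr using hα
  obtain ⟨β, hβ, hβα⟩ := (α.isFormOn univ).exists_pullback (A := P.atlas) hπ.isOpen_compl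
    (f := π) (fun _ _ => mem_univ _) (fun c hc x hx hxS => by
      obtain ⟨c', hc', x', hx', hxx'⟩ := O.cover (π (c.toFun x))
      obtain ⟨g, hg, hxg, -⟩ := hπ.exists_lift hc hx hxS hc' hx' hxx'
      exact ⟨c', hc', g, hg, hxg⟩)
  -- shrink the neighbourhoods so that they contain no other singular point
  set W : X → Set X := fun p => V p ∩ (O.singularSet \ {p})ᶜ with hW
  have hWo : ∀ p ∈ O.singularSet, IsOpen (W p) := fun p hp =>
    (hV p hp).inter (O.isClosed_of_subset_singularSet sdiff_subset).isOpen_compl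
  have hWp : ∀ p ∈ O.singularSet, p ∈ W p := fun p hp => ⟨hpV p hp, fun h => h.2 rfl⟩
  have hW1 : ∀ p q, q ∈ W p → q ∈ O.singularSet → q = p := fun p q hq hq' => by
    by_contra hne
    exact hq.2 ⟨hq', hne⟩
  have hval : ∀ p ∈ O.singularSet, ∀ c ∈ P.atlas, ∀ x ∈ c.dom, π (c.toFun x) ∈ W p →
      c.toFun x ∈ (π ⁻¹' O.singularSet)ᶜ → β c x = flatValue _ (r p) k := by
    intro p hp c hc x hx hxW hxS
    obtain ⟨c', hc', x', hx', hxx'⟩ := O.cover (π (c.toFun x))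
    obtain ⟨g, hg, hxg, hgx⟩ := hπ.exists_lift hc hx hxS hc' hx' hxx'
    rw [hβα c hc c' hc' g hg x hxg hxS, hgx, α.toFamily_eq ⟨c', hc'⟩,
      hr p hp ⟨c', hc'⟩ x' hx' (by rw [hxx']; exact hxW.1), flatValue_compContinuousLinearMap]
  obtain ⟨γ, hγ1, hγ2⟩ := hβ.exists_extension hπ.isOpen_compl (fun y => r (π y)) (by
    intro y hy
    have hy : π y ∈ O.singularSet := not_not.1 hy
    refine ⟨π ⁻¹' W (π y), (hWo _ hy).preimage hπ.continuous, hWp _ hy, ?_, ?_⟩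
    · rintro y' ⟨h1, h2⟩
      rw [hW1 _ _ h1 (not_not.1 h2)]
    · intro c hc x hx hxW hxS
      exact hval _ hy c hc x hx hxW hxS)
  refine ⟨γ, fun p hp => ⟨W p, hWo p hp, hWp p hp, r p, fun c x hx hxW => ?_⟩, ?_⟩
  · by_cases hxS : c.1.toFun x ∈ (π ⁻¹' O.singularSet)ᶜ
    · rw [hγ1 c x hx hxS]
      exact hval p hp c.1 c.2 x hx hxW hxS
    · rw [hγ2 c x hx hxS]
      rw [hW1 p _ hxW (not_not.1 hxS)]
  · intro c c' g hg x hxg hxS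
    rw [hγ1 c x (hg.source_subset hxg) hxS, hβα c.1 c.2 c'.1 c'.2 g hg x hxg hxS,
      α.toFamily_eq c']

/-- Every form on the resolution is, off the exceptional set, the pullback of a form on the
complement of the singular set. -/
theorem exists_pushforward_formOn [T1Space X] (μ : P.Form k) :
    ∃ γ : OrbifoldChart d X → EuclideanSpace ℝ (Fin d) →
      EuclideanSpace ℝ (Fin d) [⋀^Fin k]→L[ℝ] ℝ, IsFormOn O.atlas (O.singularSet)ᶜ γ ∧
      (∀ (c : P.atlas) (c' : O.atlas) (g), IsLocalLift π c.1 c'.1 g → ∀ x ∈ g.source,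
        π (c.1.toFun x) ∉ O.singularSet →
          μ.1 c x = (γ c'.1 (g x)).compContinuousLinearMap (fderiv ℝ g x)) ∧
      ∀ c' ∈ O.atlas, ∀ x' ∈ c'.dom, c'.toFun x' ∉ O.singularSet →
        ∃ (c : P.atlas), ∃ x ∈ c.1.dom, π (c.1.toFun x) = c'.toFun x' ∧
          ∃ f, γ c' x' = (μ.1 c x).compContinuousLinearMap f := by
  obtain ⟨σ, hσ1, hσ2⟩ := hπ.exists_inverse
  have hsymm : ∀ (c : OrbifoldChart d Y) (_ : c ∈ P.atlas) (c' : OrbifoldChart d X) (g),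
      IsLocalLift π c c' g → ∀ x ∈ g.source, π (c.toFun x) ∉ O.singularSet →
      ∃ h, IsLocalLift π c c' h ∧ x ∈ h.source ∧ h x = g x ∧ fderiv ℝ h x = fderiv ℝ g x ∧
        IsLocalLift σ c' c h.symm := by
    intro c hc c' g hg x hx hxS
    set s := c.dom ∩ c.toFun ⁻¹' (π ⁻¹' O.singularSet)ᶜ with hs
    have hso : IsOpen s := c.continuousOn_toFun.isOpen_inter_preimage c.isOpen_dom hπ.isOpen_compl
    refine ⟨g.restrOpen s hso, hg.restr hso, ⟨hx, hg.source_subset hx, hxS⟩, rfl, rfl,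
      (hg.restr hso).symm' ?_⟩
    rintro y ⟨hy, hys⟩
    have h1 : c'.toFun (g y) = π (c.toFun y) := (hg.map_eq y hy).symm
    change σ (c'.toFun (g y)) = _
    rw [h1, hσ2 _ hys.2]
  obtain ⟨γ, hγ, hγμ⟩ := (μ.isFormOn univ).exists_pullback (A := O.atlas)
    O.isClosed_singularSet.isOpen_compl (f := σ) (fun _ _ => mem_univ _)
    (fun c' hc' x' hx' hxS => by
      obtain ⟨c, hc, g, hg, x, hxg, hcx, rfl⟩ := hπ.exists_lift_to hc' hx' hxS
      obtain ⟨h, hh, hxh, hhx, -, hσh⟩ := hsymm c hc c' g hg x hxg (by rw [hcx]; exact hxS)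
      exact ⟨c, hc, h.symm, hσh, by rw [← hhx]; exact h.map_source hxh⟩)
  refine ⟨γ, hγ, fun c c' g hg x hxg hxS => ?_, fun c' hc' x' hx' hxS => ?_⟩
  · obtain ⟨h, hh, hxh, hhx, hhd, hσh⟩ := hsymm c.1 c.2 c'.1 g hg x hxg hxS
    have h1 := hγμ c'.1 c'.2 c.1 c.2 h.symm hσh (h x) (h.map_source hxh)
      (by rw [hhx, ← hg.map_eq x hxg]; exact hxS)
    rw [← hhx, ← hhd, h1, h.left_inv hxh, μ.toFamily_eq c]
    change _ = (μ.1 c x).compContinuousLinearMap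
      ((fderiv ℝ h.symm (h x)).comp (fderiv ℝ h x))
    rw [hh.fderiv_symm_comp hxh]
    rfl
  · obtain ⟨c, hc, g, hg, x, hxg, hcx, rfl⟩ := hπ.exists_lift_to hc' hx' hxS
    obtain ⟨h, hh, hxh, hhx, hhd, hσh⟩ := hsymm c hc c' g hg x hxg (by rw [hcx]; exact hxS)
    have h1 := hγμ c' hc' c hc h.symm hσh (h x) (h.map_source hxh) (by rw [hhx]; exact hxS)
    rw [h.left_inv hxh, μ.toFamily_eq ⟨c, hc⟩, hhx] at h1
    exact ⟨⟨c, hc⟩, x, hg.source_subset hxg, hcx, _, h1⟩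

/-- A form on the resolution which is flat near the exceptional set is the pullback of a flat
form. -/
theorem exists_pushforward [T1Space X] {μ : P.Form k} (hμ : IsFlatOver P O π μ) :
    ∃ α : O.Form k, O.IsFlat α ∧ AgreesWithPullback P O π (π ⁻¹' O.singularSet)ᶜ α μ := by
  choose! V hV hpV r hr using hμ
  obtain ⟨γ, hγ, hγ1, hγ2⟩ := hπ.exists_pushforward_formOn μ
  set W : X → Set X := fun p => V p ∩ (O.singularSet \ {p})ᶜ with hW
  have hWo : ∀ p ∈ O.singularSet, IsOpen (W p) := fun p hp =>
    (hV p hp).inter (O.isClosed_of_subset_singularSet sdiff_subset).isOpen_compl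
  have hWp : ∀ p ∈ O.singularSet, p ∈ W p := fun p hp => ⟨hpV p hp, fun h => h.2 rfl⟩
  have hW1 : ∀ p q, q ∈ W p → q ∈ O.singularSet → q = p := fun p q hq hq' => by
    by_contra hne
    exact hq.2 ⟨hq', hne⟩
  have hval : ∀ p ∈ O.singularSet, ∀ c ∈ O.atlas, ∀ x ∈ c.dom, c.toFun x ∈ W p →
      c.toFun x ∈ (O.singularSet)ᶜ → γ c x = flatValue _ (r p) k := by
    intro p hp c hc x hx hxW hxS
    obtain ⟨c', x', hx', hcx, f, hf⟩ := hγ2 c hc x hx hxS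
    rw [hf, hr p hp c' x' hx' (by rw [hcx]; exact hxW.1), flatValue_compContinuousLinearMap]
  obtain ⟨α, hα1, hα2⟩ := hγ.exists_extension O.isClosed_singularSet.isOpen_compl r (by
    intro p hp
    have hp : p ∈ O.singularSet := not_not.1 hp
    refine ⟨W p, hWo _ hp, hWp _ hp, ?_, ?_⟩
    · rintro p' ⟨h1, h2⟩
      rw [hW1 _ _ h1 (not_not.1 h2)]
    · intro c hc x hx hxW hxS
      exact hval _ hp c hc x hx hxW hxS)
  refine ⟨α, ?_, ?_⟩
  · rw [Orbifold.isFlat_iff]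
    refine fun p hp => ⟨W p, hWo p hp, hWp p hp, r p, fun c x hx hxW => ?_⟩
    by_cases hxS : c.1.toFun x ∈ (O.singularSet)ᶜ
    · rw [hα1 c x hx hxS]
      exact hval p hp c.1 c.2 x hx hxW hxS
    · rw [hα2 c x hx hxS, hW1 p _ hxW (not_not.1 hxS)]
  · intro c c' g hg x hxg hxS
    rw [hγ1 c c' g hg x hxg hxS, hα1 c' (g x) (hg.target_subset (g.map_source hxg))
      (by rw [← hg.map_eq x hxg]; exact hxS)]

end IsResolutionMap

/-- A locally finite union of submanifolds of positive codimension has dense complement. -/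
theorem IsSymplecticResolution.isResolutionMap {n : ℕ} {N : Type*} [TopologicalSpace N]
    [ChartedSpace (EuclideanSpace ℝ (Fin (2 * n))) N] [IsManifold (𝓡 (2 * n)) ∞ N]
    {O : Orbifold (2 * n) X} {Ω : O.Form 2} {Ω' : (Orbifold.ofManifold (2 * n) N).Form 2}
    {π : N → X} (hπ : IsSymplecticResolution O Ω Ω' π) :
    IsResolutionMap (Orbifold.ofManifold (2 * n) N) O π := by
  refine ⟨hπ.isProperMap, hπ.isDiffeoOn, ?_⟩
  obtain ⟨𝒮, hU, hlf, hsub⟩ := hπ.exceptional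
  -- a nonempty open set contains a nonempty open set disjoint from a given submanifold
  have step : ∀ S ∈ 𝒮, ∀ U : Set N, IsOpen U → U.Nonempty →
      ∃ U' ⊆ U, IsOpen U' ∧ U'.Nonempty ∧ Disjoint U' S := by
    intro S hS U hU hne
    by_cases hd : Disjoint U S
    · exact ⟨U, subset_rfl, hU, hne, hd⟩
    obtain ⟨p, hpU, hpS⟩ := not_disjoint_iff.1 hd
    obtain ⟨k, hk, -, hchart⟩ := hsub S hS
    obtain ⟨e, he, hpe, heS, -⟩ := hchart p hpS
    set i : Fin (2 * n) := ⟨k, by omega⟩ with hi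
    have hopen : IsOpen {y : EuclideanSpace ℝ (Fin (2 * n)) | y i ≠ 0} :=
      isOpen_ne_fun (by fun_prop) continuous_const
    refine ⟨U ∩ (e.source ∩ e ⁻¹' {y | y i ≠ 0}), inter_subset_left,
      hU.inter (e.isOpen_inter_preimage hopen), ?_, ?_⟩
    · have h1 : Filter.Tendsto (fun t : ℝ => e p + t • EuclideanSpace.single i (1 : ℝ)) (𝓝[≠] 0)
          (𝓝 (e p)) := by
        have : Continuous fun t : ℝ => e p + t • EuclideanSpace.single i (1 : ℝ) := by fun_prop
        simpa using (this.tendsto 0).mono_left nhdsWithin_le_nhds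
      have h2 : ∀ᶠ y in 𝓝 (e p), y ∈ e.target ∧ e.symm y ∈ U := by
        have h3 : ContinuousAt e.symm (e p) := e.continuousAt_symm (e.map_source hpe)
        filter_upwards [e.open_target.mem_nhds (e.map_source hpe),
          h3.eventually (hU.mem_nhds (by rw [e.left_inv hpe]; exact hpU))] with y hy hy'
        exact ⟨hy, hy'⟩
      obtain ⟨t, ⟨ht1, ht2⟩, ht0⟩ := ((h1.eventually h2).and self_mem_nhdsWithin).exists
      refine ⟨_, ht2, e.map_target ht1, ?_⟩
      rw [mem_preimage, e.right_inv ht1]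
      have h4 : (e p) i = 0 := (heS p hpe).1 hpS i le_rfl
      simpa [h4] using ht0
    · rw [disjoint_left]
      rintro y ⟨-, hy, hy'⟩ hyS
      exact hy' ((heS y hy).1 hyS i le_rfl)
  have stepf : ∀ F : Set (Set N), F.Finite → F ⊆ 𝒮 → ∀ U : Set N, IsOpen U → U.Nonempty →
      ∃ U' ⊆ U, IsOpen U' ∧ U'.Nonempty ∧ ∀ S ∈ F, Disjoint U' S := by
    intro F hF
    induction F, hF using Set.Finite.induction_on with
    | empty => exact fun _ U hU hne => ⟨U, subset_rfl, hU, hne, fun S hS => absurd hS (by simp)⟩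
    | @insert S F _ _ ih =>
      intro hF U hU hne
      obtain ⟨U1, hU1, hU1o, hU1n, hU1d⟩ := ih ((subset_insert _ _).trans hF) U hU hne
      obtain ⟨U2, hU2, hU2o, hU2n, hU2d⟩ := step S (hF (mem_insert _ _)) U1 hU1o hU1n
      refine ⟨U2, hU2.trans hU1, hU2o, hU2n, fun T hT => ?_⟩
      rcases hT with rfl | hT
      · exact hU2d
      · exact (hU1d T hT).mono_left hU2
  rw [dense_iff_inter_open]
  rintro U hU' ⟨p, hp⟩
  obtain ⟨t, ht, htf⟩ := hlf p
  obtain ⟨U', hUU', -, ⟨y, hy⟩, hd⟩ := stepf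
    (Subtype.val '' {S : 𝒮 | ((S : Set N) ∩ t).Nonempty}) (htf.image _)
    (by rintro _ ⟨S, -, rfl⟩; exact S.2) (U ∩ interior t) (hU'.inter isOpen_interior)
    ⟨p, hp, mem_interior_iff_mem_nhds.2 ht⟩
  refine ⟨y, (hUU' hy).1, fun hyE => ?_⟩
  rw [← hU] at hyE
  obtain ⟨S, hS, hyS⟩ := hyE
  exact disjoint_left.1 (hd S ⟨⟨S, hS⟩, ⟨y, hyS, interior_subset (hUU' hy).2⟩, rfl⟩) hy hyS

end Resolution

/-! ### Conical neighbourhoods of the singular points -/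

section Conical

variable {d : ℕ} {X : Type*} [TopologicalSpace X]

/-- A chart around the singular point `p`, with an invariant positive definite quadratic form `Q`,
normalized so that its closed unit ball is a compact subset of the chart domain. The quadratic form
is encoded as a smooth function which is homogeneous of degree two. -/
structure ConicalChart (O : Orbifold d X) (p : X) where
  chart : OrbifoldChart d X
  chart_mem : chart ∈ O.atlas
  toFun_zero : chart.toFun 0 = p
  Q : EuclideanSpace ℝ (Fin d) → ℝ
  contDiff_Q : ContDiff ℝ ∞ Q
  Q_group : ∀ g ∈ chart.group, ∀ x, Q (g x) = Q x
  Q_smul : ∀ (t : ℝ) x, Q (t • x) = t ^ 2 * Q x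
  Q_pos : ∀ x ≠ 0, 0 < Q x
  convex : Convex ℝ {x | Q x < 1}
  isCompact : IsCompact {x | Q x ≤ 1}
  subset_dom : {x | Q x ≤ 1} ⊆ chart.dom

namespace ConicalChart

variable {O : Orbifold d X} {p : X} (C : ConicalChart O p)

theorem Q_zero : C.Q 0 = 0 := by
  have := C.Q_smul 0 0
  simpa using this

theorem mem_dom {x : EuclideanSpace ℝ (Fin d)} (hx : C.Q x ≤ 1) : x ∈ C.chart.dom :=
  C.subset_dom hx

theorem isOpen_ball (t : ℝ) : IsOpen {x | C.Q x < t} :=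
  isOpen_lt C.contDiff_Q.continuous continuous_const

theorem ball_subset_dom {t : ℝ} (ht : t ≤ 1) : {x | C.Q x < t} ⊆ C.chart.dom :=
  fun _ hx => C.mem_dom (le_of_lt (lt_of_lt_of_le hx ht))

/-- The image of the ball `Q < t`. -/
def openCone (t : ℝ) : Set X := C.chart.toFun '' {x | C.Q x < t}

/-- The image of the closed ball `Q ≤ t`. -/
def closedCone (t : ℝ) : Set X := C.chart.toFun '' {x | C.Q x ≤ t}

theorem isOpen_openCone {t : ℝ} (ht : t ≤ 1) : IsOpen (C.openCone t) :=
  C.chart.isOpen_image _ (C.ball_subset_dom ht) (C.isOpen_ball t)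

theorem isCompact_closedCone {t : ℝ} (ht : t ≤ 1) : IsCompact (C.closedCone t) := by
  refine IsCompact.image_of_continuousOn ?_
    (C.chart.continuousOn_toFun.mono fun x hx => C.mem_dom (le_trans hx ht))
  exact C.isCompact.of_isClosed_subset (isClosed_le C.contDiff_Q.continuous continuous_const)
    fun x hx => le_trans hx ht

end ConicalChart

/-- Conical charts exist in every neighbourhood of a singular point: the quadratic form is the sum of
the squared norms over the group orbit, divided by `δ ^ 2` for the radius `δ` of a closed ball which
fits into the neighbourhood. -/
theorem exists_conicalChart (O : Orbifold d X) {p : X} (hp : p ∈ O.singularSet) {U : Set X}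
    (hU : IsOpen U) (hpU : p ∈ U) : ∃ C : ConicalChart O p, C.closedCone 1 ⊆ U := by
  obtain ⟨c, hc, hne, hcp⟩ := hp
  have h0 := c.zero_mem hne
  have := c.finite_group
  have := Fintype.ofFinite c.group
  have hnhds : c.dom ∩ c.toFun ⁻¹' U ∈ 𝓝 (0 : EuclideanSpace ℝ (Fin d)) :=
    Filter.inter_mem (c.isOpen_dom.mem_nhds h0)
      ((c.continuousAt_toFun h0).preimage_mem_nhds (hU.mem_nhds (by rwa [hcp])))
  obtain ⟨δ, hδ, hball⟩ := Metric.nhds_basis_closedBall.mem_iff.1 hnhds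
  set Q : EuclideanSpace ℝ (Fin d) → ℝ := fun x => (δ ^ 2)⁻¹ * ∑ g : c.group, ‖g.1 x‖ ^ 2 with hQ
  have hle : ∀ x, Q x ≤ 1 → ‖x‖ ≤ δ := by
    intro x hx
    have h1 : ‖x‖ ^ 2 ≤ ∑ g : c.group, ‖g.1 x‖ ^ 2 := by
      have h := Finset.single_le_sum (s := Finset.univ) (f := fun g : c.group => ‖g.1 x‖ ^ 2)
        (fun g _ => sq_nonneg _) (Finset.mem_univ 1)
      exact h
    have h2 : ∑ g : c.group, ‖g.1 x‖ ^ 2 ≤ δ ^ 2 := by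
      rw [hQ] at hx
      beta_reduce at hx
      rwa [inv_mul_le_iff₀ (by positivity), mul_one] at hx
    exact le_of_sq_le_sq (h1.trans h2) hδ.le
  have hcont : ContDiff ℝ ∞ Q :=
    contDiff_const.mul (ContDiff.sum fun g _ => (g.1.contDiff).norm_sq ℝ)
  have hsub : {x | Q x ≤ 1} ⊆ c.dom ∩ c.toFun ⁻¹' U := fun x hx =>
    hball (by simpa using hle x hx)
  refine ⟨⟨c, hc, hcp, Q, hcont, ?_, ?_, ?_, ?_, ?_, fun x hx => (hsub hx).1⟩, ?_⟩
  · intro g hg x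
    rw [hQ]
    beta_reduce
    congr 1
    exact Equiv.sum_comp (Equiv.mulRight (⟨g, hg⟩ : c.group)) fun g : c.group => ‖g.1 x‖ ^ 2
  · intro t x
    simp only [hQ, map_smul, norm_smul, mul_pow, Real.norm_eq_abs, sq_abs, ← Finset.mul_sum]
    ring
  · intro x hx
    refine mul_pos (by positivity) (Finset.sum_pos (fun g _ => ?_) ⟨1, Finset.mem_univ _⟩)
    have : g.1 x ≠ 0 := (map_ne_zero_iff _ g.1.injective).2 hx
    positivity
  · have h1 : ConvexOn ℝ univ fun x => ∑ g : c.group, ‖g.1 x‖ ^ 2 := by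
      have h2 : ∀ g : c.group, ConvexOn ℝ univ fun x : EuclideanSpace ℝ (Fin d) => ‖g.1 x‖ ^ 2 :=
        fun g => ((convexOn_univ_norm (E := EuclideanSpace ℝ (Fin d))).comp_linearMap
          (g.1 : EuclideanSpace ℝ (Fin d) →ₗ[ℝ] EuclideanSpace ℝ (Fin d))).pow
            (fun x _ => norm_nonneg _) 2
      have h3 : ∀ s : Finset c.group, ConvexOn ℝ univ fun x => ∑ g ∈ s, ‖g.1 x‖ ^ 2 := by
        intro s
        classical
        induction s using Finset.induction_on with
        | empty => simpa using convexOn_const (0 : ℝ) (convex_univ (E := EuclideanSpace ℝ (Fin d)))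
        | insert g s hg ih =>
          simp only [Finset.sum_insert hg]
          exact (h2 g).add ih
      exact h3 Finset.univ
    have h4 : ConvexOn ℝ univ Q := h1.smul (by positivity)
    simpa using h4.convex_lt 1
  · refine (isCompact_closedBall (0 : EuclideanSpace ℝ (Fin d)) δ).of_isClosed_subset
      (isClosed_le hcont.continuous continuous_const) fun x hx => ?_
    simpa using hle x hx
  · rintro _ ⟨x, hx, rfl⟩
    exact (hsub hx).2

/-- Disjoint conical neighbourhoods of all singular points, locally finite and contained in `𝒱`. -/
structure ConicalSystem (O : Orbifold d X) (𝒱 : Set X) where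
  cone : ∀ p : O.singularSet, ConicalChart O p.1
  disjoint : Pairwise fun p q => Disjoint ((cone p).closedCone 1) ((cone q).closedCone 1)
  locallyFinite : LocallyFinite fun p => (cone p).closedCone 1
  subset : ∀ p, (cone p).closedCone 1 ⊆ 𝒱

theorem exists_conicalSystem [T2Space X] [ParacompactSpace X] (O : Orbifold d X)
    {V : X → Set X} (hV : IsSmallNeighbourhoodSystem O V) {𝒱 : Set X} (h𝒱 : IsOpen 𝒱)
    (hΔ : O.singularSet ⊆ 𝒱) : Nonempty (ConicalSystem O 𝒱) := by
  obtain ⟨v, hvo, hvc, hvf, hvu⟩ := precise_refinement_set O.isClosed_singularSet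
    (fun p : O.singularSet => (O.singularSet \ {p.1})ᶜ)
    (fun p => (O.isClosed_of_subset_singularSet sdiff_subset).isOpen_compl)
    (fun p hp => mem_iUnion.2 ⟨⟨p, hp⟩, fun h => h.2 rfl⟩)
  have hpv : ∀ p : O.singularSet, p.1 ∈ v p := by
    intro p
    obtain ⟨q, hq⟩ := mem_iUnion.1 (hvc p.2)
    have h1 : p = q := by
      by_contra hne
      exact hvu q hq ⟨p.2, fun h => hne (Subtype.ext h)⟩
    rwa [← h1] at hq
  choose C hC using fun p : O.singularSet => exists_conicalChart O p.2
    ((((hV.1 p.1 p.2).1).inter (hvo p)).inter h𝒱) ⟨⟨(hV.1 p.1 p.2).2.1, hpv p⟩, hΔ p.2⟩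
  refine ⟨⟨C, fun p q hpq => ?_, hvf.subset fun p => (hC p).trans fun x hx => hx.1.2,
    fun p => (hC p).trans inter_subset_right⟩⟩
  have h1 : Disjoint (V p.1) (V q.1) := hV.2 p.2 q.2 fun h => hpq (Subtype.ext h)
  exact h1.mono ((hC p).trans fun x hx => hx.1.1) ((hC q).trans fun x hx => hx.1.1)

namespace ConicalSystem

variable {O : Orbifold d X} {𝒱 : Set X} (𝒞 : ConicalSystem O 𝒱)

/-- The union of the open cones of radius `t`. -/
def openNhd (t : ℝ) : Set X := ⋃ p, (𝒞.cone p).openCone t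

/-- The union of the closed cones of radius `t`. -/
def closedNhd (t : ℝ) : Set X := ⋃ p, (𝒞.cone p).closedCone t

theorem isOpen_openNhd {t : ℝ} (ht : t ≤ 1) : IsOpen (𝒞.openNhd t) :=
  isOpen_iUnion fun p => (𝒞.cone p).isOpen_openCone ht

theorem isClosed_closedNhd [T2Space X] {t : ℝ} (ht : t ≤ 1) : IsClosed (𝒞.closedNhd t) := by
  refine LocallyFinite.isClosed_iUnion (𝒞.locallyFinite.subset fun p => ?_)
    fun p => ((𝒞.cone p).isCompact_closedCone ht).isClosed
  exact image_mono fun x hx => le_trans hx ht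

theorem closedNhd_subset_openNhd {s t : ℝ} (h : s < t) : 𝒞.closedNhd s ⊆ 𝒞.openNhd t :=
  iUnion_mono fun _ => image_mono fun _ hx => lt_of_le_of_lt hx h

theorem openNhd_subset {t : ℝ} (ht : t ≤ 1) : 𝒞.openNhd t ⊆ 𝒱 :=
  iUnion_subset fun p => (image_mono fun _ hx => (lt_of_lt_of_le hx ht).le).trans (𝒞.subset p)

theorem mem_openNhd (p : O.singularSet) {t : ℝ} (ht : 0 < t) : p.1 ∈ 𝒞.openNhd t :=
  mem_iUnion.2 ⟨p, 0, by rw [mem_ofPred_eq, ConicalChart.Q_zero]; exact ht,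
    (𝒞.cone p).toFun_zero⟩

theorem eq_of_mem {p q : O.singularSet} {x : X} (hx : x ∈ (𝒞.cone p).closedCone 1)
    (hx' : x ∈ (𝒞.cone q).closedCone 1) : p = q := by
  by_contra h
  exact disjoint_left.1 (𝒞.disjoint h) hx hx'

/-- The chart of a conical neighbourhood, restricted to the open unit ball of `Q`. -/
def _root_.ConicalChart.unitChart {p : X} (C : ConicalChart O p) : OrbifoldChart d X where
  dom := {x | C.Q x < 1}
  isOpen_dom := C.isOpen_ball 1
  group := C.chart.group
  finite_group := C.chart.finite_group
  mapsTo g hg x hx := by rw [mem_ofPred_eq, C.Q_group g hg]; exact hx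
  eq_zero_of_fixed g hg hg1 x hx := C.chart.eq_zero_of_fixed g hg hg1 x
    (C.ball_subset_dom le_rfl hx)
  zero_mem _ := by rw [mem_ofPred_eq, C.Q_zero]; exact one_pos
  toFun := C.chart.toFun
  continuousOn_toFun := C.chart.continuousOn_toFun.mono (C.ball_subset_dom le_rfl)
  isOpen_image s hs := C.chart.isOpen_image s (hs.trans (C.ball_subset_dom le_rfl))
  toFun_eq_iff x hx y hy :=
    C.chart.toFun_eq_iff x (C.ball_subset_dom le_rfl hx) y (C.ball_subset_dom le_rfl hy)

/-- A lift of the identity to the unit chart. -/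
theorem exists_lift_unitChart {c : OrbifoldChart d X} (hc : c ∈ O.atlas)
    {x : EuclideanSpace ℝ (Fin d)} (hx : x ∈ c.dom) {p : O.singularSet}
    {y : EuclideanSpace ℝ (Fin d)} (hy : (𝒞.cone p).Q y < 1)
    (hxy : c.toFun x = (𝒞.cone p).chart.toFun y) :
    ∃ h, IsLocalLift id c (𝒞.cone p).unitChart h ∧ x ∈ h.source ∧ h x = y := by
  obtain ⟨h, hh, hxh, hhx⟩ := O.compatible c hc _ (𝒞.cone p).chart_mem x hx y
    ((𝒞.cone p).mem_dom hy.le) hxy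
  have hso : IsOpen (h.source ∩ h ⁻¹' {y | (𝒞.cone p).Q y < 1}) :=
    h.isOpen_inter_preimage ((𝒞.cone p).isOpen_ball 1)
  have hr := hh.restr hso
  refine ⟨h.restrOpen _ hso, ⟨hr.source_subset, ?_, hr.contDiffOn, hr.contDiffOn_symm, hr.map_eq⟩,
    ⟨hxh, hxh, by rw [mem_preimage, hhx]; exact hy⟩, hhx⟩
  rintro z ⟨hz, -, hz'⟩
  rw [mem_preimage, h.right_inv hz] at hz'
  exact hz'

/-- Invariant forms on the balls of the conical charts, vanishing near the boundaries of the balls,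
define a global form. -/
theorem exists_assemble [T2Space X] {k : ℕ}
    (ν : O.singularSet → EuclideanSpace ℝ (Fin d) → EuclideanSpace ℝ (Fin d) [⋀^Fin k]→L[ℝ] ℝ)
    (hν : ∀ p, ContDiffOn ℝ ∞ (ν p) {x | (𝒞.cone p).Q x < 1})
    (hνg : ∀ p, ∀ g ∈ (𝒞.cone p).chart.group, ∀ x, (𝒞.cone p).Q x < 1 →
      ν p x = (ν p (g x)).compContinuousLinearMap (g : _ →L[ℝ] _))
    {t : ℝ} (ht : t < 1) (hνt : ∀ p, ∀ x, t < (𝒞.cone p).Q x → (𝒞.cone p).Q x < 1 → ν p x = 0) :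
    ∃ T : O.Form k, (∀ p : O.singularSet, ∀ x, (𝒞.cone p).Q x < 1 →
        T.1 ⟨(𝒞.cone p).chart, (𝒞.cone p).chart_mem⟩ x = ν p x) ∧
      ∀ c : O.atlas, ∀ x ∈ c.1.dom, c.1.toFun x ∉ 𝒞.closedNhd t → T.1 c x = 0 := by
  classical
  set B : Set (OrbifoldChart d X) := range fun p => (𝒞.cone p).unitChart with hB
  have hinj : ∀ p q, (𝒞.cone p).unitChart = (𝒞.cone q).unitChart → p = q := fun p q h =>
    Subtype.ext ((𝒞.cone p).toFun_zero.symm.trans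
      ((congrArg (fun c => c.toFun 0) h).trans (𝒞.cone q).toFun_zero))
  set α : OrbifoldChart d X → EuclideanSpace ℝ (Fin d) →
      EuclideanSpace ℝ (Fin d) [⋀^Fin k]→L[ℝ] ℝ :=
    fun c => if h : ∃ p, (𝒞.cone p).unitChart = c then ν h.choose else 0 with hα
  have hαp : ∀ p, α (𝒞.cone p).unitChart = ν p := by
    intro p
    have h : ∃ q, (𝒞.cone q).unitChart = (𝒞.cone p).unitChart := ⟨p, rfl⟩
    rw [hα]
    beta_reduce
    rw [dif_pos h, hinj _ _ h.choose_spec]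
  -- the local lifts between the conical charts are given by the group, so invariance is
  -- compatibility
  have hαB : IsFormOn B (𝒞.openNhd 1) α := by
    refine ⟨?_, ?_⟩
    · rintro _ ⟨p, rfl⟩ x hx -
      beta_reduce
      rw [hαp]
      exact (hν p).contDiffAt (((𝒞.cone p).isOpen_ball 1).mem_nhds hx)
    · rintro _ ⟨p, rfl⟩ _ ⟨q, rfl⟩ h hh x hx -
      beta_reduce at hh ⊢
      have hx1 : (𝒞.cone p).Q x < 1 := hh.source_subset hx
      have hx2 : (𝒞.cone q).Q (h x) < 1 := hh.target_subset (h.map_source hx)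
      obtain rfl : p = q := 𝒞.eq_of_mem ⟨x, hx1.le, rfl⟩ ⟨h x, hx2.le, (hh.map_eq x hx).symm⟩
      obtain ⟨g, hg, hgx, hgd⟩ := hh.exists_group_eq hx
      rw [hαp, hgd, ← hgx]
      exact hνg p g hg x hx1
  obtain ⟨β, hβ, hβα⟩ := hαB.exists_pullback (A := O.atlas) (𝒞.isOpen_openNhd le_rfl) (f := id)
    (mapsTo_id _) (fun c hc x hx hxW => by
      obtain ⟨p, y, hy, hyx⟩ := mem_iUnion.1 hxW
      obtain ⟨h, hh, hxh, -⟩ := 𝒞.exists_lift_unitChart hc hx hy hyx.symm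
      exact ⟨_, ⟨p, rfl⟩, h, hh, hxh⟩)
  have hval : ∀ c ∈ O.atlas, ∀ x ∈ c.dom, c.toFun x ∈ 𝒞.openNhd 1 → c.toFun x ∉ 𝒞.closedNhd t →
      β c x = 0 := by
    intro c hc x hx hxW hxK
    obtain ⟨p, y, hy, hyx⟩ := mem_iUnion.1 hxW
    obtain ⟨h, hh, hxh, hhx⟩ := 𝒞.exists_lift_unitChart hc hx hy hyx.symm
    rw [hβα c hc _ ⟨p, rfl⟩ h hh x hxh hxW, hαp, hhx, hνt p y ?_ hy]
    · rfl
    · by_contra! hle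
      exact hxK (mem_iUnion.2 ⟨p, y, hle, hyx⟩)
  obtain ⟨T, hT1, hT2⟩ := hβ.exists_extension (𝒞.isOpen_openNhd le_rfl) (fun _ => 0) (by
    intro q hq
    refine ⟨(𝒞.closedNhd t)ᶜ, (𝒞.isClosed_closedNhd ht.le).isOpen_compl,
      fun h => hq (𝒞.closedNhd_subset_openNhd ht h), fun _ _ => rfl, ?_⟩
    intro c hc x hx hxK hxW
    rw [flatValue_zero]
    exact hval c hc x hx hxW hxK)
  refine ⟨T, fun p x hx => ?_, fun c x hx hxK => ?_⟩
  · have hxd := (𝒞.cone p).mem_dom hx.le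
    have hxW : (𝒞.cone p).chart.toFun x ∈ 𝒞.openNhd 1 := mem_iUnion.2 ⟨p, x, hx, rfl⟩
    rw [hT1 ⟨(𝒞.cone p).chart, (𝒞.cone p).chart_mem⟩ x hxd hxW]
    have hl : IsLocalLift id (𝒞.cone p).chart (𝒞.cone p).unitChart
        (OpenPartialHomeomorph.ofSet _ ((𝒞.cone p).isOpen_ball 1)) :=
      ⟨(𝒞.cone p).ball_subset_dom le_rfl, subset_rfl, contDiffOn_id, contDiffOn_id,
        fun _ _ => rfl⟩
    rw [hβα _ (𝒞.cone p).chart_mem _ ⟨p, rfl⟩ _ hl x hx hxW, hαp]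
    have h1 : fderiv ℝ (OpenPartialHomeomorph.ofSet _ ((𝒞.cone p).isOpen_ball 1)) x =
        ContinuousLinearMap.id ℝ _ := fderiv_id
    rw [h1]
    rfl
  · by_cases hxW : c.1.toFun x ∈ 𝒞.openNhd 1
    · rw [hT1 c x hx hxW]
      exact hval c.1 c.2 x hx hxW hxK
    · rw [hT2 c x hx hxW, flatValue_zero]

end ConicalSystem

end Conical

/-! ### Averaging over a finite linear group -/

section Average

variable {V : Type} [NormedAddCommGroup V] [NormedSpace ℝ V]

theorem extDeriv_finset_sum {ι : Type*} (s : Finset ι) {k : ℕ} {ν : ι → V → V [⋀^Fin k]→L[ℝ] ℝ}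
    {x : V} (h : ∀ i ∈ s, DifferentiableAt ℝ (ν i) x) :
    extDeriv (fun y => ∑ i ∈ s, ν i y) x = ∑ i ∈ s, extDeriv (ν i) x := by
  rw [extDeriv, fderiv_fun_sum h]
  exact map_sum (ContinuousAlternatingMap.alternatizeUncurryFinCLM ℝ V ℝ) _ _

/-- The mean over a finite group of the pullbacks of a primitive of an invariant form is an
invariant primitive. -/
theorem exists_invariant_primitive [FiniteDimensional ℝ V] {G : Subgroup (V ≃L[ℝ] V)}
    (hGfin : Finite G) {U : Set V} (hU : IsOpen U) (hG : ∀ g ∈ G, ∀ x ∈ U, g x ∈ U) {k : ℕ}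
    {ν : V → V [⋀^Fin k]→L[ℝ] ℝ} (hν : ContDiffOn ℝ ∞ ν U) {θ : V → V [⋀^Fin (k + 1)]→L[ℝ] ℝ}
    (hνθ : ∀ x ∈ U, extDeriv ν x = θ x)
    (hθ : ∀ g ∈ G, ∀ x ∈ U, θ x = (θ (g x)).compContinuousLinearMap (g : V →L[ℝ] V)) :
    ∃ ν' : V → V [⋀^Fin k]→L[ℝ] ℝ, ContDiffOn ℝ ∞ ν' U ∧ (∀ x ∈ U, extDeriv ν' x = θ x) ∧
      ∀ g ∈ G, ∀ x ∈ U, ν' x = (ν' (g x)).compContinuousLinearMap (g : V →L[ℝ] V) := by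
  have := Fintype.ofFinite G
  have hsm : ∀ g : G, ∀ x ∈ U, ContDiffAt ℝ ∞
      (fun y => (ν (g.1 y)).compContinuousLinearMap (g.1 : V →L[ℝ] V)) x := fun g x hx =>
    ((hν.contDiffAt (hU.mem_nhds (hG g.1 g.2 x hx))).comp x
      g.1.contDiff.contDiffAt).compContinuousLinearMap_alternating contDiffAt_const
  have hd : ∀ g : G, ∀ x ∈ U, extDeriv
      (fun y => (ν (g.1 y)).compContinuousLinearMap (g.1 : V →L[ℝ] V)) x = θ x := by
    intro g x hx
    have h1 : (fun y => (ν (g.1 y)).compContinuousLinearMap (g.1 : V →L[ℝ] V)) =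
        fun y => (ν (g.1 y)).compContinuousLinearMap (fderiv ℝ g.1 y) := by
      ext1 y
      rw [g.1.fderiv]
    rw [h1, extDeriv_pullback (hν.differentiableAt_of_isOpen hU (hG g.1 g.2 x hx))
      g.1.contDiff.contDiffAt (by simpa using Orbifold.two_le_infty),
      hνθ _ (hG g.1 g.2 x hx), g.1.fderiv]
    exact (hθ g.1 g.2 x hx).symm
  have hcard : (Fintype.card G : ℝ) ≠ 0 := Nat.cast_ne_zero.2 Fintype.card_ne_zero
  refine ⟨fun x => (Fintype.card G : ℝ)⁻¹ •
    ∑ g : G, (ν (g.1 x)).compContinuousLinearMap (g.1 : V →L[ℝ] V), ?_, ?_, ?_⟩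
  · exact fun x hx => ((ContDiffAt.sum fun g _ => hsm g x hx).const_smul _).contDiffWithinAt
  · intro x hx
    refine (extDeriv_smul (Fintype.card G : ℝ)⁻¹ fun x =>
      ∑ g : G, (ν (g.1 x)).compContinuousLinearMap (g.1 : V →L[ℝ] V)).trans ?_
    rw [extDeriv_finset_sum _ fun g _ =>
      (hsm g x hx).differentiableAt (by simp), Finset.sum_congr rfl fun g _ => hd g x hx,
      Finset.sum_const, Finset.card_univ, ← Nat.cast_smul_eq_nsmul ℝ, inv_smul_smul₀ hcard]
  · intro g hg x hx
    ext v
    change (Fintype.card G : ℝ)⁻¹ * (∑ g : G, (ν (g.1 x)).compContinuousLinearMap _) v =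
      (Fintype.card G : ℝ)⁻¹ * (∑ g' : G, (ν (g'.1 (g x))).compContinuousLinearMap _)
        fun i => g (v i)
    rw [ContinuousAlternatingMap.sum_apply, ContinuousAlternatingMap.sum_apply]
    refine congrArg _ ?_
    exact (Equiv.sum_comp (Equiv.mulRight (⟨g, hg⟩ : G)) fun g : G =>
      (ν (g.1 x)).compContinuousLinearMap (g.1 : V →L[ℝ] V) v).symm

end Average

/-! ### Radial forms -/

section Radial

variable {k : ℕ}

local notation "𝔼" => EuclideanSpace ℝ (Fin (k + 1))

/-- The wedge product of a linear form with a top degree form vanishes; contracting this identity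
with `x` relates `dH ∧ ι_x vol` and `dH(x) vol`. -/
theorem sum_linear_mul_curryLeft (vol : 𝔼 [⋀^Fin (k + 1)]→L[ℝ] ℝ) (l : 𝔼 →L[ℝ] ℝ) (x : 𝔼)
    (v : Fin (k + 1) → 𝔼) :
    ∑ i : Fin (k + 1), (-1 : ℤ) ^ (i : ℕ) • (l (v i) * vol (Matrix.vecCons x (i.removeNth v))) =
      l x * vol v := by
  have h0 : ContinuousAlternatingMap.alternatizeUncurryFin (l.smulRight vol)
      (Matrix.vecCons x v) = 0 := by
    refine AlternatingMap.map_linearDependent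
      (ContinuousAlternatingMap.alternatizeUncurryFin (l.smulRight vol)).toAlternatingMap _ ?_
    intro hli
    have := hli.fintype_card_le_finrank
    simp at this
  rw [ContinuousAlternatingMap.alternatizeUncurryFin_apply, Fin.sum_univ_succ] at h0
  have h1 : ∀ i : Fin (k + 1), (-1 : ℤ) ^ ((i.succ : Fin (k + 2)) : ℕ) •
      (l.smulRight vol (Matrix.vecCons x v i.succ)) (i.succ.removeNth (Matrix.vecCons x v)) =
      -((-1 : ℤ) ^ (i : ℕ) • (l (v i) * vol (Matrix.vecCons x (i.removeNth v)))) := by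
    intro i
    have h2 : i.succ.removeNth (Matrix.vecCons x v) = Matrix.vecCons x (i.removeNth v) := by
      ext1 j
      refine Fin.cases ?_ (fun j => ?_) j
      · rfl
      · simp [Fin.removeNth, Matrix.vecCons]
    rw [h2, Fin.val_succ, pow_succ, mul_neg_one, neg_smul]
    rfl
  rw [Finset.sum_congr rfl fun i _ => h1 i, Finset.sum_neg_distrib] at h0
  have h3 : (-1 : ℤ) ^ ((0 : Fin (k + 2)) : ℕ) • (l.smulRight vol (Matrix.vecCons x v 0))
      ((0 : Fin (k + 2)).removeNth (Matrix.vecCons x v)) = l x * vol v := by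
    rw [Fin.val_zero, pow_zero, one_smul]
    rfl
  rw [h3] at h0
  linarith

/-- `d(H ι_x vol) = ((k + 1) H + dH(x)) vol`. -/
theorem extDeriv_smul_curryLeft (vol : 𝔼 [⋀^Fin (k + 1)]→L[ℝ] ℝ) {H : 𝔼 → ℝ} {x : 𝔼}
    (hH : DifferentiableAt ℝ H x) :
    extDeriv (fun y => H y • vol.curryLeft y) x =
      ((k + 1 : ℝ) * H x + fderiv ℝ H x x) • vol := by
  rw [extDeriv, fderiv_fun_smul hH vol.curryLeft.differentiableAt, ContinuousLinearMap.fderiv,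
    ContinuousAlternatingMap.alternatizeUncurryFin_add,
    ContinuousAlternatingMap.alternatizeUncurryFin_smul,
    ContinuousAlternatingMap.alternatizeUncurryFin_curryLeft]
  ext v
  refine (congrArg₂ (· + ·) (?_ : _ = (k + 1 : ℝ) * H x * vol v)
    (?_ : _ = fderiv ℝ H x x * vol v)).trans (add_mul _ _ _).symm
  · change H x * ((k + 1) • vol) v = _
    rw [ContinuousAlternatingMap.smul_apply, nsmul_eq_mul]
    push_cast
    ring
  · refine (ContinuousAlternatingMap.alternatizeUncurryFin_apply _ _).trans ?_
    exact sum_linear_mul_curryLeft vol (fderiv ℝ H x) x v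

/-- For `Q` homogeneous of degree two, `d(f(Q) Q^{-n} ι_x vol) = 2 f'(Q) Q^{1-n} vol` in
dimension `2n`. -/
theorem extDeriv_comp_smul_curryLeft (vol : 𝔼 [⋀^Fin (k + 1)]→L[ℝ] ℝ) {Q : 𝔼 → ℝ} {x : 𝔼}
    (hQ : ContDiff ℝ ∞ Q) (hQt : ∀ (t : ℝ) x, Q (t • x) = t ^ 2 * Q x) (hx : 0 < Q x) {n : ℕ}
    (hn : k + 1 = 2 * n) {f : ℝ → ℝ} (hf : DifferentiableAt ℝ f (Q x)) :
    extDeriv (fun y => (f (Q y) * (Q y ^ n)⁻¹) • vol.curryLeft y) x =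
      (2 * Q x * (Q x ^ n)⁻¹ * deriv f (Q x)) • vol := by
  have hQd : DifferentiableAt ℝ Q x := hQ.differentiable (by simp) x
  have hQx : fderiv ℝ Q x x = 2 * Q x := by
    have h1 : HasDerivAt (fun t : ℝ => Q (t • x)) (fderiv ℝ Q x x) 1 := by
      have h2 : HasFDerivAt Q (fderiv ℝ Q x) ((1 : ℝ) • x) := by
        rw [one_smul]; exact hQd.hasFDerivAt
      have h3 : HasDerivAt (fun t : ℝ => t • x) x 1 := by
        simpa using (hasDerivAt_id (1 : ℝ)).smul_const x
      exact h2.comp_hasDerivAt 1 h3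
    have h4 : HasDerivAt (fun t : ℝ => Q (t • x)) (2 * Q x) 1 := by
      simp only [hQt]
      simpa using ((hasDerivAt_pow 2 (1 : ℝ)).mul_const (Q x))
    exact h1.unique h4
  set F : ℝ → ℝ := fun t => f t * (t ^ n)⁻¹ with hF
  have hF' : HasDerivAt F (deriv f (Q x) * (Q x ^ n)⁻¹ +
      f (Q x) * (-(n * Q x ^ (n - 1)) / (Q x ^ n) ^ 2)) (Q x) :=
    hf.hasDerivAt.mul ((hasDerivAt_pow n (Q x)).inv (pow_pos hx n).ne')
  have hH : HasFDerivAt (fun y => F (Q y)) _ x := hF'.comp_hasFDerivAt x hQd.hasFDerivAt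
  have h5 := extDeriv_smul_curryLeft vol hH.differentiableAt
  refine h5.trans (congrArg (· • vol) ?_)
  rw [hH.fderiv, hF]
  simp only [smul_apply, smul_eq_mul, hQx]
  have hk : (k + 1 : ℝ) = 2 * n := by exact_mod_cast hn
  obtain ⟨n, rfl⟩ : ∃ n', n = n' + 1 := ⟨n - 1, by omega⟩
  rw [hk]
  have := hx.ne'
  rw [Nat.add_sub_cancel]
  field_simp
  push_cast
  ring

end Radial

/-! ### Flat representatives of classes near the singular points -/

section Flatten

variable {d : ℕ} {X : Type*} [TopologicalSpace X] {O : Orbifold d X} {k : ℕ}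

namespace Orbifold.Form

theorem eq_comp_group (α : O.Form k) (c : O.atlas) {g} (hg : g ∈ c.1.group)
    {x : EuclideanSpace ℝ (Fin d)} (hx : x ∈ c.1.dom) :
    α.1 c x = (α.1 c (g x)).compContinuousLinearMap (g : _ →L[ℝ] _) := by
  obtain ⟨h, hh, hs, hhg⟩ := IsLocalLift.exists_group c.1 hg
  have h1 : (h : EuclideanSpace ℝ (Fin d) → EuclideanSpace ℝ (Fin d)) = g := funext hhg
  have h2 := α.2.2.2 c c h hh x (by rw [hs]; exact hx)
  rwa [h1, g.fderiv] at h2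

/-- Whether a form vanishes at a point can be tested in any chart. -/
theorem eq_zero_of_toFun_eq (α : O.Form k) (c c' : O.atlas) {x x' : EuclideanSpace ℝ (Fin d)}
    (hx : x ∈ c.1.dom) (hx' : x' ∈ c'.1.dom) (hxx' : c.1.toFun x = c'.1.toFun x')
    (h : α.1 c' x' = 0) : α.1 c x = 0 := by
  obtain ⟨l, hl, hxl, hlx⟩ := O.compatible c.1 c.2 c'.1 c'.2 x hx x' hx' hxx'
  rw [α.2.2.2 c c' l hl x hxl, hlx, h]
  rfl

theorem extD_eq_zero_of_eq_zero {α : O.Form k} {V : Set X} (hV : IsOpen V)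
    (h : ∀ (c : O.atlas), ∀ x ∈ c.1.dom, c.1.toFun x ∈ V → α.1 c x = 0)
    (c : O.atlas) {x : EuclideanSpace ℝ (Fin d)} (hx : x ∈ c.1.dom) (hxV : c.1.toFun x ∈ V) :
    (O.extD k α).1 c x = 0 :=
  Orbifold.extD_eq_zero_of_eq_flatValue hV (r := 0)
    (fun c x hx hxV => by rw [flatValue_zero]; exact h c x hx hxV) hx hxV

end Orbifold.Form

/-- A smooth function on the line which is `1` for `t ≤ a` and `0` for `b ≤ t`. -/
def cutoff (a b t : ℝ) : ℝ := Real.smoothTransition ((b - t) / (b - a))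

theorem contDiff_cutoff (a b : ℝ) : ContDiff ℝ ∞ (cutoff a b) :=
  Real.smoothTransition.contDiff.comp ((contDiff_const.sub contDiff_id).div_const _)

theorem cutoff_eq_one {a b t : ℝ} (hab : a < b) (ht : t ≤ a) : cutoff a b t = 1 :=
  Real.smoothTransition.one_of_one_le ((one_le_div (sub_pos.2 hab)).2 (by linarith))

theorem cutoff_eq_zero {a b t : ℝ} (hab : a < b) (ht : b ≤ t) : cutoff a b t = 0 :=
  Real.smoothTransition.zero_of_nonpos
    (div_nonpos_of_nonpos_of_nonneg (by linarith) (by linarith))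

theorem antitone_cutoff {a b : ℝ} (hab : a < b) : Antitone (cutoff a b) := fun s t hst =>
  Real.smoothTransition.monotone (div_le_div_of_nonneg_right (by linarith) (by linarith))

namespace ConicalSystem

variable {𝒱 : Set X} (𝒞 : ConicalSystem O 𝒱)

/-- The chart of a conical neighbourhood, as an element of the atlas. -/
def chartAt (p : O.singularSet) : O.atlas := ⟨(𝒞.cone p).chart, (𝒞.cone p).chart_mem⟩

theorem eq_zero_of_mem_openCone (β : O.Form k) (p : O.singularSet) {t : ℝ} (ht : t ≤ 1)
    (h : ∀ y, (𝒞.cone p).Q y < t → β.1 (𝒞.chartAt p) y = 0) (c : O.atlas)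
    {x : EuclideanSpace ℝ (Fin d)} (hx : x ∈ c.1.dom)
    (hxV : c.1.toFun x ∈ (𝒞.cone p).openCone t) : β.1 c x = 0 := by
  obtain ⟨y, hy, hyx⟩ := hxV
  exact β.eq_zero_of_toFun_eq c (𝒞.chartAt p) hx ((𝒞.cone p).ball_subset_dom ht hy) hyx.symm
    (h y hy)

theorem isFlat_of_eq_zero (β : O.Form k) {t : ℝ} (ht0 : 0 < t) (ht : t ≤ 1)
    (h : ∀ p, ∀ y, (𝒞.cone p).Q y < t → β.1 (𝒞.chartAt p) y = 0) : O.IsFlat β := by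
  rw [Orbifold.isFlat_iff]
  intro p hp
  refine ⟨(𝒞.cone ⟨p, hp⟩).openCone t, (𝒞.cone ⟨p, hp⟩).isOpen_openCone ht,
    ⟨0, by rw [mem_ofPred_eq, ConicalChart.Q_zero]; exact ht0, (𝒞.cone ⟨p, hp⟩).toFun_zero⟩, 0,
    fun c x hx hxV => ?_⟩
  rw [flatValue_zero]
  exact 𝒞.eq_zero_of_mem_openCone β ⟨p, hp⟩ ht (h _) c hx hxV

/-- An invariant form on the ball of one conical chart, vanishing near the boundary of the ball,
extends by zero to a global form. -/
theorem exists_assemble_single [T2Space X] (p : O.singularSet)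
    {ν : EuclideanSpace ℝ (Fin d) → EuclideanSpace ℝ (Fin d) [⋀^Fin k]→L[ℝ] ℝ}
    (hν : ContDiffOn ℝ ∞ ν {x | (𝒞.cone p).Q x < 1})
    (hνg : ∀ g ∈ (𝒞.cone p).chart.group, ∀ x, (𝒞.cone p).Q x < 1 →
      ν x = (ν (g x)).compContinuousLinearMap (g : _ →L[ℝ] _))
    {t : ℝ} (ht : t < 1) (hνt : ∀ x, t < (𝒞.cone p).Q x → (𝒞.cone p).Q x < 1 → ν x = 0) :
    ∃ T : O.Form k, (∀ x, (𝒞.cone p).Q x < 1 → T.1 (𝒞.chartAt p) x = ν x) ∧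
      ∀ c : O.atlas, ∀ x ∈ c.1.dom, c.1.toFun x ∉ (𝒞.cone p).closedCone t → T.1 c x = 0 := by
  classical
  obtain ⟨T, hT1, hT2⟩ := 𝒞.exists_assemble (k := k) (fun q => if q = p then ν else 0)
    (fun q => by
      by_cases h : q = p
      · subst h; rw [if_pos rfl]; exact hν
      · rw [if_neg h]; exact contDiffOn_const)
    (fun q g hg x hx => by
      by_cases h : q = p
      · subst h; rw [if_pos rfl]; exact hνg g hg x hx
      · rw [if_neg h]; rfl) ht
    (fun q x hx hx' => by
      by_cases h : q = p
      · subst h; rw [if_pos rfl]; exact hνt x hx hx'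
      · rw [if_neg h]; rfl)
  refine ⟨T, fun x hx => (hT1 p x hx).trans (by rw [if_pos rfl]),
    fun c x hx hxK => ?_⟩
  by_cases hxt : c.1.toFun x ∈ 𝒞.closedNhd t
  · obtain ⟨q, y, hy, hyx⟩ := mem_iUnion.1 hxt
    have hqp : q ≠ p := by
      rintro rfl
      exact hxK ⟨y, hy, hyx⟩
    have hy1 : (𝒞.cone q).Q y < 1 := lt_of_le_of_lt hy ht
    refine T.eq_zero_of_toFun_eq c (𝒞.chartAt q) hx ((𝒞.cone q).mem_dom hy1.le) hyx.symm ?_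
    refine (hT1 q y hy1).trans ?_
    rw [if_neg hqp]
    rfl
  · exact hT2 c x hx hxt

end ConicalSystem

theorem Orbifold.extDeriv_eq_zero_of_extD {α : O.Form k} {c : O.atlas}
    {x : EuclideanSpace ℝ (Fin d)} (hx : x ∈ c.1.dom) (h : (O.extD k α).1 c x = 0) :
    extDeriv (α.1 c) x = 0 := by
  rwa [O.extD_apply α c hx] at h

/-- A function whose differential vanishes near the singular points is constant near each of
them. -/
theorem Orbifold.isFlat_of_extD_eq_zero (α : O.Form 0) {𝒱 : Set X} (h𝒱 : IsOpen 𝒱)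
    (hΔ : O.singularSet ⊆ 𝒱)
    (hα : ∀ c : O.atlas, ∀ x ∈ c.1.dom, c.1.toFun x ∈ 𝒱 → (O.extD 0 α).1 c x = 0) :
    O.IsFlat α := by
  rw [Orbifold.isFlat_iff]
  rintro p hp
  have hp' := hp
  obtain ⟨c, hc, hne, hcp⟩ := hp'
  have h0 := c.zero_mem hne
  have h1 : ∀ᶠ y in 𝓝 (0 : EuclideanSpace ℝ (Fin d)), (O.extD 0 α).1 ⟨c, hc⟩ y = 0 := by
    filter_upwards [c.isOpen_dom.mem_nhds h0,
      (c.continuousAt_toFun h0).eventually (h𝒱.mem_nhds (by rw [hcp]; exact hΔ hp))] with y hy hyV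
    exact hα ⟨c, hc⟩ y hy hyV
  have h2 := Orbifold.eventually_eq_of_extD_eq_zero (c := ⟨c, hc⟩) h0 h1
  obtain ⟨s, hs, hso, h0s⟩ := mem_nhds_iff.1 (Filter.inter_mem h2 (c.isOpen_dom.mem_nhds h0))
  refine ⟨c.toFun '' s, c.isOpen_image s (fun y hy => (hs hy).2) hso, ⟨0, h0s, hcp⟩,
    α.1 ⟨c, hc⟩ 0 ![], fun c' x hx hxV => ?_⟩
  obtain ⟨y, hy, hyx⟩ := hxV
  obtain ⟨l, hl, hxl, hlx⟩ := O.compatible c'.1 c'.2 c hc x hx y (hs hy).2 hyx.symm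
  rw [α.2.2.2 c' ⟨c, hc⟩ l hl x hxl, hlx]
  have h3 : α.1 ⟨c, hc⟩ y = α.1 ⟨c, hc⟩ 0 := (hs hy).1
  rw [h3]
  ext v
  rw [flatValue_apply, if_pos rfl, ContinuousAlternatingMap.compContinuousLinearMap_apply]
  exact congrArg _ (Subsingleton.elim _ _)

/-- A form of positive degree which is closed near the singular points is flat up to an exact form:
it has an invariant primitive on each conical neighbourhood by the Poincaré lemma. -/
theorem Orbifold.exists_isFlat_sub_extD [T2Space X] [ParacompactSpace X] {V : X → Set X}
    (hV : IsSmallNeighbourhoodSystem O V) (α : O.Form (k + 1)) {𝒱 : Set X} (h𝒱 : IsOpen 𝒱)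
    (hΔ : O.singularSet ⊆ 𝒱)
    (hα : ∀ c : O.atlas, ∀ x ∈ c.1.dom, c.1.toFun x ∈ 𝒱 → (O.extD (k + 1) α).1 c x = 0) :
    ∃ τ : O.Form k, O.IsFlat (α - O.extD k τ) := by
  obtain ⟨𝒞⟩ := exists_conicalSystem O hV h𝒱 hΔ
  have hprim : ∀ p, ∃ ν : EuclideanSpace ℝ (Fin d) → EuclideanSpace ℝ (Fin d) [⋀^Fin k]→L[ℝ] ℝ,
      ContDiffOn ℝ ∞ ν {x | (𝒞.cone p).Q x < 1} ∧
      (∀ x, (𝒞.cone p).Q x < 1 → extDeriv ν x = α.1 (𝒞.chartAt p) x) ∧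
      ∀ g ∈ (𝒞.cone p).chart.group, ∀ x, (𝒞.cone p).Q x < 1 →
        ν x = (ν (g x)).compContinuousLinearMap (g : _ →L[ℝ] _) := by
    intro p
    have hU := (𝒞.cone p).isOpen_ball 1
    have hsub := (𝒞.cone p).ball_subset_dom le_rfl
    have hst : StarConvex ℝ 0 {x | (𝒞.cone p).Q x < 1} :=
      (𝒞.cone p).convex.starConvex (by rw [mem_ofPred_eq, ConicalChart.Q_zero]; exact one_pos)
    obtain ⟨ν, hν, hνα⟩ := hst.exists_extDeriv_eq hU ((α.2.1 (𝒞.chartAt p)).mono hsub)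
      fun x hx => Orbifold.extDeriv_eq_zero_of_extD (c := 𝒞.chartAt p) (hsub hx)
        (hα (𝒞.chartAt p) x (hsub hx) (𝒞.openNhd_subset le_rfl (mem_iUnion.2 ⟨p, x, hx, rfl⟩)))
    exact exists_invariant_primitive (𝒞.cone p).chart.finite_group hU
      (fun g hg x hx => by rw [mem_ofPred_eq, (𝒞.cone p).Q_group g hg]; exact hx) hν hνα
      fun g hg x hx => α.eq_comp_group (𝒞.chartAt p) hg (hsub hx)
  choose ν hν hνα hνg using hprim
  obtain ⟨T, hT, -⟩ := 𝒞.exists_assemble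
    (fun p x => cutoff (1 / 2) (3 / 4) ((𝒞.cone p).Q x) • ν p x)
    (fun p => ((contDiff_cutoff _ _).comp (𝒞.cone p).contDiff_Q).contDiffOn.smul (hν p))
    (fun p g hg x hx => by
      beta_reduce
      rw [(𝒞.cone p).Q_group g hg, hνg p g hg x hx]
      rfl)
    (t := 3 / 4) (by norm_num) (fun p x hx _ => by
      beta_reduce
      rw [cutoff_eq_zero (by norm_num) hx.le]
      exact zero_smul ℝ _)
  refine ⟨T, 𝒞.isFlat_of_eq_zero _ (t := 1 / 2) (by norm_num) (by norm_num) fun p y hy => ?_⟩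
  have hy1 : (𝒞.cone p).Q y < 1 := lt_trans hy (by norm_num)
  have hev : T.1 (𝒞.chartAt p) =ᶠ[𝓝 y] ν p := by
    filter_upwards [((𝒞.cone p).isOpen_ball (1 / 2)).mem_nhds hy] with z hz
    refine (hT p z (lt_trans hz (by norm_num))).trans ?_
    rw [cutoff_eq_one (by norm_num) (le_of_lt hz)]
    exact one_smul ℝ _
  have h1 : (O.extD k T).1 (𝒞.chartAt p) y = α.1 (𝒞.chartAt p) y := by
    rw [O.extD_apply T (𝒞.chartAt p) ((𝒞.cone p).mem_dom hy1.le), hev.extDeriv_eq, hνα p y hy1]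
  exact sub_eq_zero.2 h1.symm

end Flatten

/-! ### Forms on the resolution in the charts of the orbifold -/

section InChart

variable {d : ℕ} {X Y : Type*} [TopologicalSpace X] [TopologicalSpace Y] {P : Orbifold d Y}
  {O : Orbifold d X} {π : Y → X} {k : ℕ}

/-- Over the part `W` of the domain of the chart `c'`, the form `μ` is the pullback of `γ`. -/
def AgreesInChart (π : Y → X) (μ : P.Form k) (c' : O.atlas)
    (γ : EuclideanSpace ℝ (Fin d) → EuclideanSpace ℝ (Fin d) [⋀^Fin k]→L[ℝ] ℝ)
    (W : Set (EuclideanSpace ℝ (Fin d))) : Prop :=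
  ∀ (c : P.atlas) (h), IsLocalLift π c.1 c'.1 h → ∀ x ∈ h.source, h x ∈ W →
    μ.1 c x = (γ (h x)).compContinuousLinearMap (fderiv ℝ h x)

namespace AgreesInChart

variable {μ μ' : P.Form k} {c' : O.atlas}
  {γ γ' : EuclideanSpace ℝ (Fin d) → EuclideanSpace ℝ (Fin d) [⋀^Fin k]→L[ℝ] ℝ}
  {W W' : Set (EuclideanSpace ℝ (Fin d))}

theorem mono (h : AgreesInChart π μ c' γ W) (hW : W' ⊆ W) : AgreesInChart π μ c' γ W' :=
  fun c l hl x hx hxW => h c l hl x hx (hW hxW)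

theorem congr (h : AgreesInChart π μ c' γ W) (hγ : ∀ x ∈ W, γ x = γ' x) :
    AgreesInChart π μ c' γ' W :=
  fun c l hl x hx hxW => by rw [h c l hl x hx hxW, hγ _ hxW]

theorem add (h : AgreesInChart π μ c' γ W) (h' : AgreesInChart π μ' c' γ' W) :
    AgreesInChart π (μ + μ') c' (fun x => γ x + γ' x) W := fun c l hl x hx hxW =>
  (congrArg₂ (· + ·) (h c l hl x hx hxW) (h' c l hl x hx hxW)).trans rfl

theorem smul (r : ℝ) (h : AgreesInChart π μ c' γ W) :
    AgreesInChart π (r • μ) c' (fun x => r • γ x) W := fun c l hl x hx hxW =>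
  (congrArg (r • ·) (h c l hl x hx hxW)).trans rfl

theorem extD (hW : IsOpen W) (hγ : ContDiffOn ℝ ∞ γ W) (h : AgreesInChart π μ c' γ W) :
    AgreesInChart π (P.extD k μ) c' (extDeriv γ) W := by
  intro c l hl x hx hxW
  have hev : μ.1 c =ᶠ[𝓝 x] fun y => (γ (l y)).compContinuousLinearMap (fderiv ℝ l y) := by
    filter_upwards [l.open_source.mem_nhds hx,
      (l.continuousAt hx).eventually (hW.mem_nhds hxW)] with y hy hyW
    exact h c l hl y hy hyW
  rw [P.extD_apply μ c (hl.source_subset hx), hev.extDeriv_eq]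
  exact extDeriv_pullback (hγ.differentiableAt_of_isOpen hW hxW) (hl.contDiffAt hx)
    (by simpa using Orbifold.two_le_infty)

end AgreesInChart

theorem IsLocalLift.eq_zero_of_comp_fderiv {f : Y → X} {c : OrbifoldChart d Y}
    {c' : OrbifoldChart d X} {h} (hh : IsLocalLift f c c' h) {x : EuclideanSpace ℝ (Fin d)}
    (hx : x ∈ h.source) {θ : EuclideanSpace ℝ (Fin d) [⋀^Fin k]→L[ℝ] ℝ}
    (hθ : θ.compContinuousLinearMap (fderiv ℝ h x) = 0) : θ = 0 := by
  have h1 := congrArg (fun β : EuclideanSpace ℝ (Fin d) [⋀^Fin k]→L[ℝ] ℝ =>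
    β.compContinuousLinearMap (fderiv ℝ h.symm (h x))) hθ
  ext v
  have h2 : ∀ w, fderiv ℝ h x (fderiv ℝ h.symm (h x) w) = w := fun w =>
    DFunLike.congr_fun (hh.fderiv_comp_symm hx) w
  have h3 : θ (fun i => fderiv ℝ h x (fderiv ℝ h.symm (h x) (v i))) = 0 := DFunLike.congr_fun h1 v
  simp only [h2] at h3
  exact h3

theorem Orbifold.toFun_notMem_singularSet (c' : O.atlas) {x : EuclideanSpace ℝ (Fin d)}
    (hx : x ∈ c'.1.dom) (hx0 : x ≠ 0) : c'.1.toFun x ∉ O.singularSet :=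
  fun h => hx0 (O.eq_zero_of_mem_singularSet c'.2 hx h).1

theorem AgreesWithPullback.agreesInChart {α : O.Form k} {β : P.Form k}
    (h : AgreesWithPullback P O π (π ⁻¹' O.singularSet)ᶜ α β) (c' : O.atlas) :
    AgreesInChart π β c' (α.1 c') {0}ᶜ := by
  intro c l hl x hx hx0
  refine h c c' l hl x hx ?_
  rw [mem_compl_iff, mem_preimage, hl.map_eq x hx]
  exact Orbifold.toFun_notMem_singularSet c' (hl.target_subset (l.map_source hx)) hx0

namespace IsResolutionMap

variable (hπ : IsResolutionMap P O π)
include hπ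

theorem exists_lift_over (c' : O.atlas) {x' : EuclideanSpace ℝ (Fin d)} (hx' : x' ∈ c'.1.dom)
    (hx0 : x' ≠ 0) (c : P.atlas) {x : EuclideanSpace ℝ (Fin d)} (hx : x ∈ c.1.dom)
    (hxx' : c'.1.toFun x' = π (c.1.toFun x)) :
    ∃ h, IsLocalLift π c.1 c'.1 h ∧ x ∈ h.source ∧ h x = x' :=
  hπ.exists_lift c.2 hx (by rw [← hxx']; exact Orbifold.toFun_notMem_singularSet c' hx' hx0) c'.2
    hx' hxx'

theorem eq_zero_of_agreesInChart {μ : P.Form k} {c' : O.atlas}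
    {γ : EuclideanSpace ℝ (Fin d) → EuclideanSpace ℝ (Fin d) [⋀^Fin k]→L[ℝ] ℝ}
    {W : Set (EuclideanSpace ℝ (Fin d))} (h : AgreesInChart π μ c' γ W)
    {x' : EuclideanSpace ℝ (Fin d)} (hx' : x' ∈ c'.1.dom) (hx0 : x' ≠ 0) (hxW : x' ∈ W)
    (hμ : ∀ c : P.atlas, ∀ x ∈ c.1.dom, π (c.1.toFun x) = c'.1.toFun x' → μ.1 c x = 0) :
    γ x' = 0 := by
  obtain ⟨c, hc, l, hl, x, hxl, hcx, rfl⟩ :=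
    hπ.exists_lift_to c'.2 hx' (Orbifold.toFun_notMem_singularSet c' hx' hx0)
  refine hl.eq_zero_of_comp_fderiv hxl ?_
  rw [← h ⟨c, hc⟩ l hl x hxl hxW]
  exact hμ ⟨c, hc⟩ x (hl.source_subset hxl) hcx

/-- The expression of a form on the resolution in a chart of the orbifold. -/
theorem exists_agreesInChart [T1Space X] (μ : P.Form k) (c' : O.atlas) :
    ∃ γ : EuclideanSpace ℝ (Fin d) → EuclideanSpace ℝ (Fin d) [⋀^Fin k]→L[ℝ] ℝ,
      ContDiffOn ℝ ∞ γ (c'.1.dom \ {0}) ∧ AgreesInChart π μ c' γ {0}ᶜ ∧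
      ∀ g ∈ c'.1.group, ∀ x ∈ c'.1.dom \ {0},
        γ x = (γ (g x)).compContinuousLinearMap (g : _ →L[ℝ] _) := by
  obtain ⟨γ, hγ, hγ1, -⟩ := hπ.exists_pushforward_formOn μ
  refine ⟨γ c'.1, fun x hx => ?_, fun c l hl x hx hx0 => ?_, fun g hg x hx => ?_⟩
  · exact (hγ.contDiffAt c'.1 c'.2 x hx.1
      (Orbifold.toFun_notMem_singularSet c' hx.1 hx.2)).contDiffWithinAt
  · refine hγ1 c c' l hl x hx ?_
    rw [hl.map_eq x hx]
    exact Orbifold.toFun_notMem_singularSet c' (hl.target_subset (l.map_source hx)) hx0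
  · obtain ⟨h, hh, hs, hhg⟩ := IsLocalLift.exists_group c'.1 hg
    have h1 : (h : EuclideanSpace ℝ (Fin d) → EuclideanSpace ℝ (Fin d)) = g := funext hhg
    have h2 := hγ.compat c'.1 c'.2 c'.1 c'.2 h hh x (by rw [hs]; exact hx.1)
      (Orbifold.toFun_notMem_singularSet c' hx.1 hx.2)
    rwa [h1, g.fderiv] at h2

variable {𝒱 : Set X}

theorem extDeriv_eq_zero_of_extD [T1Space X] (𝒞 : ConicalSystem O 𝒱) {μ : P.Form k}
    {p : O.singularSet}
    (hμ : ∀ c : P.atlas, ∀ x ∈ c.1.dom, π (c.1.toFun x) ∈ 𝒱 → (P.extD k μ).1 c x = 0)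
    {γ : EuclideanSpace ℝ (Fin d) → EuclideanSpace ℝ (Fin d) [⋀^Fin k]→L[ℝ] ℝ}
    (hγ : ContDiffOn ℝ ∞ γ ({x | (𝒞.cone p).Q x < 1} \ {0}))
    (h : AgreesInChart π μ (𝒞.chartAt p) γ {0}ᶜ) {x' : EuclideanSpace ℝ (Fin d)}
    (hx' : x' ∈ {x | (𝒞.cone p).Q x < 1} \ {0}) : extDeriv γ x' = 0 := by
  have hW : IsOpen ({x | (𝒞.cone p).Q x < 1} \ {0}) :=
    ((𝒞.cone p).isOpen_ball 1).sdiff isClosed_singleton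
  refine hπ.eq_zero_of_agreesInChart ((h.mono (sdiff_subset_compl _ _)).extD hW hγ)
    ((𝒞.cone p).ball_subset_dom le_rfl hx'.1) hx'.2 hx' fun c x hx hxx' => hμ c x hx ?_
  rw [hxx']
  exact 𝒞.openNhd_subset le_rfl (mem_iUnion.2 ⟨p, x', hx'.1, rfl⟩)

theorem exists_chartForm [T1Space X] (𝒞 : ConicalSystem O 𝒱) (μ : P.Form k) (p : O.singularSet)
    (hμ : ∀ c : P.atlas, ∀ x ∈ c.1.dom, π (c.1.toFun x) ∈ 𝒱 → (P.extD k μ).1 c x = 0) :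
    ∃ γ : EuclideanSpace ℝ (Fin d) → EuclideanSpace ℝ (Fin d) [⋀^Fin k]→L[ℝ] ℝ,
      ContDiffOn ℝ ∞ γ ({x | (𝒞.cone p).Q x < 1} \ {0}) ∧
      AgreesInChart π μ (𝒞.chartAt p) γ {0}ᶜ ∧
      (∀ g ∈ (𝒞.cone p).chart.group, ∀ x ∈ {x | (𝒞.cone p).Q x < 1} \ {0},
        γ x = (γ (g x)).compContinuousLinearMap (g : _ →L[ℝ] _)) ∧
      ∀ x ∈ {x | (𝒞.cone p).Q x < 1} \ {0}, extDeriv γ x = 0 := by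
  obtain ⟨γ, hγ, hγμ, hγg⟩ := hπ.exists_agreesInChart μ (𝒞.chartAt p)
  have hsub : {x | (𝒞.cone p).Q x < 1} \ {0} ⊆ (𝒞.chartAt p).1.dom \ {0} :=
    sdiff_subset_sdiff_left ((𝒞.cone p).ball_subset_dom le_rfl)
  exact ⟨γ, hγ.mono hsub, hγμ, fun g hg x hx => hγg g hg x (hsub hx),
    fun x hx => hπ.extDeriv_eq_zero_of_extD 𝒞 hμ (hγ.mono hsub) hγμ hx⟩

/-- A function on the resolution which is locally constant over a neighbourhood of the singular
set is constant near each exceptional fibre: punctured balls of dimension `≠ 1` are connected. -/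
theorem isFlatOver_of_extD_eq_zero [T1Space X] (𝒞 : ConicalSystem O 𝒱) (hd : d ≠ 1) (μ : P.Form 0)
    (hμ : ∀ c : P.atlas, ∀ x ∈ c.1.dom, π (c.1.toFun x) ∈ 𝒱 → (P.extD 0 μ).1 c x = 0) :
    IsFlatOver P O π μ := by
  intro p hp
  set C := 𝒞.cone ⟨p, hp⟩ with hC
  obtain ⟨γ, hγ, hγμ, -, hγd⟩ := hπ.exists_chartForm 𝒞 μ ⟨p, hp⟩ hμ
  rw [← coordSubspace_self] at hγ hγd
  obtain ⟨r, hr⟩ := (isExactOn_diff_coordSubspace (C.isOpen_ball 1) C.convex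
    (by rw [mem_ofPred_eq, C.Q_zero]; exact one_pos) d le_rfl 0).1 (fun h => hd (by omega)) γ hγ hγd
  rw [coordSubspace_self] at hr
  refine ⟨C.openCone 1, C.isOpen_openCone le_rfl,
    ⟨0, by rw [mem_ofPred_eq, C.Q_zero]; exact one_pos, C.toFun_zero⟩, r ![], ?_⟩
  have hone : ∀ c : P.atlas, ∀ x ∈ c.1.dom, (r ![] • P.oneForm).1 c x = flatValue _ (r ![]) 0 := by
    intro c x hx
    have h1 : P.oneForm.1 c x = flatValue _ 1 0 := if_pos hx
    change r ![] • P.oneForm.1 c x = _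
    rw [h1]
    ext v
    exact mul_one _
  intro c x hx hxV
  rw [← hone c x hx]
  refine Orbifold.form_eq_of_dense hπ.dense_compl
    ((C.isOpen_openCone le_rfl).preimage hπ.continuous) (fun c x hx hxS hxV => ?_) c hx hxV
  obtain ⟨y, hy, hyx⟩ := hxV
  have hy0 : y ≠ 0 := by
    rintro rfl
    rw [C.toFun_zero] at hyx
    exact hxS (by rw [mem_preimage, ← hyx]; exact hp)
  obtain ⟨l, hl, hxl, hlx⟩ := hπ.exists_lift_over (𝒞.chartAt ⟨p, hp⟩)
    (C.ball_subset_dom le_rfl hy) hy0 c hx hyx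
  rw [hone c x hx, hγμ c l hl x hxl (by rw [hlx]; exact hy0), hlx, hr y ⟨hy, hy0⟩]
  ext v
  rw [flatValue_apply, if_pos rfl, ContinuousAlternatingMap.compContinuousLinearMap_apply]
  exact congrArg _ (Subsingleton.elim _ _)

end IsResolutionMap

end InChart

/-! ### Closed forms on the shells around the exceptional fibres -/

section Shell

variable {d : ℕ} {X Y : Type*} [TopologicalSpace X] [TopologicalSpace Y] {P : Orbifold d Y}
  {O : Orbifold d X} {π : Y → X} {k : ℕ}

/-- The product of a form of degree `0` and a form of degree `k`. -/
def Orbifold.scalarMul (O : Orbifold d X) (F : O.Form 0) (θ : O.Form k) : O.Form k :=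
  ⟨fun c x => F.1 c x ![] • θ.1 c x, by
    refine ⟨fun c => ?_, fun c x hx => ?_, fun c c' h hh x hx => ?_⟩
    · exact ((ContinuousAlternatingMap.apply ℝ (EuclideanSpace ℝ (Fin d)) ℝ
        (![] : Fin 0 → _)).contDiff.comp_contDiffOn (F.2.1 c)).smul (θ.2.1 c)
    · beta_reduce
      rw [θ.2.2.1 c x hx]
      exact smul_zero _
    · beta_reduce
      have h1 : F.1 c x ![] = F.1 c' (h x) ![] := by
        rw [F.2.2.2 c c' h hh x hx, ContinuousAlternatingMap.compContinuousLinearMap_apply]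
        exact congrArg _ (Subsingleton.elim _ _)
      rw [h1, θ.2.2.2 c c' h hh x hx]
      rfl⟩

theorem AgreesInChart.scalarMul {F : P.Form 0} {μ : P.Form k} {c' : O.atlas}
    {f : EuclideanSpace ℝ (Fin d) → ℝ}
    {γ : EuclideanSpace ℝ (Fin d) → EuclideanSpace ℝ (Fin d) [⋀^Fin k]→L[ℝ] ℝ}
    {W : Set (EuclideanSpace ℝ (Fin d))}
    (hF : AgreesInChart π F c' (fun x => flatValue _ (f x) 0) W) (h : AgreesInChart π μ c' γ W) :
    AgreesInChart π (P.scalarMul F μ) c' (fun x => f x • γ x) W := by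
  intro c l hl x hx hxW
  have h1 : F.1 c x ![] = f (l x) := by
    rw [hF c l hl x hx hxW]
    rfl
  change F.1 c x ![] • μ.1 c x = _
  rw [h1, h c l hl x hx hxW]
  rfl

namespace ConicalSystem

variable {𝒱 : Set X} (𝒞 : ConicalSystem O 𝒱)

/-- The part `1/4 < Q < 3/4` of the chart of a conical neighbourhood. -/
def midShell (p : O.singularSet) : Set (EuclideanSpace ℝ (Fin d)) :=
  {x | 1 / 4 < (𝒞.cone p).Q x ∧ (𝒞.cone p).Q x < 3 / 4}

theorem isOpen_midShell (p : O.singularSet) : IsOpen (𝒞.midShell p) :=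
  (isOpen_lt continuous_const (𝒞.cone p).contDiff_Q.continuous).inter
    (isOpen_lt (𝒞.cone p).contDiff_Q.continuous continuous_const)

theorem midShell_subset (p : O.singularSet) :
    𝒞.midShell p ⊆ {x | (𝒞.cone p).Q x < 1} \ {0} := by
  rintro x ⟨h1, h2⟩
  refine ⟨lt_trans h2 (by norm_num), ?_⟩
  rintro rfl
  rw [ConicalChart.Q_zero] at h1
  norm_num at h1

/-- Invariant forms on the punctured balls of the conical charts agree on the shells
`1/4 < Q < 3/4` with a global flat form. -/
theorem exists_form_of_shell [T2Space X]
    (σ : O.singularSet → EuclideanSpace ℝ (Fin d) → EuclideanSpace ℝ (Fin d) [⋀^Fin k]→L[ℝ] ℝ)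
    (hσ : ∀ p, ContDiffOn ℝ ∞ (σ p) ({x | (𝒞.cone p).Q x < 1} \ {0}))
    (hσg : ∀ p, ∀ g ∈ (𝒞.cone p).chart.group, ∀ x ∈ {x | (𝒞.cone p).Q x < 1} \ {0},
      σ p x = (σ p (g x)).compContinuousLinearMap (g : _ →L[ℝ] _)) :
    ∃ T : O.Form k, O.IsFlat T ∧ ∀ p, ∀ x ∈ 𝒞.midShell p, T.1 (𝒞.chartAt p) x = σ p x := by
  -- a function which is `1` on `[1/4, 3/4]` and vanishes near `0` and near `1`
  set ψ : ℝ → ℝ := fun t => (1 - cutoff (1 / 8) (1 / 4) t) * cutoff (3 / 4) (7 / 8) t with hψ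
  have hψs : ContDiff ℝ ∞ ψ :=
    (contDiff_const.sub (contDiff_cutoff _ _)).mul (contDiff_cutoff _ _)
  have hψ0 : ∀ t ≤ 1 / 8, ψ t = 0 := fun t ht => by
    rw [hψ]; beta_reduce; rw [cutoff_eq_one (by norm_num) ht, sub_self, zero_mul]
  have hψ0' : ∀ t, 7 / 8 ≤ t → ψ t = 0 := fun t ht => by
    rw [hψ]; beta_reduce; rw [cutoff_eq_zero (a := 3 / 4) (by norm_num) ht, mul_zero]
  have hψ1 : ∀ t, 1 / 4 ≤ t → t ≤ 3 / 4 → ψ t = 1 := fun t ht ht' => by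
    rw [hψ]; beta_reduce
    rw [cutoff_eq_one (a := 3 / 4) (by norm_num) ht', cutoff_eq_zero (by norm_num) ht, sub_zero,
      mul_one]
  obtain ⟨T, hT, -⟩ := 𝒞.exists_assemble (fun p x => ψ ((𝒞.cone p).Q x) • σ p x)
    (fun p x hx => by
      refine ContDiffAt.contDiffWithinAt ?_
      by_cases hx0 : (𝒞.cone p).Q x < 1 / 8
      · have hev : (fun x => ψ ((𝒞.cone p).Q x) • σ p x) =ᶠ[𝓝 x] fun _ => 0 := by
          filter_upwards [((𝒞.cone p).isOpen_ball (1 / 8)).mem_nhds hx0] with y hy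
          rw [hψ0 _ (le_of_lt hy)]
          exact zero_smul ℝ _
        exact contDiffAt_const.congr_of_eventuallyEq hev
      · have hx' : x ≠ 0 := by
          rintro rfl
          rw [ConicalChart.Q_zero] at hx0
          norm_num at hx0
        exact (hψs.comp (𝒞.cone p).contDiff_Q).contDiffAt.smul ((hσ p).contDiffAt
          ((((𝒞.cone p).isOpen_ball 1).sdiff isClosed_singleton).mem_nhds ⟨hx, hx'⟩)))
    (fun p g hg x hx => by
      beta_reduce
      rw [(𝒞.cone p).Q_group g hg]
      by_cases hx0 : x = 0
      · rw [hx0, ConicalChart.Q_zero, hψ0 0 (by norm_num)]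
        refine (zero_smul ℝ _).trans ?_
        exact (congrArg (fun θ : EuclideanSpace ℝ (Fin d) [⋀^Fin k]→L[ℝ] ℝ =>
          θ.compContinuousLinearMap
            (g : EuclideanSpace ℝ (Fin d) →L[ℝ] EuclideanSpace ℝ (Fin d)))
          (zero_smul ℝ (σ p (g 0)))).symm
      · rw [hσg p g hg x ⟨hx, hx0⟩]
        rfl)
    (t := 7 / 8) (by norm_num) (fun p x hx _ => by
      beta_reduce
      rw [hψ0' _ hx.le]
      exact zero_smul ℝ _)
  refine ⟨T, 𝒞.isFlat_of_eq_zero T (t := 1 / 8) (by norm_num) (by norm_num) fun p y hy => ?_,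
    fun p x hx => ?_⟩
  · refine (hT p y (lt_trans hy (by norm_num))).trans ?_
    rw [hψ0 _ hy.le]
    exact zero_smul ℝ _
  · refine (hT p x (lt_trans hx.2 (by norm_num))).trans ?_
    rw [hψ1 _ hx.1.le hx.2.le]
    exact one_smul ℝ _

end ConicalSystem

/-- A continuous function without zeros on the punctured ball of a conical chart has constant
sign. -/
theorem ConicalChart.sign_eq {p : X} (C : ConicalChart O p) (hd : d ≠ 1)
    {f : EuclideanSpace ℝ (Fin d) → ℝ} (hf : ContinuousOn f ({x | C.Q x < 1} \ {0}))
    (hf0 : ∀ x ∈ {x | C.Q x < 1} \ {0}, f x ≠ 0) :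
    (∀ x ∈ {x | C.Q x < 1} \ {0}, 0 < f x) ∨ ∀ x ∈ {x | C.Q x < 1} \ {0}, f x < 0 := by
  have hW : IsOpen ({x | C.Q x < 1} \ {0}) := (C.isOpen_ball 1).sdiff isClosed_singleton
  set θ : EuclideanSpace ℝ (Fin d) → EuclideanSpace ℝ (Fin d) [⋀^Fin 0]→L[ℝ] ℝ :=
    fun x => flatValue _ (if 0 < f x then 1 else 0) 0 with hθ
  have hev : ∀ x ∈ {x | C.Q x < 1} \ {0}, θ =ᶠ[𝓝 x] fun _ => θ x := by
    intro x hx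
    have hc := hf.continuousAt (hW.mem_nhds hx)
    rcases lt_or_gt_of_ne (hf0 x hx) with h | h
    · filter_upwards [hc.eventually (gt_mem_nhds h)] with y hy
      rw [hθ]; beta_reduce
      rw [if_neg h.not_gt, if_neg (not_lt.2 (le_of_lt hy))]
    · filter_upwards [hc.eventually (lt_mem_nhds h)] with y hy
      rw [hθ]; beta_reduce
      rw [if_pos h, if_pos hy]
  obtain ⟨r, hr⟩ := (isExactOn_diff_coordSubspace (C.isOpen_ball 1) C.convex
    (by rw [mem_ofPred_eq, C.Q_zero]; exact one_pos) d le_rfl 0).1 (fun h => hd (by omega)) θ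
    (by
      rw [coordSubspace_self]
      exact fun x hx => (contDiffAt_const.congr_of_eventuallyEq (hev x hx)).contDiffWithinAt)
    (by
      rw [coordSubspace_self]
      intro x hx
      rw [(hev x hx).extDeriv_eq, extDeriv, fderiv_const_apply]
      exact map_zero (ContinuousAlternatingMap.alternatizeUncurryFinCLM ℝ _ ℝ))
  rw [coordSubspace_self] at hr
  have hr' : ∀ x ∈ {x | C.Q x < 1} \ {0}, (if 0 < f x then (1 : ℝ) else 0) = r ![] := fun x hx =>
    congrArg (fun θ : EuclideanSpace ℝ (Fin d) [⋀^Fin 0]→L[ℝ] ℝ => θ ![]) (hr x hx)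
  by_cases h1 : r ![] = 1
  · left
    intro x hx
    by_contra hn
    have := hr' x hx
    rw [if_neg hn, h1] at this
    exact zero_ne_one this
  · right
    intro x hx
    refine lt_of_le_of_ne (not_lt.1 fun hp => h1 ?_) (hf0 x hx)
    rw [← hr' x hx, if_pos hp]

namespace IsResolutionMap

variable {𝒱 : Set X}

theorem exists_form_of_shell [T2Space X] (hπ : IsResolutionMap P O π) (𝒞 : ConicalSystem O 𝒱)
    (σ : O.singularSet → EuclideanSpace ℝ (Fin d) → EuclideanSpace ℝ (Fin d) [⋀^Fin k]→L[ℝ] ℝ)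
    (hσ : ∀ p, ContDiffOn ℝ ∞ (σ p) ({x | (𝒞.cone p).Q x < 1} \ {0}))
    (hσg : ∀ p, ∀ g ∈ (𝒞.cone p).chart.group, ∀ x ∈ {x | (𝒞.cone p).Q x < 1} \ {0},
      σ p x = (σ p (g x)).compContinuousLinearMap (g : _ →L[ℝ] _)) :
    ∃ T : P.Form k, ∀ p, AgreesInChart π T (𝒞.chartAt p) (σ p) (𝒞.midShell p) := by
  obtain ⟨T, hT, hTσ⟩ := 𝒞.exists_form_of_shell σ hσ hσg
  obtain ⟨T', -, hT'⟩ := hπ.exists_pullback hT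
  exact ⟨T', fun p => ((hT'.agreesInChart (𝒞.chartAt p)).mono
    fun x hx => (𝒞.midShell_subset p hx).2).congr (hTσ p)⟩

/-- A function on the resolution which depends only on the radius in one conical neighbourhood,
is `1` near the exceptional fibre and `0` outside the neighbourhood. -/
theorem exists_radial_cutoff [T2Space X] (hπ : IsResolutionMap P O π) (𝒞 : ConicalSystem O 𝒱)
    (p : O.singularSet) :
    ∃ F : P.Form 0, (∀ c : P.atlas, ∀ x ∈ c.1.dom,
        π (c.1.toFun x) ∈ (𝒞.cone p).openCone (1 / 3) → F.1 c x = flatValue _ 1 0) ∧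
      AgreesInChart π F (𝒞.chartAt p)
        (fun x => flatValue _ (cutoff (1 / 3) (2 / 3) ((𝒞.cone p).Q x)) 0)
        ({x | (𝒞.cone p).Q x < 1} \ {0}) ∧
      ∀ c : P.atlas, ∀ x ∈ c.1.dom, π (c.1.toFun x) ∉ (𝒞.cone p).closedCone (2 / 3) →
        F.1 c x = 0 := by
  classical
  set C := 𝒞.cone p with hC
  obtain ⟨F, hF1, hF2⟩ := 𝒞.exists_assemble_single p (k := 0)
    (ν := fun x => flatValue _ (cutoff (1 / 3) (2 / 3) (C.Q x)) 0)
    (ContDiff.contDiffOn ((ContinuousAlternatingMap.constOfIsEmptyLIE ℝ (EuclideanSpace ℝ (Fin d)) ℝ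
      (Fin 0)).toContinuousLinearEquiv.contDiff.comp ((contDiff_cutoff _ _).comp C.contDiff_Q)))
    (fun g hg x hx => by
      beta_reduce
      rw [C.Q_group g hg, flatValue_compContinuousLinearMap])
    (t := 2 / 3) (by norm_num) (fun x hx _ => by
      beta_reduce
      rw [cutoff_eq_zero (by norm_num) hx.le, flatValue_zero])
  -- the function is locally constant near the singular points, so its pullback extends
  have hflat : O.IsFlat F := by
    refine Orbifold.isFlat_of_extD_eq_zero F (𝒞.isOpen_openNhd (t := 1 / 3) (by norm_num))
      (fun q hq => 𝒞.mem_openNhd ⟨q, hq⟩ (by norm_num)) fun c x hx hxV => ?_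
    obtain ⟨q, hq⟩ := mem_iUnion.1 hxV
    refine 𝒞.eq_zero_of_mem_openCone (O.extD 0 F) q (t := 1 / 3) (by norm_num) (fun y hy => ?_)
      c hx hq
    have hcone : ∀ z, (𝒞.cone q).Q z < 1 / 3 →
        F.1 (𝒞.chartAt q) z = flatValue _ (if q = p then 1 else 0) 0 := by
      intro z hz
      have hz1 : (𝒞.cone q).Q z < 1 := lt_trans hz (by norm_num)
      split_ifs with h
      · subst h
        rw [hF1 z hz1, cutoff_eq_one (by norm_num) (le_of_lt hz)]
      · rw [flatValue_zero]
        refine hF2 (𝒞.chartAt q) z ((𝒞.cone q).mem_dom hz1.le) fun h' => h ?_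
        obtain ⟨w, hw, hwz⟩ := h'
        exact 𝒞.eq_of_mem ⟨z, hz1.le, rfl⟩ ⟨w, hw.trans (by norm_num : (2 / 3 : ℝ) ≤ 1), hwz⟩
    have hev : F.1 (𝒞.chartAt q) =ᶠ[𝓝 y] fun _ => flatValue _ (if q = p then 1 else 0) 0 := by
      filter_upwards [((𝒞.cone q).isOpen_ball (1 / 3)).mem_nhds hy] with z hz
      exact hcone z hz
    rw [O.extD_apply F (𝒞.chartAt q) ((𝒞.cone q).mem_dom (le_of_lt (lt_trans hy (by norm_num)))),
      hev.extDeriv_eq, extDeriv, fderiv_const_apply]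
    exact map_zero (ContinuousAlternatingMap.alternatizeUncurryFinCLM ℝ _ ℝ)
  obtain ⟨F', -, hF'⟩ := hπ.exists_pullback hflat
  refine ⟨F', fun c x hx hxV => ?_, ?_, fun c x hx hxV => ?_⟩
  · have h1 : ∀ c : P.atlas, ∀ x ∈ c.1.dom, P.oneForm.1 c x = flatValue _ 1 0 :=
      fun c x hx => if_pos hx
    rw [← h1 c x hx]
    refine Orbifold.form_eq_of_dense hπ.dense_compl
      ((C.isOpen_openCone (by norm_num)).preimage hπ.continuous) (fun c x hx hxS hxV => ?_) c hx hxV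
    obtain ⟨y, hy, hyx⟩ := hxV
    have hy1 : C.Q y < 1 := lt_trans hy (by norm_num)
    obtain ⟨l, hl, hxl, hlx⟩ := hπ.exists_lift c.2 hx hxS (𝒞.chartAt p).2
      (C.ball_subset_dom le_rfl hy1) hyx
    rw [h1 c x hx, hF' c (𝒞.chartAt p) l hl x hxl hxS, hlx, hF1 y hy1,
      cutoff_eq_one (by norm_num) (le_of_lt hy), flatValue_compContinuousLinearMap]
  · exact ((hF'.agreesInChart (𝒞.chartAt p)).mono fun x hx => hx.2).congr
      fun x hx => hF1 x hx.1
  · have hcl : IsClosed (C.closedCone (2 / 3)) := (C.isCompact_closedCone (by norm_num)).isClosed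
    refine Orbifold.form_eq_of_dense (β := (0 : P.Form 0)) hπ.dense_compl
      (hcl.isOpen_compl.preimage hπ.continuous) (fun c x hx hxS hxV => ?_) c hx hxV
    obtain ⟨c', hc', x', hx', hxx'⟩ := O.cover (π (c.1.toFun x))
    obtain ⟨l, hl, hxl, hlx⟩ := hπ.exists_lift c.2 hx hxS hc' hx' hxx'
    rw [hF' c ⟨c', hc'⟩ l hl x hxl hxS, hlx, hF2 ⟨c', hc'⟩ x' hx' (by rw [hxx']; exact hxV)]
    rfl

end IsResolutionMap

end Shell

/-! ### The angular form is not exact relative to closed forms on the resolution -/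

section Angular

variable {X N : Type*} [TopologicalSpace X] [T2Space X] [TopologicalSpace N] [T2Space N]

/-- Closed forms `μ` on the resolution, of degree one less than the dimension, cannot agree with the
angular form `Q^{-n} ι_x vol` on a shell: cutting `μ` off by a decreasing function of `Q` gives a
compactly supported form whose differential has constant sign and does not vanish, contradicting
Stokes' theorem. -/
theorem IsResolutionMap.not_agreesInChart_angular {k n : ℕ} (hk : k + 2 = 2 * n)
    [ChartedSpace (EuclideanSpace ℝ (Fin (k + 2))) N] [IsManifold (𝓡 (k + 2)) ∞ N]
    {O : Orbifold (k + 2) X} {π : N → X} (hπ : IsResolutionMap (Orbifold.ofManifold (k + 2) N) O π)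
    {𝒱 : Set X} (𝒞 : ConicalSystem O 𝒱) (p : O.singularSet)
    {volN : (Orbifold.ofManifold (k + 2) N).Form (k + 2)}
    (hvolN : ∀ c, ∀ x ∈ c.1.dom, volN.1 c x ≠ 0)
    {vol : EuclideanSpace ℝ (Fin (k + 2)) [⋀^Fin (k + 2)]→L[ℝ] ℝ} (hvol : vol ≠ 0)
    (μ : (Orbifold.ofManifold (k + 2) N).Form (k + 1))
    (hμ : ∀ c, ∀ x ∈ c.1.dom, π (c.1.toFun x) ∈ 𝒱 →
      ((Orbifold.ofManifold (k + 2) N).extD (k + 1) μ).1 c x = 0)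
    (h : AgreesInChart π μ (𝒞.chartAt p)
      (fun x => ((𝒞.cone p).Q x ^ n)⁻¹ • vol.curryLeft x) (𝒞.midShell p)) : False := by
  set C := 𝒞.cone p with hC
  set f : ℝ → ℝ := cutoff (1 / 3) (2 / 3) with hf
  have hfs : ContDiff ℝ ∞ f := contDiff_cutoff _ _
  have hf' : ∀ t, deriv f t ≤ 0 := fun t => (antitone_cutoff (by norm_num)).deriv_nonpos
  obtain ⟨F, hF1, hF2, hF3⟩ := hπ.exists_radial_cutoff 𝒞 p
  obtain ⟨γv, hγv, hγvN, -⟩ := hπ.exists_agreesInChart volN (𝒞.chartAt p)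
  have hball : {x | C.Q x < 1} \ {0} ⊆ (𝒞.chartAt p).1.dom \ {0} :=
    sdiff_subset_sdiff_left (C.ball_subset_dom le_rfl)
  -- the volume form of the resolution is a multiple, of constant sign, of the standard one
  obtain ⟨t, ht, htv⟩ : ∃ t : EuclideanSpace ℝ (Fin (k + 2)) → ℝ,
      (∀ x ∈ {x | C.Q x < 1} \ {0}, γv x = t x • vol) ∧
      ((∀ x ∈ {x | C.Q x < 1} \ {0}, 0 < t x) ∨ ∀ x ∈ {x | C.Q x < 1} \ {0}, t x < 0) := by
    have hv0 := topCoeff_ne_zero hvol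
    have h1 : ∀ x, γv x = (topCoeff (γv x) * (topCoeff vol)⁻¹) • vol := fun x =>
      topCoeff_injective (by rw [topCoeff_smul, inv_mul_cancel_right₀ hv0])
    refine ⟨fun x => topCoeff (γv x) * (topCoeff vol)⁻¹, fun x _ => h1 x,
      C.sign_eq (by omega) ((hγv.mono hball).topCoeff.continuousOn.mul continuousOn_const)
        fun x hx h0 => ?_⟩
    have h2 : γv x = 0 := by rw [h1 x, h0, zero_smul]
    obtain ⟨c, hc, l, hl, z, hzl, -, hlz⟩ := hπ.exists_lift_to (𝒞.chartAt p).2 (hball hx).1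
      (Orbifold.toFun_notMem_singularSet (𝒞.chartAt p) (hball hx).1 hx.2)
    refine hvolN ⟨c, hc⟩ z (hl.source_subset hzl) ?_
    rw [hγvN ⟨c, hc⟩ l hl z hzl (by rw [hlz]; exact hx.2), hlz, h2]
    rfl
  set Φ := (Orbifold.ofManifold (k + 2) N).scalarMul F μ with hΦ
  set coef : EuclideanSpace ℝ (Fin (k + 2)) → ℝ :=
    fun x => 2 * C.Q x * (C.Q x ^ n)⁻¹ * deriv f (C.Q x) with hcoef
  have hW := 𝒞.isOpen_midShell p
  have hpos : ∀ x ∈ 𝒞.midShell p, 0 < C.Q x := fun x hx => lt_trans (by norm_num) hx.1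
  have hsm : ContDiffOn ℝ ∞ (fun x => (f (C.Q x) * (C.Q x ^ n)⁻¹) • vol.curryLeft x)
      (𝒞.midShell p) :=
    ((hfs.comp C.contDiff_Q).contDiffOn.mul ((C.contDiff_Q.contDiffOn.pow n).inv
      fun x hx => (pow_pos (hpos x hx) n).ne')).smul vol.curryLeft.contDiff.contDiffOn
  have hΦd : AgreesInChart π ((Orbifold.ofManifold (k + 2) N).extD (k + 1) Φ) (𝒞.chartAt p)
      (fun x => coef x • vol) (𝒞.midShell p) := by
    have h1 := (hF2.mono (𝒞.midShell_subset p)).scalarMul h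
    have h2 : AgreesInChart π Φ (𝒞.chartAt p)
        (fun x => (f (C.Q x) * (C.Q x ^ n)⁻¹) • vol.curryLeft x) (𝒞.midShell p) :=
      h1.congr fun x _ => smul_smul _ _ _
    refine (h2.extD hW hsm).congr fun x hx => ?_
    exact extDeriv_comp_smul_curryLeft vol C.contDiff_Q C.Q_smul (hpos x hx) hk
      (hfs.differentiable (by simp) _)
  -- the differential vanishes where the cutoff function is locally constant
  have hin : ∀ c, ∀ x ∈ c.1.dom, π (c.1.toFun x) ∈ C.openCone (1 / 3) →
      ((Orbifold.ofManifold (k + 2) N).extD (k + 1) Φ).1 c x = 0 := by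
    intro c x hx hxV
    have h1 : ((Orbifold.ofManifold (k + 2) N).extD (k + 1) (Φ - μ)).1 c x = 0 := by
      refine Orbifold.Form.extD_eq_zero_of_eq_zero
        ((C.isOpen_openCone (by norm_num)).preimage hπ.continuous) (fun c x hx hxV => ?_) c hx hxV
      refine sub_eq_zero.2 ?_
      change F.1 c x ![] • μ.1 c x = μ.1 c x
      rw [hF1 c x hx hxV]
      exact one_smul ℝ _
    rw [map_sub] at h1
    exact (sub_eq_zero.1 h1).trans (hμ c x hx (𝒞.openNhd_subset (t := 1 / 3) (by norm_num)
      (mem_iUnion.2 ⟨p, hxV⟩)))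
  have hcl : IsClosed (C.closedCone (2 / 3)) := (C.isCompact_closedCone (by norm_num)).isClosed
  have hout0 : ∀ c, ∀ x ∈ c.1.dom, π (c.1.toFun x) ∉ C.closedCone (2 / 3) → Φ.1 c x = 0 := by
    intro c x hx hxV
    change F.1 c x ![] • μ.1 c x = 0
    rw [hF3 c x hx hxV]
    exact zero_smul ℝ _
  have hout : ∀ c, ∀ x ∈ c.1.dom, π (c.1.toFun x) ∉ C.closedCone (2 / 3) →
      ((Orbifold.ofManifold (k + 2) N).extD (k + 1) Φ).1 c x = 0 := fun c x hx hxV =>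
    Orbifold.Form.extD_eq_zero_of_eq_zero (hcl.isOpen_compl.preimage hπ.continuous) hout0 c hx hxV
  -- Stokes' theorem, for the form with the sign for which the differential is nonnegative
  obtain ⟨ε, hε0, hε⟩ : ∃ ε : ℝ, ε ≠ 0 ∧ ∀ x ∈ {x | C.Q x < 1} \ {0}, ε * (t x)⁻¹ ≤ 0 := by
    rcases htv with htv | htv
    · exact ⟨-1, by norm_num, fun x hx => by
        have := inv_pos.2 (htv x hx); linarith⟩
    · exact ⟨1, by norm_num, fun x hx => by
        have := inv_lt_zero.2 (htv x hx); linarith⟩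
  have ht0 : ∀ x ∈ {x | C.Q x < 1} \ {0}, t x ≠ 0 := fun x hx => by
    rcases htv with htv | htv
    · exact (htv x hx).ne'
    · exact (htv x hx).ne
  have hstokes : (Orbifold.ofManifold (k + 2) N).extD (k + 1) (ε • Φ) = 0 := by
    refine extD_eq_zero_of_nonneg rfl hvolN (ε • Φ)
      (hπ.isProperMap.isCompact_preimage (C.isCompact_closedCone (t := 2 / 3) (by norm_num)))
      (fun c x hx hxK => ?_) fun c x hx => ?_
    · refine (congrArg (ε • ·) (hout0 c x hx hxK)).trans (smul_zero ε)
    · rw [map_smul]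
      by_cases hx1 : π (c.1.toFun x) ∈ C.openCone (1 / 3)
      · exact ⟨0, le_rfl, (congrArg (ε • ·) (hin c x hx hx1)).trans
          ((smul_zero ε).trans (zero_smul ℝ _).symm)⟩
      by_cases hx2 : π (c.1.toFun x) ∈ C.closedCone (2 / 3)
      · obtain ⟨y, hy, hyx⟩ := hx2
        have hy3 : 1 / 3 ≤ C.Q y := by
          by_contra! hlt
          exact hx1 ⟨y, hlt, hyx⟩
        have hym : y ∈ 𝒞.midShell p :=
          ⟨lt_of_lt_of_le (by norm_num) hy3, lt_of_le_of_lt hy (by norm_num)⟩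
        have hyb := 𝒞.midShell_subset p hym
        obtain ⟨l, hl, hxl, hlx⟩ := hπ.exists_lift_over (𝒞.chartAt p) (hball hyb).1 hyb.2 c hx hyx
        refine ⟨ε * (t y)⁻¹ * coef y, mul_nonneg_of_nonpos_of_nonpos (hε y hyb) ?_, ?_⟩
        · exact mul_nonpos_of_nonneg_of_nonpos (mul_nonneg (mul_nonneg zero_le_two (hpos y hym).le)
            (inv_nonneg.2 (pow_pos (hpos y hym) n).le)) (hf' _)
        · have h1 := hΦd c l hl x hxl (by rw [hlx]; exact hym)
          have h2 := hγvN c l hl x hxl (by rw [hlx]; exact hyb.2)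
          rw [hlx] at h1 h2
          rw [ht y hyb] at h2
          rw [h2]
          refine (congrArg (ε • ·) h1).trans ?_
          ext v
          change ε * (coef y * vol _) = ε * (t y)⁻¹ * coef y * (t y * vol _)
          have := ht0 y hyb
          field_simp
      · exact ⟨0, le_rfl, (congrArg (ε • ·) (hout c x hx hx2)).trans
          ((smul_zero ε).trans (zero_smul ℝ _).symm)⟩
  have hΦ0 : (Orbifold.ofManifold (k + 2) N).extD (k + 1) Φ = 0 := by
    rw [map_smul] at hstokes
    exact (smul_eq_zero.1 hstokes).resolve_left hε0
  -- the derivative of the cutoff function does not vanish at some radius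
  obtain ⟨s, hs, hfs'⟩ := exists_deriv_eq_slope f (a := 1 / 3) (b := 2 / 3) (by norm_num)
    hfs.continuous.continuousOn (hfs.differentiable (by simp)).differentiableOn
  have hfs0 : deriv f s ≠ 0 := by
    rw [hfs', hf, cutoff_eq_zero (by norm_num) le_rfl, cutoff_eq_one (by norm_num) le_rfl]
    norm_num
  obtain ⟨x₀, hx₀⟩ := exists_ne (0 : EuclideanSpace ℝ (Fin (k + 2)))
  have hQ0 := C.Q_pos x₀ hx₀
  have hs0 : 0 < s := lt_trans (by norm_num) hs.1
  set x' := √(s / C.Q x₀) • x₀ with hx'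
  have hQx' : C.Q x' = s := by
    rw [hx', C.Q_smul, Real.sq_sqrt (by positivity), div_mul_cancel₀ _ hQ0.ne']
  have hx'm : x' ∈ 𝒞.midShell p := by
    constructor
    · rw [← hC, hQx']; exact lt_trans (by norm_num) hs.1
    · rw [← hC, hQx']; exact lt_trans hs.2 (by norm_num)
  have hx'b := 𝒞.midShell_subset p hx'm
  have h0 := hπ.eq_zero_of_agreesInChart hΦd (hball hx'b).1 hx'b.2 hx'm
    fun c x hx _ => by rw [hΦ0]; rfl
  refine (smul_eq_zero.1 h0).elim (fun h => ?_) hvol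
  rw [hcoef] at h
  beta_reduce at h
  rw [hQx'] at h
  exact mul_ne_zero (mul_ne_zero (mul_ne_zero two_ne_zero hs0.ne')
    (inv_ne_zero (pow_pos hs0 n).ne')) hfs0 h

end Angular

/-! ### Splitting off the part of a form supported near the exceptional set -/

section Splitting

variable {X N : Type*} [TopologicalSpace X] [T2Space X] [TopologicalSpace N]
  {d k : ℕ} [ChartedSpace (EuclideanSpace ℝ (Fin d)) N] [IsManifold (𝓡 d) ∞ N]
  {O : Orbifold d X} {π : N → X} {𝒱 : Set X}

/-- A form on the resolution which is closed over a neighbourhood of the singular set is exact on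
the shells around the exceptional fibres. Below the top degree of the sphere this is the vanishing
of the cohomology of the sphere; in that degree the class is a multiple of the class of the angular
form, which does not extend over the exceptional fibre. -/
theorem IsResolutionMap.exists_primitive_on_shell [T2Space N]
    (hπ : IsResolutionMap (Orbifold.ofManifold d N) O π) {n : ℕ} (hd : d = 2 * n)
    {volO : O.Form d} (hvolO : ∀ c, ∀ x ∈ c.1.dom, volO.1 c x ≠ 0)
    {volN : (Orbifold.ofManifold d N).Form d} (hvolN : ∀ c, ∀ x ∈ c.1.dom, volN.1 c x ≠ 0)
    (𝒞 : ConicalSystem O 𝒱) (μ : (Orbifold.ofManifold d N).Form (k + 1))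
    (hμ : ∀ c, ∀ x ∈ c.1.dom, π (c.1.toFun x) ∈ 𝒱 →
      ((Orbifold.ofManifold d N).extD (k + 1) μ).1 c x = 0) (p : O.singularSet) :
    ∃ ν : EuclideanSpace ℝ (Fin d) → EuclideanSpace ℝ (Fin d) [⋀^Fin k]→L[ℝ] ℝ,
      ContDiffOn ℝ ∞ ν ({x | (𝒞.cone p).Q x < 1} \ {0}) ∧
      AgreesInChart π μ (𝒞.chartAt p) (extDeriv ν) ({x | (𝒞.cone p).Q x < 1} \ {0}) ∧
      ∀ g ∈ (𝒞.cone p).chart.group, ∀ x ∈ {x | (𝒞.cone p).Q x < 1} \ {0},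
        ν x = (ν (g x)).compContinuousLinearMap (g : _ →L[ℝ] _) := by
  classical
  set C := 𝒞.cone p with hC
  have hW : IsOpen ({x | C.Q x < 1} \ {0}) := (C.isOpen_ball 1).sdiff isClosed_singleton
  have hWG : ∀ g ∈ C.chart.group, ∀ x ∈ {x | C.Q x < 1} \ {0}, g x ∈ {x | C.Q x < 1} \ {0} := by
    rintro g hg x ⟨hx, hx0⟩
    exact ⟨by rw [mem_ofPred_eq, C.Q_group g hg]; exact hx,
      (map_ne_zero_iff _ g.injective).2 hx0⟩
  have h0 : (0 : EuclideanSpace ℝ (Fin d)) ∈ {x | C.Q x < 1} := by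
    rw [mem_ofPred_eq, C.Q_zero]; exact one_pos
  obtain ⟨γ, hγ, hγμ, hγg, hγd⟩ := hπ.exists_chartForm 𝒞 μ p hμ
  suffices hex : ∃ ν : EuclideanSpace ℝ (Fin d) → EuclideanSpace ℝ (Fin d) [⋀^Fin k]→L[ℝ] ℝ,
      ContDiffOn ℝ ∞ ν ({x | C.Q x < 1} \ {0}) ∧
      ∀ x ∈ {x | C.Q x < 1} \ {0}, extDeriv ν x = γ x by
    obtain ⟨ν, hν, hνγ⟩ := hex
    obtain ⟨ν', hν', hνγ', hνg'⟩ :=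
      exists_invariant_primitive C.chart.finite_group hW hWG hν hνγ hγg
    exact ⟨ν', hν', (hγμ.mono fun x hx => hx.2).congr fun x hx => (hνγ' x hx).symm, hνg'⟩
  have hγ' := hγ
  have hγd' := hγd
  rw [← hC, ← coordSubspace_self] at hγ' hγd'
  have hcoh := isExactOn_diff_coordSubspace (C.isOpen_ball 1) C.convex h0 d le_rfl (k + 1)
  by_cases hk : k + 2 = d
  · subst hk
    set vol : EuclideanSpace ℝ (Fin (k + 2)) [⋀^Fin (k + 2)]→L[ℝ] ℝ :=
      volO.1 (𝒞.chartAt p) 0 with hvol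
    have hvol0 : vol ≠ 0 := hvolO (𝒞.chartAt p) 0 (C.ball_subset_dom le_rfl h0)
    have hQ : ∀ x ∈ {x | C.Q x < 1} \ {0}, C.Q x ^ n ≠ 0 := fun x hx =>
      (pow_pos (C.Q_pos x hx.2) n).ne'
    set θ : EuclideanSpace ℝ (Fin (k + 2)) →
        EuclideanSpace ℝ (Fin (k + 2)) [⋀^Fin (k + 1)]→L[ℝ] ℝ :=
      fun x => (C.Q x ^ n)⁻¹ • vol.curryLeft x with hθ
    have hθs : ContDiffOn ℝ ∞ θ ({x | C.Q x < 1} \ {0}) :=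
      ((C.contDiff_Q.contDiffOn.pow n).inv hQ).smul vol.curryLeft.contDiff.contDiffOn
    have hθd : ∀ x ∈ {x | C.Q x < 1} \ {0}, extDeriv θ x = 0 := by
      intro x hx
      have h1 := extDeriv_comp_smul_curryLeft vol C.contDiff_Q C.Q_smul (C.Q_pos x hx.2) hd
        (f := fun _ => 1) (differentiableAt_const _)
      simp only [one_mul, deriv_const, mul_zero, zero_smul] at h1
      exact h1
    -- the angular form is invariant, since the group preserves the volume form at the origin
    have hθg : ∀ g ∈ C.chart.group, ∀ x ∈ {x | C.Q x < 1} \ {0},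
        θ x = (θ (g x)).compContinuousLinearMap (g : _ →L[ℝ] _) := by
      intro g hg x hx
      have h1 := volO.eq_comp_group (𝒞.chartAt p) hg (C.ball_subset_dom le_rfl h0)
      rw [map_zero, ← hvol] at h1
      rw [hθ]
      beta_reduce
      rw [C.Q_group g hg]
      ext v
      have h2 : vol (Matrix.vecCons x v) = vol (Matrix.vecCons (g x) fun i => g (v i)) := by
        conv_lhs => rw [h1]
        refine congrArg vol (funext fun i => ?_)
        refine Fin.cases ?_ (fun i => ?_) i <;> rfl
      exact congrArg ((C.Q x ^ n)⁻¹ * ·) h2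
    rw [← coordSubspace_self] at hθs hθd
    -- some nontrivial combination `r γ + r' θ` is the differential of a form `σ`
    obtain ⟨r, r', hrr, σ, hσ, hσd⟩ := hcoh.2 γ θ hγ' hθs hγd' hθd
    rw [coordSubspace_self] at hσ hσd
    by_cases hr' : r' = 0
    · have hr : r ≠ 0 := fun hr => hrr (by rw [hr, hr']; rfl)
      refine ⟨fun x => r⁻¹ • σ x, hσ.const_smul _, fun x hx => ?_⟩
      refine (extDeriv_smul r⁻¹ σ).trans ?_
      rw [hσd x hx, hr']
      beta_reduce
      rw [zero_smul, add_zero, inv_smul_smul₀ hr]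
    -- otherwise `θ = d(σ / r') - (r / r') γ` on the shell, which extends to a closed form over
    -- the exceptional fibre
    · exfalso
      obtain ⟨σ', hσ', hσd', hσg'⟩ := exists_invariant_primitive C.chart.finite_group hW hWG hσ hσd
        fun g hg x hx => by
          rw [hγg g hg x hx, hθg g hg x hx]
          rfl
      obtain ⟨T, hT⟩ := hπ.exists_form_of_shell 𝒞 (fun q => if q = p then σ' else 0)
        (fun q => by
          by_cases h : q = p
          · subst h; rw [if_pos rfl]; exact hσ'
          · rw [if_neg h]; exact contDiffOn_const)
        (fun q g hg x hx => by
          by_cases h : q = p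
          · subst h; rw [if_pos rfl]; exact hσg' g hg x hx
          · rw [if_neg h]; rfl)
      have hT' := hT p
      rw [if_pos rfl] at hT'
      have hmid := 𝒞.midShell_subset p
      have h1 := ((hT'.extD (𝒞.isOpen_midShell p) (hσ'.mono hmid)).smul r'⁻¹).add
        ((hγμ.mono fun x hx => (hmid hx).2).smul (-(r'⁻¹ * r)))
      refine hπ.not_agreesInChart_angular hd 𝒞 p hvolN hvol0 _ (fun c x hx hxV => ?_)
        (h1.congr fun x hx => ?_)
      · rw [map_add, map_smul, map_smul, Orbifold.extD_extD, smul_zero, zero_add]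
        exact (congrArg (-(r'⁻¹ * r) • ·) (hμ c x hx hxV)).trans (smul_zero _)
      · rw [hσd' x (hmid hx)]
        ext v
        change r'⁻¹ * (r * γ x v + r' * θ x v) + -(r'⁻¹ * r) * γ x v = θ x v
        field_simp
        ring
  · obtain ⟨ν, hν, hνγ⟩ := hcoh.1 (by omega) γ hγ' hγd'
    rw [coordSubspace_self] at hν hνγ
    exact ⟨ν, hν, hνγ⟩

/-- A form on the resolution which is closed over a neighbourhood `𝒱` of the singular set is, up to
an exact form, the sum of a form vanishing near the exceptional set and a closed form supported
over `𝒱`. -/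
theorem IsResolutionMap.exists_splitting [T2Space N]
    (hπ : IsResolutionMap (Orbifold.ofManifold d N) O π) {n : ℕ} (hd : d = 2 * n)
    {volO : O.Form d} (hvolO : ∀ c, ∀ x ∈ c.1.dom, volO.1 c x ≠ 0)
    {volN : (Orbifold.ofManifold d N).Form d} (hvolN : ∀ c, ∀ x ∈ c.1.dom, volN.1 c x ≠ 0)
    (𝒞 : ConicalSystem O 𝒱) (μ : (Orbifold.ofManifold d N).Form (k + 1))
    (hμ : ∀ c, ∀ x ∈ c.1.dom, π (c.1.toFun x) ∈ 𝒱 →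
      ((Orbifold.ofManifold d N).extD (k + 1) μ).1 c x = 0) :
    ∃ (μ₁ μ₂ : (Orbifold.ofManifold d N).Form (k + 1)) (τ : (Orbifold.ofManifold d N).Form k),
      μ = μ₁ + μ₂ + (Orbifold.ofManifold d N).extD k τ ∧
      IsFlatOver (Orbifold.ofManifold d N) O π μ₁ ∧
      (∀ c, ∀ x ∈ c.1.dom, π (c.1.toFun x) ∉ 𝒱 → μ₂.1 c x = 0) ∧
      (Orbifold.ofManifold d N).extD (k + 1) μ₂ = 0 := by
  choose ν hν hνμ hνg using hπ.exists_primitive_on_shell hd hvolO hvolN 𝒞 μ hμ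
  obtain ⟨τ, hτ⟩ := hπ.exists_form_of_shell 𝒞 ν hν hνg
  set μ' := μ - (Orbifold.ofManifold d N).extD k τ with hμ'
  -- after subtracting the exact form, the form vanishes on the shells
  have hshell : ∀ c, ∀ x ∈ c.1.dom, π (c.1.toFun x) ∈ 𝒞.openNhd (3 / 4) →
      π (c.1.toFun x) ∉ 𝒞.closedNhd (1 / 2) → μ'.1 c x = 0 := by
    intro c x hx hxV hxK
    obtain ⟨p, y, hy, hyx⟩ := mem_iUnion.1 hxV
    have hy1 : 1 / 2 < (𝒞.cone p).Q y := by
      by_contra! hle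
      exact hxK (mem_iUnion.2 ⟨p, y, hle, hyx⟩)
    have hym : y ∈ 𝒞.midShell p := ⟨lt_trans (by norm_num) hy1, hy⟩
    have hyb := 𝒞.midShell_subset p hym
    obtain ⟨l, hl, hxl, hlx⟩ := hπ.exists_lift_over (𝒞.chartAt p)
      ((𝒞.cone p).ball_subset_dom le_rfl hyb.1) hyb.2 c hx hyx
    have h1 := hνμ p c l hl x hxl (by rw [hlx]; exact hyb)
    have h2 := (hτ p).extD (𝒞.isOpen_midShell p) ((hν p).mono (𝒞.midShell_subset p)) c l hl x hxl
      (by rw [hlx]; exact hym)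
    exact sub_eq_zero.2 (h1.trans h2.symm)
  have hcl := (𝒞.isClosed_closedNhd (t := 1 / 2) (by norm_num)).preimage hπ.continuous
  have hop := (𝒞.isOpen_openNhd (t := 3 / 4) (by norm_num)).preimage hπ.continuous
  have hsub : 𝒞.closedNhd (1 / 2) ⊆ 𝒞.openNhd (3 / 4) :=
    𝒞.closedNhd_subset_openNhd (by norm_num)
  -- cut the form at the radius `1/2`, across the shells where it vanishes
  obtain ⟨μ₁, h1, h1'⟩ := (μ'.isFormOn (π ⁻¹' 𝒞.closedNhd (1 / 2))ᶜ).exists_extension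
    hcl.isOpen_compl (fun _ => 0) (by
      intro q hq
      rw [notMem_compl_iff] at hq
      refine ⟨_, hop, hsub hq, fun _ _ => rfl, fun c hc x hx hxV hxK => ?_⟩
      rw [flatValue_zero, μ'.toFamily_eq ⟨c, hc⟩]
      exact hshell ⟨c, hc⟩ x hx hxV hxK)
  have hout : ∀ c, ∀ x ∈ c.1.dom, π (c.1.toFun x) ∉ 𝒞.closedNhd (1 / 2) →
      μ₁.1 c x = μ'.1 c x := fun c x hx hxK => by
    rw [h1 c x hx hxK, μ'.toFamily_eq c]
  have hin : ∀ c, ∀ x ∈ c.1.dom, π (c.1.toFun x) ∈ 𝒞.closedNhd (1 / 2) → μ₁.1 c x = 0 :=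
    fun c x hx hxK => by
      rw [h1' c x hx (fun h => h hxK), flatValue_zero]
  have hzero : ∀ c, ∀ x ∈ c.1.dom, π (c.1.toFun x) ∈ 𝒞.openNhd (3 / 4) → μ₁.1 c x = 0 := by
    intro c x hx hxV
    by_cases hxK : π (c.1.toFun x) ∈ 𝒞.closedNhd (1 / 2)
    · exact hin c x hx hxK
    · rw [hout c x hx hxK, hshell c x hx hxV hxK]
  have hμ₂ : ∀ c, ∀ x ∈ c.1.dom, π (c.1.toFun x) ∉ 𝒞.closedNhd (1 / 2) → (μ' - μ₁).1 c x = 0 :=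
    fun c x hx hxK => sub_eq_zero.2 (hout c x hx hxK).symm
  have hV : 𝒞.openNhd (3 / 4) ⊆ 𝒱 := 𝒞.openNhd_subset (by norm_num)
  refine ⟨μ₁, μ' - μ₁, τ, ?_, fun p hp => ?_, fun c x hx hxV => ?_, ?_⟩
  · rw [add_sub_cancel, hμ', sub_add_cancel]
  · refine ⟨_, 𝒞.isOpen_openNhd (t := 3 / 4) (by norm_num), 𝒞.mem_openNhd ⟨p, hp⟩ (by norm_num), 0,
      fun c x hx hxV => ?_⟩
    rw [flatValue_zero]
    exact hzero c x hx hxV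
  · exact hμ₂ c x hx fun h => hxV (hV (hsub h))
  · refine Orbifold.Form.ext fun c x => ?_
    by_cases hx : x ∈ c.1.dom
    · by_cases hxV : π (c.1.toFun x) ∈ 𝒞.openNhd (3 / 4)
      · rw [map_sub, hμ', map_sub, Orbifold.extD_extD, sub_zero]
        exact sub_eq_zero.2 ((hμ c x hx (hV hxV)).trans
          (Orbifold.Form.extD_eq_zero_of_eq_zero hop hzero c hx hxV).symm)
      · exact Orbifold.Form.extD_eq_zero_of_eq_zero hcl.isOpen_compl hμ₂ c hx
          fun h => hxV (hsub h)
    · exact ((Orbifold.ofManifold d N).extD (k + 1) (μ' - μ₁)).2.2.1 c x hx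

end Splitting

/-! ### Multiplicative relations between algebras of forms -/

section Relation

variable {d : ℕ} {X Y : Type*} [TopologicalSpace X] [TopologicalSpace Y] {P : Orbifold d Y}
  {O : Orbifold d X}

theorem Orbifold.forms_ext {x y : O.Forms} (h : ∀ k, x k = y k) : x = y := DFinsupp.ext h

theorem Orbifold.sum_of_apply (x : O.Forms) :
    ∃ s₀ : Finset ℕ, ∀ s : Finset ℕ, s₀ ⊆ s → ∑ k ∈ s, O.of (x k) = x := by
  classical
  refine ⟨DFinsupp.support x, fun s hs => O.forms_ext fun j => ?_⟩
  rw [DFinsupp.finsetSum_apply]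
  by_cases hj : j ∈ s
  · rw [Finset.sum_eq_single j]
    · exact O.of_apply_self _
    · exact fun i _ hij => O.of_apply_ne _ hij.symm
    · exact fun h => absurd hj h
  · rw [Finset.sum_eq_zero]
    · exact (DFinsupp.notMem_support_iff.1 fun h => hj (hs h)).symm
    · intro i hi
      exact O.of_apply_ne _ fun h => hj (h ▸ hi)

theorem Orbifold.exists_eq_sum_of (x : O.Forms) (y : P.Forms) :
    ∃ s : Finset ℕ, x = ∑ k ∈ s, O.of (x k) ∧ y = ∑ k ∈ s, P.of (y k) := by
  classical
  obtain ⟨s, hs⟩ := Orbifold.sum_of_apply x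
  obtain ⟨t, ht⟩ := Orbifold.sum_of_apply y
  exact ⟨s ∪ t, (hs _ Finset.subset_union_left).symm, (ht _ Finset.subset_union_right).symm⟩

/-- A relation between the forms of `O` and of `P` which is compatible with all algebraic
operations. -/
structure IsMultiplicativeRel (R : ∀ k, O.Form k → P.Form k → Prop) : Prop where
  zero : ∀ k, R k 0 0
  add : ∀ {k α α' β β'}, R k α β → R k α' β' → R k (α + α') (β + β')
  smul : ∀ {k α β} (r : ℝ), R k α β → R k (r • α) (r • β)
  wedge : ∀ {k l α α' β β'}, R k α β → R l α' β' →
    R (k + l) (O.wedgeForm α α') (P.wedgeForm β β')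
  one : R 0 O.oneForm P.oneForm

/-- The extension of a relation to inhomogeneous forms, degree by degree. -/
def FormsRel (R : ∀ k, O.Form k → P.Form k → Prop) (x : O.Forms) (y : P.Forms) : Prop :=
  ∀ k, R k (x k) (y k)

namespace IsMultiplicativeRel

variable {R : ∀ k, O.Form k → P.Form k → Prop} (hR : IsMultiplicativeRel R)
include hR

theorem formsRel_zero : FormsRel R (0 : O.Forms) (0 : P.Forms) := fun k => hR.zero k

theorem formsRel_add {x x' : O.Forms} {y y' : P.Forms} (h : FormsRel R x y)
    (h' : FormsRel R x' y') : FormsRel R (x + x') (y + y') := fun k => by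
  rw [DirectSum.add_apply, DirectSum.add_apply]
  exact hR.add (h k) (h' k)

theorem formsRel_smul (r : ℝ) {x : O.Forms} {y : P.Forms} (h : FormsRel R x y) :
    FormsRel R (r • x) (r • y) := fun k => hR.smul r (h k)

theorem formsRel_sub {x x' : O.Forms} {y y' : P.Forms} (h : FormsRel R x y)
    (h' : FormsRel R x' y') : FormsRel R (x - x') (y - y') := by
  have := hR.formsRel_add h (hR.formsRel_smul (-1) h')
  rwa [neg_one_smul, neg_one_smul, ← sub_eq_add_neg, ← sub_eq_add_neg] at this

theorem formsRel_sum {ι : Type*} (s : Finset ι) {x : ι → O.Forms} {y : ι → P.Forms}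
    (h : ∀ i, FormsRel R (x i) (y i)) : FormsRel R (∑ i ∈ s, x i) (∑ i ∈ s, y i) := by
  classical
  induction s using Finset.induction_on with
  | empty => exact hR.formsRel_zero
  | insert i s hi ih =>
    rw [Finset.sum_insert hi, Finset.sum_insert hi]
    exact hR.formsRel_add (h i) ih

theorem formsRel_of {k : ℕ} {α : O.Form k} {β : P.Form k} (h : R k α β) :
    FormsRel R (O.of α) (P.of β) := by
  intro j
  by_cases hj : j = k
  · subst hj
    rw [O.of_apply_self, P.of_apply_self]
    exact h
  · rw [O.of_apply_ne _ hj, P.of_apply_ne _ hj]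
    exact hR.zero j

theorem formsRel_one : FormsRel R (1 : O.Forms) (1 : P.Forms) := by
  rw [Orbifold.one_eq_of, Orbifold.one_eq_of]
  exact hR.formsRel_of hR.one

theorem formsRel_mul {x x' : O.Forms} {y y' : P.Forms} (h : FormsRel R x y)
    (h' : FormsRel R x' y') : FormsRel R (x * x') (y * y') := by
  obtain ⟨s, hx, hy⟩ := Orbifold.exists_eq_sum_of x y
  obtain ⟨t, hx', hy'⟩ := Orbifold.exists_eq_sum_of x' y'
  rw [hx, hx', hy, hy', Finset.sum_mul_sum, Finset.sum_mul_sum]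
  refine hR.formsRel_sum s fun i => hR.formsRel_sum t fun j => ?_
  rw [Orbifold.of_mul_of, Orbifold.of_mul_of]
  exact hR.formsRel_of (hR.wedge (h i) (h' j))

theorem formsRel_bar {x : O.Forms} {y : P.Forms} (h : FormsRel R x y) :
    FormsRel R (O.bar x) (P.bar y) := by
  obtain ⟨s, hx, hy⟩ := Orbifold.exists_eq_sum_of x y
  rw [hx, hy, map_sum, map_sum]
  refine hR.formsRel_sum s fun i => ?_
  rw [Orbifold.bar_of, Orbifold.bar_of]
  exact hR.formsRel_smul _ (hR.formsRel_of (h i))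

theorem formsRel_prodForm {m : ℕ} {ξ : Fin m → O.Forms} {ζ : Fin m → P.Forms}
    (h : ∀ i, FormsRel R (ξ i) (ζ i)) : FormsRel R (O.prodForm ξ) (P.prodForm ζ) := by
  induction m with
  | zero =>
    rw [Orbifold.prodForm_zero, Orbifold.prodForm_zero]
    exact hR.formsRel_one
  | succ m ih =>
    rw [Orbifold.prodForm_succ, Orbifold.prodForm_succ]
    exact hR.formsRel_mul (h 0) (ih fun i => h i.succ)

theorem formsRel_masseySum {m : ℕ} {b ξ : Fin m → O.Forms} {b' ζ : Fin m → P.Forms}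
    (hb : ∀ i, FormsRel R (b i) (b' i)) (h : ∀ i, FormsRel R (ξ i) (ζ i)) :
    FormsRel R (O.masseySum b ξ) (P.masseySum b' ζ) := by
  induction m with
  | zero =>
    rw [Orbifold.masseySum_zero, Orbifold.masseySum_zero]
    exact hR.formsRel_zero
  | succ m ih =>
    rw [Orbifold.masseySum_succ, Orbifold.masseySum_succ]
    exact hR.formsRel_add (hR.formsRel_mul (hb 0) (hR.formsRel_prodForm fun i => h i.succ))
      (hR.formsRel_mul (hR.formsRel_bar (h 0)) (ih (fun i => hb i.succ) fun i => h i.succ))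

theorem formsRel_masseyForm {m : ℕ} {q : Fin m → ℕ} {b : ∀ i, O.Form (q i)}
    {b' : ∀ i, P.Form (q i)} {ξ : Fin m → O.Forms} {ζ : Fin m → P.Forms}
    (hb : ∀ i, R (q i) (b i) (b' i)) (h : ∀ i, FormsRel R (ξ i) (ζ i)) :
    FormsRel R (O.masseyForm b ξ) (P.masseyForm b' ζ) := by
  rw [Orbifold.masseyForm_eq, Orbifold.masseyForm_eq]
  exact hR.formsRel_masseySum (fun i => hR.formsRel_of (hb i)) h

end IsMultiplicativeRel

/-- The forms `α` and `β` have the same value at the point `x` of the chart `c`. -/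
def EqAtPoint (O : Orbifold d X) (c : O.atlas) (x : EuclideanSpace ℝ (Fin d)) (k : ℕ)
    (α β : O.Form k) : Prop := α.1 c x = β.1 c x

theorem isMultiplicativeRel_eqAtPoint (O : Orbifold d X) (c : O.atlas)
    (x : EuclideanSpace ℝ (Fin d)) : IsMultiplicativeRel (EqAtPoint O c x) where
  zero _ := rfl
  add h h' := congrArg₂ (· + ·) h h'
  smul r h := congrArg (r • ·) h
  wedge h h' := congrArg₂ _root_.wedge h h'
  one := rfl

theorem Orbifold.masseySum_zero_left {m : ℕ} (ξ : Fin m → O.Forms) :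
    O.masseySum (fun _ => 0) ξ = 0 := by
  induction m with
  | zero => exact O.masseySum_zero _ _
  | succ m ih => rw [masseySum_succ, ih, zero_mul, mul_zero, add_zero]

theorem masseyForm_eq_of_eqAtPoint {m : ℕ} {q : Fin m → ℕ} (b : ∀ i, O.Form (q i))
    {ξ ζ : Fin m → O.Forms}
    (h : ∀ (c : O.atlas), ∀ x ∈ c.1.dom, (∀ i, (b i).1 c x = 0) ∨
      ∀ i k, ((ξ i) k).1 c x = ((ζ i) k).1 c x) :
    O.masseyForm b ξ = O.masseyForm b ζ := by
  refine O.forms_ext fun k => Orbifold.Form.ext fun c x => ?_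
  by_cases hx : x ∈ c.1.dom
  · have hR := isMultiplicativeRel_eqAtPoint O c x
    rcases h c x hx with h | h
    · -- every summand contains one of the `b i`
      have h0 : ∀ ξ : Fin m → O.Forms, ((O.masseyForm b ξ) k).1 c x = 0 := by
        intro ξ
        have h1 := hR.formsRel_masseySum (b := fun i => O.of (b i)) (b' := fun _ => 0) (ξ := ξ)
          (ζ := ξ) (fun i => by
            have h2 : EqAtPoint O c x (q i) (b i) 0 := h i
            have h3 := hR.formsRel_of h2
            rwa [show O.of (0 : O.Form (q i)) = 0 from map_zero _] at h3) (fun i k => rfl) k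
        rw [Orbifold.masseySum_zero_left] at h1
        exact h1
      rw [h0, h0]
    · exact hR.formsRel_masseyForm (fun _ => rfl) h k
  · rw [((O.masseyForm b ξ) k).2.2.1 c x hx, ((O.masseyForm b ζ) k).2.2.1 c x hx]

/-- The form `α` is flat and `β` is its pullback. -/
def IsFlatPullback (P : Orbifold d Y) (O : Orbifold d X) (π : Y → X) (k : ℕ) (α : O.Form k)
    (β : P.Form k) : Prop :=
  O.IsFlat α ∧ AgreesWithPullback P O π (π ⁻¹' O.singularSet)ᶜ α β

theorem isMultiplicativeRel_isFlatPullback (P : Orbifold d Y) (O : Orbifold d X) (π : Y → X) :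
    IsMultiplicativeRel (IsFlatPullback P O π) where
  zero _ := ⟨Orbifold.isFlat_zero, agreesWithPullback_zero⟩
  add h h' := ⟨h.1.add h'.1, h.2.add h'.2⟩
  smul r h := ⟨h.1.smul r, h.2.smul r⟩
  wedge h h' := ⟨h.1.wedgeForm h'.1, h.2.wedgeForm h'.2⟩
  one := ⟨Orbifold.isFlat_oneForm, agreesWithPullback_oneForm⟩

namespace IsResolutionMap

variable {π : Y → X} (hπ : IsResolutionMap P O π) {x x' : O.Forms} {y y' : P.Forms}
include hπ

theorem formsRel_D [T1Space X] (h : FormsRel (IsFlatPullback P O π) x y) :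
    FormsRel (IsFlatPullback P O π) (O.D x) (P.D y) := by
  rintro (- | k)
  · rw [O.D_apply_zero, P.D_apply_zero]
    exact (isMultiplicativeRel_isFlatPullback P O π).zero 0
  · rw [O.D_apply_succ, P.D_apply_succ]
    exact ⟨(h k).1.extD, (h k).2.extD hπ.isOpen_compl⟩

theorem formsRel_unique_right (h : FormsRel (IsFlatPullback P O π) x y)
    (h' : FormsRel (IsFlatPullback P O π) x y') : y = y' :=
  P.forms_ext fun k => hπ.unique_right (h k).2 (h' k).2

theorem formsRel_unique_left (h : FormsRel (IsFlatPullback P O π) x y)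
    (h' : FormsRel (IsFlatPullback P O π) x' y) : x = x' :=
  O.forms_ext fun k => hπ.unique_left (h k).2 (h' k).2

theorem exists_formsRel [T1Space X] (hx : ∀ k, O.IsFlat (x k)) :
    ∃ y, FormsRel (IsFlatPullback P O π) x y := by
  classical
  choose β _ hβ using fun k => hπ.exists_pullback (hx k)
  obtain ⟨s, hs⟩ := Orbifold.sum_of_apply x
  refine ⟨∑ k ∈ s, P.of (β k), ?_⟩
  have hR := isMultiplicativeRel_isFlatPullback P O π
  have h1 := hR.formsRel_sum s fun k => hR.formsRel_of ⟨hx k, hβ k⟩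
  rwa [hs s subset_rfl] at h1

end IsResolutionMap

end Relation

/-! ### The pullback on cohomology -/

section Pullback

variable {d : ℕ} {X Y : Type*} [TopologicalSpace X] [TopologicalSpace Y] {P : Orbifold d Y}
  {O : Orbifold d X} {π : Y → X}

theorem Orbifold.of_zero (O : Orbifold d X) (k : ℕ) : O.of (0 : O.Form k) = 0 := map_zero _

/-- If a form vanishes on an open set, its pullback vanishes over this set. -/
theorem IsResolutionMap.pullback_eq_zero (hπ : IsResolutionMap P O π) {𝒱 : Set X} (h𝒱 : IsOpen 𝒱)
    {k : ℕ} {α : O.Form k} (hα : ∀ c : O.atlas, ∀ x ∈ c.1.dom, c.1.toFun x ∈ 𝒱 → α.1 c x = 0)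
    {β : P.Form k} (h : AgreesWithPullback P O π (π ⁻¹' O.singularSet)ᶜ α β) (c : P.atlas)
    {x : EuclideanSpace ℝ (Fin d)} (hx : x ∈ c.1.dom) (hxV : π (c.1.toFun x) ∈ 𝒱) :
    β.1 c x = 0 := by
  refine Orbifold.form_eq_of_dense (β := (0 : P.Form k)) hπ.dense_compl
    (h𝒱.preimage hπ.continuous) (fun c x hx hxS hxV => ?_) c hx hxV
  obtain ⟨c', hc', x', hx', hxx'⟩ := O.cover (π (c.1.toFun x))
  obtain ⟨l, hl, hxl, hlx⟩ := hπ.exists_lift c.2 hx hxS hc' hx' hxx'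
  rw [h c ⟨c', hc'⟩ l hl x hxl hxS, hlx, hα ⟨c', hc'⟩ x' hx' (by rw [hxx']; exact hxV)]
  rfl

theorem Orbifold.IsFlat.exists_isOpen_eq_zero {k : ℕ} {α : O.Form k} (h : O.IsFlat α)
    (hk : 0 < k) : ∃ 𝒱 : Set X, IsOpen 𝒱 ∧ O.singularSet ⊆ 𝒱 ∧
      ∀ c : O.atlas, ∀ x ∈ c.1.dom, c.1.toFun x ∈ 𝒱 → α.1 c x = 0 := by
  choose! V hV hpV r hr using h
  refine ⟨⋃ p ∈ O.singularSet, V p, isOpen_biUnion hV, fun p hp => mem_biUnion hp (hpV p hp),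
    fun c x hx hxV => ?_⟩
  obtain ⟨p, hp, hxp⟩ := mem_iUnion₂.1 hxV
  ext v
  exact (hr p hp c x hx hxp v).trans (if_neg hk.ne')

theorem Orbifold.isFlat_sum {ι : Type*} (s : Finset ι) {x : ι → O.Forms}
    (h : ∀ i k, O.IsFlat (x i k)) (k : ℕ) : O.IsFlat ((∑ i ∈ s, x i) k) := by
  rw [DFinsupp.finsetSum_apply]
  classical
  induction s using Finset.induction_on with
  | empty => exact isFlat_zero
  | insert i s hi ih => rw [Finset.sum_insert hi]; exact (h i k).add ih

theorem Orbifold.isFlat_of {k : ℕ} {α : O.Form k} (h : O.IsFlat α) (j : ℕ) :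
    O.IsFlat ((O.of α) j) := by
  by_cases hj : j = k
  · subst hj; rw [O.of_apply_self]; exact h
  · rw [O.of_apply_ne _ hj]; exact isFlat_zero

section Flat

variable [T2Space X] [ParacompactSpace X] {V : X → Set X} (hV : IsSmallNeighbourhoodSystem O V)
include hV

/-- A homogeneous form with flat differential is flat up to an exact form. -/
theorem Orbifold.exists_isFlat_of_sub_D {k : ℕ} {α : O.Form k} (hα : O.IsFlat (O.extD k α)) :
    ∃ τ : O.Forms, O.IsHomPred k τ ∧ ∀ j, O.IsFlat ((O.of α - O.D τ) j) := by
  obtain ⟨𝒱, h𝒱, hΔ, h0⟩ := hα.exists_isOpen_eq_zero (Nat.succ_pos k)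
  cases k with
  | zero =>
    refine ⟨0, isHomPred_zero _, fun j => ?_⟩
    rw [map_zero, sub_zero]
    exact isFlat_of (isFlat_of_extD_eq_zero α h𝒱 hΔ h0) j
  | succ k =>
    obtain ⟨τ, hτ⟩ := exists_isFlat_sub_extD hV α h𝒱 hΔ h0
    refine ⟨O.of τ, isHomPred_of τ, fun j => ?_⟩
    rw [D_of]
    have h1 := isFlat_of hτ j
    rwa [show O.of (α - O.extD k τ) = O.of α - O.of (O.extD k τ) from map_sub _ _ _] at h1

theorem Orbifold.exists_isFlat_sub_D {σ : O.Forms} (hσ : ∀ k, O.IsFlat ((O.D σ) k)) :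
    ∃ τ : O.Forms, ∀ j, O.IsFlat ((σ - O.D τ) j) := by
  have h1 : ∀ k, ∃ τ : O.Forms, ∀ j, O.IsFlat ((O.of (σ k) - O.D τ) j) := fun k => by
    obtain ⟨τ, -, hτ⟩ := exists_isFlat_of_sub_D hV (α := σ k) (by
      rw [← D_apply_succ]; exact hσ (k + 1))
    exact ⟨τ, hτ⟩
  choose τ hτ using h1
  obtain ⟨s, hs⟩ := Orbifold.sum_of_apply σ
  refine ⟨∑ k ∈ s, τ k, fun j => ?_⟩
  have h2 := isFlat_sum s hτ j
  rwa [Finset.sum_sub_distrib, hs s subset_rfl, ← map_sum] at h2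

variable (hπ : IsResolutionMap P O π)
include hπ

theorem IsResolutionMap.cohomologyPullback_unique {x : O.Cohomology} {y y' : P.Cohomology}
    (h : CohomologyPullback P O π x y) (h' : CohomologyPullback P O π x y') : y = y' := by
  obtain ⟨α, β, hα, rfl, hαβ⟩ := h
  obtain ⟨α', β', hα', rfl, hαβ'⟩ := h'
  obtain ⟨σ, hσ⟩ := Orbifold.exists_of_cls_eq (hα.trans hα'.symm)
  have hR := isMultiplicativeRel_isFlatPullback P O π
  have hsub := hR.formsRel_sub hαβ hαβ'
  have hσ' : (α : O.Forms) - α' = O.D σ := sub_eq_of_eq_add' hσ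
  obtain ⟨τ, hτ⟩ := Orbifold.exists_isFlat_sub_D hV (σ := σ) fun k => by
    rw [← hσ']; exact (hsub k).1
  obtain ⟨s, hs⟩ := hπ.exists_formsRel hτ
  have hD := hπ.formsRel_D hs
  rw [map_sub, Orbifold.D_D, sub_zero, ← hσ'] at hD
  exact Orbifold.cls_eq_of_eq_add_D (sub_eq_iff_eq_add'.1 (hπ.formsRel_unique_right hsub hD))

end Flat

end Pullback

/-! ### Injectivity of the pullback -/

section Resolution

variable {n : ℕ} {M N : Type*} [TopologicalSpace M] [T2Space M] [ParacompactSpace M]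
  {O : Orbifold (2 * n) M} {Ω : O.Form 2} [TopologicalSpace N] [T2Space N]
  [ChartedSpace (EuclideanSpace ℝ (Fin (2 * n))) N] [IsManifold (𝓡 (2 * n)) ∞ N]
  {Ω' : (Orbifold.ofManifold (2 * n) N).Form 2} {π : N → M}

namespace IsSymplecticResolution

variable (hπ : IsSymplecticResolution O Ω Ω' π) (hΩ : O.IsSymplectic Ω)
  (hΩ' : (Orbifold.ofManifold (2 * n) N).IsSymplectic Ω')
include hπ hΩ hΩ'

/-- A homogeneous form on the resolution which is closed over a neighbourhood `𝒱` of the singular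
set is, up to an exact form, the sum of the pullback of a flat form and a closed form supported
over `𝒱`. -/
theorem exists_pullback_add {𝒱 : Set M} (h𝒱 : IsOpen 𝒱) (hΔ : O.singularSet ⊆ 𝒱) {k : ℕ}
    (μ : (Orbifold.ofManifold (2 * n) N).Form k)
    (hμ : ∀ c, ∀ x ∈ c.1.dom, π (c.1.toFun x) ∈ 𝒱 →
      ((Orbifold.ofManifold (2 * n) N).extD k μ).1 c x = 0) :
    ∃ (α : O.Form k) (μ₁ μ₂ : (Orbifold.ofManifold (2 * n) N).Form k)
      (τ : (Orbifold.ofManifold (2 * n) N).Forms),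
      (Orbifold.ofManifold (2 * n) N).of μ = (Orbifold.ofManifold (2 * n) N).of μ₁ +
        (Orbifold.ofManifold (2 * n) N).of μ₂ + (Orbifold.ofManifold (2 * n) N).D τ ∧
      IsFlatPullback (Orbifold.ofManifold (2 * n) N) O π k α μ₁ ∧
      (∀ c, ∀ x ∈ c.1.dom, π (c.1.toFun x) ∉ 𝒱 → μ₂.1 c x = 0) ∧
      (Orbifold.ofManifold (2 * n) N).extD k μ₂ = 0 := by
  have hπ' := hπ.isResolutionMap
  obtain ⟨V, hV, -⟩ := hπ.agrees
  obtain ⟨𝒞⟩ := exists_conicalSystem O hV h𝒱 hΔ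
  cases k with
  | zero =>
    obtain ⟨α, hα⟩ := hπ'.exists_pushforward (hπ'.isFlatOver_of_extD_eq_zero 𝒞 (by omega) μ hμ)
    refine ⟨α, μ, 0, 0, ?_, hα, fun _ _ _ _ => rfl, map_zero _⟩
    rw [Orbifold.of_zero, map_zero, add_zero, add_zero]
  | succ k =>
    obtain ⟨μ₁, μ₂, τ, h, h1, h2, h3⟩ := hπ'.exists_splitting rfl hΩ.2 hΩ'.2 𝒞 μ hμ
    obtain ⟨α, hα⟩ := hπ'.exists_pushforward h1
    refine ⟨α, μ₁, μ₂, (Orbifold.ofManifold (2 * n) N).of τ, ?_, hα, h2, h3⟩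
    rw [Orbifold.D_of]
    conv_lhs => rw [h]
    exact (map_add _ _ _).trans (congrArg (· + _) (map_add _ _ _))

/-- The pullback on cohomology is injective. -/
theorem eq_zero_of_cohomologyPullback_zero {x : O.Cohomology}
    (h : CohomologyPullback (Orbifold.ofManifold (2 * n) N) O π x 0) : x = 0 := by
  have hπ' := hπ.isResolutionMap
  obtain ⟨α, β, rfl, hβ, hαβ⟩ := h
  obtain ⟨η, hη⟩ := Orbifold.exists_of_cls_eq (z := 0)
    (hβ.trans (Submodule.Quotient.mk_zero _).symm)
  have hη' : (β : (Orbifold.ofManifold (2 * n) N).Forms) =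
      (Orbifold.ofManifold (2 * n) N).D η := hη.trans (zero_add _)
  have hR := isMultiplicativeRel_isFlatPullback (Orbifold.ofManifold (2 * n) N) O π
  have key : ∀ k, ∃ (ξ : O.Forms) (ζ : (Orbifold.ofManifold (2 * n) N).Forms),
      FormsRel (IsFlatPullback (Orbifold.ofManifold (2 * n) N) O π) ξ ζ ∧
      (Orbifold.ofManifold (2 * n) N).D ζ =
        (Orbifold.ofManifold (2 * n) N).D ((Orbifold.ofManifold (2 * n) N).of (η k)) := by
    intro k
    obtain ⟨𝒱, h𝒱, hΔ, h0⟩ := (hαβ (k + 1)).1.exists_isOpen_eq_zero (Nat.succ_pos k)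
    obtain ⟨ξ, μ₁, μ₂, τ, h1, h2, -, h4⟩ := hπ.exists_pullback_add hΩ hΩ' h𝒱 hΔ (η k)
      (fun c x hx hxV => by
        rw [← Orbifold.D_apply_succ, ← hη']
        exact hπ'.pullback_eq_zero h𝒱 h0 (hαβ (k + 1)).2 c hx hxV)
    refine ⟨O.of ξ, (Orbifold.ofManifold (2 * n) N).of μ₁, hR.formsRel_of h2, ?_⟩
    rw [h1, map_add, map_add, Orbifold.D_D, Orbifold.D_of_eq_zero h4, add_zero, add_zero]
  choose ξ ζ hξζ hζ using key
  obtain ⟨s, hs⟩ := Orbifold.sum_of_apply η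
  have h1 := hπ'.formsRel_D (hR.formsRel_sum s hξζ)
  have h2 : (Orbifold.ofManifold (2 * n) N).D (∑ k ∈ s, ζ k) = β := by
    rw [hη', map_sum, Finset.sum_congr rfl fun k _ => hζ k, ← map_sum, hs s subset_rfl]
  rw [h2] at h1
  have h3 := hπ'.formsRel_unique_left hαβ h1
  refine (Orbifold.cls_eq_of_eq_add_D (z := 0) (x := ∑ k ∈ s, ξ k) ?_).trans
    (Submodule.Quotient.mk_zero _)
  exact h3.trans (zero_add _).symm

end IsSymplecticResolution

end Resolution

/-! ### Massey products under symplectic resolutions -/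

section Main

variable {n : ℕ} {M N : Type*} [TopologicalSpace M] [T2Space M] [ParacompactSpace M]
  {O : Orbifold (2 * n) M} {Ω : O.Form 2} [TopologicalSpace N]
  [ChartedSpace (EuclideanSpace ℝ (Fin (2 * n))) N] [IsManifold (𝓡 (2 * n)) ∞ N]
  {Ω' : (Orbifold.ofManifold (2 * n) N).Form 2} {π : N → M} {m p : ℕ} {q : Fin m → ℕ}
  {a : O.Form p} {b : ∀ i, O.Form (q i)} {a' : (Orbifold.ofManifold (2 * n) N).Form p}
  {b' : ∀ i, (Orbifold.ofManifold (2 * n) N).Form (q i)}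

namespace IsSymplecticResolution

/-- A system of primitives on the orbifold can be made flat, without changing the class of the
Massey form; its pullback is a system of primitives on the resolution. -/
theorem exists_flat_primitiveSystem (hπ : IsSymplecticResolution O Ω Ω' π)
    (hdef : O.MasseyDefined a b)
    (ha' : IsFlatPullback (Orbifold.ofManifold (2 * n) N) O π p a a')
    (hb' : ∀ i, IsFlatPullback (Orbifold.ofManifold (2 * n) N) O π (q i) (b i) (b' i))
    {ξ : Fin m → O.Forms} (hξ : O.IsPrimitiveSystem a b ξ) :
    ∃ (ζ : Fin m → O.Forms) (ζ' : Fin m → (Orbifold.ofManifold (2 * n) N).Forms) (S : O.Forms),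
      O.IsPrimitiveSystem a b ζ ∧ (Orbifold.ofManifold (2 * n) N).IsPrimitiveSystem a' b' ζ' ∧
      O.masseyForm b ζ = O.masseyForm b ξ + O.D S ∧
      FormsRel (IsFlatPullback (Orbifold.ofManifold (2 * n) N) O π) (O.masseyForm b ζ)
        ((Orbifold.ofManifold (2 * n) N).masseyForm b' ζ') := by
  have hπ' := hπ.isResolutionMap
  obtain ⟨V, hV, -⟩ := hπ.agrees
  have hR := isMultiplicativeRel_isFlatPullback (Orbifold.ofManifold (2 * n) N) O π
  have hab := fun i => hR.formsRel_mul (hR.formsRel_of ha') (hR.formsRel_of (hb' i))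
  have hτ : ∀ i, ∃ τ : O.Forms, O.IsHomPred (p + q i) (ξ i + O.D τ) ∧
      ∀ j, O.IsFlat ((ξ i + O.D τ) j) := by
    intro i
    obtain ⟨h1, h2⟩ := Orbifold.isPrimitiveSystem_iff.1 hξ i
    generalize p + q i = l at h1
    cases l with
    | zero =>
      refine ⟨0, ?_, fun j => ?_⟩
      · rw [map_zero, add_zero]; exact h1
      · rw [map_zero, add_zero, h1.eq_zero]; exact Orbifold.isFlat_zero
    | succ k =>
      obtain ⟨τ, hτ, hτf⟩ := Orbifold.exists_isFlat_of_sub_D hV (α := ξ i k) (by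
        rw [← O.D_apply_succ, h2]; exact (hab i (k + 1)).1)
      rw [← h1.eq_of] at hτf
      refine ⟨-τ, ?_, fun j => ?_⟩
      · rw [map_neg]; exact h1.add hτ.D.neg
      · rw [map_neg, ← sub_eq_add_neg]; exact hτf j
  choose τ hτ1 hτ2 using hτ
  choose ζ' hζ' using fun i => hπ'.exists_formsRel (hτ2 i)
  have hζ : ∀ i, O.D (ξ i + O.D (τ i)) = O.of a * O.of (b i) := fun i => by
    rw [map_add, O.D_D, add_zero, (hξ i).2]
  obtain ⟨S, hS⟩ := Orbifold.exists_masseyForm_add_D hdef.1 hdef.2.2.1 hξ τ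
  refine ⟨fun i => ξ i + O.D (τ i), ζ', S, fun i => ⟨hτ1 i, hζ i⟩, fun i => ⟨fun j hj => ?_, ?_⟩,
    hS, hR.formsRel_masseyForm hb' hζ'⟩
  · have h1 := hζ' i j
    rw [hτ1 i j hj] at h1
    exact hπ'.unique_right h1.2 (hR.zero j).2
  · have h1 := hπ'.formsRel_D (hζ' i)
    rw [hζ i] at h1
    exact hπ'.formsRel_unique_right h1 (hab i)

/-- The statement on Massey products for flat forms and their pullbacks. -/
theorem masseyProduct_eq_of_isFlatPullback [T2Space N] (hπ : IsSymplecticResolution O Ω Ω' π)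
    (hΩ : O.IsSymplectic Ω)
    (hΩ' : (Orbifold.ofManifold (2 * n) N).IsSymplectic Ω') (hdef : O.MasseyDefined a b)
    (hq : ∀ i, 0 < q i)
    (ha' : IsFlatPullback (Orbifold.ofManifold (2 * n) N) O π p a a')
    (hb' : ∀ i, IsFlatPullback (Orbifold.ofManifold (2 * n) N) O π (q i) (b i) (b' i)) :
    (Orbifold.ofManifold (2 * n) N).MasseyDefined a' b' ∧
      (Orbifold.ofManifold (2 * n) N).masseyProduct a' b' =
        {y | ∃ x ∈ O.masseyProduct a b,
          CohomologyPullback (Orbifold.ofManifold (2 * n) N) O π x y} := by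
  have hπ' := hπ.isResolutionMap
  obtain ⟨V, hV, -⟩ := hπ.agrees
  have hR := isMultiplicativeRel_isFlatPullback (Orbifold.ofManifold (2 * n) N) O π
  have hclosed : ∀ {k : ℕ} {α : O.Form k} {β : (Orbifold.ofManifold (2 * n) N).Form k},
      IsFlatPullback (Orbifold.ofManifold (2 * n) N) O π k α β → O.extD k α = 0 →
        (Orbifold.ofManifold (2 * n) N).extD k β = 0 := by
    intro k α β h hα
    have h1 := h.2.extD hπ'.isOpen_compl
    rw [hα] at h1
    exact hπ'.unique_right h1 (hR.zero _).2
  have hdef' : (Orbifold.ofManifold (2 * n) N).MasseyDefined a' b' := by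
    obtain ⟨ξ, hξ⟩ := hdef.2.2.2
    obtain ⟨-, ζ', -, -, hζ', -⟩ := hπ.exists_flat_primitiveSystem hdef ha' hb' hξ
    exact ⟨hdef.1, hclosed ha' hdef.2.1, fun i => hclosed (hb' i) (hdef.2.2.1 i), ζ', hζ'⟩
  refine ⟨hdef', Set.Subset.antisymm ?_ ?_⟩
  · rintro _ ⟨ξ', hξ', z', hz', rfl⟩
    -- the forms `b i` vanish on a neighbourhood `𝒱` of the singular set
    choose 𝒱 h𝒱 hΔ h0 using fun i => (hb' i).1.exists_isOpen_eq_zero (hq i)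
    have h𝒱' : IsOpen (⋂ i, 𝒱 i) := isOpen_iInter_of_finite h𝒱
    have hΔ' : O.singularSet ⊆ ⋂ i, 𝒱 i := subset_iInter hΔ
    have hb0 : ∀ i c, ∀ x ∈ c.1.dom, π (c.1.toFun x) ∈ ⋂ i, 𝒱 i → (b' i).1 c x = 0 :=
      fun i c x hx hxV => hπ'.pullback_eq_zero (h𝒱 i) (h0 i) (hb' i).2 c hx (mem_iInter.1 hxV i)
    have hsplit : ∀ i, ∃ (α : O.Forms) (μ₁ μ₂ τ : (Orbifold.ofManifold (2 * n) N).Forms),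
        ξ' i = μ₁ + μ₂ + (Orbifold.ofManifold (2 * n) N).D τ ∧ O.IsHomPred (p + q i) α ∧
        (Orbifold.ofManifold (2 * n) N).IsHomPred (p + q i) (μ₁ + μ₂) ∧
        FormsRel (IsFlatPullback (Orbifold.ofManifold (2 * n) N) O π) α μ₁ ∧
        (∀ c, ∀ x ∈ c.1.dom, π (c.1.toFun x) ∉ ⋂ i, 𝒱 i → ∀ j, (μ₂ j).1 c x = 0) ∧
        (Orbifold.ofManifold (2 * n) N).D μ₂ = 0 := by
      intro i
      obtain ⟨h1, h2⟩ := Orbifold.isPrimitiveSystem_iff.1 hξ' i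
      obtain ⟨k, hk⟩ : ∃ k, p + q i = k + 1 := ⟨p + q i - 1, by have := hq i; omega⟩
      rw [hk] at h1 ⊢
      obtain ⟨α, μ₁, μ₂, τ, hμ, hα, hμ₂, hμ₂d⟩ := hπ.exists_pullback_add hΩ hΩ' h𝒱' hΔ' (ξ' i k)
        fun c x hx hxV => by
          rw [← Orbifold.D_apply_succ, h2]
          -- the product `a' ∧ b' i` vanishes together with `b' i`
          have hE := isMultiplicativeRel_eqAtPoint (Orbifold.ofManifold (2 * n) N) c x
          have h3 : EqAtPoint _ c x (q i) (b' i) 0 := hb0 i c x hx hxV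
          have h4 := hE.formsRel_mul (hE.formsRel_of (show EqAtPoint _ c x p a' a' from rfl))
            (hE.formsRel_of h3) (k + 1)
          rw [Orbifold.of_zero, mul_zero] at h4
          exact h4
      refine ⟨O.of α, _, _, τ, h1.eq_of.trans hμ, Orbifold.isHomPred_of α,
        (Orbifold.isHomPred_of μ₁).add (Orbifold.isHomPred_of μ₂), hR.formsRel_of hα,
        fun c x hx hxV j => ?_, Orbifold.D_of_eq_zero hμ₂d⟩
      by_cases hj : j = k
      · subst hj
        rw [Orbifold.of_apply_self]
        exact hμ₂ c x hx hxV
      · rw [Orbifold.of_apply_ne _ _ hj]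
        rfl
    choose α μ₁ μ₂ τ h1 h2 h3 h4 h5 h6 using hsplit
    have hD : ∀ i, (Orbifold.ofManifold (2 * n) N).D (μ₁ i) =
        (Orbifold.ofManifold (2 * n) N).of a' * (Orbifold.ofManifold (2 * n) N).of (b' i) := by
      intro i
      rw [← (hξ' i).2, h1 i, map_add, map_add, Orbifold.D_D, h6 i, add_zero, add_zero]
    have hprim : (Orbifold.ofManifold (2 * n) N).IsPrimitiveSystem a' b'
        (fun i => μ₁ i + μ₂ i) := fun i => ⟨h3 i, by rw [map_add, h6 i, add_zero, hD i]⟩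
    obtain ⟨S, hS⟩ := Orbifold.exists_masseyForm_add_D hdef'.1 hdef'.2.2.1 hprim τ
    -- where the forms `μ₂ i` do not vanish, all `b' i` do
    have hform : (Orbifold.ofManifold (2 * n) N).masseyForm b' (fun i => μ₁ i + μ₂ i) =
        (Orbifold.ofManifold (2 * n) N).masseyForm b' μ₁ := by
      refine masseyForm_eq_of_eqAtPoint b' fun c x hx => ?_
      by_cases hxV : π (c.1.toFun x) ∈ ⋂ i, 𝒱 i
      · exact Or.inl fun i => hb0 i c x hx hxV
      · refine Or.inr fun i k => ?_
        rw [DirectSum.add_apply]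
        refine (congrArg (((μ₁ i) k).1 c x + ·) (h5 i c x hx hxV k)).trans (add_zero _)
    have hα : O.IsPrimitiveSystem a b α := by
      refine fun i => ⟨h2 i, ?_⟩
      have h7 := hπ'.formsRel_D (h4 i)
      rw [hD i] at h7
      exact hπ'.formsRel_unique_left h7
        (hR.formsRel_mul (hR.formsRel_of ha') (hR.formsRel_of (hb' i)))
    have hrel := hR.formsRel_masseyForm hb' h4
    have hz0 : (z' : (Orbifold.ofManifold (2 * n) N).Forms) =
        (Orbifold.ofManifold (2 * n) N).masseyForm b' μ₁ +
          (Orbifold.ofManifold (2 * n) N).D S := by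
      rw [hz', ← hform, ← hS]
      exact congrArg _ (funext h1)
    refine ⟨O.cls ⟨O.masseyForm b α, Orbifold.D_masseyForm hdef.1 hdef.2.2.1 hα⟩,
      ⟨α, hα, _, rfl, rfl⟩, _,
      ⟨(Orbifold.ofManifold (2 * n) N).masseyForm b' μ₁, ?_⟩, rfl, ?_, hrel⟩
    · rw [← hform]
      exact Orbifold.D_masseyForm hdef'.1 hdef'.2.2.1 hprim
    · exact (Orbifold.cls_eq_of_eq_add_D hz0).symm
  · rintro y ⟨_, ⟨ξ, hξ, z, hz, rfl⟩, hy⟩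
    obtain ⟨ζ, ζ', S, hζ, hζ', hS, hrel⟩ := hπ.exists_flat_primitiveSystem hdef ha' hb' hξ
    refine ⟨ζ', hζ', ⟨_, Orbifold.D_masseyForm hdef'.1 hdef'.2.2.1 hζ'⟩, rfl, ?_⟩
    refine hπ'.cohomologyPullback_unique hV ⟨⟨_, Orbifold.D_masseyForm hdef.1 hdef.2.2.1 hζ⟩, _,
      ?_, rfl, hrel⟩ hy
    rw [← hz] at hS
    exact Orbifold.cls_eq_of_eq_add_D hS

end IsSymplecticResolution

end Main

/-! ### Reduction to flat representatives -/

section Representatives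

variable {d : ℕ} {X Y : Type*} [TopologicalSpace X] [TopologicalSpace Y] {P : Orbifold d Y}
  {O : Orbifold d X} {π : Y → X} {k : ℕ}

theorem Orbifold.exists_of_apply_eq_add_D {x y σ : O.Forms} (h : x = y + O.D σ) (k : ℕ) :
    ∃ τ, O.of (x k) = O.of (y k) + O.D τ := by
  have hk : O.of (x k) = O.of (y k) + O.of ((O.D σ) k) := by
    rw [h, DirectSum.add_apply]
    exact map_add _ _ _
  cases k with
  | zero => exact ⟨0, by rw [hk, O.D_apply_zero, O.of_zero, map_zero]⟩
  | succ k => exact ⟨O.of (σ k), by rw [hk, O.D_apply_succ, O.D_of]⟩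

/-- The class of a homogeneous closed form is sent to the class of a homogeneous form only if
the two forms are, up to exact forms, a flat form and its pullback. -/
theorem exists_isFlatPullback_of_cohomologyPullback {α : O.Form k}
    (hα : O.extD k α = 0) {β : P.Form k} (hβ : P.extD k β = 0)
    (h : CohomologyPullback P O π (O.homCls α hα) (P.homCls β hβ)) :
    ∃ (α₁ : O.Form k) (β₁ : P.Form k) (x : O.Forms) (y : P.Forms), O.extD k α₁ = 0 ∧
      IsFlatPullback P O π k α₁ β₁ ∧ O.of α₁ = O.of α + O.D x ∧ P.of β = P.of β₁ + P.D y := by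
  obtain ⟨z, w, hz, hw, hzw⟩ := h
  obtain ⟨x, hx⟩ := Orbifold.exists_of_cls_eq hz
  obtain ⟨y, hy⟩ := Orbifold.exists_of_cls_eq hw.symm
  obtain ⟨x', hx'⟩ := Orbifold.exists_of_apply_eq_add_D hx k
  obtain ⟨y', hy'⟩ := Orbifold.exists_of_apply_eq_add_D hy k
  rw [O.of_apply_self] at hx'
  rw [P.of_apply_self] at hy'
  refine ⟨z.1 k, w.1 k, x', y', ?_, hzw k, hx', hy'⟩
  rw [← O.D_apply_succ, LinearMap.mem_ker.1 z.2]
  rfl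

theorem Orbifold.exists_isFlat_representative [T2Space X] [ParacompactSpace X] {V : X → Set X}
    (hV : IsSmallNeighbourhoodSystem O V) {α : O.Form k} (hα : O.extD k α = 0) :
    ∃ (α₁ : O.Form k) (x : O.Forms), O.IsFlat α₁ ∧ O.extD k α₁ = 0 ∧
      O.of α₁ = O.of α + O.D x := by
  obtain ⟨τ, hτ, hflat⟩ := Orbifold.exists_isFlat_of_sub_D hV (α := α)
    (by rw [hα]; exact Orbifold.isFlat_zero)
  have h1 := ((Orbifold.isHomPred_of α).sub hτ.D).eq_of
  refine ⟨(O.of α - O.D τ) k, -τ, hflat k, ?_, ?_⟩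
  · rw [← O.D_apply_succ, map_sub, O.D_D, Orbifold.D_of_eq_zero hα, sub_zero]
    rfl
  · rw [← h1, map_neg, sub_eq_add_neg]

/-- In order one, the `a`-product `⟨0; 1⟩ = {[1]}` is nontrivial on every nonempty orbifold. -/
theorem Orbifold.hasNontrivialMasseyProduct_one [Nonempty X] (O : Orbifold d X) :
    O.HasNontrivialMasseyProduct 1 := by
  have h1 : O.D (O.of O.oneForm) = 0 := by rw [← one_eq_of, D_one]
  have h1' : O.extD 0 O.oneForm = 0 := by
    rw [D_of] at h1
    rw [← O.of_apply_self (O.extD 0 O.oneForm), h1]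
    rfl
  refine ⟨0, fun _ => 0, 0, fun _ => O.oneForm, ⟨Even.zero, map_zero _, fun _ => h1', 0, fun i =>
    ⟨fun _ _ => rfl, ?_⟩⟩, ?_⟩
  · rw [O.of_zero, zero_mul]
    exact map_zero _
  · rintro ⟨ξ, hξ, z, hz, hz0⟩
    rw [masseyForm_eq, masseySum_succ, masseySum_zero, mul_zero, add_zero, prodForm_zero,
      mul_one] at hz
    obtain ⟨x, hx⟩ := exists_of_cls_eq (z := 0) (hz0.trans (Submodule.Quotient.mk_zero _).symm)
    rw [hz] at hx
    have h2 : O.of O.oneForm = O.D x := hx.trans (zero_add _)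
    have h3 : O.oneForm = 0 := by
      rw [← O.of_apply_self O.oneForm, h2, D_apply_zero]
    obtain ⟨c, hc, y, hy, -⟩ := O.cover (Classical.arbitrary X)
    have h4 : O.oneForm.1 ⟨c, hc⟩ y = flatValue _ 1 0 := if_pos hy
    rw [h3] at h4
    exact zero_ne_one (congrArg (fun θ : EuclideanSpace ℝ (Fin d) [⋀^Fin 0]→L[ℝ] ℝ => θ ![]) h4)

theorem Orbifold.HasNontrivialMasseyProduct.nonempty {m : ℕ} (h : O.HasNontrivialMasseyProduct m) :
    Nonempty X := by
  by_contra hX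
  rw [not_nonempty_iff] at hX
  obtain ⟨p, q, a, b, ⟨-, -, -, ξ, hξ⟩, h0⟩ := h
  have hF : ∀ k (α : O.Form k), α = 0 := fun k α => Orbifold.Form.ext fun c x => by
    by_cases hx : x ∈ c.1.dom
    · exact hX.elim (c.1.toFun x)
    · exact α.2.2.1 c x hx
  refine h0 ⟨ξ, hξ, 0, O.forms_ext fun k => (hF k _).symm, Submodule.Quotient.mk_zero _⟩

theorem IsResolutionMap.nonempty (hπ : IsResolutionMap P O π) [Nonempty X] : Nonempty Y := by
  obtain ⟨p, hp⟩ := O.dense_compl_singularSet.nonempty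
  obtain ⟨y, -⟩ := hπ.isDiffeoOn.1.surjOn hp
  exact ⟨y⟩

end Representatives

end

theorem mainTheorem5 {n : ℕ} {M N : Type*}
    [TopologicalSpace M] [T2Space M] [ParacompactSpace M]
    (O : Orbifold (2 * n) M) (Ω : O.Form 2) (hΩ : O.IsSymplectic Ω)
    [TopologicalSpace N] [T2Space N] [ParacompactSpace N]
    [ChartedSpace (EuclideanSpace ℝ (Fin (2 * n))) N] [IsManifold (𝓡 (2 * n)) ∞ N]
    (Ω' : (Orbifold.ofManifold (2 * n) N).Form 2)
    (hΩ' : (Orbifold.ofManifold (2 * n) N).IsSymplectic Ω')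
    (π : N → M) (hπ : IsSymplecticResolution O Ω Ω' π) :
    (∀ m : ℕ, O.HasNontrivialMasseyProduct m →
      (Orbifold.ofManifold (2 * n) N).HasNontrivialMasseyProduct m) ∧
    (∀ (m p : ℕ) (q : Fin m → ℕ) (a : O.Form p) (b : ∀ i, O.Form (q i))
      (ha : O.extD p a = 0) (hb : ∀ i, O.extD (q i) (b i) = 0),
      O.MasseyDefined a b → (∀ i, 0 < q i) →
      ∀ (a' : (Orbifold.ofManifold (2 * n) N).Form p)
        (b' : ∀ i, (Orbifold.ofManifold (2 * n) N).Form (q i))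
        (ha' : (Orbifold.ofManifold (2 * n) N).extD p a' = 0)
        (hb' : ∀ i, (Orbifold.ofManifold (2 * n) N).extD (q i) (b' i) = 0),
        CohomologyPullback (Orbifold.ofManifold (2 * n) N) O π
          (O.homCls a ha) ((Orbifold.ofManifold (2 * n) N).homCls a' ha') →
        (∀ i, CohomologyPullback (Orbifold.ofManifold (2 * n) N) O π
          (O.homCls (b i) (hb i)) ((Orbifold.ofManifold (2 * n) N).homCls (b' i) (hb' i))) →
        (Orbifold.ofManifold (2 * n) N).MasseyDefined a' b' ∧
        (Orbifold.ofManifold (2 * n) N).masseyProduct a' b' =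
          {y | ∃ x ∈ O.masseyProduct a b,
            CohomologyPullback (Orbifold.ofManifold (2 * n) N) O π x y}) := by
  have hπ' := hπ.isResolutionMap
  constructor
  · intro m hM
    have := hM.nonempty
    have := hπ'.nonempty
    obtain ⟨p, q, a, b, hdef, h0⟩ := hM
    by_cases hq : ∀ i, 0 < q i
    · obtain ⟨V, hV, -⟩ := hπ.agrees
      obtain ⟨a₁, x, ha₁, hda₁, hx⟩ := Orbifold.exists_isFlat_representative hV hdef.2.1
      choose b₁ y hb₁ hdb₁ hy using fun i =>
        Orbifold.exists_isFlat_representative hV (hdef.2.2.1 i)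
      obtain ⟨hdef₁, hprod⟩ := Orbifold.masseyProduct_congr hdef hda₁ hdb₁ hx hy
      obtain ⟨a', -, ha'⟩ := hπ'.exists_pullback ha₁
      choose b' _ hb' using fun i => hπ'.exists_pullback (hb₁ i)
      obtain ⟨hdef', hprod'⟩ := hπ.masseyProduct_eq_of_isFlatPullback hΩ hΩ' hdef₁ hq
        ⟨ha₁, ha'⟩ fun i => ⟨hb₁ i, hb' i⟩
      refine ⟨p, q, a', b', hdef', fun h => h0 ?_⟩
      rw [hprod'] at h
      obtain ⟨z, hz, hz0⟩ := h
      rw [hπ.eq_zero_of_cohomologyPullback_zero hΩ hΩ' hz0, hprod] at hz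
      exact hz
    -- some `b i` has degree zero: the product is trivial if `m ≥ 2`, and for `m = 1` the resolution
    -- has the nontrivial product `⟨0; 1⟩`
    · push Not at hq
      obtain ⟨i, hi⟩ := hq
      by_cases hm : 2 ≤ m
      · exact absurd (Orbifold.zero_mem_masseyProduct_of_degree_eq_zero hdef hm i
          (Nat.le_zero.1 hi)) h0
      · obtain rfl : m = 1 := by have := i.pos; omega
        exact Orbifold.hasNontrivialMasseyProduct_one _
  · intro m p q a b ha hb hdef hq a' b' ha' hb' haa' hbb'
    obtain ⟨a₁, a₁', x, x', hda₁, ha₁, hx, hx'⟩ :=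
      exists_isFlatPullback_of_cohomologyPullback ha ha' haa'
    choose b₁ b₁' y y' hdb₁ hb₁ hy hy' using fun i =>
      exists_isFlatPullback_of_cohomologyPullback (hb i) (hb' i) (hbb' i)
    obtain ⟨hdef₁, hprod⟩ := Orbifold.masseyProduct_congr hdef hda₁ hdb₁ hx hy
    obtain ⟨hdef₁', hprod₁⟩ :=
      hπ.masseyProduct_eq_of_isFlatPullback hΩ hΩ' hdef₁ hq ha₁ hb₁
    obtain ⟨hdef', hprod'⟩ := Orbifold.masseyProduct_congr hdef₁' ha' hb' hx' hy'
    exact ⟨hdef', by rw [hprod', hprod₁, hprod]⟩
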